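/- Let $\Lambda=\mathbb Z[t,t^{-1}]$, let $p$ be a prime, and write $\mathbb Z_m=\mathbb Z/m\mathbb Z$. For an abelian group $M=\mathbb Z_{p^{e_1}}\times\cdots\times\mathbb Z_{p^{e_k}}$ and an integer matrix $A=(a_{ij})$ with $p^{e_i}\mid a_{ij}p^{e_j}$ for all $i,j$, let $A$ act on $M$ by $(x_j)\mapsto(\sum_j a_{ij}x_j)_i$; if this is an automorphism of $M$, the pair $(M,A)$ denotes the $\Lambda$-module $M$ on which $t$ acts as $A$. Matrices are written row by row, rows being separated by semicolons. All parameters are integers, subject to the following conventions: "$b\in\mathbb Z_{p^e}^\times$" means $0\le b<p^e$, $p\nmid b$; "$\alpha\in\mathbb Z_p$" means $0\le\alpha<p$; "$X^d+b_{d-1}X^{d-1}+\cdots+b_0$ irreducible" means that $0\le b_i<p$ and that the polynomial is irreducible over the field $\mathbb Z_p$. Pairs of integers are ordered lexicographically. For each $n\le 4$, every matrix in the list below for $n$ defines an automorphism of the group of its row. The resulting $\Lambda$-modules have order $p^n$, modules given by different entries (different rows, or different matrices in one row) are not isomorphic, and every $\Lambda$-module of order $p^n$ is isomorphic to one of them.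 The number of entries in each row is the number in brackets. $n=0$: - $M=0$: $[0]$. $[1]$ $n=1$: - $\mathbb Z_p$: $[b]$, $b\in\mathbb Z_p^\times$. $[p-1]$ $n=2$: - $\mathbb Z_{p^2}$: $[b]$, $b\in\mathbb Z_{p^2}^\times$. $[p^2-p]$ - $\mathbb Z_p^2$: $[b,0;\,0,c]$, $0<b\le c<p$. $[\binom p2]$ - $\mathbb Z_p^2$: $[b,1;\,0,b]$, $b\in\mathbb Z_p^\times$. $[p-1]$ - $\mathbb Z_p^2$: $[0,1;\,-b_0,-b_1]$, $X^2+b_1X+b_0$ irreducible. $[\frac12(p^2-p)]$ $n=3$: - $\mathbb Z_{p^3}$: $[b]$, $b\in\mathbb Z_{p^3}^\times$. $[p^3-p^2]$ - $\mathbb Z_{p^2}\times\mathbb Z_p$: $[b,0;\,0,c]$, $b\in\mathbb Z_{p^2}^\times$, $c\in\mathbb Z_p^\times$. $[p(p-1)^2]$ - $\mathbb Z_{p^2}\times\mathbb Z_p$: $[b,0;\,1,b]$, $0<b<p$. $[p-1]$ - $\mathbb Z_{p^2}\times\mathbb Z_p$: $[b,p;\,\gamma,b]$, $0<b<p$, $\gamma\in\mathbb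 Z_p$. $[p(p-1)]$ - $\mathbb Z_p^3$: $[b,0,0;\,0,c,0;\,0,0,d]$, $0<b\le c\le d<p$. $[\binom{p+1}3]$ - $\mathbb Z_p^3$: $[b,1,0;\,0,b,0;\,0,0,c]$, $b,c\in\mathbb Z_p^\times$. $[(p-1)^2]$ - $\mathbb Z_p^3$: $[b,1,0;\,0,b,1;\,0,0,b]$, $b\in\mathbb Z_p^\times$. $[p-1]$ - $\mathbb Z_p^3$: $[0,1,0;\,0,0,1;\,-b_0,-b_1,-b_2]$, $X^3+b_2X^2+b_1X+b_0$ irreducible. $[\frac13(p^3-p)]$ - $\mathbb Z_p^3$: $[0,1,0;\,-b_0,-b_1,0;\,0,0,c]$, $X^2+b_1X+b_0$ irreducible, $c\in\mathbb Z_p^\times$. $[\frac12p(p-1)^2]$ $n=4$: - $\mathbb Z_{p^4}$: $[b]$, $b\in\mathbb Z_{p^4}^\times$. $[p^3(p-1)]$ - $\mathbb Z_{p^3}\times\mathbb Z_p$: $[b,0;\,0,c]$, $b\in\mathbb Z_{p^3}^\times$, $c\in\mathbb Z_p^\times$. $[p^2(p-1)^2]$ - $\mathbb Z_{p^3}\times\mathbb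 Z_p$: $[b,0;\,1,b]$, $0<b<p^2$, $p\nmid b$. $[p(p-1)]$ - $\mathbb Z_{p^3}\times\mathbb Z_p$: $[b,p^2;\,\gamma,b]$, $0<b<p^2$, $p\nmid b$, $\gamma\in\mathbb Z_p$. $[p^2(p-1)]$ - $\mathbb Z_{p^2}^2$: $[b,0;\,0,c]$, $b,c\in\mathbb Z_{p^2}^\times$, $b\le c$. $[\binom{p(p-1)+1}2]$ - $\mathbb Z_{p^2}^2$: $[b,p;\,0,b]$, $b\in\mathbb Z_{p^2}^\times$. $[p(p-1)]$ - $\mathbb Z_{p^2}^2$: $[b,p;\,-pb_0,b-pb_1]$, $0<b<p$, $X^2+b_1X+b_0$ irreducible. $[\frac12p(p-1)^2]$ - $\mathbb Z_{p^2}^2$: $[b+p\alpha,1;\,p\gamma,b]$, $0<b<p$, $\alpha,\gamma\in\mathbb Z_p$. $[p^2(p-1)]$ - $\mathbb Z_{p^2}^2$: $[p\alpha,1+p\beta;\,-b_0,-b_1]$, $X^2+b_1X+b_0$ irreducible, $\alpha,\beta\in\mathbb Z_p$. $[\frac12p^2(p^2-p)]$ - $\mathbb Z_{p^2}\times\mathbb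 Z_p^2$: $[b,0,0;\,0,c,0;\,0,0,d]$, $b\in\mathbb Z_{p^2}^\times$, $0<c\le d<p$. $[\frac12p^2(p-1)^2]$ - $\mathbb Z_{p^2}\times\mathbb Z_p^2$: $[b,0,0;\,1,b,0;\,0,0,c]$, $0<b<p$, $c\in\mathbb Z_p^\times$. $[(p-1)^2]$ - $\mathbb Z_{p^2}\times\mathbb Z_p^2$: $[b,p,0;\,\eta,b,0;\,0,0,b]$, $0<b<p$, $\eta\in\mathbb Z_p$. $[p(p-1)]$ - $\mathbb Z_{p^2}\times\mathbb Z_p^2$: $[b,p,0;\,0,b,0;\,1,0,b]$, $0<b<p$. $[p-1]$ - $\mathbb Z_{p^2}\times\mathbb Z_p^2$: $[b,0,0;\,0,c,1;\,0,0,c]$, $b\in\mathbb Z_{p^2}^\times$, $c\in\mathbb Z_p^\times$. $[p(p-1)^2]$ - $\mathbb Z_{p^2}\times\mathbb Z_p^2$: $[b,0,0;\,0,b,1;\,1,0,b]$, $0<b<p$. $[p-1]$ - $\mathbb Z_{p^2}\times\mathbb Z_p^2$: $[b,p,0;\,0,b,1;\,\eta,0,b]$, $0<b<p$, $\eta\in\mathbb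 Z_p$. $[p(p-1)]$ - $\mathbb Z_p^4$: $[b,0,0,0;\,0,c,0,0;\,0,0,d,0;\,0,0,0,e]$, $0<b\le c\le d\le e<p$. $[\binom{p+2}4]$ - $\mathbb Z_p^4$: $[b,1,0,0;\,0,b,0,0;\,0,0,c,0;\,0,0,0,d]$, $b\in\mathbb Z_p^\times$, $0<c\le d<p$. $[\frac12p(p-1)^2]$ - $\mathbb Z_p^4$: $[b,1,0,0;\,0,b,0,0;\,0,0,c,1;\,0,0,0,c]$, $0<b\le c<p$. $[\binom p2]$ - $\mathbb Z_p^4$: $[b,1,0,0;\,0,b,1,0;\,0,0,b,0;\,0,0,0,c]$, $b,c\in\mathbb Z_p^\times$. $[(p-1)^2]$ - $\mathbb Z_p^4$: $[b,1,0,0;\,0,b,1,0;\,0,0,b,1;\,0,0,0,b]$, $b\in\mathbb Z_p^\times$. $[p-1]$ - $\mathbb Z_p^4$: $[0,1,0,0;\,-b_0,-b_1,0,0;\,0,0,0,1;\,0,0,-c_0,-c_1]$, $X^2+b_1X+b_0$ and $X^2+c_1X+c_0$ irreducible, $(b_0,b_1)\le(c_0,c_1)$. $[\binom{\frac12(p^2-p)+1}2]$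 - $\mathbb Z_p^4$: $[0,1,1,0;\,-b_0,-b_1,0,1;\,0,0,0,1;\,0,0,-b_0,-b_1]$, $X^2+b_1X+b_0$ irreducible. $[\frac12(p^2-p)]$ - $\mathbb Z_p^4$: $[0,1,0,0;\,0,0,1,0;\,0,0,0,1;\,-b_0,-b_1,-b_2,-b_3]$, $X^4+b_3X^3+b_2X^2+b_1X+b_0$ irreducible. $[\frac14(p^4-p^2)]$ - $\mathbb Z_{p^2}\times\mathbb Z_p^2$: $[b,p,0;\,\gamma,b,0;\,0,0,c]$, $0<b<p$, $\gamma\in\mathbb Z_p$, $c\in\mathbb Z_p^\times$, $b\ne c$. $[p(p-1)(p-2)]$ - $\mathbb Z_p^4$: $[0,1,0,0;\,0,0,1,0;\,-b_0,-b_1,-b_2,0;\,0,0,0,c]$, $X^3+b_2X^2+b_1X+b_0$ irreducible, $c\in\mathbb Z_p^\times$. $[\frac13(p^3-p)(p-1)]$ - $\mathbb Z_{p^2}\times\mathbb Z_p^2$: $[b,0,0;\,0,0,1;\,0,-c_0,-c_1]$, $b\in\mathbb Z_{p^2}^\times$, $X^2+c_1X+c_0$ irreducible. $[\frac12p^2(p-1)^2]$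 - $\mathbb Z_p^4$: $[0,1,0,0;\,-b_0,-b_1,0,0;\,0,0,c,0;\,0,0,0,d]$, $X^2+b_1X+b_0$ irreducible, $0<c\le d<p$. $[\frac14p^2(p-1)^2]$ - $\mathbb Z_p^4$: $[b,1,0,0;\,0,b,0,0;\,0,0,0,1;\,0,0,-c_0,-c_1]$, $b\in\mathbb Z_p^\times$, $X^2+c_1X+c_0$ irreducible. $[\frac12p(p-1)^2]$ Consequently the number of isomorphism classes of $\Lambda$-modules of order $p^n$ is $$1,\qquad p-1,\qquad 2p^2-p-1,\qquad 3p^3-2p^2-1,\qquad 5p^4-2p^3-2p-1$$ for $n=0,1,2,3,4$ respectively. -/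

import Mathlib

open Polynomial

universe u

/-- The ring `Λ = ℤ[t, t⁻¹]` of Laurent polynomials over `ℤ`. -/
abbrev LambdaRing : Type := LaurentPolynomial ℤ

section LambdaModule

variable {M : Type u} [AddCommGroup M]

/-- The ring homomorphism `Λ → End_ℤ(M)` that sends `t` to a given automorphism `α` of `M`. -/
noncomputable def lambdaHom (α : M ≃+ M) : LambdaRing →ₐ[ℤ] Module.End ℤ M :=
  AddMonoidAlgebra.lift ℤ (Module.End ℤ M) ℤ
    ((LinearEquiv.automorphismGroup.toLinearMapMonoidHom (R := ℤ) (M := M)).comp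
      (zpowersHom (M ≃ₗ[ℤ] M) α.toIntLinearEquiv))

/-- The `Λ`-module `M_α`: the abelian group `M` on which `t` acts as the automorphism `α`. -/
def LambdaModule (_α : M ≃+ M) : Type u := M

instance (α : M ≃+ M) : AddCommGroup (LambdaModule α) := inferInstanceAs (AddCommGroup M)

noncomputable instance (α : M ≃+ M) : Module LambdaRing (LambdaModule α) :=
  letI : Module (Module.End ℤ M) (LambdaModule α) :=
    inferInstanceAs (Module (Module.End ℤ M) M)
  Module.compHom (LambdaModule α) (lambdaHom α).toRingHom

theorem LambdaModule.T_one_smul (α : M ≃+ M) (x : M) :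
    (LaurentPolynomial.T 1 : LambdaRing) • (show LambdaModule α from x)
      = (show LambdaModule α from α x) := by
  change (lambdaHom α (LaurentPolynomial.T 1)) x = α x
  rw [lambdaHom, LaurentPolynomial.T, AddMonoidAlgebra.lift_single]
  simp [zpowersHom]

end LambdaModule

/-- The number of isomorphism classes of `Λ`-modules (in the universe `u`) with exactly `m`
elements. -/
noncomputable def numLambdaModules (m : ℕ) : ℕ :=
  Set.ncard ((fun M : ModuleCat.{u} LambdaRing =>
      Quotient.mk (CategoryTheory.isIsomorphicSetoid (ModuleCat.{u} LambdaRing)) M) ''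
    {M | Nat.card M = m})

/-- `b` is the representative with `0 ≤ b < p ^ e` of a unit of `ℤ / p ^ e`. -/
def IsUnitRep (p e : ℕ) (b : ℤ) : Prop := 0 ≤ b ∧ b < (p : ℤ) ^ e ∧ ¬ (p : ℤ) ∣ b

/-- `a` is the representative with `0 ≤ a < p` of an element of `ℤ / p`. -/
def IsRep (p : ℕ) (a : ℤ) : Prop := 0 ≤ a ∧ a < (p : ℤ)

/-- `X² + b₁ X + b₀` is irreducible over `ℤ / p` (coefficients represented in `[0, p)`). -/
def IrrTwo (p : ℕ) (b₀ b₁ : ℤ) : Prop :=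
  IsRep p b₀ ∧ IsRep p b₁ ∧
    Irreducible (X ^ 2 + C (b₁ : ZMod p) * X + C (b₀ : ZMod p) : (ZMod p)[X])

/-- `X³ + b₂ X² + b₁ X + b₀` is irreducible over `ℤ / p` (coefficients represented in
`[0, p)`). -/
def IrrThree (p : ℕ) (b₀ b₁ b₂ : ℤ) : Prop :=
  IsRep p b₀ ∧ IsRep p b₁ ∧ IsRep p b₂ ∧
    Irreducible (X ^ 3 + C (b₂ : ZMod p) * X ^ 2 + C (b₁ : ZMod p) * X
      + C (b₀ : ZMod p) : (ZMod p)[X])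

/-- `X⁴ + b₃ X³ + b₂ X² + b₁ X + b₀` is irreducible over `ℤ / p` (coefficients represented in
`[0, p)`). -/
def IrrFour (p : ℕ) (b₀ b₁ b₂ b₃ : ℤ) : Prop :=
  IsRep p b₀ ∧ IsRep p b₁ ∧ IsRep p b₂ ∧ IsRep p b₃ ∧
    Irreducible (X ^ 4 + C (b₃ : ZMod p) * X ^ 3 + C (b₂ : ZMod p) * X ^ 2
      + C (b₁ : ZMod p) * X + C (b₀ : ZMod p) : (ZMod p)[X])

/-- The lexicographic total order on pairs. -/
def LexLE (b₀ b₁ c₀ c₁ : ℤ) : Prop := b₀ < c₀ ∨ (b₀ = c₀ ∧ b₁ ≤ c₁)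

/-- A row of the table: the group `ℤ_{p^{e 0}} × ⋯ × ℤ_{p^{e (k-1)}}`, the set of integer matrices
by which `t` acts on it, and the number of these matrices. -/
structure TableRow where
  k : ℕ
  e : Fin k → ℕ
  matrices : Set (Matrix (Fin k) (Fin k) ℤ)
  total : ℚ

/-- The rows of the table for modules of order `p ^ 0`. -/
def tableZero : List TableRow :=
  [⟨1, ![0], {!![0]}, (1 : ℚ)⟩]

/-- The rows of the table for modules of order `p ^ 1`. -/
def tableOne (p : ℕ) : List TableRow :=
  [⟨1, ![1], {A | ∃ b : ℤ, IsUnitRep p 1 b ∧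
        A = !![b]}, (p - 1 : ℚ)⟩]

/-- The rows of the table for modules of order `p ^ 2`. -/
def tableTwo (p : ℕ) : List TableRow :=
  [⟨1, ![2], {A | ∃ b : ℤ, IsUnitRep p 2 b ∧
        A = !![b]}, (p ^ 2 - p : ℚ)⟩,
   ⟨2, ![1, 1], {A | ∃ b c : ℤ, 0 < b ∧ b ≤ c ∧ c < p ∧
        A = !![b, 0; 0, c]}, ((p.choose 2 : ℕ) : ℚ)⟩,
   ⟨2, ![1, 1], {A | ∃ b : ℤ, IsUnitRep p 1 b ∧
        A = !![b, 1; 0, b]}, (p - 1 : ℚ)⟩,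
   ⟨2, ![1, 1], {A | ∃ b₀ b₁ : ℤ, IrrTwo p b₀ b₁ ∧
        A = !![0, 1; -b₀, -b₁]}, ((p ^ 2 - p) / 2 : ℚ)⟩]

/-- The rows of the table for modules of order `p ^ 3`. -/
def tableThree (p : ℕ) : List TableRow :=
  [⟨1, ![3], {A | ∃ b : ℤ, IsUnitRep p 3 b ∧
        A = !![b]}, (p ^ 3 - p ^ 2 : ℚ)⟩,
   ⟨2, ![2, 1], {A | ∃ b c : ℤ, IsUnitRep p 2 b ∧ IsUnitRep p 1 c ∧
        A = !![b, 0; 0, c]}, (p * (p - 1) ^ 2 : ℚ)⟩,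
   ⟨2, ![2, 1], {A | ∃ b : ℤ, 0 < b ∧ b < p ∧
        A = !![b, 0; 1, b]}, (p - 1 : ℚ)⟩,
   ⟨2, ![2, 1], {A | ∃ b γ : ℤ, 0 < b ∧ b < p ∧ IsRep p γ ∧
        A = !![b, p; γ, b]}, (p * (p - 1) : ℚ)⟩,
   ⟨3, ![1, 1, 1], {A | ∃ b c d : ℤ, 0 < b ∧ b ≤ c ∧ c ≤ d ∧ d < p ∧
        A = !![b, 0, 0; 0, c, 0; 0, 0, d]}, (((p + 1).choose 3 : ℕ) : ℚ)⟩,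
   ⟨3, ![1, 1, 1], {A | ∃ b c : ℤ, IsUnitRep p 1 b ∧ IsUnitRep p 1 c ∧
        A = !![b, 1, 0; 0, b, 0; 0, 0, c]}, ((p - 1) ^ 2 : ℚ)⟩,
   ⟨3, ![1, 1, 1], {A | ∃ b : ℤ, IsUnitRep p 1 b ∧
        A = !![b, 1, 0; 0, b, 1; 0, 0, b]}, (p - 1 : ℚ)⟩,
   ⟨3, ![1, 1, 1], {A | ∃ b₀ b₁ b₂ : ℤ, IrrThree p b₀ b₁ b₂ ∧
        A = !![0, 1, 0; 0, 0, 1; -b₀, -b₁, -b₂]}, ((p ^ 3 - p) / 3 : ℚ)⟩,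
   ⟨3, ![1, 1, 1], {A | ∃ b₀ b₁ c : ℤ, IrrTwo p b₀ b₁ ∧ IsUnitRep p 1 c ∧
        A = !![0, 1, 0; -b₀, -b₁, 0; 0, 0, c]}, (p * (p - 1) ^ 2 / 2 : ℚ)⟩]

/-- The rows of the table for modules of order `p ^ 4`. -/
def tableFour (p : ℕ) : List TableRow :=
  [⟨1, ![4], {A | ∃ b : ℤ, IsUnitRep p 4 b ∧
        A = !![b]}, (p ^ 3 * (p - 1) : ℚ)⟩,
   ⟨2, ![3, 1], {A | ∃ b c : ℤ, IsUnitRep p 3 b ∧ IsUnitRep p 1 c ∧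
        A = !![b, 0; 0, c]}, (p ^ 2 * (p - 1) ^ 2 : ℚ)⟩,
   ⟨2, ![3, 1], {A | ∃ b : ℤ, 0 < b ∧ b < p ^ 2 ∧ ¬ (p : ℤ) ∣ b ∧
        A = !![b, 0; 1, b]}, (p * (p - 1) : ℚ)⟩,
   ⟨2, ![3, 1], {A | ∃ b γ : ℤ, 0 < b ∧ b < p ^ 2 ∧ ¬ (p : ℤ) ∣ b ∧ IsRep p γ ∧
        A = !![b, p ^ 2; γ, b]}, (p ^ 2 * (p - 1) : ℚ)⟩,
   ⟨2, ![2, 2], {A | ∃ b c : ℤ, IsUnitRep p 2 b ∧ IsUnitRep p 2 c ∧ b ≤ c ∧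
        A = !![b, 0; 0, c]}, (((p * (p - 1) + 1).choose 2 : ℕ) : ℚ)⟩,
   ⟨2, ![2, 2], {A | ∃ b : ℤ, IsUnitRep p 2 b ∧
        A = !![b, p; 0, b]}, (p * (p - 1) : ℚ)⟩,
   ⟨2, ![2, 2], {A | ∃ b b₀ b₁ : ℤ, 0 < b ∧ b < p ∧ IrrTwo p b₀ b₁ ∧
        A = !![b, p; -(p * b₀), b - p * b₁]}, (p * (p - 1) ^ 2 / 2 : ℚ)⟩,
   ⟨2, ![2, 2], {A | ∃ b α γ : ℤ, 0 < b ∧ b < p ∧ IsRep p α ∧ IsRep p γ ∧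
        A = !![b + p * α, 1; p * γ, b]}, (p ^ 2 * (p - 1) : ℚ)⟩,
   ⟨2, ![2, 2], {A | ∃ b₀ b₁ α β : ℤ, IrrTwo p b₀ b₁ ∧ IsRep p α ∧ IsRep p β ∧
        A = !![p * α, 1 + p * β; -b₀, -b₁]}, (p ^ 2 * (p ^ 2 - p) / 2 : ℚ)⟩,
   ⟨3, ![2, 1, 1], {A | ∃ b c d : ℤ, IsUnitRep p 2 b ∧ 0 < c ∧ c ≤ d ∧ d < p ∧
        A = !![b, 0, 0; 0, c, 0; 0, 0, d]}, (p ^ 2 * (p - 1) ^ 2 / 2 : ℚ)⟩,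
   ⟨3, ![2, 1, 1], {A | ∃ b c : ℤ, 0 < b ∧ b < p ∧ IsUnitRep p 1 c ∧
        A = !![b, 0, 0; 1, b, 0; 0, 0, c]}, ((p - 1) ^ 2 : ℚ)⟩,
   ⟨3, ![2, 1, 1], {A | ∃ b η : ℤ, 0 < b ∧ b < p ∧ IsRep p η ∧
        A = !![b, p, 0; η, b, 0; 0, 0, b]}, (p * (p - 1) : ℚ)⟩,
   ⟨3, ![2, 1, 1], {A | ∃ b : ℤ, 0 < b ∧ b < p ∧
        A = !![b, p, 0; 0, b, 0; 1, 0, b]}, (p - 1 : ℚ)⟩,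
   ⟨3, ![2, 1, 1], {A | ∃ b c : ℤ, IsUnitRep p 2 b ∧ IsUnitRep p 1 c ∧
        A = !![b, 0, 0; 0, c, 1; 0, 0, c]}, (p * (p - 1) ^ 2 : ℚ)⟩,
   ⟨3, ![2, 1, 1], {A | ∃ b : ℤ, 0 < b ∧ b < p ∧
        A = !![b, 0, 0; 0, b, 1; 1, 0, b]}, (p - 1 : ℚ)⟩,
   ⟨3, ![2, 1, 1], {A | ∃ b η : ℤ, 0 < b ∧ b < p ∧ IsRep p η ∧
        A = !![b, p, 0; 0, b, 1; η, 0, b]}, (p * (p - 1) : ℚ)⟩,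
   ⟨4, ![1, 1, 1, 1], {A | ∃ b c d e : ℤ, 0 < b ∧ b ≤ c ∧ c ≤ d ∧ d ≤ e ∧ e < p ∧
        A = !![b, 0, 0, 0; 0, c, 0, 0; 0, 0, d, 0; 0, 0, 0, e]}, (((p + 2).choose 4 : ℕ) : ℚ)⟩,
   ⟨4, ![1, 1, 1, 1], {A | ∃ b c d : ℤ, IsUnitRep p 1 b ∧ 0 < c ∧ c ≤ d ∧ d < p ∧
        A = !![b, 1, 0, 0; 0, b, 0, 0; 0, 0, c, 0; 0, 0, 0, d]}, (p * (p - 1) ^ 2 / 2 : ℚ)⟩,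
   ⟨4, ![1, 1, 1, 1], {A | ∃ b c : ℤ, 0 < b ∧ b ≤ c ∧ c < p ∧
        A = !![b, 1, 0, 0; 0, b, 0, 0; 0, 0, c, 1; 0, 0, 0, c]}, ((p.choose 2 : ℕ) : ℚ)⟩,
   ⟨4, ![1, 1, 1, 1], {A | ∃ b c : ℤ, IsUnitRep p 1 b ∧ IsUnitRep p 1 c ∧
        A = !![b, 1, 0, 0; 0, b, 1, 0; 0, 0, b, 0; 0, 0, 0, c]}, ((p - 1) ^ 2 : ℚ)⟩,
   ⟨4, ![1, 1, 1, 1], {A | ∃ b : ℤ, IsUnitRep p 1 b ∧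
        A = !![b, 1, 0, 0; 0, b, 1, 0; 0, 0, b, 1; 0, 0, 0, b]}, (p - 1 : ℚ)⟩,
   ⟨4, ![1, 1, 1, 1], {A | ∃ b₀ b₁ c₀ c₁ : ℤ, IrrTwo p b₀ b₁ ∧ IrrTwo p c₀ c₁ ∧ LexLE b₀ b₁ c₀ c₁ ∧
        A = !![0, 1, 0, 0; -b₀, -b₁, 0, 0; 0, 0, 0, 1; 0, 0, -c₀, -c₁]}, ((((p ^ 2 - p) / 2 + 1).choose 2 : ℕ) : ℚ)⟩,
   ⟨4, ![1, 1, 1, 1], {A | ∃ b₀ b₁ : ℤ, IrrTwo p b₀ b₁ ∧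
        A = !![0, 1, 1, 0; -b₀, -b₁, 0, 1; 0, 0, 0, 1; 0, 0, -b₀, -b₁]}, ((p ^ 2 - p) / 2 : ℚ)⟩,
   ⟨4, ![1, 1, 1, 1], {A | ∃ b₀ b₁ b₂ b₃ : ℤ, IrrFour p b₀ b₁ b₂ b₃ ∧
        A = !![0, 1, 0, 0; 0, 0, 1, 0; 0, 0, 0, 1; -b₀, -b₁, -b₂, -b₃]}, ((p ^ 4 - p ^ 2) / 4 : ℚ)⟩,
   ⟨3, ![2, 1, 1], {A | ∃ b c γ : ℤ, 0 < b ∧ b < p ∧ IsRep p γ ∧ IsUnitRep p 1 c ∧ b ≠ c ∧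
        A = !![b, p, 0; γ, b, 0; 0, 0, c]}, (p * (p - 1) * (p - 2) : ℚ)⟩,
   ⟨4, ![1, 1, 1, 1], {A | ∃ b₀ b₁ b₂ c : ℤ, IrrThree p b₀ b₁ b₂ ∧ IsUnitRep p 1 c ∧
        A = !![0, 1, 0, 0; 0, 0, 1, 0; -b₀, -b₁, -b₂, 0; 0, 0, 0, c]}, ((p ^ 3 - p) * (p - 1) / 3 : ℚ)⟩,
   ⟨3, ![2, 1, 1], {A | ∃ b c₀ c₁ : ℤ, IsUnitRep p 2 b ∧ IrrTwo p c₀ c₁ ∧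
        A = !![b, 0, 0; 0, 0, 1; 0, -c₀, -c₁]}, (p ^ 2 * (p - 1) ^ 2 / 2 : ℚ)⟩,
   ⟨4, ![1, 1, 1, 1], {A | ∃ b₀ b₁ c d : ℤ, IrrTwo p b₀ b₁ ∧ 0 < c ∧ c ≤ d ∧ d < p ∧
        A = !![0, 1, 0, 0; -b₀, -b₁, 0, 0; 0, 0, c, 0; 0, 0, 0, d]}, (p ^ 2 * (p - 1) ^ 2 / 4 : ℚ)⟩,
   ⟨4, ![1, 1, 1, 1], {A | ∃ b c₀ c₁ : ℤ, IsUnitRep p 1 b ∧ IrrTwo p c₀ c₁ ∧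
        A = !![b, 1, 0, 0; 0, b, 0, 0; 0, 0, 0, 1; 0, 0, -c₀, -c₁]}, (p * (p - 1) ^ 2 / 2 : ℚ)⟩]

/-- The rows of the table for modules of order `p ^ n`, `n ≤ 4`. -/
def table (p : ℕ) : ℕ → List TableRow
  | 0 => tableZero
  | 1 => tableOne p
  | 2 => tableTwo p
  | 3 => tableThree p
  | 4 => tableFour p
  | _ => []

/-- An entry of the table for `p ^ n`: a row together with one of the matrices of that row. -/
abbrev Entry (p n : ℕ) : Type :=
  Σ r : Fin (table p n).length, {A // A ∈ ((table p n).get r).matrices}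

namespace Entry

variable {p n : ℕ}

/-- The underlying abelian group `ℤ_{p^{e 0}} × ⋯ × ℤ_{p^{e (k-1)}}` of an entry. -/
abbrev Group (E : Entry p n) : Type :=
  (i : Fin ((table p n).get E.1).k) → ZMod (p ^ ((table p n).get E.1).e i)

/-- The map `x ↦ A x`: each coordinate of `x` is lifted to an integer in `[0, p ^ e j)`, the lift is
multiplied by `A`, and the `i`-th coordinate of the product is reduced modulo `p ^ e i`. -/
def matrixMap (E : Entry p n) (x : E.Group) : E.Group :=
  fun i => ((∑ j, E.2.1 i j * ((x j).val : ℤ) : ℤ) : ZMod _)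

end Entry

/-! A `Λ`-module is an abelian group with an automorphism, the action of `t`. Two such modules are
isomorphic exactly when a group isomorphism carries one automorphism to the other. A group of order
`p ^ n` is a product of cyclic groups indexed by the parts of a partition of `n`, and the orders of
its `p ^ j`-torsion subgroups determine the partition. The theorem therefore asks for the conjugacy
classes of `Aut(G)` for eleven nontrivial groups `G`. Endomorphisms of `G` lift to integer matrices
satisfying a divisibility condition, automorphisms are those with determinant prime to `p`, and
conjugacy becomes a system of congruences `A * P ≡ P * B` in which row `i` is read modulo `p ^ e i`.

Four kinds of groups occur. If `G` is cyclic, `Aut(G)` is commutative and nothing happens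
(`classifies_cyclic`). If `G` is elementary abelian, an automorphism is a finite `𝔽_p[X]`-module on
which `X` is invertible. It is classified by its multiset of elementary divisors, and each row of
the table is one pattern of degrees and exponents (`HasElemDiv.unique`, `classifies_of_divShape`).

On `ℤ_{p²}²`, a matrix that is not scalar modulo `p` has a cyclic vector, so trace and determinant
modulo `p²` determine its class (`matConj_sq_of_not_scalar`). A matrix that is scalar modulo `p` has
the form `r + p N`, and its class is given by `r` and the class of `N` modulo `p`
(`matConj_scalar_add_iff`).

On `ℤ_{p^{s+1}} × ℤ_p` and `ℤ_{p²} × ℤ_p²`, a matrix is made of a corner `a`, a row `b` carrying the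
factor `p ^ s` (with `s = 1` in the second case), a column `c` and a block `D` over `𝔽_p`. If `a` is
not an eigenvalue of `D`, both `b` and `c` can be cleared. If it is one, `b` matters only modulo the
row space of `D - a`, and `c` modulo its column space. What survives can be used to remove the top
`p`-adic digit of `a`, and the pairing of row with column leaves the parameter `γ` or `η`
(`classifies_hook`, `isTabulated_of_isAut`, `HasBlkInv.eq_of_matConj`).

The row sizes reduce to counting units, weakly increasing tuples and monic irreducible polynomials.
The last count comes from sorting the elements of a finite field extension by minimal polynomial
(`sum_mul_ncard_monicIrreducible`). Summing the rows gives the stated polynomials in `p`. -/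

/-! ### Modules as groups with an automorphism, and automorphisms as integer matrices -/

section Framework

/-- The group `ℤ_{p^{e 0}} × ⋯ × ℤ_{p^{e (k-1)}}`. -/
abbrev PGroup (p : ℕ) {k : ℕ} (e : Fin k → ℕ) : Type := (i : Fin k) → ZMod (p ^ e i)

/-- The integer matrix `A` acts on `PGroup p e` and its determinant is prime to `p`. -/
structure IsAut (p : ℕ) {k : ℕ} (e : Fin k → ℕ) (A : Matrix (Fin k) (Fin k) ℤ) : Prop where
  dvd : ∀ i j, (p : ℤ) ^ e i ∣ A i j * (p : ℤ) ^ e j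
  det : ¬ (p : ℤ) ∣ A.det

/-- The matrices `A` and `B` induce the same map on `PGroup p e`. -/
def MatCong (p : ℕ) {k : ℕ} (e : Fin k → ℕ) (A B : Matrix (Fin k) (Fin k) ℤ) : Prop :=
  ∀ i j, (p : ℤ) ^ e i ∣ A i j - B i j

/-- The matrices `A` and `B` are conjugate as automorphisms of `PGroup p e`. -/
def MatConj (p : ℕ) {k : ℕ} (e : Fin k → ℕ) (A B : Matrix (Fin k) (Fin k) ℤ) : Prop :=
  ∃ P, IsAut p e P ∧ MatCong p e (A * P) (P * B)

/-- Two groups with automorphisms are isomorphic. -/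
def AutConj {M N : Type*} [AddCommGroup M] [AddCommGroup N] (α : M ≃+ M) (β : N ≃+ N) : Prop :=
  ∃ φ : M ≃+ N, ∀ x, φ (α x) = β (φ x)

variable {p : ℕ} {k : ℕ} {e : Fin k → ℕ}

theorem AutConj.symm {M N : Type*} [AddCommGroup M] [AddCommGroup N] {α : M ≃+ M} {β : N ≃+ N}
    (h : AutConj α β) : AutConj β α := by
  obtain ⟨φ, hφ⟩ := h
  refine ⟨φ.symm, fun x => ?_⟩
  rw [AddEquiv.symm_apply_eq, hφ, AddEquiv.apply_symm_apply]

theorem AutConj.trans {M N L : Type*} [AddCommGroup M] [AddCommGroup N] [AddCommGroup L]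
    {α : M ≃+ M} {β : N ≃+ N} {γ : L ≃+ L} (h : AutConj α β) (h' : AutConj β γ) :
    AutConj α γ := by
  obtain ⟨φ, hφ⟩ := h
  obtain ⟨ψ, hψ⟩ := h'
  exact ⟨φ.trans ψ, fun x => by simp [hφ, hψ]⟩

/-- Since `T 1` is invertible, commuting with it forces commuting with its inverse; the integer
powers follow by induction in both directions. -/
theorem map_T_smul {M N : Type*} [AddCommGroup M] [AddCommGroup N] [Module LambdaRing M]
    [Module LambdaRing N] (φ : M →+ N)
    (h : ∀ x, φ ((LaurentPolynomial.T 1 : LambdaRing) • x)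
      = (LaurentPolynomial.T 1 : LambdaRing) • φ x) (n : ℤ) (x : M) :
    φ ((LaurentPolynomial.T n : LambdaRing) • x) = (LaurentPolynomial.T n : LambdaRing) • φ x := by
  have h' : ∀ x, φ ((LaurentPolynomial.T (-1) : LambdaRing) • x)
      = (LaurentPolynomial.T (-1) : LambdaRing) • φ x := by
    intro x
    have := h ((LaurentPolynomial.T (-1) : LambdaRing) • x)
    rw [smul_smul, ← LaurentPolynomial.T_add, add_neg_cancel, LaurentPolynomial.T_zero,
      one_smul] at this
    rw [this, smul_smul, ← LaurentPolynomial.T_add, neg_add_cancel, LaurentPolynomial.T_zero,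
      one_smul]
  induction n using Int.induction_on generalizing x with
  | zero => simp
  | succ i ih =>
    rw [LaurentPolynomial.T_add, mul_smul, mul_smul, ih, h]
  | pred i ih =>
    rw [sub_eq_add_neg, LaurentPolynomial.T_add, mul_smul, mul_smul, ih, h']

theorem map_laurent_smul {M N : Type*} [AddCommGroup M] [AddCommGroup N] [Module LambdaRing M]
    [Module LambdaRing N] (φ : M →+ N)
    (h : ∀ x, φ ((LaurentPolynomial.T 1 : LambdaRing) • x)
      = (LaurentPolynomial.T 1 : LambdaRing) • φ x) (f : LambdaRing) (x : M) :
    φ (f • x) = f • φ x := by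
  induction f using LaurentPolynomial.induction_on' with
  | add f g hf hg => rw [add_smul, add_smul, map_add, hf, hg]
  | C_mul_T n a =>
    rw [mul_smul, mul_smul, ← map_T_smul φ h]
    have : (LaurentPolynomial.C a : LambdaRing) = ((a : ℤ) : LambdaRing) := by
      simp
    rw [this, Int.cast_smul_eq_zsmul, Int.cast_smul_eq_zsmul, map_zsmul]

/-- The automorphism by which `t` acts on a `Λ`-module. -/
noncomputable def tAut (M : Type*) [AddCommGroup M] [Module LambdaRing M] : M ≃+ M where
  toFun x := (LaurentPolynomial.T 1 : LambdaRing) • x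
  invFun x := (LaurentPolynomial.T (-1) : LambdaRing) • x
  left_inv x := by
    beta_reduce
    rw [smul_smul, ← LaurentPolynomial.T_add, neg_add_cancel, LaurentPolynomial.T_zero, one_smul]
  right_inv x := by
    beta_reduce
    rw [smul_smul, ← LaurentPolynomial.T_add, add_neg_cancel, LaurentPolynomial.T_zero, one_smul]
  map_add' x y := smul_add _ _ _

theorem nonempty_linearEquiv_iff {M N : Type*} [AddCommGroup M] [AddCommGroup N]
    [Module LambdaRing M] [Module LambdaRing N] :
    Nonempty (M ≃ₗ[LambdaRing] N) ↔ AutConj (tAut M) (tAut N) := by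
  constructor
  · rintro ⟨φ⟩
    exact ⟨φ.toAddEquiv, fun x => φ.map_smul _ _⟩
  · rintro ⟨φ, hφ⟩
    exact ⟨{ φ with map_smul' := map_laurent_smul φ.toAddMonoidHom hφ }⟩

theorem autConj_tAut_lambdaModule {M : Type*} [AddCommGroup M] (α : M ≃+ M) :
    AutConj α (tAut (LambdaModule α)) :=
  ⟨AddEquiv.refl M, fun x => (LambdaModule.T_one_smul α x).symm⟩

theorem lambdaModule_equiv_iff {M N : Type*} [AddCommGroup M] [AddCommGroup N] (α : M ≃+ M)
    (β : N ≃+ N) :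
    Nonempty (LambdaModule α ≃ₗ[LambdaRing] LambdaModule β) ↔ AutConj α β := by
  rw [nonempty_linearEquiv_iff]
  exact ⟨fun h => (autConj_tAut_lambdaModule α).trans (h.trans (autConj_tAut_lambdaModule β).symm),
    fun h => (autConj_tAut_lambdaModule α).symm.trans (h.trans (autConj_tAut_lambdaModule β))⟩

theorem equiv_lambdaModule_iff {M N : Type*} [AddCommGroup M] [Module LambdaRing M]
    [AddCommGroup N] (β : N ≃+ N) :
    Nonempty (M ≃ₗ[LambdaRing] LambdaModule β) ↔ AutConj (tAut M) β := by
  rw [nonempty_linearEquiv_iff]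
  exact ⟨fun h => h.trans (autConj_tAut_lambdaModule β).symm,
    fun h => h.trans (autConj_tAut_lambdaModule β)⟩

/-- Reduction of an integer vector to `PGroup p e`. -/
def toPGroup (p : ℕ) {k : ℕ} (e : Fin k → ℕ) : (Fin k → ℤ) →+ PGroup p e where
  toFun x i := (x i : ZMod (p ^ e i))
  map_zero' := by ext; simp
  map_add' x y := by ext; simp

/-- The map `x ↦ A x` on `PGroup p e`. -/
def matMap (p : ℕ) {k : ℕ} (e : Fin k → ℕ) (A : Matrix (Fin k) (Fin k) ℤ) (x : PGroup p e) :
    PGroup p e :=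
  fun i => ((∑ j, A i j * ((x j).val : ℤ) : ℤ) : ZMod _)

theorem toPGroup_eq_iff {x y : Fin k → ℤ} :
    toPGroup p e x = toPGroup p e y ↔ ∀ i, (p : ℤ) ^ e i ∣ x i - y i := by
  rw [funext_iff]
  refine forall_congr' fun i => ?_
  change ((x i : ℤ) : ZMod (p ^ e i)) = ((y i : ℤ) : ZMod (p ^ e i)) ↔ _
  rw [eq_comm, ZMod.intCast_eq_intCast_iff_dvd_sub]
  push_cast
  rfl

theorem toPGroup_surjective [Fact p.Prime] : Function.Surjective (toPGroup p e) := by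
  intro x
  refine ⟨fun i => ((x i).val : ℤ), ?_⟩
  ext i
  have : NeZero p := ⟨(Fact.out : p.Prime).ne_zero⟩
  simp [toPGroup]

theorem toPGroup_val [Fact p.Prime] (x : PGroup p e) :
    toPGroup p e (fun i => ((x i).val : ℤ)) = x := by
  ext i
  have : NeZero p := ⟨(Fact.out : p.Prime).ne_zero⟩
  simp [toPGroup]

/-- The divisibility condition makes the choice of integer lifts immaterial. All later computations
with `matMap` thereby become computations with integer vectors. -/
theorem matMap_toPGroup [Fact p.Prime] {A : Matrix (Fin k) (Fin k) ℤ}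
    (hA : ∀ i j, (p : ℤ) ^ e i ∣ A i j * (p : ℤ) ^ e j) (x : Fin k → ℤ) :
    matMap p e A (toPGroup p e x) = toPGroup p e (A.mulVec x) := by
  have h1 : matMap p e A (toPGroup p e x)
      = toPGroup p e (A.mulVec fun i => ((toPGroup p e x i).val : ℤ)) := rfl
  rw [h1, toPGroup_eq_iff]
  intro i
  have h2 := toPGroup_eq_iff.1 (toPGroup_val (toPGroup p e x))
  simp only [Matrix.mulVec, dotProduct, ← Finset.sum_sub_distrib, ← mul_sub]
  refine Finset.dvd_sum fun j _ => ?_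
  exact (hA i j).trans (mul_dvd_mul_left _ (h2 j))

/-- The additive map induced by an integer matrix. -/
def matHom (p : ℕ) [Fact p.Prime] {k : ℕ} (e : Fin k → ℕ) {A : Matrix (Fin k) (Fin k) ℤ}
    (hA : ∀ i j, (p : ℤ) ^ e i ∣ A i j * (p : ℤ) ^ e j) : PGroup p e →+ PGroup p e :=
  AddMonoidHom.mk' (matMap p e A) fun x y => by
    obtain ⟨x, rfl⟩ := toPGroup_surjective x
    obtain ⟨y, rfl⟩ := toPGroup_surjective y
    rw [← map_add, matMap_toPGroup hA, matMap_toPGroup hA, matMap_toPGroup hA,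
      Matrix.mulVec_add, map_add]

theorem exists_mul_modEq_one (hp : p.Prime) {a : ℤ} (ha : ¬ (p : ℤ) ∣ a) (m : ℕ) :
    ∃ b : ℤ, (p : ℤ) ^ m ∣ a * b - 1 := by
  have : IsCoprime ((p : ℤ) ^ m) a :=
    ((Prime.coprime_iff_not_dvd (Nat.prime_iff_prime_int.1 hp)).2 ha).pow_left
  obtain ⟨u, v, h⟩ := this
  exact ⟨v, -u, by linear_combination h⟩

theorem matMap_bijective [Fact p.Prime] {A : Matrix (Fin k) (Fin k) ℤ} (hA : IsAut p e A) :
    Function.Bijective (matMap p e A) := by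
  have : NeZero p := ⟨(Fact.out : p.Prime).ne_zero⟩
  rw [← Finite.surjective_iff_bijective]
  intro y
  obtain ⟨y, rfl⟩ := toPGroup_surjective y
  obtain ⟨d, hd⟩ := exists_mul_modEq_one Fact.out hA.det (∑ i, e i)
  -- The adjugate is only applied to one integer vector, so it need not itself satisfy the
  -- divisibility condition. The number `d` inverts `A.det` modulo a power of `p` large enough for
  -- every coordinate.
  refine ⟨toPGroup p e (A.adjugate.mulVec (d • y)), ?_⟩
  rw [matMap_toPGroup hA.dvd, Matrix.mulVec_mulVec, Matrix.mul_adjugate, toPGroup_eq_iff]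
  intro i
  have : (p : ℤ) ^ e i ∣ A.det * d - 1 :=
    (pow_dvd_pow _ (Finset.single_le_sum (fun _ _ => Nat.zero_le _) (Finset.mem_univ i))).trans hd
  rw [Matrix.smul_mulVec, Matrix.one_mulVec]
  simp only [Pi.smul_apply, smul_eq_mul]
  rw [show A.det * (d * y i) - y i = (A.det * d - 1) * y i by ring]
  exact this.mul_right _

/-- The automorphism of `PGroup p e` induced by an integer matrix. -/
noncomputable def matEquiv (p : ℕ) [Fact p.Prime] {k : ℕ} (e : Fin k → ℕ)
    {A : Matrix (Fin k) (Fin k) ℤ} (hA : IsAut p e A) : PGroup p e ≃+ PGroup p e :=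
  AddEquiv.ofBijective (matHom p e hA.dvd) (matMap_bijective hA)

theorem matEquiv_apply [Fact p.Prime] {A : Matrix (Fin k) (Fin k) ℤ} (hA : IsAut p e A)
    (x : PGroup p e) : matEquiv p e hA x = matMap p e A x := rfl

theorem dvd_mul_matrix {A B : Matrix (Fin k) (Fin k) ℤ}
    (hA : ∀ i j, (p : ℤ) ^ e i ∣ A i j * (p : ℤ) ^ e j)
    (hB : ∀ i j, (p : ℤ) ^ e i ∣ B i j * (p : ℤ) ^ e j) (i j : Fin k) :
    (p : ℤ) ^ e i ∣ (A * B) i j * (p : ℤ) ^ e j := by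
  rw [Matrix.mul_apply, Finset.sum_mul]
  refine Finset.dvd_sum fun l _ => ?_
  rw [mul_assoc]
  exact (hA i l).trans (mul_dvd_mul_left _ (hB l j))

theorem matMap_mul [Fact p.Prime] {A B : Matrix (Fin k) (Fin k) ℤ}
    (hA : ∀ i j, (p : ℤ) ^ e i ∣ A i j * (p : ℤ) ^ e j)
    (hB : ∀ i j, (p : ℤ) ^ e i ∣ B i j * (p : ℤ) ^ e j) (x : PGroup p e) :
    matMap p e (A * B) x = matMap p e A (matMap p e B x) := by
  obtain ⟨x, rfl⟩ := toPGroup_surjective x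
  rw [matMap_toPGroup (dvd_mul_matrix hA hB), matMap_toPGroup hB, matMap_toPGroup hA,
    Matrix.mulVec_mulVec]

theorem matMap_eq_iff [Fact p.Prime] {A B : Matrix (Fin k) (Fin k) ℤ}
    (hA : ∀ i j, (p : ℤ) ^ e i ∣ A i j * (p : ℤ) ^ e j)
    (hB : ∀ i j, (p : ℤ) ^ e i ∣ B i j * (p : ℤ) ^ e j) :
    (∀ x, matMap p e A x = matMap p e B x) ↔ MatCong p e A B := by
  constructor
  · intro h i j
    have := h (toPGroup p e (Pi.single j 1))
    rw [matMap_toPGroup hA, matMap_toPGroup hB, toPGroup_eq_iff] at this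
    simpa using this i
  · intro h x
    obtain ⟨x, rfl⟩ := toPGroup_surjective x
    rw [matMap_toPGroup hA, matMap_toPGroup hB, toPGroup_eq_iff]
    intro i
    simp only [Matrix.mulVec, dotProduct, ← Finset.sum_sub_distrib, ← sub_mul]
    exact Finset.dvd_sum fun j _ => (h i j).mul_right _

/-- The columns are lifts of the images of the standard generators. The divisibility holds because
`p ^ e j` kills the `j`-th generator, hence also its image. -/
theorem exists_matrix_of_addMonoidHom [Fact p.Prime] (φ : PGroup p e →+ PGroup p e) :
    ∃ A : Matrix (Fin k) (Fin k) ℤ, (∀ i j, (p : ℤ) ^ e i ∣ A i j * (p : ℤ) ^ e j) ∧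
      ∀ x, φ x = matMap p e A x := by
  have : NeZero p := ⟨(Fact.out : p.Prime).ne_zero⟩
  let A : Matrix (Fin k) (Fin k) ℤ := fun i j => ((φ (toPGroup p e (Pi.single j 1)) i).val : ℤ)
  have hcol : ∀ j, toPGroup p e (fun i => A i j) = φ (toPGroup p e (Pi.single j 1)) :=
    fun j => toPGroup_val _
  have hA : ∀ i j, (p : ℤ) ^ e i ∣ A i j * (p : ℤ) ^ e j := by
    intro i j
    have h0 : ((p : ℤ) ^ e j) • toPGroup p e (Pi.single j 1) = 0 := by
      rw [← map_zsmul, ← map_zero (toPGroup p e), toPGroup_eq_iff]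
      intro l
      by_cases h : l = j
      · subst h; simp
      · simp [h]
    have h1 := congrArg φ h0
    rw [map_zero, map_zsmul, ← hcol, ← map_zsmul, ← map_zero (toPGroup p e), toPGroup_eq_iff] at h1
    simpa [mul_comm] using h1 i
  refine ⟨A, hA, fun x => ?_⟩
  obtain ⟨x, rfl⟩ := toPGroup_surjective x
  rw [matMap_toPGroup hA]
  have hx : x = ∑ j, x j • (Pi.single j 1 : Fin k → ℤ) := by
    ext i; simp [Finset.sum_apply, Pi.single_apply]
  have hAx : A.mulVec x = ∑ j, x j • (fun i => A i j) := by
    ext i; simp [Matrix.mulVec, dotProduct, Finset.sum_apply, mul_comm]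
  rw [hAx, map_sum]
  conv_lhs => rw [hx, map_sum, map_sum]
  refine Finset.sum_congr rfl fun j _ => ?_
  rw [map_zsmul, map_zsmul, map_zsmul, hcol]

/-- Because every exponent is positive, the congruence can be reduced modulo `p` in all rows at
once, where determinants are multiplicative. -/
theorem not_dvd_det_of_matCong_one (hp : p.Prime) (he : ∀ i, 1 ≤ e i)
    {P Q : Matrix (Fin k) (Fin k) ℤ} (h : MatCong p e (P * Q) 1) : ¬ (p : ℤ) ∣ P.det := by
  intro hd
  have h1 : (P * Q).map (Int.castRingHom (ZMod p)) = 1 := by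
    ext i j
    have h2 : (p : ℤ) ∣ (P * Q) i j - (1 : Matrix (Fin k) (Fin k) ℤ) i j :=
      (dvd_pow_self _ (by have := he i; lia)).trans (h i j)
    rw [← ZMod.intCast_eq_intCast_iff_dvd_sub] at h2
    simp only [Matrix.map_apply, eq_intCast]
    rw [← h2, Matrix.one_apply, Matrix.one_apply]
    split_ifs <;> simp
  have h3 := congrArg Matrix.det h1
  rw [← RingHom.mapMatrix_apply, ← RingHom.map_det, Matrix.det_mul, Matrix.det_one, map_mul,
    eq_intCast, (ZMod.intCast_zmod_eq_zero_iff_dvd P.det p).2 hd, zero_mul] at h3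
  have : Fact p.Prime := ⟨hp⟩
  exact zero_ne_one h3

theorem matMap_one [Fact p.Prime] (x : PGroup p e) : matMap p e 1 x = x := by
  obtain ⟨x, rfl⟩ := toPGroup_surjective x
  rw [matMap_toPGroup, Matrix.one_mulVec]
  intro i j
  by_cases h : i = j
  · subst h; simp
  · simp [h]

theorem isAut_one (hp : p.Prime) : IsAut p e 1 where
  dvd i j := by
    by_cases h : i = j
    · subst h; simp
    · simp [h]
  det := by
    rw [Matrix.det_one]
    exact fun h => (Nat.prime_iff_prime_int.1 hp).not_dvd_one h

theorem exists_isAut_of_addEquiv [Fact p.Prime] (he : ∀ i, 1 ≤ e i)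
    (φ : PGroup p e ≃+ PGroup p e) :
    ∃ A : Matrix (Fin k) (Fin k) ℤ, IsAut p e A ∧ ∀ x, φ x = matMap p e A x := by
  obtain ⟨A, hA, hφ⟩ := exists_matrix_of_addMonoidHom φ.toAddMonoidHom
  obtain ⟨B, hB, hψ⟩ := exists_matrix_of_addMonoidHom φ.symm.toAddMonoidHom
  refine ⟨A, ⟨hA, not_dvd_det_of_matCong_one (e := e) Fact.out he (Q := B) ?_⟩, hφ⟩
  rw [← matMap_eq_iff (dvd_mul_matrix hA hB) (isAut_one Fact.out).dvd]
  intro x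
  rw [matMap_mul hA hB, matMap_one, ← hψ, ← hφ]
  exact φ.apply_symm_apply x

theorem IsAut.mul (hp : p.Prime) {A B : Matrix (Fin k) (Fin k) ℤ} (hA : IsAut p e A)
    (hB : IsAut p e B) : IsAut p e (A * B) where
  dvd := dvd_mul_matrix hA.dvd hB.dvd
  det := by
    rw [Matrix.det_mul, (Nat.prime_iff_prime_int.1 hp).dvd_mul]
    exact not_or.2 ⟨hA.det, hB.det⟩

theorem MatCong.refl (A : Matrix (Fin k) (Fin k) ℤ) : MatCong p e A A := fun i j => by simp

theorem MatConj.of_matCong (hp : p.Prime) {A B : Matrix (Fin k) (Fin k) ℤ}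
    (h : MatCong p e A B) : MatConj p e A B :=
  ⟨1, isAut_one hp, by simpa using h⟩

theorem autConj_of_matConj [Fact p.Prime] {A B : Matrix (Fin k) (Fin k) ℤ} (hA : IsAut p e A)
    (hB : IsAut p e B) (h : MatConj p e A B) : AutConj (matEquiv p e hB) (matEquiv p e hA) := by
  obtain ⟨P, hP, h⟩ := h
  refine ⟨matEquiv p e hP, fun x => ?_⟩
  simp only [matEquiv_apply]
  rw [← matMap_mul hP.dvd hB.dvd, ← matMap_mul hA.dvd hP.dvd]
  exact ((matMap_eq_iff (hA.mul Fact.out hP).dvd (hP.mul Fact.out hB).dvd).2 h x).symm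

theorem matConj_of_autConj [Fact p.Prime] (he : ∀ i, 1 ≤ e i) {A B : Matrix (Fin k) (Fin k) ℤ}
    (hA : IsAut p e A) (hB : IsAut p e B) (h : AutConj (matEquiv p e hB) (matEquiv p e hA)) :
    MatConj p e A B := by
  obtain ⟨φ, h⟩ := h
  obtain ⟨P, hP, hφ⟩ := exists_isAut_of_addEquiv he φ
  refine ⟨P, hP, ?_⟩
  rw [← matMap_eq_iff (hA.mul Fact.out hP).dvd (hP.mul Fact.out hB).dvd]
  intro x
  rw [matMap_mul hP.dvd hB.dvd, matMap_mul hA.dvd hP.dvd, ← hφ, ← hφ]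
  exact (h x).symm

/-- Rowwise congruence is not obviously compatible with products, so the argument passes to the
induced maps. This is why all three matrices must act on the group. -/
theorem MatConj.trans (hp : p.Prime) {A B C : Matrix (Fin k) (Fin k) ℤ} (h : MatConj p e A B)
    (h' : MatConj p e B C) (hA : ∀ i j, (p : ℤ) ^ e i ∣ A i j * (p : ℤ) ^ e j)
    (hB : ∀ i j, (p : ℤ) ^ e i ∣ B i j * (p : ℤ) ^ e j)
    (hC : ∀ i j, (p : ℤ) ^ e i ∣ C i j * (p : ℤ) ^ e j) : MatConj p e A C := by
  have : Fact p.Prime := ⟨hp⟩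
  obtain ⟨P, hP, h⟩ := h
  obtain ⟨Q, hQ, h'⟩ := h'
  have hPQ := hP.mul hp hQ
  refine ⟨P * Q, hPQ, ?_⟩
  rw [← matMap_eq_iff (dvd_mul_matrix hA hPQ.dvd) (dvd_mul_matrix hPQ.dvd hC)]
  intro x
  have h1 := (matMap_eq_iff (dvd_mul_matrix hA hP.dvd) (dvd_mul_matrix hP.dvd hB)).2 h
  have h2 := (matMap_eq_iff (dvd_mul_matrix hB hQ.dvd) (dvd_mul_matrix hQ.dvd hC)).2 h'
  rw [← mul_assoc, matMap_mul (dvd_mul_matrix hA hP.dvd) hQ.dvd, h1,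
    ← matMap_mul (dvd_mul_matrix hP.dvd hB) hQ.dvd, mul_assoc,
    matMap_mul hP.dvd (dvd_mul_matrix hB hQ.dvd), h2, ← matMap_mul hP.dvd (dvd_mul_matrix hQ.dvd hC),
    mul_assoc]

theorem MatConj.symm (hp : p.Prime) (he : ∀ i, 1 ≤ e i) {A B : Matrix (Fin k) (Fin k) ℤ}
    (hA : IsAut p e A) (hB : IsAut p e B) (h : MatConj p e A B) : MatConj p e B A := by
  have : Fact p.Prime := ⟨hp⟩
  exact matConj_of_autConj he hB hA (autConj_of_matConj hA hB h).symm

end Framework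

/-! ### Finite abelian `p`-groups and their partitions -/

section Partition

variable {p : ℕ} {k : ℕ} {e : Fin k → ℕ}

theorem card_zmod_pow_torsion (hp : p.Prime) (m j : ℕ) :
    Nat.card {x : ZMod (p ^ m) // (p ^ j) • x = 0} = p ^ min j m := by
  have : NeZero p := ⟨hp.ne_zero⟩
  have h := IsAddCyclic.card_nsmulAddMonoidHom_ker (G := ZMod (p ^ m)) (p ^ j)
  rw [Nat.card_zmod] at h
  have hgcd : (p ^ m).gcd (p ^ j) = p ^ min j m := by
    rcases le_total j m with hjm | hjm
    · rw [min_eq_left hjm, Nat.gcd_eq_right (pow_dvd_pow p hjm)]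
    · rw [min_eq_right hjm, Nat.gcd_eq_left (pow_dvd_pow p hjm)]
  rw [← hgcd, ← h]
  rfl

theorem card_pGroup_torsion (hp : p.Prime) (e : Fin k → ℕ) (j : ℕ) :
    Nat.card {x : PGroup p e // (p ^ j) • x = 0} = p ^ ∑ i, min j (e i) := by
  have h : {x : PGroup p e // (p ^ j) • x = 0}
      ≃ ((i : Fin k) → {x : ZMod (p ^ e i) // (p ^ j) • x = 0}) :=
    (Equiv.subtypeEquivRight fun x => by rw [funext_iff]; rfl).trans Equiv.subtypePiEquivPi
  rw [Nat.card_congr h, Nat.card_pi, ← Finset.prod_pow_eq_pow_sum]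
  exact Finset.prod_congr rfl fun i _ => card_zmod_pow_torsion hp _ _

/-- An isomorphism preserves the order of the `p ^ j`-torsion, and a factor with exponent `e i`
contributes `p ^ min j (e i)` to it. A single well chosen `j` suffices to tell two partitions apart.
-/
theorem sum_min_eq_of_addEquiv (hp : p.Prime) {k' : ℕ} {e' : Fin k' → ℕ}
    (φ : PGroup p e ≃+ PGroup p e') (j : ℕ) : ∑ i, min j (e i) = ∑ i, min j (e' i) := by
  apply Nat.pow_right_injective hp.two_le
  change p ^ _ = p ^ _
  rw [← card_pGroup_torsion hp, ← card_pGroup_torsion hp]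
  refine Nat.card_congr (φ.toEquiv.subtypeEquiv fun x => ?_)
  change _ ↔ _ • φ x = 0
  rw [← map_nsmul, map_eq_zero_iff φ φ.injective]

theorem card_pGroup (e : Fin k → ℕ) : Nat.card (PGroup p e) = p ^ ∑ i, e i := by
  rw [Nat.card_pi, ← Finset.prod_pow_eq_pow_sum]
  simp

theorem exists_addEquiv_pGroup (hp : p.Prime) {n : ℕ} {M : Type u} [AddCommGroup M]
    (hM : Nat.card M = p ^ n) :
    ∃ (k : ℕ) (e : Fin k → ℕ), Antitone e ∧ (∀ i, 1 ≤ e i) ∧ ∑ i, e i = n ∧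
      Nonempty (M ≃+ PGroup p e) := by
  have hfin : Finite M := Nat.finite_of_card_ne_zero (by rw [hM]; exact (pow_pos hp.pos n).ne')
  obtain ⟨ι, hι, m, hm, ⟨φ⟩⟩ := AddCommGroup.equiv_directSum_zmod_of_finite' M
  classical
  have φ' : M ≃+ ((i : ι) → ZMod (m i)) := φ.trans (DirectSum.addEquivProd fun i => ZMod (m i))
  have hprod : ∏ i, m i = p ^ n := by
    rw [← hM, Nat.card_congr φ'.toEquiv, Nat.card_pi]
    simp
  have hdvd : ∀ i, ∃ e, 1 ≤ e ∧ m i = p ^ e := by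
    intro i
    obtain ⟨e, -, he⟩ := (Nat.dvd_prime_pow hp).1
      (hprod ▸ Finset.dvd_prod_of_mem m (Finset.mem_univ i))
    refine ⟨e, ?_, he⟩
    by_contra h
    have := hm i
    rw [he, show e = 0 by lia] at this
    simp at this
  choose e he hme using hdvd
  obtain rfl : m = fun i => p ^ e i := funext hme
  let ε := Fintype.equivFin ι
  -- Sorting in the dual order makes the exponents weakly decreasing.
  let f : Fin (Fintype.card ι) → ℕᵒᵈ := fun i => OrderDual.toDual (e (ε.symm i))
  let σ : Fin (Fintype.card ι) ≃ ι := (Tuple.sort f).trans ε.symm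
  refine ⟨Fintype.card ι, fun i => e (σ i), ?_, fun i => he _, ?_, ⟨φ'.trans ?_⟩⟩
  · exact fun i j hij => Tuple.monotone_sort f hij
  · rw [Equiv.sum_comp σ e]
    apply Nat.pow_right_injective hp.two_le
    change p ^ _ = p ^ _
    rw [← hprod, Finset.prod_pow_eq_pow_sum]
  · exact (RingEquiv.piCongrLeft (fun i => ZMod (p ^ e i)) σ).symm.toAddEquiv

end Partition

/-! ### From conjugacy classes for each group to isomorphism classes of modules -/

section Assembly

variable {p : ℕ} {k : ℕ} {e : Fin k → ℕ}

/-- The sets of matrices in `L` classify the automorphisms of `PGroup p e` up to conjugation. -/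
structure Classifies (p : ℕ) {k : ℕ} (e : Fin k → ℕ)
    (L : List (Set (Matrix (Fin k) (Fin k) ℤ) × ℚ)) : Prop where
  isAut : ∀ S ∈ L, ∀ A ∈ S.1, IsAut p e A
  pairwise : L.Pairwise fun S T => ∀ A ∈ S.1, ∀ B ∈ T.1, ¬ MatConj p e A B
  inj : ∀ S ∈ L, ∀ A ∈ S.1, ∀ B ∈ S.1, MatConj p e A B → A = B
  exhaust : ∀ A, IsAut p e A → ∃ S ∈ L, ∃ B ∈ S.1, MatConj p e A B

/-- The table rows with the given group. -/
def rowsOf {k : ℕ} (e : Fin k → ℕ) (L : List (Set (Matrix (Fin k) (Fin k) ℤ) × ℚ)) :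
    List TableRow :=
  L.map fun S => ⟨k, e, S.1, S.2⟩

/-- No module of one row is isomorphic to a module of the other. -/
def RowsDisjoint (p : ℕ) [Fact p.Prime] (r s : TableRow) : Prop :=
  ∀ A ∈ r.matrices, ∀ B ∈ s.matrices, ∀ (hA : IsAut p r.e A) (hB : IsAut p s.e B),
    ¬ AutConj (matEquiv p r.e hA) (matEquiv p s.e hB)

/-- The rows of `T` list pairwise nonisomorphic modules of order `p ^ n`. -/
structure Separates (p : ℕ) [Fact p.Prime] (n : ℕ) (T : List TableRow) : Prop where
  isAut : ∀ r ∈ T, ∀ A ∈ r.matrices, IsAut p r.e A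
  pairwise : T.Pairwise (RowsDisjoint p)
  inj : ∀ r ∈ T, ∀ A ∈ r.matrices, ∀ B ∈ r.matrices, ∀ (hA : IsAut p r.e A) (hB : IsAut p r.e B),
    AutConj (matEquiv p r.e hA) (matEquiv p r.e hB) → A = B
  sum_eq : ∀ r ∈ T, ∑ i, r.e i = n

/-- Every automorphism of a group of order `p ^ n` occurs in one of the rows of `T`. -/
def Exhausts (p : ℕ) [Fact p.Prime] (n : ℕ) (T : List TableRow) : Prop :=
  ∀ (M : Type u) [AddCommGroup M] (α : M ≃+ M), Nat.card M = p ^ n →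
    ∃ r ∈ T, ∃ A ∈ r.matrices, ∃ hA : IsAut p r.e A, AutConj α (matEquiv p r.e hA)

theorem RowsDisjoint.symm [Fact p.Prime] {r s : TableRow} (h : RowsDisjoint p r s) :
    RowsDisjoint p s r :=
  fun A hA B hB hA' hB' hc => h B hB A hA hB' hA' hc.symm

theorem separates_perm [Fact p.Prime] {n : ℕ} {T T' : List TableRow} (hT : T.Perm T')
    (h : Separates p n T) : Separates p n T' where
  isAut r hr := h.isAut r (hT.mem_iff.2 hr)
  pairwise := (hT.pairwise_iff fun h => h.symm).1 h.pairwise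
  inj r hr := h.inj r (hT.mem_iff.2 hr)
  sum_eq r hr := h.sum_eq r (hT.mem_iff.2 hr)

theorem exhausts_perm [Fact p.Prime] {n : ℕ} {T T' : List TableRow} (hT : T.Perm T')
    (h : Exhausts.{u} p n T) : Exhausts.{u} p n T' := by
  intro M _ α hM
  obtain ⟨r, hr, h⟩ := h M α hM
  exact ⟨r, hT.mem_iff.1 hr, h⟩

theorem Classifies.separates [Fact p.Prime] {n : ℕ}
    {L : List (Set (Matrix (Fin k) (Fin k) ℤ) × ℚ)} (h : Classifies p e L) (he : ∀ i, 1 ≤ e i)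
    (hn : ∑ i, e i = n) : Separates p n (rowsOf e L) where
  isAut r hr A hA := by
    obtain ⟨S, hS, rfl⟩ := List.mem_map.1 hr
    exact h.isAut S hS A hA
  pairwise := by
    rw [rowsOf, List.pairwise_map]
    refine h.pairwise.imp fun {S T} hST A hA B hB hA' hB' hc => ?_
    exact hST A hA B hB (matConj_of_autConj he hA' hB' hc.symm)
  inj r hr A hA B hB hA' hB' hc := by
    obtain ⟨S, hS, rfl⟩ := List.mem_map.1 hr
    exact h.inj S hS A hA B hB (matConj_of_autConj he hA' hB' hc.symm)
  sum_eq r hr := by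
    obtain ⟨S, hS, rfl⟩ := List.mem_map.1 hr
    exact hn

/-- Modules from the two lists already differ as abelian groups, by the order of their `p ^
j`-torsion. -/
theorem Separates.append [Fact p.Prime] {n : ℕ} {T T' : List TableRow} (h : Separates p n T)
    (h' : Separates p n T') (j : ℕ)
    (hj : ∀ r ∈ T, ∀ s ∈ T', ∑ i, min j (r.e i) ≠ ∑ i, min j (s.e i)) :
    Separates p n (T ++ T') where
  isAut r hr := (List.mem_append.1 hr).elim (h.isAut r) (h'.isAut r)
  pairwise := by
    rw [List.pairwise_append]
    refine ⟨h.pairwise, h'.pairwise, fun r hr s hs A _ B _ hA hB hc => hj r hr s hs ?_⟩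
    exact sum_min_eq_of_addEquiv Fact.out hc.choose j
  inj r hr := (List.mem_append.1 hr).elim (h.inj r) (h'.inj r)
  sum_eq r hr := (List.mem_append.1 hr).elim (h.sum_eq r) (h'.sum_eq r)

theorem Classifies.exists_row [Fact p.Prime] {L : List (Set (Matrix (Fin k) (Fin k) ℤ) × ℚ)}
    (h : Classifies p e L) (he : ∀ i, 1 ≤ e i) {M : Type u} [AddCommGroup M] (α : M ≃+ M)
    (φ : M ≃+ PGroup p e) :
    ∃ r ∈ rowsOf e L, ∃ A ∈ r.matrices, ∃ hA : IsAut p r.e A, AutConj α (matEquiv p r.e hA) := by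
  obtain ⟨A, hA, hα⟩ := exists_isAut_of_addEquiv he (φ.symm.trans (α.trans φ))
  obtain ⟨S, hS, B, hB, hc⟩ := h.exhaust A hA
  refine ⟨_, List.mem_map_of_mem hS, B, hB, h.isAut S hS B hB, ?_⟩
  refine AutConj.trans (β := matEquiv p e hA) ⟨φ, fun x => ?_⟩
    (autConj_of_matConj hA (h.isAut S hS B hB) hc).symm
  rw [matEquiv_apply, ← hα]
  simp

theorem exists_tau [Fact p.Prime] {n : ℕ} (h : Separates p n (table p n))
    (h' : Exhausts.{u} p n (table p n)) :
    ∃ τ : (E : Entry p n) → (E.Group ≃+ E.Group),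
      (∀ (E : Entry p n) (x : E.Group), τ E x = E.matrixMap x) ∧
      (∀ E : Entry p n, Nat.card (LambdaModule (τ E)) = p ^ n) ∧
      (∀ E F : Entry p n,
        Nonempty (LambdaModule (τ E) ≃ₗ[LambdaRing] LambdaModule (τ F)) → E = F) ∧
      (∀ (M : Type u) [AddCommGroup M] [Module LambdaRing M], Nat.card M = p ^ n →
        ∃ E : Entry p n, Nonempty (M ≃ₗ[LambdaRing] LambdaModule (τ E))) := by
  have haut : ∀ E : Entry p n, IsAut p ((table p n).get E.1).e E.2.1 :=
    fun E => h.isAut _ (List.get_mem _ _) _ E.2.2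
  refine ⟨fun E => matEquiv p _ (haut E), fun E x => rfl, fun E => ?_, fun E F hEF => ?_,
    fun M _ _ hM => ?_⟩
  · exact (card_pGroup _).trans (congrArg _ (h.sum_eq _ (List.get_mem _ _)))
  · rw [lambdaModule_equiv_iff] at hEF
    have hpw := List.pairwise_iff_get.1 h.pairwise
    obtain ⟨i, A, hA⟩ := E
    obtain ⟨j, B, hB⟩ := F
    rcases lt_trichotomy i j with hij | hij | hij
    · exact (hpw i j hij A hA B hB (haut ⟨i, A, hA⟩) (haut ⟨j, B, hB⟩) hEF).elim
    · subst hij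
      have := h.inj _ (List.get_mem _ _) A hA B hB (haut ⟨i, A, hA⟩) (haut ⟨i, B, hB⟩) hEF
      subst this
      rfl
    · exact (hpw j i hij B hB A hA (haut ⟨j, B, hB⟩) (haut ⟨i, A, hA⟩) hEF.symm).elim
  · obtain ⟨r, hr, A, hA, hA', hc⟩ := h' M (tAut M) hM
    obtain ⟨i, rfl⟩ := List.get_of_mem hr
    exact ⟨⟨i, A, hA⟩, (equiv_lambdaModule_iff _).2 hc⟩

/-- The listed modules form a system of representatives, so sending an entry to the class of its
module is a bijection onto the set being counted. -/
theorem numLambdaModules_eq_card_entry {n : ℕ}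
    (h : ∃ τ : (E : Entry p n) → (E.Group ≃+ E.Group),
      (∀ (E : Entry p n) (x : E.Group), τ E x = E.matrixMap x) ∧
      (∀ E : Entry p n, Nat.card (LambdaModule (τ E)) = p ^ n) ∧
      (∀ E F : Entry p n,
        Nonempty (LambdaModule (τ E) ≃ₗ[LambdaRing] LambdaModule (τ F)) → E = F) ∧
      (∀ (M : Type u) [AddCommGroup M] [Module LambdaRing M], Nat.card M = p ^ n →
        ∃ E : Entry p n, Nonempty (M ≃ₗ[LambdaRing] LambdaModule (τ E)))) :
    numLambdaModules.{u} (p ^ n) = Nat.card (Entry p n) := by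
  obtain ⟨τ, -, hcard, hinj, hex⟩ := h
  let f : Entry p n → Quotient (CategoryTheory.isIsomorphicSetoid (ModuleCat.{u} LambdaRing)) :=
    -- The listed modules live in `Type`, while the classes are counted in universe `u`.
    fun E => Quotient.mk _ (ModuleCat.of LambdaRing (ULift.{u} (LambdaModule (τ E))))
  have hf : Function.Injective f := by
    intro E F hEF
    obtain ⟨i⟩ := Quotient.exact hEF
    exact hinj E F ⟨ULift.moduleEquiv.symm.trans (i.toLinearEquiv.trans ULift.moduleEquiv)⟩
  rw [numLambdaModules, ← Set.ncard_univ, ← Set.ncard_image_of_injective _ hf, Set.image_univ]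
  congr 1
  ext q
  simp only [Set.mem_image, Set.mem_ofPred_eq, Set.mem_range]
  constructor
  · rintro ⟨M, hM, rfl⟩
    obtain ⟨E, ⟨φ⟩⟩ := hex M hM
    exact ⟨E, Quotient.sound ⟨(φ.trans ULift.moduleEquiv.symm).toModuleIso.symm⟩⟩
  · rintro ⟨E, rfl⟩
    exact ⟨_, (Nat.card_congr Equiv.ulift).trans (hcard E), rfl⟩

theorem card_entry_eq_sum {n : ℕ}
    (h : ∀ r ∈ table p n, r.matrices.Finite ∧ (r.matrices.ncard : ℚ) = r.total) :
    (Nat.card (Entry p n) : ℚ) = ((table p n).map TableRow.total).sum := by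
  have hfin : ∀ i : Fin (table p n).length, Finite {A // A ∈ ((table p n).get i).matrices} :=
    fun i => (h _ (List.get_mem _ _)).1
  rw [Nat.card_sigma, ← Fin.sum_univ_fun_getElem, Nat.cast_sum]
  exact Finset.sum_congr rfl fun i _ => (h _ (List.get_mem _ i)).2

end Assembly

/-! ### The rows regrouped by abelian group, and the enumeration of partitions -/

section Tables

/-- The matrices of the table for the group with exponents `![1]`. -/
def auts1 (p : ℕ) : List (Set (Matrix (Fin 1) (Fin 1) ℤ) × ℚ) :=
  [({A | ∃ b : ℤ, IsUnitRep p 1 b ∧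
        A = !![b]}, (p - 1 : ℚ))]

/-- The matrices of the table for the group with exponents `![2]`. -/
def auts2 (p : ℕ) : List (Set (Matrix (Fin 1) (Fin 1) ℤ) × ℚ) :=
  [({A | ∃ b : ℤ, IsUnitRep p 2 b ∧
        A = !![b]}, (p ^ 2 - p : ℚ))]

/-- The matrices of the table for the group with exponents `![1, 1]`. -/
def auts11 (p : ℕ) : List (Set (Matrix (Fin 2) (Fin 2) ℤ) × ℚ) :=
  [({A | ∃ b c : ℤ, 0 < b ∧ b ≤ c ∧ c < p ∧
        A = !![b, 0; 0, c]}, ((p.choose 2 : ℕ) : ℚ)),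
   ({A | ∃ b : ℤ, IsUnitRep p 1 b ∧
        A = !![b, 1; 0, b]}, (p - 1 : ℚ)),
   ({A | ∃ b₀ b₁ : ℤ, IrrTwo p b₀ b₁ ∧
        A = !![0, 1; -b₀, -b₁]}, ((p ^ 2 - p) / 2 : ℚ))]

/-- The matrices of the table for the group with exponents `![3]`. -/
def auts3 (p : ℕ) : List (Set (Matrix (Fin 1) (Fin 1) ℤ) × ℚ) :=
  [({A | ∃ b : ℤ, IsUnitRep p 3 b ∧
        A = !![b]}, (p ^ 3 - p ^ 2 : ℚ))]

/-- The matrices of the table for the group with exponents `![2, 1]`. -/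
def auts21 (p : ℕ) : List (Set (Matrix (Fin 2) (Fin 2) ℤ) × ℚ) :=
  [({A | ∃ b c : ℤ, IsUnitRep p 2 b ∧ IsUnitRep p 1 c ∧
        A = !![b, 0; 0, c]}, (p * (p - 1) ^ 2 : ℚ)),
   ({A | ∃ b : ℤ, 0 < b ∧ b < p ∧
        A = !![b, 0; 1, b]}, (p - 1 : ℚ)),
   ({A | ∃ b γ : ℤ, 0 < b ∧ b < p ∧ IsRep p γ ∧
        A = !![b, p; γ, b]}, (p * (p - 1) : ℚ))]

/-- The matrices of the table for the group with exponents `![1, 1, 1]`. -/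
def auts111 (p : ℕ) : List (Set (Matrix (Fin 3) (Fin 3) ℤ) × ℚ) :=
  [({A | ∃ b c d : ℤ, 0 < b ∧ b ≤ c ∧ c ≤ d ∧ d < p ∧
        A = !![b, 0, 0; 0, c, 0; 0, 0, d]}, (((p + 1).choose 3 : ℕ) : ℚ)),
   ({A | ∃ b c : ℤ, IsUnitRep p 1 b ∧ IsUnitRep p 1 c ∧
        A = !![b, 1, 0; 0, b, 0; 0, 0, c]}, ((p - 1) ^ 2 : ℚ)),
   ({A | ∃ b : ℤ, IsUnitRep p 1 b ∧
        A = !![b, 1, 0; 0, b, 1; 0, 0, b]}, (p - 1 : ℚ)),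
   ({A | ∃ b₀ b₁ b₂ : ℤ, IrrThree p b₀ b₁ b₂ ∧
        A = !![0, 1, 0; 0, 0, 1; -b₀, -b₁, -b₂]}, ((p ^ 3 - p) / 3 : ℚ)),
   ({A | ∃ b₀ b₁ c : ℤ, IrrTwo p b₀ b₁ ∧ IsUnitRep p 1 c ∧
        A = !![0, 1, 0; -b₀, -b₁, 0; 0, 0, c]}, (p * (p - 1) ^ 2 / 2 : ℚ))]

/-- The matrices of the table for the group with exponents `![4]`. -/
def auts4 (p : ℕ) : List (Set (Matrix (Fin 1) (Fin 1) ℤ) × ℚ) :=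
  [({A | ∃ b : ℤ, IsUnitRep p 4 b ∧
        A = !![b]}, (p ^ 3 * (p - 1) : ℚ))]

/-- The matrices of the table for the group with exponents `![3, 1]`. -/
def auts31 (p : ℕ) : List (Set (Matrix (Fin 2) (Fin 2) ℤ) × ℚ) :=
  [({A | ∃ b c : ℤ, IsUnitRep p 3 b ∧ IsUnitRep p 1 c ∧
        A = !![b, 0; 0, c]}, (p ^ 2 * (p - 1) ^ 2 : ℚ)),
   ({A | ∃ b : ℤ, 0 < b ∧ b < p ^ 2 ∧ ¬ (p : ℤ) ∣ b ∧
        A = !![b, 0; 1, b]}, (p * (p - 1) : ℚ)),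
   ({A | ∃ b γ : ℤ, 0 < b ∧ b < p ^ 2 ∧ ¬ (p : ℤ) ∣ b ∧ IsRep p γ ∧
        A = !![b, p ^ 2; γ, b]}, (p ^ 2 * (p - 1) : ℚ))]

/-- The matrices of the table for the group with exponents `![2, 2]`. -/
def auts22 (p : ℕ) : List (Set (Matrix (Fin 2) (Fin 2) ℤ) × ℚ) :=
  [({A | ∃ b c : ℤ, IsUnitRep p 2 b ∧ IsUnitRep p 2 c ∧ b ≤ c ∧
        A = !![b, 0; 0, c]}, (((p * (p - 1) + 1).choose 2 : ℕ) : ℚ)),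
   ({A | ∃ b : ℤ, IsUnitRep p 2 b ∧
        A = !![b, p; 0, b]}, (p * (p - 1) : ℚ)),
   ({A | ∃ b b₀ b₁ : ℤ, 0 < b ∧ b < p ∧ IrrTwo p b₀ b₁ ∧
        A = !![b, p; -(p * b₀), b - p * b₁]}, (p * (p - 1) ^ 2 / 2 : ℚ)),
   ({A | ∃ b α γ : ℤ, 0 < b ∧ b < p ∧ IsRep p α ∧ IsRep p γ ∧
        A = !![b + p * α, 1; p * γ, b]}, (p ^ 2 * (p - 1) : ℚ)),
   ({A | ∃ b₀ b₁ α β : ℤ, IrrTwo p b₀ b₁ ∧ IsRep p α ∧ IsRep p β ∧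
        A = !![p * α, 1 + p * β; -b₀, -b₁]}, (p ^ 2 * (p ^ 2 - p) / 2 : ℚ))]

/-- The matrices of the table for the group with exponents `![2, 1, 1]`. -/
def auts211 (p : ℕ) : List (Set (Matrix (Fin 3) (Fin 3) ℤ) × ℚ) :=
  [({A | ∃ b c d : ℤ, IsUnitRep p 2 b ∧ 0 < c ∧ c ≤ d ∧ d < p ∧
        A = !![b, 0, 0; 0, c, 0; 0, 0, d]}, (p ^ 2 * (p - 1) ^ 2 / 2 : ℚ)),
   ({A | ∃ b c : ℤ, 0 < b ∧ b < p ∧ IsUnitRep p 1 c ∧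
        A = !![b, 0, 0; 1, b, 0; 0, 0, c]}, ((p - 1) ^ 2 : ℚ)),
   ({A | ∃ b η : ℤ, 0 < b ∧ b < p ∧ IsRep p η ∧
        A = !![b, p, 0; η, b, 0; 0, 0, b]}, (p * (p - 1) : ℚ)),
   ({A | ∃ b : ℤ, 0 < b ∧ b < p ∧
        A = !![b, p, 0; 0, b, 0; 1, 0, b]}, (p - 1 : ℚ)),
   ({A | ∃ b c : ℤ, IsUnitRep p 2 b ∧ IsUnitRep p 1 c ∧
        A = !![b, 0, 0; 0, c, 1; 0, 0, c]}, (p * (p - 1) ^ 2 : ℚ)),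
   ({A | ∃ b : ℤ, 0 < b ∧ b < p ∧
        A = !![b, 0, 0; 0, b, 1; 1, 0, b]}, (p - 1 : ℚ)),
   ({A | ∃ b η : ℤ, 0 < b ∧ b < p ∧ IsRep p η ∧
        A = !![b, p, 0; 0, b, 1; η, 0, b]}, (p * (p - 1) : ℚ)),
   ({A | ∃ b c γ : ℤ, 0 < b ∧ b < p ∧ IsRep p γ ∧ IsUnitRep p 1 c ∧ b ≠ c ∧
        A = !![b, p, 0; γ, b, 0; 0, 0, c]}, (p * (p - 1) * (p - 2) : ℚ)),
   ({A | ∃ b c₀ c₁ : ℤ, IsUnitRep p 2 b ∧ IrrTwo p c₀ c₁ ∧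
        A = !![b, 0, 0; 0, 0, 1; 0, -c₀, -c₁]}, (p ^ 2 * (p - 1) ^ 2 / 2 : ℚ))]

/-- The matrices of the table for the group with exponents `![1, 1, 1, 1]`. -/
def auts1111 (p : ℕ) : List (Set (Matrix (Fin 4) (Fin 4) ℤ) × ℚ) :=
  [({A | ∃ b c d e : ℤ, 0 < b ∧ b ≤ c ∧ c ≤ d ∧ d ≤ e ∧ e < p ∧
        A = !![b, 0, 0, 0; 0, c, 0, 0; 0, 0, d, 0; 0, 0, 0, e]}, (((p + 2).choose 4 : ℕ) : ℚ)),
   ({A | ∃ b c d : ℤ, IsUnitRep p 1 b ∧ 0 < c ∧ c ≤ d ∧ d < p ∧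
        A = !![b, 1, 0, 0; 0, b, 0, 0; 0, 0, c, 0; 0, 0, 0, d]}, (p * (p - 1) ^ 2 / 2 : ℚ)),
   ({A | ∃ b c : ℤ, 0 < b ∧ b ≤ c ∧ c < p ∧
        A = !![b, 1, 0, 0; 0, b, 0, 0; 0, 0, c, 1; 0, 0, 0, c]}, ((p.choose 2 : ℕ) : ℚ)),
   ({A | ∃ b c : ℤ, IsUnitRep p 1 b ∧ IsUnitRep p 1 c ∧
        A = !![b, 1, 0, 0; 0, b, 1, 0; 0, 0, b, 0; 0, 0, 0, c]}, ((p - 1) ^ 2 : ℚ)),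
   ({A | ∃ b : ℤ, IsUnitRep p 1 b ∧
        A = !![b, 1, 0, 0; 0, b, 1, 0; 0, 0, b, 1; 0, 0, 0, b]}, (p - 1 : ℚ)),
   ({A | ∃ b₀ b₁ c₀ c₁ : ℤ, IrrTwo p b₀ b₁ ∧ IrrTwo p c₀ c₁ ∧ LexLE b₀ b₁ c₀ c₁ ∧
        A = !![0, 1, 0, 0; -b₀, -b₁, 0, 0; 0, 0, 0, 1; 0, 0, -c₀, -c₁]}, ((((p ^ 2 - p) / 2 + 1).choose 2 : ℕ) : ℚ)),
   ({A | ∃ b₀ b₁ : ℤ, IrrTwo p b₀ b₁ ∧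
        A = !![0, 1, 1, 0; -b₀, -b₁, 0, 1; 0, 0, 0, 1; 0, 0, -b₀, -b₁]}, ((p ^ 2 - p) / 2 : ℚ)),
   ({A | ∃ b₀ b₁ b₂ b₃ : ℤ, IrrFour p b₀ b₁ b₂ b₃ ∧
        A = !![0, 1, 0, 0; 0, 0, 1, 0; 0, 0, 0, 1; -b₀, -b₁, -b₂, -b₃]}, ((p ^ 4 - p ^ 2) / 4 : ℚ)),
   ({A | ∃ b₀ b₁ b₂ c : ℤ, IrrThree p b₀ b₁ b₂ ∧ IsUnitRep p 1 c ∧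
        A = !![0, 1, 0, 0; 0, 0, 1, 0; -b₀, -b₁, -b₂, 0; 0, 0, 0, c]}, ((p ^ 3 - p) * (p - 1) / 3 : ℚ)),
   ({A | ∃ b₀ b₁ c d : ℤ, IrrTwo p b₀ b₁ ∧ 0 < c ∧ c ≤ d ∧ d < p ∧
        A = !![0, 1, 0, 0; -b₀, -b₁, 0, 0; 0, 0, c, 0; 0, 0, 0, d]}, (p ^ 2 * (p - 1) ^ 2 / 4 : ℚ)),
   ({A | ∃ b c₀ c₁ : ℤ, IsUnitRep p 1 b ∧ IrrTwo p c₀ c₁ ∧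
        A = !![b, 1, 0, 0; 0, b, 0, 0; 0, 0, 0, 1; 0, 0, -c₀, -c₁]}, (p * (p - 1) ^ 2 / 2 : ℚ))]

theorem tableTwo_eq (p : ℕ) : table p 2 = rowsOf ![2] (auts2 p) ++ rowsOf ![1, 1] (auts11 p) := rfl

theorem tableThree_eq (p : ℕ) : table p 3
    = (rowsOf ![3] (auts3 p) ++ rowsOf ![2, 1] (auts21 p)) ++ rowsOf ![1, 1, 1] (auts111 p) := rfl

theorem tableFour_perm (p : ℕ) :
    ((((rowsOf ![4] (auts4 p) ++ rowsOf ![3, 1] (auts31 p)) ++ rowsOf ![2, 2] (auts22 p))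
      ++ rowsOf ![2, 1, 1] (auts211 p)) ++ rowsOf ![1, 1, 1, 1] (auts1111 p)).Perm (table p 4) := by
  let f : Fin 29 → TableRow := (table p 4).get
  -- The positions `24` and `26` hold the two rows for `ℤ_{p²} × ℤ_p²` that stand among the
  -- elementary abelian ones in the table.
  have h : ([0, 1, 2, 3, 4, 5, 6, 7, 8, 9, 10, 11, 12, 13, 14, 15, 24, 26, 16, 17, 18, 19, 20,
    21, 22, 23, 25, 27, 28] : List (Fin 29)).Perm
    [0, 1, 2, 3, 4, 5, 6, 7, 8, 9, 10, 11, 12, 13, 14, 15, 16, 17, 18, 19, 20, 21, 22, 23, 24, 25,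
    26, 27, 28] := by decide
  exact h.map f

variable {p : ℕ} [Fact p.Prime]

theorem sum_min_of_mem_rowsOf {k : ℕ} {e : Fin k → ℕ}
    {L : List (Set (Matrix (Fin k) (Fin k) ℤ) × ℚ)} {r : TableRow} (hr : r ∈ rowsOf e L) (j : ℕ) :
    ∑ i, min j (r.e i) = ∑ i, min j (e i) := by
  obtain ⟨S, hS, rfl⟩ := List.mem_map.1 hr
  rfl

theorem separates_one (h1 : Classifies p ![1] (auts1 p)) : Separates p 1 (table p 1) :=
  h1.separates (by decide) rfl

theorem separates_two (h2 : Classifies p ![2] (auts2 p)) (h11 : Classifies p ![1, 1] (auts11 p)) :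
    Separates p 2 (table p 2) := by
  rw [tableTwo_eq]
  refine (h2.separates (by decide) rfl).append (h11.separates (by decide) rfl) 1 ?_
  intro r hr s hs
  rw [sum_min_of_mem_rowsOf hr, sum_min_of_mem_rowsOf hs]
  decide

theorem separates_three (h3 : Classifies p ![3] (auts3 p)) (h21 : Classifies p ![2, 1] (auts21 p))
    (h111 : Classifies p ![1, 1, 1] (auts111 p)) : Separates p 3 (table p 3) := by
  rw [tableThree_eq]
  refine ((h3.separates (by decide) rfl).append (h21.separates (by decide) rfl) 1 ?_).append
    (h111.separates (by decide) rfl) 1 ?_ <;>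
  · intro r hr s hs
    rw [sum_min_of_mem_rowsOf hs]
    try simp only [List.mem_append] at hr
    (try casesm* _ ∨ _) <;> rw [sum_min_of_mem_rowsOf ‹r ∈ _›] <;> decide

theorem separates_four (h4 : Classifies p ![4] (auts4 p)) (h31 : Classifies p ![3, 1] (auts31 p))
    (h22 : Classifies p ![2, 2] (auts22 p)) (h211 : Classifies p ![2, 1, 1] (auts211 p))
    (h1111 : Classifies p ![1, 1, 1, 1] (auts1111 p)) : Separates p 4 (table p 4) := by
  refine separates_perm (tableFour_perm p) ?_
  -- The `p²`-torsion is needed to separate `![3, 1]` from `![2, 2]`, which have the same number of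
  -- parts. The longer partitions are told apart by the number of parts, that is, by the
  -- `p`-torsion.
  refine (((((h4.separates (by decide) rfl).append (h31.separates (by decide) rfl) 2 ?_).append
    (h22.separates (by decide) rfl) 2 ?_).append (h211.separates (by decide) rfl) 1 ?_)).append
    (h1111.separates (by decide) rfl) 1 ?_ <;>
  · intro r hr s hs
    rw [sum_min_of_mem_rowsOf hs]
    try simp only [List.mem_append] at hr
    (try casesm* _ ∨ _) <;> rw [sum_min_of_mem_rowsOf ‹r ∈ _›] <;> decide

theorem Exhausts.of_partitions {n : ℕ} {T : List TableRow}
    (h : ∀ (k : ℕ) (e : Fin k → ℕ), Antitone e → (∀ i, 1 ≤ e i) → ∑ i, e i = n →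
      ∃ L, Classifies p e L ∧ rowsOf e L ⊆ T) : Exhausts.{u} p n T := by
  intro M _ α hM
  obtain ⟨k, e, hanti, he, hn, ⟨φ⟩⟩ := exists_addEquiv_pGroup Fact.out hM
  obtain ⟨L, hL, hT⟩ := h k e hanti he hn
  obtain ⟨r, hr, hr'⟩ := hL.exists_row he α φ
  exact ⟨r, hT hr, hr'⟩

/-- Positivity of the parts gives `k ≤ n ≤ 4`. For each length the weakly decreasing positive
sequences with bounded sum are few enough to list. -/
theorem partition_cases {k n : ℕ} {e : Fin k → ℕ} (hanti : Antitone e) (he : ∀ i, 1 ≤ e i)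
    (hn : ∑ i, e i = n) (hn4 : n ≤ 4) (Q : (k : ℕ) → (Fin k → ℕ) → Prop)
    (h0 : n = 0 → Q 0 ![]) (h1 : n = 1 → Q 1 ![1]) (h2 : n = 2 → Q 1 ![2] ∧ Q 2 ![1, 1])
    (h3 : n = 3 → Q 1 ![3] ∧ Q 2 ![2, 1] ∧ Q 3 ![1, 1, 1])
    (h4 : n = 4 → Q 1 ![4] ∧ Q 2 ![3, 1] ∧ Q 2 ![2, 2] ∧ Q 3 ![2, 1, 1] ∧ Q 4 ![1, 1, 1, 1]) :
    Q k e := by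
  have hk : k ≤ n := by
    have := Finset.card_nsmul_le_sum Finset.univ e 1 fun i _ => he i
    simpa [hn] using this
  have hk4 : k ≤ 4 := hk.trans hn4
  interval_cases k
  · obtain rfl : e = ![] := Subsingleton.elim _ _
    exact h0 (by simpa using hn.symm)
  · obtain ⟨a, rfl⟩ : ∃ a, e = ![a] := ⟨e 0, by ext i; fin_cases i; rfl⟩
    simp at hn
    subst hn
    interval_cases a
    exacts [h1 rfl, (h2 rfl).1, (h3 rfl).1, (h4 rfl).1]
  · obtain ⟨a, b, rfl⟩ : ∃ a b, e = ![a, b] := ⟨e 0, e 1, by ext i; fin_cases i <;> rfl⟩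
    simp [Fin.sum_univ_succ] at hn
    have hab : b ≤ a := hanti (show (0 : Fin 2) ≤ 1 by decide)
    have hb : 1 ≤ b := he 1
    obtain ⟨rfl, rfl⟩ | ⟨rfl, rfl⟩ | ⟨rfl, rfl⟩ | ⟨rfl, rfl⟩ :
      (a = 1 ∧ b = 1) ∨ (a = 2 ∧ b = 1) ∨ (a = 3 ∧ b = 1) ∨ (a = 2 ∧ b = 2) := by lia
    exacts [(h2 hn.symm).2, (h3 hn.symm).2.1, (h4 hn.symm).2.1, (h4 hn.symm).2.2.1]
  · obtain ⟨a, b, c, rfl⟩ : ∃ a b c, e = ![a, b, c] :=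
      ⟨e 0, e 1, e 2, by ext i; fin_cases i <;> rfl⟩
    simp [Fin.sum_univ_succ] at hn
    have hab : b ≤ a := hanti (show (0 : Fin 3) ≤ 1 by decide)
    have hbc : c ≤ b := hanti (show (1 : Fin 3) ≤ 2 by decide)
    have hc : 1 ≤ c := he 2
    obtain ⟨rfl, rfl, rfl⟩ | ⟨rfl, rfl, rfl⟩ :
      (a = 1 ∧ b = 1 ∧ c = 1) ∨ (a = 2 ∧ b = 1 ∧ c = 1) := by lia
    exacts [(h3 hn.symm).2.2, (h4 hn.symm).2.2.2.1]
  · obtain ⟨a, b, c, d, rfl⟩ : ∃ a b c d, e = ![a, b, c, d] :=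
      ⟨e 0, e 1, e 2, e 3, by ext i; fin_cases i <;> rfl⟩
    simp [Fin.sum_univ_succ] at hn
    have ha : 1 ≤ a := he 0
    have hb : 1 ≤ b := he 1
    have hc : 1 ≤ c := he 2
    have hd : 1 ≤ d := he 3
    obtain ⟨rfl, rfl, rfl, rfl⟩ : a = 1 ∧ b = 1 ∧ c = 1 ∧ d = 1 := by lia
    exact (h4 hn.symm).2.2.2.2

theorem exhausts_one (h1 : Classifies p ![1] (auts1 p)) : Exhausts.{u} p 1 (table p 1) :=
  .of_partitions fun k e hanti he hn =>
    partition_cases hanti he hn (by lia)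
      (fun k e => ∃ L, Classifies p e L ∧ rowsOf e L ⊆ table p 1) (by simp)
      (fun _ => ⟨_, h1, List.Subset.refl _⟩) (by simp) (by simp) (by simp)

theorem exhausts_two (h2 : Classifies p ![2] (auts2 p)) (h11 : Classifies p ![1, 1] (auts11 p)) :
    Exhausts.{u} p 2 (table p 2) := by
  rw [tableTwo_eq]
  exact .of_partitions fun k e hanti he hn =>
    partition_cases hanti he hn (by lia)
      (fun k e => ∃ L, Classifies p e L ∧ rowsOf e L ⊆ _) (by simp) (by simp)
      (fun _ => ⟨⟨_, h2, fun r hr => by simp [hr]⟩, ⟨_, h11, fun r hr => by simp [hr]⟩⟩) (by simp) (by simp)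

theorem exhausts_three (h3 : Classifies p ![3] (auts3 p)) (h21 : Classifies p ![2, 1] (auts21 p))
    (h111 : Classifies p ![1, 1, 1] (auts111 p)) : Exhausts.{u} p 3 (table p 3) := by
  rw [tableThree_eq]
  exact .of_partitions fun k e hanti he hn =>
    partition_cases hanti he hn (by lia)
      (fun k e => ∃ L, Classifies p e L ∧ rowsOf e L ⊆ _) (by simp) (by simp) (by simp)
      (fun _ => ⟨⟨_, h3, fun r hr => by simp [hr]⟩, ⟨_, h21, fun r hr => by simp [hr]⟩,
        ⟨_, h111, fun r hr => by simp [hr]⟩⟩) (by simp)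

theorem exhausts_four (h4 : Classifies p ![4] (auts4 p)) (h31 : Classifies p ![3, 1] (auts31 p))
    (h22 : Classifies p ![2, 2] (auts22 p)) (h211 : Classifies p ![2, 1, 1] (auts211 p))
    (h1111 : Classifies p ![1, 1, 1, 1] (auts1111 p)) : Exhausts.{u} p 4 (table p 4) := by
  refine exhausts_perm (tableFour_perm p) ?_
  exact .of_partitions fun k e hanti he hn =>
    partition_cases hanti he hn (by lia)
      (fun k e => ∃ L, Classifies p e L ∧ rowsOf e L ⊆ _) (by simp) (by simp) (by simp) (by simp)
      (fun _ => ⟨⟨_, h4, fun r hr => by simp [hr]⟩, ⟨_, h31, fun r hr => by simp [hr]⟩,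
        ⟨_, h22, fun r hr => by simp [hr]⟩, ⟨_, h211, fun r hr => by simp [hr]⟩, ⟨_, h1111, fun r hr => by simp [hr]⟩⟩)

theorem subsingleton_entry_zero_group (p : ℕ) (E : Entry p 0) : Subsingleton E.Group := by
  obtain ⟨i, A⟩ := E
  obtain rfl : i = (0 : Fin 1) := Subsingleton.elim (α := Fin 1) _ _
  have : Subsingleton (ZMod (p ^ 0)) := by rw [pow_zero]; infer_instance
  exact ⟨fun x y => funext fun j => by
    obtain rfl : j = (0 : Fin 1) := Subsingleton.elim (α := Fin 1) _ _
    exact this.elim _ _⟩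

theorem subsingleton_entry_zero (p : ℕ) : Subsingleton (Entry p 0) :=
  ⟨fun ⟨i, A, hA⟩ ⟨j, B, hB⟩ => by
    obtain rfl : i = (0 : Fin 1) := Subsingleton.elim (α := Fin 1) _ _
    obtain rfl : j = (0 : Fin 1) := Subsingleton.elim (α := Fin 1) _ _
    obtain rfl : A = !![0] := hA
    obtain rfl : B = !![0] := hB
    rfl⟩

/-- The general framework assumes positive exponents, whereas the only row here has the exponent
`0`. Everything is instead a statement about one-element sets. -/
theorem exists_tau_zero (p : ℕ) :
    ∃ τ : (E : Entry p 0) → (E.Group ≃+ E.Group),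
      (∀ (E : Entry p 0) (x : E.Group), τ E x = E.matrixMap x) ∧
      (∀ E : Entry p 0, Nat.card (LambdaModule (τ E)) = p ^ 0) ∧
      (∀ E F : Entry p 0,
        Nonempty (LambdaModule (τ E) ≃ₗ[LambdaRing] LambdaModule (τ F)) → E = F) ∧
      (∀ (M : Type u) [AddCommGroup M] [Module LambdaRing M], Nat.card M = p ^ 0 →
        ∃ E : Entry p 0, Nonempty (M ≃ₗ[LambdaRing] LambdaModule (τ E))) := by
  have hsub := subsingleton_entry_zero_group p
  refine ⟨fun E => AddEquiv.refl _, fun E x => Subsingleton.elim _ _, fun E => ?_, fun E F _ => ?_,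
    fun M _ _ hM => ?_⟩
  · have : Subsingleton (LambdaModule (AddEquiv.refl E.Group)) := hsub E
    rw [pow_zero]
    exact Nat.card_of_subsingleton 0
  · exact (subsingleton_entry_zero p).elim E F
  · let E : Entry p 0 := ⟨(0 : Fin 1), !![0], rfl⟩
    have h1 : Subsingleton (LambdaModule (AddEquiv.refl E.Group)) := hsub E
    have h2 : Subsingleton M := (Nat.card_eq_one_iff_unique.1 (hM.trans (pow_zero p))).1
    exact ⟨E, ⟨{ toFun := 0, invFun := 0, map_add' := by simp, map_smul' := by simp,
                 left_inv := fun x => Subsingleton.elim _ _,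
                 right_inv := fun x => Subsingleton.elim _ _ }⟩⟩

end Tables

/-! ### Canonical integer representatives of residues -/

section Representatives

theorem exists_rep {q : ℤ} (hq : 0 < q) (a : ℤ) : ∃ b, 0 ≤ b ∧ b < q ∧ q ∣ a - b :=
  ⟨a % q, Int.emod_nonneg _ hq.ne', Int.emod_lt_of_pos _ hq, Int.dvd_self_sub_emod⟩

theorem eq_of_rep {q a b : ℤ} (ha : 0 ≤ a) (ha' : a < q) (hb : 0 ≤ b) (hb' : b < q)
    (h : q ∣ a - b) : a = b :=
  sub_eq_zero.1 (Int.eq_zero_of_abs_lt_dvd h (abs_lt.2 ⟨by lia, by lia⟩))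

variable {p : ℕ}

theorem dvd_iff_cast (x : ℤ) : (p : ℤ) ∣ x ↔ ((x : ℤ) : ZMod p) = 0 :=
  (ZMod.intCast_zmod_eq_zero_iff_dvd x p).symm

theorem eq_of_rep_cast {a b : ℤ} (ha : 0 ≤ a) (ha' : a < p) (hb : 0 ≤ b) (hb' : b < p)
    (h : (a : ZMod p) = b) : a = b :=
  eq_of_rep ha ha' hb hb' ((dvd_iff_cast _).2 (by push_cast; rw [h, sub_self]))

theorem exists_rep_cast (hp : p.Prime) (x : ZMod p) : ∃ a : ℤ, 0 ≤ a ∧ a < p ∧ (a : ZMod p) = x := by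
  have : NeZero p := ⟨hp.ne_zero⟩
  exact ⟨x.val, by positivity, by exact_mod_cast x.val_lt, by simp⟩

theorem exists_unitRep (hp : p.Prime) {m : ℕ} (hm : 1 ≤ m) {a : ℤ} (ha : ¬ (p : ℤ) ∣ a) :
    ∃ b, IsUnitRep p m b ∧ (p : ℤ) ^ m ∣ a - b := by
  obtain ⟨b, h0, h1, h2⟩ := exists_rep (q := (p : ℤ) ^ m) (by have := hp.pos; positivity) a
  refine ⟨b, ⟨h0, h1, fun h => ha ?_⟩, h2⟩
  have := ((dvd_pow_self (p : ℤ) (by lia : m ≠ 0)).trans h2).add h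
  rwa [sub_add_cancel] at this

theorem not_dvd_of_pos_lt {b : ℤ} (h0 : 0 < b) (h1 : b < p) : ¬ (p : ℤ) ∣ b :=
  fun h => absurd (Int.le_of_dvd h0 h) (by lia)

theorem isUnitRep_one_iff {b : ℤ} : IsUnitRep p 1 b ↔ 0 < b ∧ b < p := by
  rw [IsUnitRep, pow_one]
  constructor
  · rintro ⟨h0, h1, h2⟩
    refine ⟨lt_of_le_of_ne h0 ?_, h1⟩
    rintro rfl
    exact h2 (dvd_zero _)
  · rintro ⟨h0, h1⟩
    exact ⟨h0.le, h1, not_dvd_of_pos_lt h0 h1⟩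

theorem cast_ne_zero_of_pos_lt {b : ℤ} (h0 : 0 < b) (h1 : b < p) : (b : ZMod p) ≠ 0 :=
  fun h => not_dvd_of_pos_lt h0 h1 ((dvd_iff_cast _).2 h)

theorem pos_of_cast_ne_zero {b : ℤ} (h0 : 0 ≤ b) (h : (b : ZMod p) ≠ 0) : 0 < b :=
  lt_of_le_of_ne h0 (by rintro rfl; simp at h)

end Representatives

/-! ### Cyclic groups -/

section Cyclic

variable {p : ℕ}

theorem isAut_cyclic_iff {m : ℕ} {a : ℤ} : IsAut p ![m] !![a] ↔ ¬ (p : ℤ) ∣ a :=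
  ⟨fun h => by simpa using h.det, fun h => ⟨fun i j => by fin_cases i; fin_cases j; simp,
    by simpa using h⟩⟩

/-- Automorphisms of a cyclic group commute, so the conjugating unit cancels. -/
theorem matConj_cyclic (hp : p.Prime) {m : ℕ} {a b : ℤ} :
    MatConj p ![m] !![a] !![b] ↔ (p : ℤ) ^ m ∣ a - b := by
  constructor
  · rintro ⟨P, hP, h⟩
    obtain ⟨u, rfl⟩ : ∃ u, P = !![u] := ⟨P 0 0, by ext i j; fin_cases i; fin_cases j; rfl⟩
    have h0 := h 0 0
    simp [Matrix.mul_apply] at h0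
    rw [mul_comm u, ← sub_mul] at h0
    refine (IsCoprime.pow_left ?_).dvd_of_dvd_mul_right h0
    exact (Prime.coprime_iff_not_dvd (Nat.prime_iff_prime_int.1 hp)).2 (isAut_cyclic_iff.1 hP)
  · intro h
    refine .of_matCong hp fun i j => ?_
    fin_cases i; fin_cases j
    simpa using h

theorem classifies_cyclic (hp : p.Prime) {m : ℕ} (hm : 1 ≤ m) (t : ℚ) :
    Classifies p ![m] [({A | ∃ b : ℤ, IsUnitRep p m b ∧ A = !![b]}, t)] where
  isAut := by
    simp only [List.mem_singleton, forall_eq]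
    rintro _ ⟨b, hb, rfl⟩
    exact isAut_cyclic_iff.2 hb.2.2
  pairwise := List.pairwise_singleton _ _
  inj := by
    simp only [List.mem_singleton, forall_eq]
    rintro _ ⟨b, hb, rfl⟩ _ ⟨c, hc, rfl⟩ h
    rw [eq_of_rep hb.1 hb.2.1 hc.1 hc.2.1 ((matConj_cyclic hp).1 h)]
  exhaust := by
    intro A hA
    obtain ⟨a, rfl⟩ : ∃ u, A = !![u] := ⟨A 0 0, by ext i j; fin_cases i; fin_cases j; rfl⟩
    obtain ⟨b, hb, h⟩ := exists_unitRep hp hm (isAut_cyclic_iff.1 hA)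
    exact ⟨_, List.mem_singleton_self _, _, ⟨b, hb, rfl⟩, (matConj_cyclic hp).2 h⟩

end Cyclic

/-! ### The groups `ℤ_{p^{s+1}} × ℤ_p` -/

section HookTwo

variable {p s : ℕ}

/-- The factor `p ^ s` with `s ≥ 1` makes the matrix lower triangular modulo `p`, so its determinant
reduces to `a * d`. -/
theorem isAut_hook_iff (hs : 1 ≤ s) {a b c d : ℤ} :
    IsAut p ![s + 1, 1] !![a, p ^ s * b; c, d] ↔ ¬ (p : ℤ) ∣ a * d := by
  have h2 : (p : ℤ) ∣ a * d - p ^ s * b * c ↔ (p : ℤ) ∣ a * d :=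
    dvd_sub_left (((dvd_pow_self _ (by lia : s ≠ 0)).mul_right b).mul_right c)
  constructor
  · intro h
    have h4 := h.det
    rwa [Matrix.det_fin_two_of, h2] at h4
  · intro h4
    refine ⟨fun i j => ?_, by rwa [Matrix.det_fin_two_of, h2]⟩
    fin_cases i <;> fin_cases j
    · simp
    · exact ⟨b, by simp; ring⟩
    · have h5 : (p : ℤ) ∣ c * p ^ (s + 1) := (dvd_pow_self _ (Nat.succ_ne_zero s)).mul_left c
      simpa using h5
    · simp

theorem exists_hook_form (hp : p.Prime) {A : Matrix (Fin 2) (Fin 2) ℤ}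
    (hA : IsAut p ![s + 1, 1] A) : ∃ a b c d : ℤ, A = !![a, p ^ s * b; c, d] := by
  have h := hA.dvd 0 1
  have h1 : (p : ℤ) ^ (s + 1) ∣ A 0 1 * p := by simpa using h
  rw [pow_succ, mul_dvd_mul_iff_right (by exact_mod_cast hp.ne_zero)] at h1
  obtain ⟨b, hb⟩ := h1
  exact ⟨A 0 0, b, A 1 0, A 1 1, by rw [← hb]; exact Matrix.eta_fin_two A⟩

/-- After the common factor `p ^ s` is cancelled, only the upper left entry keeps a condition beyond
`𝔽_p`. There the off-diagonal entries act through a correction that is a multiple of `p ^ s`, so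
they reach just the top digit of `a`. -/
theorem matConj_hook_iff (hp : p.Prime) (hs : 1 ≤ s) {a b c d a' b' c' d' : ℤ} :
    MatConj p ![s + 1, 1] !![a, p ^ s * b; c, d] !![a', p ^ s * b'; c', d'] ↔
      ∃ u v w z : ℤ, ((u : ZMod p) ≠ 0 ∧ (z : ZMod p) ≠ 0) ∧
        (p : ℤ) ^ (s + 1) ∣ (a - a') * u + p ^ s * (b * w - v * c') ∧
        (a * v + b * z : ZMod p) = u * b' + v * d' ∧
        (c * u + d * w : ZMod p) = w * a' + z * c' ∧ (d : ZMod p) = d' := by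
  have : Fact p.Prime := ⟨hp⟩
  have hps : (p : ZMod p) ^ s = 0 := by simp [show s ≠ 0 by lia]
  have e1 : ∀ u v w z : ℤ, (p : ℤ) ^ (s + 1) ∣ a * (p ^ s * v) + p ^ s * b * z
      - (u * (p ^ s * b') + p ^ s * v * d')
      ↔ (a * v + b * z : ZMod p) = u * b' + v * d' := by
    intro u v w z
    rw [show a * (p ^ s * v) + p ^ s * b * z - (u * (p ^ s * b') + p ^ s * v * d')
      = p ^ s * (a * v + b * z - (u * b' + v * d')) by ring, pow_succ,
      mul_dvd_mul_iff_left (pow_ne_zero _ (by exact_mod_cast hp.ne_zero)), dvd_iff_cast]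
    push_cast
    exact sub_eq_zero
  have e2 : ∀ u v w z : ℤ, (p : ℤ) ∣ c * u + d * w - (w * a' + z * c')
      ↔ (c * u + d * w : ZMod p) = w * a' + z * c' := by
    intro u v w z
    rw [dvd_iff_cast]
    push_cast
    exact sub_eq_zero
  have e3 : ∀ u v w z : ℤ, (z : ZMod p) ≠ 0 → ((p : ℤ) ∣ c * (p ^ s * v) + d * z
      - (w * (p ^ s * b') + z * d') ↔ (d : ZMod p) = d') := by
    intro u v w z hz
    rw [dvd_iff_cast]
    push_cast
    rw [hps]
    constructor
    · intro h
      exact mul_right_cancel₀ hz (by linear_combination h)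
    · intro h
      linear_combination z * h
  have e4 : ∀ u z : ℤ, ¬ (p : ℤ) ∣ u * z ↔ ((u : ZMod p) ≠ 0 ∧ (z : ZMod p) ≠ 0) := by
    intro u z
    rw [(Nat.prime_iff_prime_int.1 hp).dvd_mul, not_or, dvd_iff_cast, dvd_iff_cast]
  constructor
  · rintro ⟨P, hP, h⟩
    obtain ⟨u, v, w, z, rfl⟩ := exists_hook_form hp hP
    rw [isAut_hook_iff hs, e4] at hP
    have h00 := h 0 0
    have h01 := h 0 1
    have h10 := h 1 0
    have h11 := h 1 1
    simp only [Matrix.mul_apply, Fin.sum_univ_two, Matrix.of_apply, Matrix.cons_val', Matrix.cons_val_zero,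
      Matrix.cons_val_one, Matrix.cons_val_fin_one, pow_one] at h00 h01 h10 h11
    refine ⟨u, v, w, z, hP, ?_, (e1 u v w z).1 h01, (e2 u v w z).1 h10, (e3 u v w z hP.2).1 h11⟩
    convert h00 using 1
    ring
  · rintro ⟨u, v, w, z, hP, h00, h01, h10, h11⟩
    refine ⟨!![u, p ^ s * v; w, z], (isAut_hook_iff hs).2 ((e4 u z).2 hP), fun i j => ?_⟩
    fin_cases i <;> fin_cases j <;>
    simp only [Matrix.mul_apply, Fin.sum_univ_two, Matrix.of_apply, Matrix.cons_val', Matrix.cons_val_zero,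
      Matrix.cons_val_one, Matrix.cons_val_fin_one, pow_one, Fin.zero_eta, Fin.mk_one]
    · convert h00 using 1
      ring
    · exact (e1 u v w z).2 h01
    · exact (e2 u v w z).2 h10
    · exact (e3 u v w z hP.2).2 h11

theorem cast_eq_of_pow_dvd (hs : 1 ≤ s) {a b : ℤ} (h : (p : ℤ) ^ s ∣ a - b) :
    (a : ZMod p) = b := by
  have := (dvd_pow_self (p : ℤ) (by lia : s ≠ 0)).trans h
  rw [dvd_iff_cast] at this
  push_cast at this
  exact sub_eq_zero.1 this

theorem pow_dvd_of_mul (hp : p.Prime) {m : ℕ} {x u : ℤ} (hu : (u : ZMod p) ≠ 0)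
    (h : (p : ℤ) ^ m ∣ x * u) : (p : ℤ) ^ m ∣ x := by
  refine (IsCoprime.pow_left ?_).dvd_of_dvd_mul_right h
  rw [Ne, ← dvd_iff_cast] at hu
  exact (Prime.coprime_iff_not_dvd (Nat.prime_iff_prime_int.1 hp)).2 hu

/-- The matrices of the table for `ℤ_{p^{s+1}} × ℤ_p`. -/
def hookAuts (p s : ℕ) (t₀ t₁ t₂ : ℚ) : List (Set (Matrix (Fin 2) (Fin 2) ℤ) × ℚ) :=
  [({A | ∃ b c : ℤ, IsUnitRep p (s + 1) b ∧ IsUnitRep p 1 c ∧ A = !![b, 0; 0, c]}, t₀),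
   ({A | ∃ b : ℤ, IsUnitRep p s b ∧ A = !![b, 0; 1, b]}, t₁),
   ({A | ∃ b γ : ℤ, IsUnitRep p s b ∧ IsRep p γ ∧ A = !![b, p ^ s; γ, b]}, t₂)]

/-- If `a` and `d` differ modulo `p`, both off-diagonal entries can be cleared. If they agree, `v`
and `w` cancel from the equations for `b` and `c`, which are merely rescaled by inverse factors.
Hence the vanishing of `b`, that of `c`, and the product `b * c` are invariants. As soon as `b` or
`c` is nonzero, `w` or `v` removes the top digit of `a`, which is why the last two rows take `b`
only modulo `p ^ s`. -/
theorem classifies_hook (hp : p.Prime) (hs : 1 ≤ s) (t₀ t₁ t₂ : ℚ) :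
    Classifies p ![s + 1, 1] (hookAuts p s t₀ t₁ t₂) := by
  have : Fact p.Prime := ⟨hp⟩
  have key : ∀ {a b c d a' b' c' d' : ℤ},
      MatConj p ![s + 1, 1] !![a, p ^ s * b; c, d] !![a', p ^ s * b'; c', d'] →
      ∃ u v w z : ℤ, ((u : ZMod p) ≠ 0 ∧ (z : ZMod p) ≠ 0) ∧
        (p : ℤ) ^ (s + 1) ∣ (a - a') * u + p ^ s * (b * w - v * c') ∧
        (a * v + b * z : ZMod p) = u * b' + v * d' ∧
        (c * u + d * w : ZMod p) = w * a' + z * c' ∧ (d : ZMod p) = d' ∧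
        (p : ℤ) ^ s ∣ a - a' ∧ (a : ZMod p) = a' := by
    intro a b c d a' b' c' d' h
    obtain ⟨u, v, w, z, hP, h00, h01, h10, h11⟩ := (matConj_hook_iff hp hs).1 h
    have h1 := (pow_dvd_pow (p : ℤ) (Nat.le_succ s)).trans h00
    rw [dvd_add_left (dvd_mul_right _ _)] at h1
    have h2 := pow_dvd_of_mul hp hP.1 h1
    exact ⟨u, v, w, z, hP, h00, h01, h10, h11, h2, cast_eq_of_pow_dvd hs h2⟩
  have f0 : ∀ a c d : ℤ, !![a, 0; c, d] = !![a, p ^ s * 0; c, d] := by simp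
  have f1 : ∀ a c d : ℤ, !![a, (p : ℤ) ^ s; c, d] = !![a, p ^ s * 1; c, d] := by simp
  have hprime := Nat.prime_iff_prime_int.1 hp
  refine ⟨?_, ?_, ?_, ?_⟩
  · simp only [hookAuts, List.forall_mem_cons, List.not_mem_nil, IsEmpty.forall_iff, implies_true,
      and_true]
    refine ⟨?_, ?_, ?_⟩
    · rintro _ ⟨b, c, hb, hc, rfl⟩
      rw [f0, isAut_hook_iff hs, hprime.dvd_mul]
      exact not_or.2 ⟨hb.2.2, hc.2.2⟩
    · rintro _ ⟨b, hb, rfl⟩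
      rw [f0, isAut_hook_iff hs, hprime.dvd_mul]
      exact not_or.2 ⟨hb.2.2, hb.2.2⟩
    · rintro _ ⟨b, γ, hb, hγ, rfl⟩
      rw [f1, isAut_hook_iff hs, hprime.dvd_mul]
      exact not_or.2 ⟨hb.2.2, hb.2.2⟩
  · simp only [hookAuts, List.pairwise_cons, List.forall_mem_cons, List.not_mem_nil,
      IsEmpty.forall_iff, implies_true, and_true, List.Pairwise.nil]
    refine ⟨⟨?_, ?_⟩, ?_⟩
    · rintro _ ⟨b, c, hb, hc, rfl⟩ _ ⟨b', hb', rfl⟩ h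
      rw [f0, f0] at h
      obtain ⟨u, v, w, z, ⟨hu, hz⟩, -, h01, h10, h11, -, h2⟩ := key h
      push_cast at *
      grind
    · rintro _ ⟨b, c, hb, hc, rfl⟩ _ ⟨b', γ, hb', hγ, rfl⟩ h
      rw [f0, f1] at h
      obtain ⟨u, v, w, z, ⟨hu, hz⟩, -, h01, h10, h11, -, h2⟩ := key h
      push_cast at *
      grind
    · rintro _ ⟨b, hb, rfl⟩ _ ⟨b', γ, hb', hγ, rfl⟩ h
      rw [f0, f1] at h
      obtain ⟨u, v, w, z, ⟨hu, hz⟩, -, h01, h10, h11, -, h2⟩ := key h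
      push_cast at *
      grind
  · simp only [hookAuts, List.forall_mem_cons, List.not_mem_nil, IsEmpty.forall_iff, implies_true,
      and_true]
    refine ⟨?_, ?_, ?_⟩
    · rintro _ ⟨b, c, hb, hc, rfl⟩ _ ⟨b', c', hb', hc', rfl⟩ h
      rw [f0, f0] at h
      obtain ⟨u, v, w, z, ⟨hu, hz⟩, h00, h01, h10, h11, -, h2⟩ := key h
      rw [zero_mul, mul_zero, sub_zero, mul_zero, add_zero] at h00
      rw [eq_of_rep hb.1 hb.2.1 hb'.1 hb'.2.1 (pow_dvd_of_mul hp hu h00),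
        eq_of_rep_cast hc.1 (by simpa using hc.2.1) hc'.1 (by simpa using hc'.2.1) h11]
    · rintro _ ⟨b, hb, rfl⟩ _ ⟨b', hb', rfl⟩ h
      rw [f0, f0] at h
      obtain ⟨u, v, w, z, ⟨hu, hz⟩, -, h01, h10, h11, h1, h2⟩ := key h
      rw [eq_of_rep hb.1 hb.2.1 hb'.1 hb'.2.1 h1]
    · rintro _ ⟨b, γ, hb, hγ, rfl⟩ _ ⟨b', γ', hb', hγ', rfl⟩ h
      rw [f1, f1] at h
      obtain ⟨u, v, w, z, ⟨hu, hz⟩, -, h01, h10, h11, h1, h2⟩ := key h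
      have h3 : (γ : ZMod p) = γ' := by
        push_cast at *
        grind
      rw [eq_of_rep hb.1 hb.2.1 hb'.1 hb'.2.1 h1, eq_of_rep_cast hγ.1 hγ.2 hγ'.1 hγ'.2 h3]
  · intro A hA
    obtain ⟨a, b, c, d, rfl⟩ := exists_hook_form hp hA
    rw [isAut_hook_iff hs, hprime.dvd_mul, not_or] at hA
    have hlift : ∀ x : ZMod p, ∃ y : ℤ, (y : ZMod p) = x := ZMod.intCast_surjective
    simp only [hookAuts, List.exists_mem_cons_iff, List.not_mem_nil, false_and, exists_false, or_false]
    obtain ⟨d', hd', hdd'⟩ := exists_unitRep hp le_rfl hA.2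
    have hdd := cast_eq_of_pow_dvd le_rfl hdd'
    by_cases had : (a : ZMod p) = d
    · obtain ⟨a', ha', x, hx⟩ := exists_unitRep hp hs hA.1
      have haa := cast_eq_of_pow_dvd hs ⟨x, hx⟩
      by_cases hb : (b : ZMod p) = 0
      · by_cases hc : (c : ZMod p) = 0
        · obtain ⟨a', ha', haa'⟩ := exists_unitRep hp (m := s + 1) (by lia) hA.1
          refine .inl ⟨_, ⟨a', d', ha', hd', rfl⟩, ?_⟩
          rw [f0, matConj_hook_iff hp hs]
          refine ⟨1, 0, 0, 1, by simp, by simpa using haa', by simp [hb], by simp [hc], hdd⟩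
        · obtain ⟨v, hv⟩ := hlift x
          refine .inr (.inl ⟨_, ⟨a', ha', rfl⟩, ?_⟩)
          rw [f0, matConj_hook_iff hp hs]
          -- The entry `v = x` cancels the top digit `x` of `a`, and `z = c` rescales the lower left
          -- entry to `1`.
          refine ⟨1, x, 0, c, by simpa using hc, ⟨0, ?_⟩, ?_, by simp, by rw [← had, haa]⟩
          · rw [hx]; ring
          · rw [hb, haa]; push_cast; ring
      -- Now `z` rescales `b` to `1`, which turns `c` into `b * c`, and `w` cancels the top digit
      -- `x` of `a`.
      · obtain ⟨z, hz⟩ := hlift (b : ZMod p)⁻¹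
        obtain ⟨w, hw⟩ := hlift (-x * (b : ZMod p)⁻¹)
        obtain ⟨γ, hγ0, hγ1, hγ⟩ := exists_rep_cast hp (b * c : ZMod p)
        refine .inr (.inr ⟨_, ⟨a', γ, ha', ⟨hγ0, hγ1⟩, rfl⟩, ?_⟩)
        rw [f1, matConj_hook_iff hp hs]
        refine ⟨1, 0, w, z, by simpa [hz] using hb, ?_, ?_, ?_, by rw [← had, haa]⟩
        · rw [hx, show (p : ℤ) ^ s * x * 1 + p ^ s * (b * w - 0 * γ) = p ^ s * (x + b * w) by ring,
            pow_succ]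
          refine mul_dvd_mul_left _ ((dvd_iff_cast _).2 ?_)
          push_cast
          rw [hw]
          field_simp
          ring
        · rw [hz]; push_cast; field_simp; ring
        · rw [hz, hγ, ← had, haa]; push_cast; field_simp; ring
    · have had' : (a : ZMod p) - d ≠ 0 := sub_ne_zero.2 had
      obtain ⟨w, hw⟩ := hlift (c * (a - d : ZMod p)⁻¹)
      obtain ⟨v, hv⟩ := hlift (-b * (a - d : ZMod p)⁻¹)
      -- Clearing the off-diagonal entries shifts `a` by this multiple of `p ^ s`.
      have ha : ¬ (p : ℤ) ∣ a + p ^ s * (b * w) := by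
        rw [dvd_add_left ((dvd_pow_self _ (by lia)).mul_right _)]
        exact hA.1
      obtain ⟨a', ha', haa'⟩ := exists_unitRep hp (m := s + 1) (by lia) ha
      have haa : (a : ZMod p) = a' := by
        have := cast_eq_of_pow_dvd (by lia) haa'
        push_cast at this
        simpa [show s ≠ 0 by lia] using this
      refine .inl ⟨_, ⟨a', d', ha', hd', rfl⟩, ?_⟩
      rw [f0, matConj_hook_iff hp hs]
      refine ⟨1, v, w, 1, by simp, ?_, ?_, ?_, hdd⟩
      · convert haa' using 1; ring
      · rw [hv, ← hdd]; push_cast; field_simp; ring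
      · rw [hw, ← haa]; push_cast; field_simp; ring

end HookTwo

/-! ### The cyclic and two-generator hook groups of the table -/

section Instances

variable {p : ℕ}

theorem classifies_auts1 (hp : p.Prime) : Classifies p ![1] (auts1 p) :=
  classifies_cyclic hp le_rfl _

theorem classifies_auts2 (hp : p.Prime) : Classifies p ![2] (auts2 p) :=
  classifies_cyclic hp (by lia) _

theorem classifies_auts3 (hp : p.Prime) : Classifies p ![3] (auts3 p) :=
  classifies_cyclic hp (by lia) _

theorem classifies_auts4 (hp : p.Prime) : Classifies p ![4] (auts4 p) :=
  classifies_cyclic hp (by lia) _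

theorem classifies_auts21 (hp : p.Prime) : Classifies p ![2, 1] (auts21 p) := by
  have h := classifies_hook hp le_rfl (p * (p - 1) ^ 2) (p - 1) (p * (p - 1))
  unfold auts21
  simpa only [hookAuts, isUnitRep_one_iff, pow_one, and_assoc] using h

theorem classifies_auts31 (hp : p.Prime) : Classifies p ![3, 1] (auts31 p) := by
  have h := classifies_hook hp (s := 2) (by lia) (p ^ 2 * (p - 1) ^ 2) (p * (p - 1))
    (p ^ 2 * (p - 1))
  have h0 : ∀ b, IsUnitRep p 2 b ↔ 0 < b ∧ b < p ^ 2 ∧ ¬ (p : ℤ) ∣ b := fun b =>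
    ⟨fun h => ⟨lt_of_le_of_ne h.1 (by rintro rfl; exact h.2.2 (dvd_zero _)), h.2⟩,
      fun h => ⟨h.1.le, h.2⟩⟩
  unfold auts31
  simpa only [hookAuts, h0, and_assoc] using h

end Instances

/-! ### Irreducible quadratics over `𝔽_p` -/

section QuadraticIrreducible

variable {p : ℕ}

theorem quadratic_natDegree [Fact p.Prime] (b c : ZMod p) :
    (X ^ 2 + C b * X + C c : (ZMod p)[X]).natDegree = 2 ∧
      (X ^ 2 + C b * X + C c : (ZMod p)[X]).Monic := by
  have h : (X ^ 2 + C b * X + C c : (ZMod p)[X]).natDegree = 2 := by compute_degree!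
  refine ⟨h, ?_⟩
  rw [Monic, leadingCoeff, h]
  simp

theorem irrTwo_iff (hp : p.Prime) {b₀ b₁ : ℤ} : IrrTwo p b₀ b₁ ↔
    IsRep p b₀ ∧ IsRep p b₁ ∧ ∀ x : ZMod p, x ^ 2 + b₁ * x + b₀ ≠ 0 := by
  have : Fact p.Prime := ⟨hp⟩
  obtain ⟨hd, hm⟩ := quadratic_natDegree (b₁ : ZMod p) (b₀ : ZMod p)
  rw [IrrTwo, hm.irreducible_iff_roots_eq_zero_of_degree_le_three (by lia) (by lia),
    Multiset.eq_zero_iff_forall_notMem]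
  have h : ∀ x : ZMod p, x ∉ (X ^ 2 + C (b₁ : ZMod p) * X + C (b₀ : ZMod p)).roots ↔
      x ^ 2 + b₁ * x + b₀ ≠ 0 := fun x => by rw [mem_roots hm.ne_zero]; simp
  simp only [h]

end QuadraticIrreducible

/-! ### Two-by-two matrices modulo `p ^ m` -/

section SquareTwo

variable {p m : ℕ}

theorem dvd_sq (p m : ℕ) (A : Matrix (Fin 2) (Fin 2) ℤ) (i j : Fin 2) :
    (p : ℤ) ^ (![m, m] i) ∣ A i j * (p : ℤ) ^ (![m, m] j) := by
  fin_cases i <;> fin_cases j <;> simp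

theorem isAut_sq_iff {a b c d : ℤ} :
    IsAut p ![m, m] !![a, b; c, d] ↔ ((a * d - b * c : ℤ) : ZMod p) ≠ 0 := by
  rw [Ne, ← dvd_iff_cast, ← Matrix.det_fin_two_of]
  exact ⟨fun h => h.det, fun h => ⟨dvd_sq _ _ _, h⟩⟩

theorem matConj_sq_iff {a b c d a' b' c' d' : ℤ} :
    MatConj p ![m, m] !![a, b; c, d] !![a', b'; c', d'] ↔
      ∃ u v w z : ℤ, ((u * z - v * w : ℤ) : ZMod p) ≠ 0 ∧
        (p : ℤ) ^ m ∣ a * u + b * w - (u * a' + v * c') ∧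
        (p : ℤ) ^ m ∣ a * v + b * z - (u * b' + v * d') ∧
        (p : ℤ) ^ m ∣ c * u + d * w - (w * a' + z * c') ∧
        (p : ℤ) ^ m ∣ c * v + d * z - (w * b' + z * d') := by
  constructor
  · rintro ⟨P, hP, h⟩
    obtain ⟨u, v, w, z, rfl⟩ : ∃ u v w z, P = !![u, v; w, z] := ⟨_, _, _, _, Matrix.eta_fin_two P⟩
    have h00 := h 0 0
    have h01 := h 0 1
    have h10 := h 1 0
    have h11 := h 1 1
    simp only [Matrix.mul_apply, Fin.sum_univ_two, Matrix.of_apply, Matrix.cons_val',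
      Matrix.cons_val_zero, Matrix.cons_val_one, Matrix.cons_val_fin_one] at h00 h01 h10 h11
    exact ⟨u, v, w, z, isAut_sq_iff.1 hP, h00, h01, h10, h11⟩
  · rintro ⟨u, v, w, z, hP, h00, h01, h10, h11⟩
    refine ⟨!![u, v; w, z], isAut_sq_iff.2 hP, fun i j => ?_⟩
    fin_cases i <;> fin_cases j <;>
    simp only [Matrix.mul_apply, Fin.sum_univ_two, Matrix.of_apply, Matrix.cons_val',
      Matrix.cons_val_zero, Matrix.cons_val_one, Matrix.cons_val_fin_one, Fin.zero_eta,
      Fin.mk_one] <;> assumption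

/-- Multiplying `A P - P B` by the adjugate of `P` and taking traces yields `det P` times the
difference of traces. Expanding `det (A P) - det (P B)` yields `det P` times the difference of
determinants. As `det P` is a unit, it can be cancelled. Being scalar modulo `p` is visibly
invariant. -/
theorem matConj_sq_invariants (hp : p.Prime) (hm : 1 ≤ m) {a b c d a' b' c' d' : ℤ}
    (h : MatConj p ![m, m] !![a, b; c, d] !![a', b'; c', d']) :
    (p : ℤ) ^ m ∣ a + d - (a' + d') ∧ (p : ℤ) ^ m ∣ a * d - b * c - (a' * d' - b' * c') ∧
    (((b : ZMod p) = 0 ∧ (c : ZMod p) = 0 ∧ (a : ZMod p) = d) ↔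
      ((b' : ZMod p) = 0 ∧ (c' : ZMod p) = 0 ∧ (a' : ZMod p) = d')) := by
  have : Fact p.Prime := ⟨hp⟩
  obtain ⟨u, v, w, z, hP, h00, h01, h10, h11⟩ := matConj_sq_iff.1 h
  refine ⟨pow_dvd_of_mul hp hP ?_, pow_dvd_of_mul hp hP ?_, ?_⟩
  · obtain ⟨k₀, h00⟩ := h00
    obtain ⟨k₁, h01⟩ := h01
    obtain ⟨k₂, h10⟩ := h10
    obtain ⟨k₃, h11⟩ := h11
    exact ⟨z * k₀ - w * k₁ - v * k₂ + u * k₃, by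
      linear_combination z * h00 - w * h01 - v * h10 + u * h11⟩
  · obtain ⟨k₀, h00⟩ := h00
    obtain ⟨k₁, h01⟩ := h01
    obtain ⟨k₂, h10⟩ := h10
    obtain ⟨k₃, h11⟩ := h11
    exact ⟨(c * v + d * z) * k₀ + (u * a' + v * c') * k₃ - (a * v + b * z) * k₂
      - (w * a' + z * c') * k₁, by
      linear_combination (c * v + d * z) * h00 + (u * a' + v * c') * h11
        - (a * v + b * z) * h10 - (w * a' + z * c') * h01⟩
  · replace h00 := cast_eq_of_pow_dvd hm h00
    replace h01 := cast_eq_of_pow_dvd hm h01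
    replace h10 := cast_eq_of_pow_dvd hm h10
    replace h11 := cast_eq_of_pow_dvd hm h11
    push_cast at *
    constructor
    · rintro ⟨hb, hc, had⟩
      refine ⟨mul_right_cancel₀ hP ?_, mul_right_cancel₀ hP ?_, mul_right_cancel₀ hP ?_⟩ <;> grind
    · rintro ⟨hb, hc, had⟩
      refine ⟨mul_right_cancel₀ hP ?_, mul_right_cancel₀ hP ?_, mul_right_cancel₀ hP ?_⟩ <;> grind

/-- A matrix that is not scalar modulo `p` is determined up to conjugation by its trace and
determinant. -/
theorem matConj_sq_of_not_scalar {a b c d x t y z t' : ℤ}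
    (hns : ¬ ((b : ZMod p) = 0 ∧ (c : ZMod p) = 0 ∧ (a : ZMod p) = d))
    (ht : (p : ℤ) ^ m ∣ t * t' - 1) (ht' : (t' : ZMod p) ≠ 0) [Fact p.Prime]
    (hT : (p : ℤ) ^ m ∣ a + d - (x + z)) (hD : (p : ℤ) ^ m ∣ a * d - b * c - (x * z - t * y)) :
    MatConj p ![m, m] !![a, b; c, d] !![x, t; y, z] := by
  -- A cyclic vector modulo `p`: the determinant of `A (v, w)` and `(v, w)` is nonzero. If it
  -- vanished at the two basis vectors and at their sum, the matrix would be scalar.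
  obtain ⟨v, w, hvw⟩ : ∃ v w : ℤ,
      (((a * v + b * w) * w - (c * v + d * w) * v : ℤ) : ZMod p) ≠ 0 := by
    by_contra! hcon
    have h1 := hcon 0 1
    have h2 := hcon 1 0
    have h3 := hcon 1 1
    push_cast at h1 h2 h3
    exact hns ⟨by linear_combination h1, by linear_combination -h2,
      by linear_combination h3 - h1 - h2⟩
  -- The target sends its second basis vector `e₂` to `t e₁ + z e₂`. So the second column is the
  -- cyclic vector and the first is `t⁻¹ (A - z)` applied to it. The two equations for the first
  -- column are the Cayley–Hamilton identity for `A`.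
  refine matConj_sq_iff.2 ⟨t' * ((a - z) * v + b * w), v, t' * (c * v + (d - z) * w), w,
    ?_, ?_, ?_, ?_, ?_⟩
  · rw [show t' * ((a - z) * v + b * w) * w - v * (t' * (c * v + (d - z) * w))
      = t' * ((a * v + b * w) * w - (c * v + d * w) * v) by ring, Int.cast_mul]
    exact mul_ne_zero ht' hvw
  all_goals
    obtain ⟨k₀, hT⟩ := hT
    obtain ⟨k₁, hD⟩ := hD
    obtain ⟨k₂, ht⟩ := ht
  · exact ⟨t' * (a * v + b * w) * k₀ - t' * v * k₁ + y * v * k₂, by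
      linear_combination t' * (a * v + b * w) * hT - t' * v * hD + y * v * ht⟩
  · exact ⟨-((a - z) * v + b * w) * k₂, by linear_combination -((a - z) * v + b * w) * ht⟩
  · exact ⟨t' * (c * v + d * w) * k₀ - t' * w * k₁ + y * w * k₂, by
      linear_combination t' * (c * v + d * w) * hT - t' * w * hD + y * w * ht⟩
  · exact ⟨-(c * v + (d - z) * w) * k₂, by linear_combination -(c * v + (d - z) * w) * ht⟩

theorem matConj_sq_diag [Fact p.Prime] {a b c d x z : ℤ}
    (hns : ¬ ((b : ZMod p) = 0 ∧ (c : ZMod p) = 0 ∧ (a : ZMod p) = d))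
    (hT : (p : ℤ) ^ m ∣ a + d - (x + z)) (hD : (p : ℤ) ^ m ∣ a * d - b * c - x * z)
    (hxz : (x : ZMod p) ≠ z) :
    MatConj p ![m, m] !![a, b; c, d] !![x, 0; 0, z] := by
  -- The intermediate matrix is upper triangular with diagonal `x, z` and upper right entry `1`. Its
  -- eigenvectors `(1, 0)` and `(1, z - x)` form a basis because `z - x` is a unit.
  refine MatConj.trans Fact.out (matConj_sq_of_not_scalar (t := 1) (t' := 1) (y := 0) hns (by simp)
    (by simp) hT (by simpa using hD)) (matConj_sq_iff.2 ⟨1, 1, 0, z - x, ?_, ?_⟩) (dvd_sq _ _ _)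
    (dvd_sq _ _ _) (dvd_sq _ _ _)
  · push_cast
    simpa [sub_eq_zero] using hxz.symm
  · exact ⟨⟨0, by ring⟩, ⟨0, by ring⟩, ⟨0, by ring⟩, ⟨0, by ring⟩⟩

/-- Normal forms of `2 × 2` matrices modulo `p`. -/
theorem exists_normalForm_two (hp : p.Prime) (a b c d : ℤ) :
    ∃ x y z w : ℤ, MatConj p ![1, 1] !![a, b; c, d] !![x, y; z, w] ∧
      ((0 ≤ x ∧ x ≤ w ∧ w < p ∧ y = 0 ∧ z = 0) ∨
        (0 ≤ x ∧ x < p ∧ y = 1 ∧ z = 0 ∧ w = x) ∨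
        ∃ b₀ b₁, IrrTwo p b₀ b₁ ∧ x = 0 ∧ y = 1 ∧ z = -b₀ ∧ w = -b₁) := by
  have : Fact p.Prime := ⟨hp⟩
  have hdvd : ∀ x : ℤ, (p : ℤ) ^ 1 ∣ x ↔ ((x : ℤ) : ZMod p) = 0 := fun x => by
    rw [pow_one, dvd_iff_cast]
  by_cases hs : (b : ZMod p) = 0 ∧ (c : ZMod p) = 0 ∧ (a : ZMod p) = d
  · obtain ⟨hb, hc, had⟩ := hs
    obtain ⟨x, hx0, hx1, hx⟩ := exists_rep_cast hp (a : ZMod p)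
    refine ⟨x, 0, 0, x, matConj_sq_iff.2 ⟨1, 0, 0, 1, by simp, ?_⟩,
      .inl ⟨hx0, le_rfl, hx1, rfl, rfl⟩⟩
    simp only [hdvd]
    push_cast
    rw [hb, hc, ← had, hx]
    simp
  · by_cases hr : ∃ x : ZMod p, x ^ 2 - (a + d) * x + (a * d - b * c) = 0
    · obtain ⟨r, hr⟩ := hr
      by_cases hrd : r = a + d - r
      · obtain ⟨x, hx0, hx1, hx⟩ := exists_rep_cast hp r
        refine ⟨x, 1, 0, x, matConj_sq_of_not_scalar (t' := 1) hs (by simp) (by simp) ?_ ?_,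
          .inr (.inl ⟨hx0, hx1, rfl, rfl, rfl⟩)⟩
        · rw [hdvd]; push_cast; rw [hx]; linear_combination - hrd
        · rw [hdvd]; push_cast; rw [hx]; linear_combination hr - r * hrd
      · obtain ⟨x, hx0, hx1, hx⟩ := exists_rep_cast hp r
        obtain ⟨w, hw0, hw1, hw⟩ := exists_rep_cast hp (a + d - r)
        rcases le_total x w with h | h
        · refine ⟨x, 0, 0, w, matConj_sq_diag hs ?_ ?_ (by rwa [hx, hw]),
            .inl ⟨hx0, h, hw1, rfl, rfl⟩⟩
          · rw [hdvd]; push_cast; rw [hx, hw]; ring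
          · rw [hdvd]; push_cast; rw [hx, hw]; linear_combination hr
        · refine ⟨w, 0, 0, x, matConj_sq_diag hs ?_ ?_ (by rw [hx, hw]; exact Ne.symm hrd),
            .inl ⟨hw0, h, hx1, rfl, rfl⟩⟩
          · rw [hdvd]; push_cast; rw [hx, hw]; ring
          · rw [hdvd]; push_cast; rw [hx, hw]; linear_combination hr
    · push Not at hr
      obtain ⟨b₀, h0, h0', hb₀⟩ := exists_rep_cast hp (a * d - b * c : ZMod p)
      obtain ⟨b₁, h1, h1', hb₁⟩ := exists_rep_cast hp (-(a + d) : ZMod p)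
      refine ⟨0, 1, -b₀, -b₁, matConj_sq_of_not_scalar (t' := 1) hs (by simp) (by simp) ?_ ?_,
        .inr (.inr ⟨b₀, b₁, (irrTwo_iff hp).2 ⟨⟨h0, h0'⟩, ⟨h1, h1'⟩, fun x => ?_⟩, rfl, rfl, rfl,
          rfl⟩)⟩
      · rw [hdvd]; push_cast; rw [hb₁]; ring
      · rw [hdvd]; push_cast; rw [hb₀]; ring
      · rw [hb₀, hb₁]
        intro h
        exact hr x (by linear_combination h)

end SquareTwo

/-! ### The group `ℤ_{p²}²` -/

section SquareTwoTwo

variable {p : ℕ}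

/-- The scalar `r` commutes with every conjugating matrix and drops out; the remaining factor `p`
lowers the modulus from `p²` to `p`. -/
theorem matConj_scalar_add_iff (hp : p.Prime) {r x y z w x' y' z' w' : ℤ} :
    MatConj p ![2, 2] !![r + p * x, p * y; p * z, r + p * w]
      !![r + p * x', p * y'; p * z', r + p * w'] ↔
    MatConj p ![1, 1] !![x, y; z, w] !![x', y'; z', w'] := by
  have h : ∀ s : ℤ, (p : ℤ) ^ 2 ∣ p * s ↔ (p : ℤ) ^ 1 ∣ s := fun s => by
    rw [pow_two, pow_one, mul_dvd_mul_iff_left (by exact_mod_cast hp.ne_zero)]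
  rw [matConj_sq_iff, matConj_sq_iff]
  refine exists_congr fun _ => exists_congr fun _ => exists_congr fun _ => exists_congr fun _ =>
    and_congr_right fun _ => and_congr ?_ (and_congr ?_ (and_congr ?_ ?_)) <;>
  · rw [← h]
    ring_nf

theorem exists_digit {a r : ℤ} (h : (a : ZMod p) = r) : ∃ x, a = r + p * x := by
  obtain ⟨x, hx⟩ : (p : ℤ) ∣ a - r := by
    rw [dvd_iff_cast]; push_cast; rw [h, sub_self]
  exact ⟨x, by lia⟩

theorem eq_of_digit {r x y : ℤ} (h : (x : ZMod p) = y) (h0 : 0 ≤ r + p * x)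
    (h1 : r + p * x < p ^ 2) (h2 : 0 ≤ r + p * y) (h3 : r + p * y < p ^ 2) :
    r + p * x = r + p * y := by
  obtain ⟨k, hk⟩ := exists_digit h
  exact eq_of_rep h0 h1 h2 h3 ⟨k, by rw [hk]; ring⟩

theorem cast_unitRep_ne_zero {b : ℤ} {e : ℕ} (hb : IsUnitRep p e b) : (b : ZMod p) ≠ 0 :=
  fun h => hb.2.2 ((dvd_iff_cast b).2 h)

theorem isAut_auts22 (hp : p.Prime) : ∀ S ∈ auts22 p, ∀ A ∈ S.1, IsAut p ![2, 2] A := by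
  have : Fact p.Prime := ⟨hp⟩
  simp only [auts22, List.forall_mem_cons, List.not_mem_nil, IsEmpty.forall_iff, implies_true,
    and_true]
  refine ⟨?_, ?_, ?_, ?_, ?_⟩
  · rintro _ ⟨b, c, hb, hc, -, rfl⟩
    rw [isAut_sq_iff]
    push_cast
    simpa using ⟨cast_unitRep_ne_zero hb, cast_unitRep_ne_zero hc⟩
  · rintro _ ⟨b, hb, rfl⟩
    rw [isAut_sq_iff]
    push_cast
    simpa using cast_unitRep_ne_zero hb
  · rintro _ ⟨b, b₀, b₁, hb, hb', h, rfl⟩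
    rw [isAut_sq_iff]
    push_cast
    simpa using cast_ne_zero_of_pos_lt hb hb'
  · rintro _ ⟨b, α, γ, hb, hb', hα, hγ, rfl⟩
    rw [isAut_sq_iff]
    push_cast
    simpa using cast_ne_zero_of_pos_lt hb hb'
  · rintro _ ⟨b₀, b₁, α, β, h, hα, hβ, rfl⟩
    rw [isAut_sq_iff]
    have := ((irrTwo_iff hp).1 h).2.2 0
    push_cast
    simpa using this

/-- The first three rows contain all matrices that are scalar modulo `p`. When two of these meet,
trace and determinant make the residues agree and the comparison moves to the digit matrices `N`
modulo `p`. All other pairs are already separated modulo `p`, by scalarity or by the roots of the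
characteristic polynomial. -/
theorem pairwise_auts22 (hp : p.Prime) :
    (auts22 p).Pairwise fun S T => ∀ A ∈ S.1, ∀ B ∈ T.1, ¬ MatConj p ![2, 2] A B := by
  have : Fact p.Prime := ⟨hp⟩
  have key : ∀ {a b c d a' b' c' d' : ℤ},
      MatConj p ![2, 2] !![a, b; c, d] !![a', b'; c', d'] →
      (a + d : ZMod p) = a' + d' ∧ (a * d - b * c : ZMod p) = a' * d' - b' * c' ∧
      (((b : ZMod p) = 0 ∧ (c : ZMod p) = 0 ∧ (a : ZMod p) = d) ↔
      ((b' : ZMod p) = 0 ∧ (c' : ZMod p) = 0 ∧ (a' : ZMod p) = d')) := by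
    intro a b c d a' b' c' d' h
    obtain ⟨hT, hD, hS⟩ := matConj_sq_invariants hp (by lia) h
    replace hT := cast_eq_of_pow_dvd (by lia) hT
    replace hD := cast_eq_of_pow_dvd (by lia) hD
    push_cast at hT hD
    exact ⟨hT, hD, hS⟩
  have key1 : ∀ {a b c d a' b' c' d' : ℤ},
      MatConj p ![1, 1] !![a, b; c, d] !![a', b'; c', d'] →
      (a + d : ZMod p) = a' + d' ∧ (a * d - b * c : ZMod p) = a' * d' - b' * c' ∧
      (((b : ZMod p) = 0 ∧ (c : ZMod p) = 0 ∧ (a : ZMod p) = d) ↔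
      ((b' : ZMod p) = 0 ∧ (c' : ZMod p) = 0 ∧ (a' : ZMod p) = d')) := by
    intro a b c d a' b' c' d' h
    obtain ⟨hT, hD, hS⟩ := matConj_sq_invariants hp (by lia) h
    replace hT := cast_eq_of_pow_dvd (by lia) hT
    replace hD := cast_eq_of_pow_dvd (by lia) hD
    push_cast at hT hD
    exact ⟨hT, hD, hS⟩
  have f : ∀ {b₀ b₁ : ℤ}, IrrTwo p b₀ b₁ → ∀ x : ZMod p, x ^ 2 + b₁ * x + b₀ ≠ 0 :=
    fun h => ((irrTwo_iff hp).1 h).2.2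
  simp only [auts22, List.pairwise_cons, List.forall_mem_cons, List.not_mem_nil,
    IsEmpty.forall_iff, implies_true, and_true, List.Pairwise.nil]
  refine ⟨⟨?_, ?_, ?_, ?_⟩, ⟨?_, ?_, ?_⟩, ⟨?_, ?_⟩, ?_⟩
  · rintro _ ⟨b, c, hb, hc, -, rfl⟩ _ ⟨b', hb', rfl⟩ h
    obtain ⟨hT, hD, hS⟩ := key h
    push_cast at hT hD hS
    obtain ⟨-, -, hbc⟩ := hS.2 (by simp)
    have hbb : (b : ZMod p) = b' := by
      have : ((b : ZMod p) - b') * (b - b') = 0 := by rw [← hbc] at hT hD; grind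
      grind
    obtain ⟨x, rfl⟩ := exists_digit hbb
    obtain ⟨y, rfl⟩ := exists_digit (hbc.symm.trans hbb)
    have h' : MatConj p ![1, 1] !![x, 0; 0, y] !![0, 1; 0, 0] := by
      rw [← matConj_scalar_add_iff hp (r := b')]
      simpa using h
    obtain ⟨hT, hD, hS⟩ := key1 h'
    push_cast at hT hD hS
    grind
  · rintro _ ⟨b, c, hb, hc, -, rfl⟩ _ ⟨b', b₀, b₁, hb', hb'', hi, rfl⟩ h
    obtain ⟨hT, hD, hS⟩ := key h
    push_cast at hT hD hS
    obtain ⟨-, -, hbc⟩ := hS.2 (by simp)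
    have hbb : (b : ZMod p) = b' := by
      have : ((b : ZMod p) - b') * (b - b') = 0 := by
        rw [← hbc] at hT hD
        simp at hT hD
        grind
      grind
    obtain ⟨x, rfl⟩ := exists_digit hbb
    obtain ⟨y, rfl⟩ := exists_digit (hbc.symm.trans hbb)
    have h' : MatConj p ![1, 1] !![x, 0; 0, y] !![0, 1; -b₀, -b₁] := by
      rw [← matConj_scalar_add_iff hp (r := b')]
      simpa [sub_eq_add_neg] using h
    obtain ⟨hT, hD, hS⟩ := key1 h'
    push_cast at hT hD hS
    exact f hi x (by grind)
  · rintro _ ⟨b, c, hb, hc, -, rfl⟩ _ ⟨b', α, γ, hb', hb'', hα, hγ, rfl⟩ h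
    obtain ⟨hT, hD, hS⟩ := key h
    push_cast at hT hD hS
    simp at hT hD hS
    apply hS
    have : ((b : ZMod p) - c) * (b - c) = 0 := by grind
    grind
  · rintro _ ⟨b, c, hb, hc, -, rfl⟩ _ ⟨b₀, b₁, α, β, hi, hα, hβ, rfl⟩ h
    obtain ⟨hT, hD, hS⟩ := key h
    push_cast at hT hD hS
    simp at hT hD hS
    exact f hi b (by grind)
  · rintro _ ⟨b, hb, rfl⟩ _ ⟨b', b₀, b₁, hb', hb'', hi, rfl⟩ h
    obtain ⟨hT, hD, hS⟩ := key h
    push_cast at hT hD hS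
    simp at hT hD
    have hbb : (b : ZMod p) = b' := by
      have : ((b : ZMod p) - b') * (b - b') = 0 := by grind
      grind
    obtain ⟨x, rfl⟩ := exists_digit hbb
    have h' : MatConj p ![1, 1] !![x, 1; 0, x] !![0, 1; -b₀, -b₁] := by
      rw [← matConj_scalar_add_iff hp (r := b')]
      simpa [sub_eq_add_neg] using h
    obtain ⟨hT, hD, hS⟩ := key1 h'
    push_cast at hT hD hS
    exact f hi x (by grind)
  · rintro _ ⟨b, hb, rfl⟩ _ ⟨b', α, γ, hb', hb'', hα, hγ, rfl⟩ h
    obtain ⟨hT, hD, hS⟩ := key h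
    simp at hS
  · rintro _ ⟨b, hb, rfl⟩ _ ⟨b₀, b₁, α, β, hi, hα, hβ, rfl⟩ h
    obtain ⟨hT, hD, hS⟩ := key h
    simp at hS
  · rintro _ ⟨b, b₀, b₁, hb, hb', hi, rfl⟩ _ ⟨b', α, γ, hb'', hb''', hα, hγ, rfl⟩ h
    obtain ⟨hT, hD, hS⟩ := key h
    simp at hS
  · rintro _ ⟨b, b₀, b₁, hb, hb', hi, rfl⟩ _ ⟨c₀, c₁, α, β, hi', hα, hβ, rfl⟩ h
    obtain ⟨hT, hD, hS⟩ := key h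
    simp at hS
  · rintro _ ⟨b, α, γ, hb'', hb''', hα, hγ, rfl⟩ _ ⟨c₀, c₁, α', β, hi', hα', hβ, rfl⟩ h
    obtain ⟨hT, hD, hS⟩ := key h
    push_cast at hT hD hS
    simp at hT hD
    exact f hi' b (by grind)

theorem inj_auts22 (hp : p.Prime) :
    ∀ S ∈ auts22 p, ∀ A ∈ S.1, ∀ B ∈ S.1, MatConj p ![2, 2] A B → A = B := by
  have : Fact p.Prime := ⟨hp⟩
  have key : ∀ {m : ℕ} {a b c d a' b' c' d' : ℤ}, 1 ≤ m →
      MatConj p ![m, m] !![a, b; c, d] !![a', b'; c', d'] →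
      (a + d : ZMod p) = a' + d' ∧ (a * d - b * c : ZMod p) = a' * d' - b' * c' ∧
      (((b : ZMod p) = 0 ∧ (c : ZMod p) = 0 ∧ (a : ZMod p) = d) ↔
      ((b' : ZMod p) = 0 ∧ (c' : ZMod p) = 0 ∧ (a' : ZMod p) = d')) := by
    intro m a b c d a' b' c' d' hm h
    obtain ⟨hT, hD, hS⟩ := matConj_sq_invariants hp hm h
    replace hT := cast_eq_of_pow_dvd hm hT
    replace hD := cast_eq_of_pow_dvd hm hD
    push_cast at hT hD
    exact ⟨hT, hD, hS⟩
  have hdvd : ∀ x : ℤ, (p : ℤ) ^ 2 ∣ p * x ↔ ((x : ℤ) : ZMod p) = 0 := fun x => by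
    rw [pow_two, mul_dvd_mul_iff_left (by exact_mod_cast hp.ne_zero), dvd_iff_cast]
  simp only [auts22, List.forall_mem_cons, List.not_mem_nil, IsEmpty.forall_iff, implies_true,
    and_true]
  refine ⟨?_, ?_, ?_, ?_, ?_⟩
  · rintro _ ⟨b, c, hb, hc, hbc, rfl⟩ _ ⟨b', c', hb', hc', hbc', rfl⟩ h
    obtain ⟨hT, hD, hS⟩ := key (by lia) h
    push_cast at hT hD hS
    by_cases hs : (b : ZMod p) = c
    · have hs' := (hS.1 (by simpa using hs)).2.2
      have hbb : (b' : ZMod p) = b := by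
        have : ((b : ZMod p) - b') * (b - b') = 0 := by grind
        grind
      -- A copy of `b` serves as common base point for the digits, since `b` itself is about to be
      -- replaced by `r + p * x`.
      obtain ⟨r, hr⟩ : ∃ r : ℤ, r = b := ⟨b, rfl⟩
      rw [← hr] at hbb
      obtain ⟨x, rfl⟩ := exists_digit (show (b : ZMod p) = r by rw [hr])
      obtain ⟨y, rfl⟩ := exists_digit (show (c : ZMod p) = r by rw [hr, hs])
      obtain ⟨x', rfl⟩ := exists_digit hbb
      obtain ⟨y', rfl⟩ := exists_digit (hs'.symm.trans hbb)
      have h' : MatConj p ![1, 1] !![x, 0; 0, y] !![x', 0; 0, y'] := by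
        rw [← matConj_scalar_add_iff hp (r := r)]
        simpa using h
      obtain ⟨hT, hD, -⟩ := key le_rfl h'
      push_cast at hT hD
      have h1 : ((x' : ZMod p) - x) * (x' - y) = 0 := by grind
      rcases mul_eq_zero.1 h1 with h1 | h1
      · rw [eq_of_digit (sub_eq_zero.1 h1) hb'.1 hb'.2.1 hb.1 hb.2.1,
          eq_of_digit (x := y') (y := y) (by grind) hc'.1 hc'.2.1 hc.1 hc.2.1]
      · have h2 := eq_of_digit (sub_eq_zero.1 h1) hb'.1 hb'.2.1 hc.1 hc.2.1
        have h3 := eq_of_digit (x := y') (y := x) (by grind) hc'.1 hc'.2.1 hb.1 hb.2.1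
        have h4 : r + p * x = r + p * y := by lia
        rw [h2, h3, h4]
    · obtain ⟨hT', hD', -⟩ := matConj_sq_invariants hp (by lia) h
      obtain ⟨k₀, hT'⟩ := hT'
      obtain ⟨k₁, hD'⟩ := hD'
      -- The entry `b'` is a root modulo `p²` of the polynomial with roots `b` and `c`. These differ
      -- modulo `p`, so one factor is a unit and the other is divisible by `p²`.
      have h0 : (p : ℤ) ^ 2 ∣ (b' - b) * (b' - c) := ⟨k₁ - b' * k₀, by
        linear_combination hD' - b' * hT'⟩
      have h1 : ((b' : ZMod p) - b) * (b' - c) = 0 := by grind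
      rcases mul_eq_zero.1 h1 with h1 | h1
      · have h2 : ((b' - c : ℤ) : ZMod p) ≠ 0 := by push_cast; grind
        have h3 := eq_of_rep hb'.1 hb'.2.1 hb.1 hb.2.1 (pow_dvd_of_mul hp h2 h0)
        subst h3
        have h4 := eq_of_rep hc.1 hc.2.1 hc'.1 hc'.2.1 ⟨k₀, by linear_combination hT'⟩
        rw [h4]
      · have h2 : ((b' - b : ℤ) : ZMod p) ≠ 0 := by push_cast; grind
        rw [mul_comm] at h0
        have h3 := eq_of_rep hb'.1 hb'.2.1 hc.1 hc.2.1 (pow_dvd_of_mul hp h2 h0)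
        subst h3
        have h4 := eq_of_rep hb.1 hb.2.1 hc'.1 hc'.2.1 ⟨k₀, by linear_combination hT'⟩
        subst h4
        rw [le_antisymm hbc hbc']
  · rintro _ ⟨b, hb, rfl⟩ _ ⟨b', hb', rfl⟩ h
    obtain ⟨hT, hD, hS⟩ := key (by lia) h
    push_cast at hT hD hS
    simp at hT hD
    have hbb : (b' : ZMod p) = b := by
      have : ((b : ZMod p) - b') * (b - b') = 0 := by grind
      grind
    obtain ⟨r, hr⟩ : ∃ r : ℤ, r = b := ⟨b, rfl⟩
    rw [← hr] at hbb
    obtain ⟨x, rfl⟩ := exists_digit (show (b : ZMod p) = r by rw [hr])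
    obtain ⟨x', rfl⟩ := exists_digit hbb
    have h' : MatConj p ![1, 1] !![x, 1; 0, x] !![x', 1; 0, x'] := by
      rw [← matConj_scalar_add_iff hp (r := r)]
      simpa using h
    obtain ⟨hT, hD, -⟩ := key le_rfl h'
    push_cast at hT hD
    have h1 : ((x' : ZMod p) - x) * (x' - x) = 0 := by grind
    rw [eq_of_digit (x := x) (y := x') (by grind) hb.1 hb.2.1 hb'.1 hb'.2.1]
  · rintro _ ⟨b, b₀, b₁, hb, hb', hi, rfl⟩ _ ⟨c, c₀, c₁, hc, hc', hi', rfl⟩ h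
    obtain ⟨hT, hD, hS⟩ := key (by lia) h
    push_cast at hT hD hS
    simp at hT hD
    have hbb : (b : ZMod p) = c := by
      have : ((b : ZMod p) - c) * (b - c) = 0 := by grind
      grind
    obtain rfl := eq_of_rep_cast hb.le hb' hc.le hc' hbb
    have h' : MatConj p ![1, 1] !![0, 1; -b₀, -b₁] !![0, 1; -c₀, -c₁] := by
      rw [← matConj_scalar_add_iff hp (r := b)]
      simpa [sub_eq_add_neg] using h
    obtain ⟨hT, hD, -⟩ := key le_rfl h'
    push_cast at hT hD
    rw [eq_of_rep_cast hi.1.1 hi.1.2 hi'.1.1 hi'.1.2 (by grind),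
      eq_of_rep_cast hi.2.1.1 hi.2.1.2 hi'.2.1.1 hi'.2.1.2 (by grind)]
  · rintro _ ⟨b, α, γ, hb, hb', hα, hγ, rfl⟩ _ ⟨c, α', γ', hc, hc', hα', hγ', rfl⟩ h
    obtain ⟨hT, hD, hS⟩ := key (by lia) h
    obtain ⟨hT', hD', -⟩ := matConj_sq_invariants hp (by lia) h
    push_cast at hT hD hS
    simp at hT hD
    have hbb : (b : ZMod p) = c := by
      have : ((b : ZMod p) - c) * (b - c) = 0 := by grind
      grind
    obtain rfl := eq_of_rep_cast hb.le hb' hc.le hc' hbb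
    rw [show b + p * α + b - (b + p * α' + b) = p * (α - α') by ring, hdvd] at hT'
    obtain rfl := eq_of_rep_cast hα.1 hα.2 hα'.1 hα'.2 (by push_cast at hT'; grind)
    rw [show (b + p * α) * b - 1 * (p * γ) - ((b + p * α) * b - 1 * (p * γ')) = p * (γ' - γ) by
      ring, hdvd] at hD'
    rw [eq_of_rep_cast hγ.1 hγ.2 hγ'.1 hγ'.2 (by push_cast at hD'; grind)]
  · rintro _ ⟨b₀, b₁, α, β, hi, hα, hβ, rfl⟩ _ ⟨c₀, c₁, α', β', hi', hα', hβ', rfl⟩ h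
    obtain ⟨hT, hD, hS⟩ := key (by lia) h
    obtain ⟨hT', hD', -⟩ := matConj_sq_invariants hp (by lia) h
    push_cast at hT hD hS
    simp at hT hD
    obtain rfl := eq_of_rep_cast hi.1.1 hi.1.2 hi'.1.1 hi'.1.2 hD
    obtain rfl := eq_of_rep_cast hi.2.1.1 hi.2.1.2 hi'.2.1.1 hi'.2.1.2 hT
    rw [show p * α + -b₁ - (p * α' + -b₁) = p * (α - α') by ring, hdvd] at hT'
    obtain rfl := eq_of_rep_cast hα.1 hα.2 hα'.1 hα'.2 (by push_cast at hT'; grind)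
    rw [show p * α * -b₁ - (1 + p * β) * -b₀ - (p * α * -b₁ - (1 + p * β') * -b₀)
      = p * ((β - β') * b₀) by ring, hdvd] at hD'
    have h0 : (b₀ : ZMod p) ≠ 0 := by simpa using ((irrTwo_iff hp).1 hi).2.2 0
    push_cast at hD'
    rw [eq_of_rep_cast hβ.1 hβ.2 hβ'.1 hβ'.2
      (sub_eq_zero.1 ((mul_eq_zero.1 hD').resolve_right h0))]

/-- A matrix that is scalar modulo `p` is reduced through the normal form of its digit matrix. For
the others a tabulated matrix with the same trace and determinant modulo `p²` suffices. It is chosen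
according to whether the characteristic polynomial modulo `p` has a double root, two distinct roots
or no root. -/
theorem exhaust_auts22 (hp : p.Prime) (A : Matrix (Fin 2) (Fin 2) ℤ) (hA : IsAut p ![2, 2] A) :
    ∃ S ∈ auts22 p, ∃ B ∈ S.1, MatConj p ![2, 2] A B := by
  have : Fact p.Prime := ⟨hp⟩
  have hp0 : (0 : ℤ) < p := by exact_mod_cast hp.pos
  have hlift : ∀ x : ZMod p, ∃ y : ℤ, (y : ZMod p) = x := ZMod.intCast_surjective
  obtain ⟨a, b, c, d, rfl⟩ : ∃ u v w z, A = !![u, v; w, z] := ⟨_, _, _, _, Matrix.eta_fin_two A⟩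
  rw [isAut_sq_iff] at hA
  push_cast at hA
  have hdvd : ∀ x : ℤ, (p : ℤ) ^ 2 ∣ p * x ↔ ((x : ℤ) : ZMod p) = 0 := fun x => by
    rw [pow_two, mul_dvd_mul_iff_left (by exact_mod_cast hp.ne_zero), dvd_iff_cast]
  simp only [auts22, List.exists_mem_cons_iff, List.not_mem_nil, false_and, exists_false, or_false]
  by_cases hs : (b : ZMod p) = 0 ∧ (c : ZMod p) = 0 ∧ (a : ZMod p) = d
  · obtain ⟨hb, hc, had⟩ := hs
    obtain ⟨r, hr0, hr1, hr⟩ := exists_rep_cast hp (a : ZMod p)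
    obtain ⟨a, rfl⟩ := exists_digit hr.symm
    obtain ⟨d, rfl⟩ := exists_digit (had.symm.trans hr.symm)
    obtain ⟨b, rfl⟩ := (dvd_iff_cast b).2 hb
    obtain ⟨c, rfl⟩ := (dvd_iff_cast c).2 hc
    have hr' : (r : ZMod p) ≠ 0 := by
      rintro h
      simp [h] at hA
    have hrpos := pos_of_cast_ne_zero hr0 hr'
    have hu : ∀ x : ℤ, 0 ≤ x → x < p → IsUnitRep p 2 (r + p * x) := by
      intro x h0 h1
      refine ⟨by positivity, by nlinarith, ?_⟩
      rw [dvd_iff_cast]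
      simpa using hr'
    obtain ⟨x, y, z, w, hN, hcase⟩ := exists_normalForm_two hp a b c d
    rw [← matConj_scalar_add_iff hp (r := r)] at hN
    rcases hcase with ⟨h0, h1, h2, rfl, rfl⟩ | ⟨h0, h1, rfl, rfl, rfl⟩ |
      ⟨b₀, b₁, hi, rfl, rfl, rfl, rfl⟩
    · exact .inl ⟨_, ⟨r + p * x, r + p * w, hu x h0 (by lia), hu w (by lia) h2, by nlinarith, rfl⟩,
        by simpa using hN⟩
    · exact .inr (.inl ⟨_, ⟨r + p * w, hu w h0 h1, rfl⟩, by simpa using hN⟩)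
    · exact .inr (.inr (.inl ⟨_, ⟨r, b₀, b₁, hrpos, hr1, hi, rfl⟩,
        by simpa [sub_eq_add_neg] using hN⟩))
  · by_cases hroot : ∃ x : ZMod p, x ^ 2 - (a + d) * x + (a * d - b * c) = 0
    · obtain ⟨t, ht⟩ := hroot
      by_cases htd : t = a + d - t
      · obtain ⟨r, hr0, hr1, hr⟩ := exists_rep_cast hp t
        have ht0 : t ≠ 0 := by
          rintro rfl
          exact hA (by linear_combination ht)
        have hrpos := pos_of_cast_ne_zero hr0 (by rwa [hr])
        -- The `p`-digit of the trace determines `α`; once `α` is fixed, the `p`-digit of the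
        -- determinant determines `γ`.
        obtain ⟨x, hx⟩ := exists_digit (a := a + d) (r := 2 * r)
          (by push_cast; rw [hr]; linear_combination -htd)
        obtain ⟨α, hα0, hα1, hα⟩ := exists_rep_cast hp (x : ZMod p)
        obtain ⟨y, hy⟩ := exists_digit (a := a * d - b * c) (r := r * (r + p * α))
          (by push_cast; rw [hr]; simp; linear_combination ht - t * htd)
        obtain ⟨γ, hγ0, hγ1, hγ⟩ := exists_rep_cast hp (-y : ZMod p)
        refine .inr (.inr (.inr (.inl ⟨_, ⟨r, α, γ, hrpos, hr1, ⟨hα0, hα1⟩, ⟨hγ0, hγ1⟩, rfl⟩, ?_⟩)))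
        refine matConj_sq_of_not_scalar (t' := 1) hs (by simp) (by simp) ?_ ?_
        · rw [hx, show 2 * r + p * x - (r + p * α + r) = p * (x - α) by ring, hdvd]
          push_cast
          rw [hα, sub_self]
        · rw [hy, show r * (r + p * α) + p * y - ((r + p * α) * r - 1 * (p * γ)) = p * (y + γ) by
            ring, hdvd]
          push_cast
          rw [hγ, add_neg_cancel]
      · obtain ⟨r, hr⟩ := hlift t
        obtain ⟨k, hk⟩ := exists_digit (a := r ^ 2 - (a + d) * r + (a * d - b * c)) (r := 0)
          (by push_cast; rw [hr, ht])
        -- The derivative of the characteristic polynomial does not vanish at a simple root, so one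
        -- Newton step lifts the root to `r + p * s` modulo `p²`. The trace supplies the second
        -- root.
        have hne : (2 * t - (a + d) : ZMod p) ≠ 0 := fun h => htd (by linear_combination h)
        obtain ⟨s, hs'⟩ := hlift (-k * (2 * t - (a + d) : ZMod p)⁻¹)
        have hf : (p : ℤ) ^ 2 ∣ (r + p * s) ^ 2 - (a + d) * (r + p * s) + (a * d - b * c) := by
          rw [show (r + p * s) ^ 2 - (a + d) * (r + p * s) + (a * d - b * c)
            = p * (k + s * (2 * r - (a + d))) + p ^ 2 * s ^ 2 by linear_combination hk,
            dvd_add_left (dvd_mul_right _ _), hdvd]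
          push_cast
          rw [hr, hs']
          field_simp
          ring
        obtain ⟨x, hx0, hx1, q₁, hx⟩ := exists_rep (q := (p : ℤ) ^ 2) (by positivity) (r + p * s)
        obtain ⟨w, hw0, hw1, q₂, hw⟩ := exists_rep (q := (p : ℤ) ^ 2) (by positivity)
          (a + d - (r + p * s))
        have hxt : (x : ZMod p) = t := by
          have := congrArg (Int.cast : ℤ → ZMod p) hx
          push_cast at this
          simp at this
          rw [← hr]
          linear_combination -this
        have hwt : (w : ZMod p) = a + d - t := by
          have := congrArg (Int.cast : ℤ → ZMod p) hw
          push_cast at this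
          simp at this
          rw [← hr]
          linear_combination -this
        have hT : (p : ℤ) ^ 2 ∣ a + d - (x + w) := ⟨q₁ + q₂, by linear_combination hx + hw⟩
        have hD : (p : ℤ) ^ 2 ∣ a * d - b * c - x * w := by
          obtain ⟨q₃, hf⟩ := hf
          refine ⟨q₃ + q₁ * (a + d - (r + p * s)) + x * q₂, ?_⟩
          linear_combination hf + (a + d - (r + p * s)) * hx + x * hw
        have htm : t * (a + d - t) ≠ 0 := fun h => hA (by linear_combination ht + h)
        have hux : IsUnitRep p 2 x := ⟨hx0, hx1, by
          rw [dvd_iff_cast, hxt]; exact left_ne_zero_of_mul htm⟩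
        have huw : IsUnitRep p 2 w := ⟨hw0, hw1, by
          rw [dvd_iff_cast, hwt]; exact right_ne_zero_of_mul htm⟩
        have hxw : (x : ZMod p) ≠ w := by rwa [hxt, hwt]
        rcases le_total x w with h | h
        · exact .inl ⟨_, ⟨x, w, hux, huw, h, rfl⟩, matConj_sq_diag hs hT hD hxw⟩
        · exact .inl ⟨_, ⟨w, x, huw, hux, h, rfl⟩, matConj_sq_diag hs (by rwa [add_comm w])
            (by rwa [mul_comm w]) hxw.symm⟩
    · push Not at hroot
      obtain ⟨b₀, h0, h0', hb₀⟩ := exists_rep_cast hp (a * d - b * c : ZMod p)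
      obtain ⟨b₁, h1, h1', hb₁⟩ := exists_rep_cast hp (-(a + d) : ZMod p)
      have hi : IrrTwo p b₀ b₁ := (irrTwo_iff hp).2 ⟨⟨h0, h0'⟩, ⟨h1, h1'⟩, fun x h =>
        hroot x (by rw [hb₀, hb₁] at h; linear_combination h)⟩
      obtain ⟨x, hx⟩ := exists_digit (a := a + d) (r := -b₁) (by push_cast; rw [hb₁]; ring)
      obtain ⟨α, hα0, hα1, hα⟩ := exists_rep_cast hp (x : ZMod p)
      obtain ⟨y, hy⟩ := exists_digit (a := a * d - b * c) (r := -(p * α * b₁) + b₀)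
        (by push_cast; rw [hb₀]; simp)
      have hb0 : (b₀ : ZMod p) ≠ 0 := by rwa [hb₀]
      obtain ⟨β, hβ0, hβ1, hβ⟩ := exists_rep_cast hp (y * (b₀ : ZMod p)⁻¹)
      refine .inr (.inr (.inr (.inr ⟨_, ⟨b₀, b₁, α, β, hi, ⟨hα0, hα1⟩, ⟨hβ0, hβ1⟩, rfl⟩, ?_⟩)))
      -- Modulo `p²` the inverse of `1 + p * β` is `1 - p * β`. The digit `β` could be solved for
      -- because `b₀` is nonzero modulo `p`.
      refine matConj_sq_of_not_scalar (t' := 1 - p * β) hs ⟨-β ^ 2, by ring⟩ (by simp) ?_ ?_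
      · rw [hx, show -b₁ + p * x - (p * α + -b₁) = p * (x - α) by ring, hdvd]
        push_cast
        rw [hα, sub_self]
      · rw [hy, show -(p * α * b₁) + b₀ + p * y - (p * α * -b₁ - (1 + p * β) * -b₀)
          = p * (y - β * b₀) by ring, hdvd]
        push_cast
        rw [hβ]
        field_simp
        ring

theorem classifies_auts22 (hp : p.Prime) : Classifies p ![2, 2] (auts22 p) :=
  ⟨isAut_auts22 hp, pairwise_auts22 hp, inj_auts22 hp, exhaust_auts22 hp⟩

end SquareTwoTwo

/-! ### Matrices on `ℤ_{p²} × ℤ_p²` -/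

section HookThree

variable {p : ℕ}

/-- The matrices acting on `ℤ_{p²} × ℤ_p²`. -/
def blk (p : ℕ) (a b₁ b₂ c₁ c₂ d₁₁ d₁₂ d₂₁ d₂₂ : ℤ) : Matrix (Fin 3) (Fin 3) ℤ :=
  !![a, p * b₁, p * b₂; c₁, d₁₁, d₁₂; c₂, d₂₁, d₂₂]

theorem exists_blk_form (hp : p.Prime) {A : Matrix (Fin 3) (Fin 3) ℤ}
    (hA : IsAut p ![2, 1, 1] A) : ∃ a b₁ b₂ c₁ c₂ d₁₁ d₁₂ d₂₁ d₂₂ : ℤ,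
      A = blk p a b₁ b₂ c₁ c₂ d₁₁ d₁₂ d₂₁ d₂₂ := by
  have h : ∀ x : ℤ, (p : ℤ) ^ 2 ∣ x * p → ∃ y, x = p * y := fun x hx => by
    rwa [pow_two, mul_dvd_mul_iff_right (by exact_mod_cast hp.ne_zero)] at hx
  obtain ⟨b₁, hb₁⟩ := h (A 0 1) (by simpa using hA.dvd 0 1)
  obtain ⟨b₂, hb₂⟩ := h (A 0 2) (by simpa using hA.dvd 0 2)
  refine ⟨A 0 0, b₁, b₂, A 1 0, A 2 0, A 1 1, A 1 2, A 2 1, A 2 2, ?_⟩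
  rw [blk, ← hb₁, ← hb₂]
  exact Matrix.eta_fin_three A

theorem blk_dvd (p : ℕ) (a b₁ b₂ c₁ c₂ d₁₁ d₁₂ d₂₁ d₂₂ : ℤ) (i j : Fin 3) :
    (p : ℤ) ^ (![2, 1, 1] i) ∣ blk p a b₁ b₂ c₁ c₂ d₁₁ d₁₂ d₂₁ d₂₂ i j * (p : ℤ) ^ (![2, 1, 1] j) := by
  fin_cases i <;> fin_cases j <;> simp [blk]
  · exact ⟨b₁, by ring⟩
  · exact ⟨b₂, by ring⟩
  · exact ⟨c₁ * p, by ring⟩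
  · exact ⟨c₂ * p, by ring⟩

/-- The top row is `(a, 0, 0)` modulo `p`, so the determinant reduces to `a` times that of the lower
right block. -/
theorem isAut_blk_iff (hp : p.Prime) {a b₁ b₂ c₁ c₂ d₁₁ d₁₂ d₂₁ d₂₂ : ℤ} :
    IsAut p ![2, 1, 1] (blk p a b₁ b₂ c₁ c₂ d₁₁ d₁₂ d₂₁ d₂₂) ↔
      (a : ZMod p) ≠ 0 ∧ (d₁₁ * d₂₂ - d₁₂ * d₂₁ : ZMod p) ≠ 0 := by
  have : Fact p.Prime := ⟨hp⟩
  have h : ((p : ℤ) ∣ (blk p a b₁ b₂ c₁ c₂ d₁₁ d₁₂ d₂₁ d₂₂).det) ↔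
      (a : ZMod p) = 0 ∨ (d₁₁ * d₂₂ - d₁₂ * d₂₁ : ZMod p) = 0 := by
    rw [← mul_eq_zero, dvd_iff_cast, blk, Matrix.det_fin_three]
    simp only [Matrix.of_apply, Matrix.cons_val', Matrix.cons_val_zero, Matrix.cons_val_one,
      Matrix.cons_val_fin_one, Matrix.cons_val]
    push_cast
    simp only [CharP.cast_eq_zero, zero_mul, mul_zero, sub_zero, add_zero]
    rw [mul_sub, mul_assoc, mul_assoc]
  rw [← not_or, ← h]
  exact ⟨fun h => h.det, fun h => ⟨blk_dvd p _ _ _ _ _ _ _ _ _, h⟩⟩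

/-- The equations are grouped by blocks: corner, row, column and lower right square. Only the corner
needs a congruence modulo `p²`; the row equations lose a factor `p`. -/
theorem matConj_blk_iff (hp : p.Prime) {a b₁ b₂ c₁ c₂ d₁₁ d₁₂ d₂₁ d₂₂ : ℤ}
    {a' b₁' b₂' c₁' c₂' d₁₁' d₁₂' d₂₁' d₂₂' : ℤ} :
    MatConj p ![2, 1, 1] (blk p a b₁ b₂ c₁ c₂ d₁₁ d₁₂ d₂₁ d₂₂)
      (blk p a' b₁' b₂' c₁' c₂' d₁₁' d₁₂' d₂₁' d₂₂') ↔
    ∃ u v₁ v₂ w₁ w₂ z₁₁ z₁₂ z₂₁ z₂₂ : ℤ,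
      ((u : ZMod p) ≠ 0 ∧ (z₁₁ * z₂₂ - z₁₂ * z₂₁ : ZMod p) ≠ 0) ∧
      (p : ℤ) ^ 2 ∣ (a - a') * u + p * (b₁ * w₁ + b₂ * w₂ - v₁ * c₁' - v₂ * c₂') ∧
      ((a * v₁ + b₁ * z₁₁ + b₂ * z₂₁ : ZMod p) = u * b₁' + v₁ * d₁₁' + v₂ * d₂₁' ∧
      (a * v₂ + b₁ * z₁₂ + b₂ * z₂₂ : ZMod p) = u * b₂' + v₁ * d₁₂' + v₂ * d₂₂') ∧
      ((c₁ * u + d₁₁ * w₁ + d₁₂ * w₂ : ZMod p) = w₁ * a' + z₁₁ * c₁' + z₁₂ * c₂' ∧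
      (c₂ * u + d₂₁ * w₁ + d₂₂ * w₂ : ZMod p) = w₂ * a' + z₂₁ * c₁' + z₂₂ * c₂') ∧
      ((d₁₁ * z₁₁ + d₁₂ * z₂₁ : ZMod p) = z₁₁ * d₁₁' + z₁₂ * d₂₁' ∧
      (d₁₁ * z₁₂ + d₁₂ * z₂₂ : ZMod p) = z₁₁ * d₁₂' + z₁₂ * d₂₂' ∧
      (d₂₁ * z₁₁ + d₂₂ * z₂₁ : ZMod p) = z₂₁ * d₁₁' + z₂₂ * d₂₁' ∧
      (d₂₁ * z₁₂ + d₂₂ * z₂₂ : ZMod p) = z₂₁ * d₁₂' + z₂₂ * d₂₂') := by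
  have : Fact p.Prime := ⟨hp⟩
  have hp0 : (p : ℤ) ≠ 0 := by exact_mod_cast hp.ne_zero
  have hcong : ∀ u v₁ v₂ w₁ w₂ z₁₁ z₁₂ z₂₁ z₂₂ : ℤ,
      MatCong p ![2, 1, 1] (blk p a b₁ b₂ c₁ c₂ d₁₁ d₁₂ d₂₁ d₂₂
        * blk p u v₁ v₂ w₁ w₂ z₁₁ z₁₂ z₂₁ z₂₂)
        (blk p u v₁ v₂ w₁ w₂ z₁₁ z₁₂ z₂₁ z₂₂
        * blk p a' b₁' b₂' c₁' c₂' d₁₁' d₁₂' d₂₁' d₂₂') ↔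
      ((p : ℤ) ^ 2 ∣ (a - a') * u + p * (b₁ * w₁ + b₂ * w₂ - v₁ * c₁' - v₂ * c₂') ∧
      ((a * v₁ + b₁ * z₁₁ + b₂ * z₂₁ : ZMod p) = u * b₁' + v₁ * d₁₁' + v₂ * d₂₁' ∧
      (a * v₂ + b₁ * z₁₂ + b₂ * z₂₂ : ZMod p) = u * b₂' + v₁ * d₁₂' + v₂ * d₂₂') ∧
      ((c₁ * u + d₁₁ * w₁ + d₁₂ * w₂ : ZMod p) = w₁ * a' + z₁₁ * c₁' + z₁₂ * c₂' ∧
      (c₂ * u + d₂₁ * w₁ + d₂₂ * w₂ : ZMod p) = w₂ * a' + z₂₁ * c₁' + z₂₂ * c₂') ∧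
      ((d₁₁ * z₁₁ + d₁₂ * z₂₁ : ZMod p) = z₁₁ * d₁₁' + z₁₂ * d₂₁' ∧
      (d₁₁ * z₁₂ + d₁₂ * z₂₂ : ZMod p) = z₁₁ * d₁₂' + z₁₂ * d₂₂' ∧
      (d₂₁ * z₁₁ + d₂₂ * z₂₁ : ZMod p) = z₂₁ * d₁₁' + z₂₂ * d₂₁' ∧
      (d₂₁ * z₁₂ + d₂₂ * z₂₂ : ZMod p) = z₂₁ * d₁₂' + z₂₂ * d₂₂')) := by
    intro u v₁ v₂ w₁ w₂ z₁₁ z₁₂ z₂₁ z₂₂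
    have e1 : ∀ x y : ℤ, (p : ℤ) ^ 1 ∣ x - y ↔ (x : ZMod p) = y := fun x y => by
      rw [pow_one, dvd_iff_cast, Int.cast_sub, sub_eq_zero]
    have e2 : ∀ x y x' y' : ℤ, x - y = p * (x' - y') →
        ((p : ℤ) ^ 2 ∣ x - y ↔ (x' : ZMod p) = y') := fun x y x' y' h => by
      rw [h, pow_two, mul_dvd_mul_iff_left hp0, ← pow_one (p : ℤ), e1]
    have h00 : (a * u + p * b₁ * w₁ + p * b₂ * w₂ - (u * a' + p * v₁ * c₁' + p * v₂ * c₂'))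
      = (a - a') * u + p * (b₁ * w₁ + b₂ * w₂ - v₁ * c₁' - v₂ * c₂') := by ring
    have h01 := e2 (a * (p * v₁) + p * b₁ * z₁₁ + p * b₂ * z₂₁)
      (u * (p * b₁') + p * v₁ * d₁₁' + p * v₂ * d₂₁') (a * v₁ + b₁ * z₁₁ + b₂ * z₂₁)
      (u * b₁' + v₁ * d₁₁' + v₂ * d₂₁') (by ring)
    have h02 := e2 (a * (p * v₂) + p * b₁ * z₁₂ + p * b₂ * z₂₂)
      (u * (p * b₂') + p * v₁ * d₁₂' + p * v₂ * d₂₂') (a * v₂ + b₁ * z₁₂ + b₂ * z₂₂)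
      (u * b₂' + v₁ * d₁₂' + v₂ * d₂₂') (by ring)
    simp only [MatCong, Fin.forall_fin_succ, blk, Matrix.mul_apply, Fin.sum_univ_three,
      Matrix.of_apply, Matrix.cons_val', Matrix.cons_val_zero, Matrix.cons_val_one,
      Matrix.cons_val_fin_one, Matrix.cons_val, Fin.succ_zero_eq_one, Fin.succ_one_eq_two,
      IsEmpty.forall_iff, and_true, Matrix.cons_val_succ, h00, h01, h02, e1]
    push_cast
    simp only [CharP.cast_eq_zero, zero_mul, mul_zero, zero_add]
    tauto
  constructor
  · rintro ⟨P, hP, h⟩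
    obtain ⟨u, v₁, v₂, w₁, w₂, z₁₁, z₁₂, z₂₁, z₂₂, rfl⟩ := exists_blk_form hp hP
    exact ⟨u, v₁, v₂, w₁, w₂, z₁₁, z₁₂, z₂₁, z₂₂, (isAut_blk_iff hp).1 hP, (hcong ..).1 h⟩
  · rintro ⟨u, v₁, v₂, w₁, w₂, z₁₁, z₁₂, z₂₁, z₂₂, hP, h⟩
    exact ⟨_, (isAut_blk_iff hp).2 hP, (hcong ..).2 h⟩

end HookThree

/-! ### Reduction of every automorphism of `ℤ_{p²} × ℤ_p²` to a tabulated one -/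

section HookThreeExhaust

variable {p : ℕ}

/-- Once the corners are known to agree modulo `p`, the digit `k` of their difference turns the last
congruence into an equation over `𝔽_p`. Conjugating matrices can then be sought over the field. -/
theorem matConj_blk_of (hp : p.Prime) {a b₁ b₂ c₁ c₂ d₁₁ d₁₂ d₂₁ d₂₂ : ℤ}
    {a' b₁' b₂' c₁' c₂' d₁₁' d₁₂' d₂₁' d₂₂' k : ℤ} (hk : a = a' + p * k)
    (u v₁ v₂ w₁ w₂ z₁₁ z₁₂ z₂₁ z₂₂ : ZMod p)
    (hu : u ≠ 0) (hz : z₁₁ * z₂₂ - z₁₂ * z₂₁ ≠ 0)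
    (h : k * u + b₁ * w₁ + b₂ * w₂ - v₁ * c₁' - v₂ * c₂' = 0)
    (h₁ : a' * v₁ + b₁ * z₁₁ + b₂ * z₂₁ = u * b₁' + v₁ * d₁₁' + v₂ * d₂₁')
    (h₂ : a' * v₂ + b₁ * z₁₂ + b₂ * z₂₂ = u * b₂' + v₁ * d₁₂' + v₂ * d₂₂')
    (h₃ : c₁ * u + d₁₁ * w₁ + d₁₂ * w₂ = w₁ * a' + z₁₁ * c₁' + z₁₂ * c₂')
    (h₄ : c₂ * u + d₂₁ * w₁ + d₂₂ * w₂ = w₂ * a' + z₂₁ * c₁' + z₂₂ * c₂')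
    (h₅ : d₁₁ * z₁₁ + d₁₂ * z₂₁ = z₁₁ * d₁₁' + z₁₂ * d₂₁')
    (h₆ : d₁₁ * z₁₂ + d₁₂ * z₂₂ = z₁₁ * d₁₂' + z₁₂ * d₂₂')
    (h₇ : d₂₁ * z₁₁ + d₂₂ * z₂₁ = z₂₁ * d₁₁' + z₂₂ * d₂₁')
    (h₈ : d₂₁ * z₁₂ + d₂₂ * z₂₂ = z₂₁ * d₁₂' + z₂₂ * d₂₂') :
    MatConj p ![2, 1, 1] (blk p a b₁ b₂ c₁ c₂ d₁₁ d₁₂ d₂₁ d₂₂)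
      (blk p a' b₁' b₂' c₁' c₂' d₁₁' d₁₂' d₂₁' d₂₂') := by
  have hlift : ∀ x : ZMod p, ∃ y : ℤ, (y : ZMod p) = x := ZMod.intCast_surjective
  obtain ⟨u, rfl⟩ := hlift u
  obtain ⟨v₁, rfl⟩ := hlift v₁
  obtain ⟨v₂, rfl⟩ := hlift v₂
  obtain ⟨w₁, rfl⟩ := hlift w₁
  obtain ⟨w₂, rfl⟩ := hlift w₂
  obtain ⟨z₁₁, rfl⟩ := hlift z₁₁
  obtain ⟨z₁₂, rfl⟩ := hlift z₁₂
  obtain ⟨z₂₁, rfl⟩ := hlift z₂₁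
  obtain ⟨z₂₂, rfl⟩ := hlift z₂₂
  have haa : (a : ZMod p) = a' := by rw [hk]; simp
  refine (matConj_blk_iff hp).2 ⟨u, v₁, v₂, w₁, w₂, z₁₁, z₁₂, z₂₁, z₂₂, ⟨hu, hz⟩, ?_,
    ⟨by rwa [haa], by rwa [haa]⟩, ⟨h₃, h₄⟩, h₅, h₆, h₇, h₈⟩
  rw [show (a - a') * u + p * (b₁ * w₁ + b₂ * w₂ - v₁ * c₁' - v₂ * c₂')
    = p * (k * u + b₁ * w₁ + b₂ * w₂ - v₁ * c₁' - v₂ * c₂') by rw [hk]; ring, pow_two,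
    mul_dvd_mul_iff_left (by exact_mod_cast hp.ne_zero), dvd_iff_cast]
  exact_mod_cast h

/-- This leaves room to change the second `p`-adic digit of the corner by any prescribed amount `s`,
as clearing the off-diagonal blocks requires. -/
theorem exists_unitRep_two (hp : p.Prime) {a : ℤ} (ha : (a : ZMod p) ≠ 0) (s : ZMod p) :
    ∃ a' k : ℤ, IsUnitRep p 2 a' ∧ a = a' + p * k ∧ (k : ZMod p) = s ∧ (a' : ZMod p) = a := by
  obtain ⟨t, rfl⟩ := ZMod.intCast_surjective s
  have h : ¬ (p : ℤ) ∣ a - p * t := by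
    rw [dvd_iff_cast]
    simpa using ha
  obtain ⟨a', ha', q, hq⟩ := exists_unitRep hp (m := 2) (by lia) h
  refine ⟨a', t + p * q, ha', by linear_combination hq, by simp, ?_⟩
  have := congrArg (Int.cast : ℤ → ZMod p) hq
  push_cast at this
  simp at this
  linear_combination -this

/-- If `a` is not an eigenvalue of the lower right block, the off-diagonal blocks can be removed. -/
theorem exists_matConj_blk_diag (hp : p.Prime) {a b₁ b₂ c₁ c₂ d₁₁ d₁₂ d₂₁ d₂₂ : ℤ}
    (ha : (a : ZMod p) ≠ 0)
    (h : ((d₁₁ - a) * (d₂₂ - a) - d₁₂ * d₂₁ : ZMod p) ≠ 0) :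
    ∃ a', IsUnitRep p 2 a' ∧ MatConj p ![2, 1, 1] (blk p a b₁ b₂ c₁ c₂ d₁₁ d₁₂ d₂₁ d₂₂)
      (blk p a' 0 0 0 0 d₁₁ d₁₂ d₂₁ d₂₂) := by
  have : Fact p.Prime := ⟨hp⟩
  set δ : ZMod p := (d₁₁ - a) * (d₂₂ - a) - d₁₂ * d₂₁ with hδ
  -- Cramer's rule for `v (D - a) = b` and `(D - a) w = -c`; clearing both blocks adds `p * (b · w)`
  -- to the corner.
  let v₁ : ZMod p := δ⁻¹ * (b₁ * (d₂₂ - a) - b₂ * d₂₁)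
  let v₂ : ZMod p := δ⁻¹ * (b₂ * (d₁₁ - a) - b₁ * d₁₂)
  let w₁ : ZMod p := - δ⁻¹ * ((d₂₂ - a) * c₁ - d₁₂ * c₂)
  let w₂ : ZMod p := - δ⁻¹ * ((d₁₁ - a) * c₂ - d₂₁ * c₁)
  have hδ' : δ⁻¹ * δ = 1 := inv_mul_cancel₀ h
  obtain ⟨a', k, ha', hk, hks, haa⟩ := exists_unitRep_two hp ha (-(b₁ * w₁ + b₂ * w₂))
  refine ⟨a', ha', matConj_blk_of hp hk 1 v₁ v₂ w₁ w₂ 1 0 0 1 one_ne_zero (by simp) ?_ ?_ ?_ ?_ ?_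
    (by ring) (by ring) (by ring) (by ring)⟩ <;> push_cast
  · rw [hks]; ring
  · rw [haa]; linear_combination (b₁ : ZMod p) * (δ⁻¹ * hδ - hδ')
  · rw [haa]; linear_combination (b₂ : ZMod p) * (δ⁻¹ * hδ - hδ')
  · rw [haa]; linear_combination (c₁ : ZMod p) * (δ⁻¹ * hδ - hδ')
  · rw [haa]; linear_combination (c₂ : ZMod p) * (δ⁻¹ * hδ - hδ')

/-- Conjugation by the block diagonal matrix with blocks `1` and `Z` changes the row to `b Z` and
the column to `Z⁻¹ c`, leaving the corner alone. -/
theorem exists_matConj_blk_normalForm (hp : p.Prime) {a b₁ b₂ c₁ c₂ d₁₁ d₁₂ d₂₁ d₂₂ x y z w : ℤ}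
    (h : MatConj p ![1, 1] !![d₁₁, d₁₂; d₂₁, d₂₂] !![x, y; z, w]) :
    ∃ b₁' b₂' c₁' c₂', MatConj p ![2, 1, 1] (blk p a b₁ b₂ c₁ c₂ d₁₁ d₁₂ d₂₁ d₂₂)
      (blk p a b₁' b₂' c₁' c₂' x y z w) := by
  have : Fact p.Prime := ⟨hp⟩
  have hlift : ∀ x : ZMod p, ∃ y : ℤ, (y : ZMod p) = x := ZMod.intCast_surjective
  obtain ⟨z₁₁, z₁₂, z₂₁, z₂₂, hz, h00, h01, h10, h11⟩ := matConj_sq_iff.1 h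
  replace h00 := cast_eq_of_pow_dvd le_rfl h00
  replace h01 := cast_eq_of_pow_dvd le_rfl h01
  replace h10 := cast_eq_of_pow_dvd le_rfl h10
  replace h11 := cast_eq_of_pow_dvd le_rfl h11
  push_cast at h00 h01 h10 h11 hz
  set δ : ZMod p := z₁₁ * z₂₂ - z₁₂ * z₂₁ with hδ
  have hδ' : δ⁻¹ * δ = 1 := inv_mul_cancel₀ hz
  obtain ⟨c₁', hc₁⟩ := hlift (δ⁻¹ * (z₂₂ * c₁ - z₁₂ * c₂))
  obtain ⟨c₂', hc₂⟩ := hlift (δ⁻¹ * (z₁₁ * c₂ - z₂₁ * c₁))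
  refine ⟨b₁ * z₁₁ + b₂ * z₂₁, b₁ * z₁₂ + b₂ * z₂₂, c₁', c₂',
    matConj_blk_of hp (k := 0) (by ring) 1 0 0 0 0 z₁₁ z₁₂ z₂₁ z₂₂ one_ne_zero hz
    (by simp) ?_ ?_ ?_ ?_ h00 h01 h10 h11⟩
  · push_cast; ring
  · push_cast; ring
  · rw [hc₁, hc₂]; linear_combination (c₁ : ZMod p) * (δ⁻¹ * hδ - hδ')
  · rw [hc₁, hc₂]; linear_combination (c₂ : ZMod p) * (δ⁻¹ * hδ - hδ')

theorem exists_matConj_blk_diag_zero (hp : p.Prime) {a b₁ b₂ c₁ c₂ d₁₁ d₁₂ d₂₁ d₂₂ : ℤ}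
    (ha : (a : ZMod p) ≠ 0) (hb₁ : (b₁ : ZMod p) = 0) (hb₂ : (b₂ : ZMod p) = 0)
    (hc₁ : (c₁ : ZMod p) = 0) (hc₂ : (c₂ : ZMod p) = 0) :
    ∃ a', IsUnitRep p 2 a' ∧ MatConj p ![2, 1, 1] (blk p a b₁ b₂ c₁ c₂ d₁₁ d₁₂ d₂₁ d₂₂)
      (blk p a' 0 0 0 0 d₁₁ d₁₂ d₂₁ d₂₂) := by
  have : Fact p.Prime := ⟨hp⟩
  obtain ⟨a', k, ha', hk, hks, haa⟩ := exists_unitRep_two hp ha 0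
  refine ⟨a', ha', matConj_blk_of hp hk 1 0 0 0 0 1 0 0 1 one_ne_zero (by simp) ?_ ?_ ?_ ?_ ?_
    (by ring) (by ring) (by ring) (by ring)⟩ <;>
    simp [hks, hb₁, hb₂, hc₁, hc₂, haa]

/-- Conclusion of the reduction of a matrix to one in the table. -/
def IsTabulated (p : ℕ) (A : Matrix (Fin 3) (Fin 3) ℤ) : Prop :=
  (∃ b c d : ℤ, IsUnitRep p 2 b ∧ (0 < c ∧ c ≤ d ∧ d < p) ∧
    MatConj p ![2, 1, 1] A (blk p b 0 0 0 0 c 0 0 d)) ∨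
  (∃ b c : ℤ, (0 < b ∧ b < p) ∧ (0 < c ∧ c < p) ∧
    MatConj p ![2, 1, 1] A (blk p b 0 0 1 0 b 0 0 c)) ∨
  (∃ b η : ℤ, (0 < b ∧ b < p) ∧ IsRep p η ∧
    MatConj p ![2, 1, 1] A (blk p b 1 0 η 0 b 0 0 b)) ∨
  (∃ b : ℤ, (0 < b ∧ b < p) ∧ MatConj p ![2, 1, 1] A (blk p b 1 0 0 1 b 0 0 b)) ∨
  (∃ b c : ℤ, IsUnitRep p 2 b ∧ (0 < c ∧ c < p) ∧
    MatConj p ![2, 1, 1] A (blk p b 0 0 0 0 c 1 0 c)) ∨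
  (∃ b : ℤ, (0 < b ∧ b < p) ∧ MatConj p ![2, 1, 1] A (blk p b 0 0 0 1 b 1 0 b)) ∨
  (∃ b η : ℤ, (0 < b ∧ b < p) ∧ IsRep p η ∧
    MatConj p ![2, 1, 1] A (blk p b 1 0 0 η b 1 0 b)) ∨
  (∃ b c γ : ℤ, (0 < b ∧ b < p) ∧ IsRep p γ ∧ (0 < c ∧ c < p) ∧ b ≠ c ∧
    MatConj p ![2, 1, 1] A (blk p b 1 0 γ 0 b 0 0 c)) ∨
  (∃ b c₀ c₁ : ℤ, IsUnitRep p 2 b ∧ IrrTwo p c₀ c₁ ∧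
    MatConj p ![2, 1, 1] A (blk p b 0 0 0 0 0 1 (-c₀) (-c₁)))

theorem IsTabulated.of_matConj (hp : p.Prime) {a b₁ b₂ c₁ c₂ d₁₁ d₁₂ d₂₁ d₂₂ : ℤ}
    {a' b₁' b₂' c₁' c₂' d₁₁' d₁₂' d₂₁' d₂₂' : ℤ}
    (h : MatConj p ![2, 1, 1] (blk p a b₁ b₂ c₁ c₂ d₁₁ d₁₂ d₂₁ d₂₂)
      (blk p a' b₁' b₂' c₁' c₂' d₁₁' d₁₂' d₂₁' d₂₂'))
    (h' : IsTabulated p (blk p a' b₁' b₂' c₁' c₂' d₁₁' d₁₂' d₂₁' d₂₂')) :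
    IsTabulated p (blk p a b₁ b₂ c₁ c₂ d₁₁ d₁₂ d₂₁ d₂₂) := by
  have key : ∀ {x y₁ y₂ z₁ z₂ d e f g : ℤ},
      MatConj p ![2, 1, 1] (blk p a' b₁' b₂' c₁' c₂' d₁₁' d₁₂' d₂₁' d₂₂')
        (blk p x y₁ y₂ z₁ z₂ d e f g) →
      MatConj p ![2, 1, 1] (blk p a b₁ b₂ c₁ c₂ d₁₁ d₁₂ d₂₁ d₂₂)
        (blk p x y₁ y₂ z₁ z₂ d e f g) :=
    fun h'' => h.trans hp h'' (fun _ _ => blk_dvd ..) (fun _ _ => blk_dvd ..) fun _ _ => blk_dvd ..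
  refine h'.imp ?_ (Or.imp ?_ (Or.imp ?_ (Or.imp ?_ (Or.imp ?_ (Or.imp ?_ (Or.imp ?_
    (Or.imp ?_ ?_)))))))
  · rintro ⟨b, c, d, hb, hc, h⟩; exact ⟨b, c, d, hb, hc, key h⟩
  · rintro ⟨b, c, hb, hc, h⟩; exact ⟨b, c, hb, hc, key h⟩
  · rintro ⟨b, c, hb, hc, h⟩; exact ⟨b, c, hb, hc, key h⟩
  · rintro ⟨b, hb, h⟩; exact ⟨b, hb, key h⟩
  · rintro ⟨b, c, hb, hc, h⟩; exact ⟨b, c, hb, hc, key h⟩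
  · rintro ⟨b, hb, h⟩; exact ⟨b, hb, key h⟩
  · rintro ⟨b, c, hb, hc, h⟩; exact ⟨b, c, hb, hc, key h⟩
  · rintro ⟨b, c, d, hb, hc, hd, hn, h⟩; exact ⟨b, c, d, hb, hc, hd, hn, key h⟩
  · rintro ⟨b, c, d, hb, hc, h⟩; exact ⟨b, c, d, hb, hc, key h⟩

theorem matConj_blk_swap (hp : p.Prime) (a b₁ b₂ c₁ c₂ x w : ℤ) :
    MatConj p ![2, 1, 1] (blk p a b₁ b₂ c₁ c₂ x 0 0 w) (blk p a b₂ b₁ c₂ c₁ w 0 0 x) := by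
  have : Fact p.Prime := ⟨hp⟩
  refine matConj_blk_of hp (k := 0) (by ring) 1 0 0 0 0 0 1 1 0 one_ne_zero (by simp)
    ?_ ?_ ?_ ?_ ?_ ?_ ?_ ?_ ?_ <;> push_cast <;> ring

theorem isTabulated_diag (hp : p.Prime) {a x w : ℤ} (ha : IsUnitRep p 2 a) (hx : 0 < x)
    (hx' : x < p) (hw : 0 < w) (hw' : w < p) : IsTabulated p (blk p a 0 0 0 0 x 0 0 w) := by
  rcases le_total x w with h | h
  · exact .inl ⟨a, x, w, ha, ⟨hx, h, hw'⟩, .of_matCong hp (.refl _)⟩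
  · exact .inl ⟨a, w, x, ha, ⟨hw, h, hx'⟩, matConj_blk_swap hp _ _ _ _ _ _ _⟩

/-- Reduction when `a` is one of two distinct eigenvalues of the lower right block. -/
theorem isTabulated_of_simple_eigenvalue (hp : p.Prime) {a b₁ b₂ c₁ c₂ x w : ℤ}
    (hax : (a : ZMod p) = x) (hxw : (x : ZMod p) ≠ w) (hx : 0 < x) (hx' : x < p) (hw : 0 < w)
    (hw' : w < p) : IsTabulated p (blk p a b₁ b₂ c₁ c₂ x 0 0 w) := by
  have : Fact p.Prime := ⟨hp⟩
  obtain ⟨k, hk⟩ := exists_digit hax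
  have h : (x : ZMod p) - w ≠ 0 := sub_ne_zero.2 hxw
  have hne : x ≠ w := by rintro rfl; exact hxw rfl
  have hx0 := cast_ne_zero_of_pos_lt hx hx'
  by_cases hb : (b₁ : ZMod p) = 0
  · by_cases hc : (c₁ : ZMod p) = 0
    · have ha0 : (a : ZMod p) ≠ 0 := by rwa [hax]
      -- The entries attached to the other eigenvalue `w` are cleared by dividing by `x - w`, at the
      -- cost of this correction to the corner. What remains is a matrix on `ℤ_{p²} × ℤ_p`, treated
      -- as in the two-generator case.
      obtain ⟨a', k, ha', hk, hks, haa⟩ := exists_unitRep_two hp ha0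
        (-(b₂ * (c₂ * (x - w : ZMod p)⁻¹)))
      refine .of_matConj hp (matConj_blk_of hp hk 1 0 (-b₂ * (x - w : ZMod p)⁻¹) 0
        (c₂ * (x - w : ZMod p)⁻¹) 1 0 0 1 one_ne_zero (by simp) ?_ ?_ ?_ ?_ ?_
        ?_ ?_ ?_ ?_) (isTabulated_diag hp ha' hx hx' hw hw') <;> push_cast
      · rw [hks, hb]; ring
      · rw [hb]; ring
      · rw [haa, hax, hb]; field_simp; ring
      · rw [hc]; ring
      · rw [haa, hax]; field_simp; ring
      all_goals ring
    -- The first entry of `v` absorbs the digit `k` together with the correction coming from `w`; in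
    -- the next case, where `b₁ ≠ 0`, the first entry of the conjugating column does so.
    · refine .inr (.inl ⟨x, w, ⟨hx, hx'⟩, ⟨hw, hw'⟩, matConj_blk_of hp hk 1
        (k + b₂ * c₂ * (x - w : ZMod p)⁻¹)
        (-b₂ * (x - w : ZMod p)⁻¹) 0 (c₂ * (x - w : ZMod p)⁻¹) c₁ 0 0 1 one_ne_zero (by simpa using hc)
        ?_ ?_ ?_ ?_ ?_ ?_ ?_ ?_ ?_⟩) <;> push_cast
      · rw [hb]; ring
      · rw [hb]; ring
      · rw [hb]; field_simp; ring
      · ring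
      · field_simp; ring
      all_goals ring
  · obtain ⟨γ, h0, h1, hγ⟩ := exists_rep_cast hp (b₁ * c₁ : ZMod p)
    refine .inr (.inr (.inr (.inr (.inr (.inr (.inr (.inl ⟨x, w, γ, ⟨hx, hx'⟩, ⟨h0, h1⟩,
      ⟨hw, hw'⟩, hne, matConj_blk_of hp hk 1 0 (-b₂ * (x - w : ZMod p)⁻¹)
        (-(k + b₂ * c₂ * (x - w : ZMod p)⁻¹) * (b₁ : ZMod p)⁻¹)
        (c₂ * (x - w : ZMod p)⁻¹) (b₁ : ZMod p)⁻¹ 0 0 1 one_ne_zero (by simpa using hb)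
        ?_ ?_ ?_ ?_ ?_ ?_ ?_ ?_ ?_⟩))))))) <;> push_cast
    · field_simp; ring
    · field_simp; ring
    · field_simp; ring
    · rw [hγ]; field_simp; ring
    · field_simp; ring
    all_goals ring

/-- Reduction when the lower right block is the scalar `a`. -/
theorem isTabulated_of_scalar (hp : p.Prime) {a b₁ b₂ c₁ c₂ x : ℤ}
    (hax : (a : ZMod p) = x) (hx : 0 < x) (hx' : x < p) :
    IsTabulated p (blk p a b₁ b₂ c₁ c₂ x 0 0 x) := by
  have : Fact p.Prime := ⟨hp⟩
  obtain ⟨k, hk⟩ := exists_digit hax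
  have hx0 := cast_ne_zero_of_pos_lt hx hx'
  -- Since `D - a` vanishes, `b` and `c` change only by `b Z` and `Z⁻¹ c`, up to the unit `u`. The
  -- invariants are whether each is zero and the pairing `b · c`.
  by_cases hb : (b₁ : ZMod p) = 0 ∧ (b₂ : ZMod p) = 0
  · obtain ⟨hb₁, hb₂⟩ := hb
    by_cases hc : (c₁ : ZMod p) = 0
    · by_cases hc' : (c₂ : ZMod p) = 0
      · obtain ⟨a', ha', h⟩ := exists_matConj_blk_diag_zero hp (d₁₁ := x) (d₁₂ := 0) (d₂₁ := 0)
          (d₂₂ := x) (by rwa [hax]) hb₁ hb₂ hc hc'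
        exact .of_matConj hp h (isTabulated_diag hp ha' hx hx' hx hx')
      · refine .inr (.inl ⟨x, x, ⟨hx, hx'⟩, ⟨hx, hx'⟩, matConj_blk_of hp hk 1 k 0 0 0 0 1 c₂ 0
          one_ne_zero (by simpa using hc') ?_ ?_ ?_ ?_ ?_ ?_ ?_ ?_ ?_⟩) <;> push_cast <;>
          (try simp only [hb₁, hb₂, hc]) <;> ring
    · refine .inr (.inl ⟨x, x, ⟨hx, hx'⟩, ⟨hx, hx'⟩, matConj_blk_of hp hk 1 k 0 0 0 c₁ 0 c₂ 1
        one_ne_zero (by simpa using hc) ?_ ?_ ?_ ?_ ?_ ?_ ?_ ?_ ?_⟩) <;> push_cast <;>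
        (try simp only [hb₁, hb₂]) <;> ring
  -- A vector `s` with `b · s = 1`: the column `-k s` removes the digit `k` of the corner, and `s`
  -- can serve as first column of `Z` to bring the row to `(1, 0)`.
  · obtain ⟨s₁, s₂, hs⟩ : ∃ s₁ s₂ : ZMod p, b₁ * s₁ + b₂ * s₂ = 1 := by
      by_cases hb₁ : (b₁ : ZMod p) = 0
      · have hb₂ : (b₂ : ZMod p) ≠ 0 := fun h => hb ⟨hb₁, h⟩
        exact ⟨0, (b₂ : ZMod p)⁻¹, by field_simp; ring⟩
      · exact ⟨(b₁ : ZMod p)⁻¹, 0, by field_simp; ring⟩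
    by_cases hη : (b₁ * c₁ + b₂ * c₂ : ZMod p) = 0
    · by_cases hc : (c₁ : ZMod p) = 0 ∧ (c₂ : ZMod p) = 0
      · obtain ⟨hc₁, hc₂⟩ := hc
        refine .inr (.inr (.inl ⟨x, 0, ⟨hx, hx'⟩, ⟨le_rfl, by lia⟩, matConj_blk_of hp hk 1 0 0
          (-k * s₁) (-k * s₂) s₁ (-b₂) s₂ b₁ one_ne_zero ?_ ?_ ?_ ?_ ?_ ?_ ?_ ?_ ?_ ?_⟩)) <;>
          push_cast
        · rw [show s₁ * b₁ - -b₂ * s₂ = b₁ * s₁ + b₂ * s₂ by ring, hs]; exact one_ne_zero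
        · linear_combination -k * hs
        · linear_combination hs
        · ring
        · rw [hc₁]; ring
        · rw [hc₂]; ring
        all_goals ring
      -- Here `c` is a nonzero vector in the kernel of `b`, hence independent of `s`; taking the
      -- columns `s, c` sends the row to `(1, 0)` and the column to `(0, 1)`.
      · refine .inr (.inr (.inr (.inl ⟨x, ⟨hx, hx'⟩, matConj_blk_of hp hk 1 0 0
          (-k * s₁) (-k * s₂) s₁ c₁ s₂ c₂ one_ne_zero ?_ ?_ ?_ ?_ ?_ ?_ ?_ ?_ ?_ ?_⟩))) <;>
          push_cast
        · intro h
          refine hc ⟨?_, ?_⟩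
          · linear_combination -c₁ * hs + s₁ * hη - b₂ * h
          · linear_combination -c₂ * hs + s₂ * hη + b₁ * h
        · linear_combination -k * hs
        · linear_combination hs
        · linear_combination hη
        all_goals ring
    · obtain ⟨η, h0, h1, hη'⟩ := exists_rep_cast hp (b₁ * c₁ + b₂ * c₂ : ZMod p)
      rw [← hη'] at hη
      -- The vector `η⁻¹ c` pairs to `1` with `b`, so it can be the first column; `(-b₂, b₁)` spans
      -- the kernel of `b`.
      refine .inr (.inr (.inl ⟨x, η, ⟨hx, hx'⟩, ⟨h0, h1⟩, matConj_blk_of hp hk 1 0 0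
        (-k * s₁) (-k * s₂) (c₁ * (η : ZMod p)⁻¹) (-b₂) (c₂ * (η : ZMod p)⁻¹) b₁
        one_ne_zero ?_ ?_ ?_ ?_ ?_ ?_ ?_ ?_ ?_ ?_⟩)) <;>
        push_cast
      · rw [show (c₁ * (η : ZMod p)⁻¹) * b₁ - -b₂ * (c₂ * (η : ZMod p)⁻¹)
          = (b₁ * c₁ + b₂ * c₂) * (η : ZMod p)⁻¹ by ring, ← hη', mul_inv_cancel₀ hη]
        exact one_ne_zero
      · linear_combination -k * hs
      · have h2 := mul_inv_cancel₀ hη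
        linear_combination (η : ZMod p)⁻¹ * -hη' + h2
      · ring
      · field_simp; ring
      · field_simp; ring
      all_goals ring

/-- Reduction when the lower right block is a Jordan block with eigenvalue `a`. -/
theorem isTabulated_of_jordan (hp : p.Prime) {a b₁ b₂ c₁ c₂ x : ℤ}
    (hax : (a : ZMod p) = x) (hx : 0 < x) (hx' : x < p) :
    IsTabulated p (blk p a b₁ b₂ c₁ c₂ x 1 0 x) := by
  have : Fact p.Prime := ⟨hp⟩
  obtain ⟨k, hk⟩ := exists_digit hax
  have hx0 := cast_ne_zero_of_pos_lt hx hx'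
  -- For a Jordan block, the row space of `D - a` is spanned by `(0, 1)` and its column space by
  -- `(1, 0)`. So `b₂` and `c₁` can be cleared and only `b₁` and `c₂` matter. If one of these is
  -- nonzero it also removes the digit of the corner.
  by_cases hb : (b₁ : ZMod p) = 0
  · by_cases hc : (c₂ : ZMod p) = 0
    · have ha0 : (a : ZMod p) ≠ 0 := by rwa [hax]
      obtain ⟨a', k, ha', hk, hks, haa⟩ := exists_unitRep_two hp ha0 (b₂ * c₁)
      refine .inr (.inr (.inr (.inr (.inl ⟨a', x, ha', ⟨hx, hx'⟩, matConj_blk_of hp hk 1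
        b₂ 0 0 (-c₁) 1 0 0 1 one_ne_zero (by simp) ?_ ?_ ?_ ?_ ?_ ?_ ?_ ?_ ?_⟩)))) <;>
        push_cast <;> (try simp only [hks, hb, hc, haa, hax]) <;> ring
    · refine .inr (.inr (.inr (.inr (.inr (.inl ⟨x, ⟨hx, hx'⟩, matConj_blk_of hp hk 1
        (b₂ * c₂) (k - b₂ * c₁) 0 (-c₁) c₂ 0 0 c₂ one_ne_zero (by simpa using hc)
        ?_ ?_ ?_ ?_ ?_ ?_ ?_ ?_ ?_⟩))))) <;> push_cast <;> (try simp only [hb]) <;> ring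
  · obtain ⟨η, h0, h1, hη⟩ := exists_rep_cast hp (b₁ * c₂ : ZMod p)
    have hb' : (b₁ : ZMod p) * (b₁ : ZMod p)⁻¹ = 1 := mul_inv_cancel₀ hb
    refine .inr (.inr (.inr (.inr (.inr (.inr (.inl ⟨x, η, ⟨hx, hx'⟩, ⟨h0, h1⟩,
      matConj_blk_of hp hk 1 (b₂ * (b₁ : ZMod p)⁻¹) 0 ((b₂ * c₁ - k) * (b₁ : ZMod p)⁻¹) (-c₁)
      (b₁ : ZMod p)⁻¹ 0 0 (b₁ : ZMod p)⁻¹ one_ne_zero (by simpa using hb)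
      ?_ ?_ ?_ ?_ ?_ ?_ ?_ ?_ ?_⟩)))))) <;> push_cast
    · linear_combination (b₂ * c₁ - k : ZMod p) * hb'
    · linear_combination hb'
    · ring
    · ring
    · rw [hη]; linear_combination -c₂ * hb'
    all_goals ring

theorem isTabulated_of_isAut (hp : p.Prime) {A : Matrix (Fin 3) (Fin 3) ℤ}
    (hA : IsAut p ![2, 1, 1] A) : IsTabulated p A := by
  have : Fact p.Prime := ⟨hp⟩
  obtain ⟨a, b₁, b₂, c₁, c₂, d₁₁, d₁₂, d₂₁, d₂₂, rfl⟩ := exists_blk_form hp hA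
  obtain ⟨ha, hdet⟩ := (isAut_blk_iff hp).1 hA
  obtain ⟨x, y, z, w, hN, hcase⟩ := exists_normalForm_two hp d₁₁ d₁₂ d₂₁ d₂₂
  obtain ⟨-, hD, -⟩ := matConj_sq_invariants hp le_rfl hN
  replace hD := cast_eq_of_pow_dvd le_rfl hD
  push_cast at hD
  rw [hD] at hdet
  obtain ⟨b₁', b₂', c₁', c₂', h⟩ := exists_matConj_blk_normalForm hp (a := a) (b₁ := b₁) (b₂ := b₂)
    (c₁ := c₁) (c₂ := c₂) hN
  refine .of_matConj hp h ?_
  clear h hD hN hA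
  rcases hcase with ⟨h0, h1, h2, rfl, rfl⟩ | ⟨h0, h1, rfl, rfl, hwx⟩ |
    ⟨e₀, e₁, hi, rfl, rfl, rfl, rfl⟩
  · simp at hdet
    have hx := pos_of_cast_ne_zero h0 hdet.1
    have hw := pos_of_cast_ne_zero (by lia) hdet.2
    have hx' : x < p := by lia
    by_cases hax : (a : ZMod p) = x
    · by_cases hxw : (x : ZMod p) = w
      · obtain rfl := eq_of_rep_cast hx.le hx' hw.le h2 hxw
        exact isTabulated_of_scalar hp hax hx hx'
      · exact isTabulated_of_simple_eigenvalue hp hax hxw hx hx' hw h2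
    · by_cases haw : (a : ZMod p) = w
      · exact .of_matConj hp (matConj_blk_swap hp _ _ _ _ _ _ _)
          (isTabulated_of_simple_eigenvalue hp haw (fun h => hax (haw.trans h)) hw h2 hx hx')
      · obtain ⟨a', ha', h⟩ := exists_matConj_blk_diag hp (b₁ := b₁') (b₂ := b₂') (c₁ := c₁')
          (c₂ := c₂') (d₁₁ := x) (d₁₂ := 0) (d₂₁ := 0) (d₂₂ := w) ha (by
            simpa [sub_eq_zero] using ⟨Ne.symm hax, Ne.symm haw⟩)
        exact .of_matConj hp h (isTabulated_diag hp ha' hx hx' hw h2)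
  · subst hwx
    simp at hdet
    have hx := pos_of_cast_ne_zero h0 hdet
    by_cases hax : (a : ZMod p) = w
    · exact isTabulated_of_jordan hp hax hx h1
    · obtain ⟨a', ha', h⟩ := exists_matConj_blk_diag hp (b₁ := b₁') (b₂ := b₂') (c₁ := c₁')
        (c₂ := c₂') (d₁₁ := w) (d₁₂ := 1) (d₂₁ := 0) (d₂₂ := w) ha (by
          simpa [sub_eq_zero] using Ne.symm hax)
      exact .inr (.inr (.inr (.inr (.inl ⟨a', w, ha', ⟨hx, h1⟩, h⟩))))
  · obtain ⟨a', ha', h⟩ := exists_matConj_blk_diag hp (b₁ := b₁') (b₂ := b₂') (c₁ := c₁')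
      (c₂ := c₂') (d₁₁ := 0) (d₁₂ := 1) (d₂₁ := -e₀) (d₂₂ := -e₁) ha (by
        intro h
        refine ((irrTwo_iff hp).1 hi).2.2 a ?_
        push_cast at h
        linear_combination h)
    exact .inr (.inr (.inr (.inr (.inr (.inr (.inr (.inr ⟨a', e₀, e₁, ha', hi, h⟩)))))))

theorem exhaust_auts211 (hp : p.Prime) (A : Matrix (Fin 3) (Fin 3) ℤ)
    (hA : IsAut p ![2, 1, 1] A) :
    ∃ S ∈ auts211 p, ∃ B ∈ S.1, MatConj p ![2, 1, 1] A B := by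
  simp only [auts211, List.exists_mem_cons_iff, List.not_mem_nil, false_and, exists_false, or_false,
    isUnitRep_one_iff]
  refine (isTabulated_of_isAut hp hA).imp ?_ (Or.imp ?_ (Or.imp ?_ (Or.imp ?_ (Or.imp ?_
    (Or.imp ?_ (Or.imp ?_ (Or.imp ?_ ?_)))))))
  · rintro ⟨b, c, d, hb, hc, h⟩
    exact ⟨_, ⟨b, c, d, hb, hc.1, hc.2.1, hc.2.2, rfl⟩, by simpa [blk] using h⟩
  · rintro ⟨b, c, hb, hc, h⟩
    exact ⟨_, ⟨b, c, hb.1, hb.2, hc, rfl⟩, by simpa [blk] using h⟩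
  · rintro ⟨b, c, hb, hc, h⟩
    exact ⟨_, ⟨b, c, hb.1, hb.2, hc, rfl⟩, by simpa [blk] using h⟩
  · rintro ⟨b, hb, h⟩
    exact ⟨_, ⟨b, hb.1, hb.2, rfl⟩, by simpa [blk] using h⟩
  · rintro ⟨b, c, hb, hc, h⟩
    exact ⟨_, ⟨b, c, hb, hc, rfl⟩, by simpa [blk] using h⟩
  · rintro ⟨b, hb, h⟩
    exact ⟨_, ⟨b, hb.1, hb.2, rfl⟩, by simpa [blk] using h⟩
  · rintro ⟨b, c, hb, hc, h⟩
    exact ⟨_, ⟨b, c, hb.1, hb.2, hc, rfl⟩, by simpa [blk] using h⟩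
  · rintro ⟨b, c, γ, hb, hγ, hc, hne, h⟩
    exact ⟨_, ⟨b, c, γ, hb.1, hb.2, hγ, hc, hne, rfl⟩, by simpa [blk] using h⟩
  · rintro ⟨b, c, d, hb, hc, h⟩
    exact ⟨_, ⟨b, c, d, hb, hc, rfl⟩, by simpa [blk] using h⟩

end HookThreeExhaust

/-! ### Invariants separating the rows for `ℤ_{p²} × ℤ_p²` -/

section HookThreeSeparation

variable {p : ℕ}

/-- Attaching a label to each row reduces the separation of rows to that of labels: mutually
exclusive predicates below, and distinct shapes in the elementary abelian case. -/
theorem List.pairwise_of_forall₂ {α β : Type*} {R : α → β → Prop} {P : β → β → Prop}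
    {Q : α → α → Prop} {l : List α} {m : List β} (h : List.Forall₂ R l m) (hm : m.Pairwise P)
    (hQ : ∀ a b x y, R a x → R b y → P x y → Q a b) : l.Pairwise Q := by
  induction h with
  | nil => exact .nil
  | cons hax h ih =>
    rw [List.pairwise_cons] at hm ⊢
    refine ⟨fun b hb => ?_, ih hm.2⟩
    obtain ⟨i, hi, rfl⟩ := List.getElem_of_mem hb
    have hi' := h.length_eq ▸ hi
    exact hQ _ _ _ _ hax (h.get hi hi') (hm.1 _ (List.getElem_mem hi'))

/-- Isomorphism invariants of a matrix acting on `ℤ_{p²} × ℤ_p²`. -/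
structure BlkInv (p : ℕ) where
  eig : ZMod p
  trace : ZMod p
  det : ZMod p
  row : Prop
  col : Prop
  scalar : Prop
  orth : Prop

/-- The invariants of `blk p a b₁ b₂ c₁ c₂ d₁₁ d₁₂ d₂₁ d₂₂`. -/
def blkInv (p : ℕ) (a b₁ b₂ c₁ c₂ d₁₁ d₁₂ d₂₁ d₂₂ : ZMod p) : BlkInv p where
  eig := a
  trace := d₁₁ + d₂₂
  det := d₁₁ * d₂₂ - d₁₂ * d₂₁
  row := ∃ x y, b₁ = x * (d₁₁ - a) + y * d₂₁ ∧ b₂ = x * d₁₂ + y * (d₂₂ - a)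
  col := ∃ x y, c₁ = (d₁₁ - a) * x + d₁₂ * y ∧ c₂ = d₂₁ * x + (d₂₂ - a) * y
  scalar := d₁₂ = 0 ∧ d₂₁ = 0 ∧ d₁₁ = d₂₂
  orth := d₁₂ = 0 → d₂₁ = 0 → d₁₁ = a → d₂₂ = a → b₁ * c₁ + b₂ * c₂ = 0

theorem eig_of_matConj_blk (hp : p.Prime) {a b₁ b₂ c₁ c₂ d₁₁ d₁₂ d₂₁ d₂₂ : ℤ}
    {a' b₁' b₂' c₁' c₂' d₁₁' d₁₂' d₂₁' d₂₂' : ℤ}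
    (h : MatConj p ![2, 1, 1] (blk p a b₁ b₂ c₁ c₂ d₁₁ d₁₂ d₂₁ d₂₂)
      (blk p a' b₁' b₂' c₁' c₂' d₁₁' d₁₂' d₂₁' d₂₂')) :
    ∃ u v₁ v₂ w₁ w₂ z₁₁ z₁₂ z₂₁ z₂₂ : ZMod p,
      u ≠ 0 ∧ z₁₁ * z₂₂ - z₁₂ * z₂₁ ≠ 0 ∧ (a : ZMod p) = a' ∧
      a * v₁ + b₁ * z₁₁ + b₂ * z₂₁ = u * b₁' + v₁ * d₁₁' + v₂ * d₂₁' ∧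
      a * v₂ + b₁ * z₁₂ + b₂ * z₂₂ = u * b₂' + v₁ * d₁₂' + v₂ * d₂₂' ∧
      c₁ * u + d₁₁ * w₁ + d₁₂ * w₂ = w₁ * a + z₁₁ * c₁' + z₁₂ * c₂' ∧
      c₂ * u + d₂₁ * w₁ + d₂₂ * w₂ = w₂ * a + z₂₁ * c₁' + z₂₂ * c₂' ∧
      d₁₁ * z₁₁ + d₁₂ * z₂₁ = z₁₁ * d₁₁' + z₁₂ * d₂₁' ∧
      d₁₁ * z₁₂ + d₁₂ * z₂₂ = z₁₁ * d₁₂' + z₁₂ * d₂₂' ∧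
      d₂₁ * z₁₁ + d₂₂ * z₂₁ = z₂₁ * d₁₁' + z₂₂ * d₂₁' ∧
      d₂₁ * z₁₂ + d₂₂ * z₂₂ = z₂₁ * d₁₂' + z₂₂ * d₂₂' := by
  have : Fact p.Prime := ⟨hp⟩
  obtain ⟨u, v₁, v₂, w₁, w₂, z₁₁, z₁₂, z₂₁, z₂₂, ⟨hu, hz⟩, h0, ⟨h1, h2⟩, ⟨h3, h4⟩, h5⟩ :=
    (matConj_blk_iff hp).1 h
  have haa : (a : ZMod p) = a' := by
    have := (dvd_pow_self (p : ℤ) (by lia : 2 ≠ 0)).trans h0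
    rw [dvd_add_left (dvd_mul_right _ _), dvd_iff_cast] at this
    push_cast at this
    exact sub_eq_zero.1 ((mul_eq_zero.1 this).resolve_right hu)
  exact ⟨u, v₁, v₂, w₁, w₂, z₁₁, z₁₂, z₂₁, z₂₂, hu, hz, haa, h1, h2, by rwa [haa], by rwa [haa], h5⟩

theorem matConj_sq_of_matConj_blk (hp : p.Prime) {a b₁ b₂ c₁ c₂ d₁₁ d₁₂ d₂₁ d₂₂ : ℤ}
    {a' b₁' b₂' c₁' c₂' d₁₁' d₁₂' d₂₁' d₂₂' : ℤ}
    (h : MatConj p ![2, 1, 1] (blk p a b₁ b₂ c₁ c₂ d₁₁ d₁₂ d₂₁ d₂₂)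
      (blk p a' b₁' b₂' c₁' c₂' d₁₁' d₁₂' d₂₁' d₂₂')) :
    MatConj p ![1, 1] !![d₁₁, d₁₂; d₂₁, d₂₂] !![d₁₁', d₁₂'; d₂₁', d₂₂'] := by
  obtain ⟨u, v₁, v₂, w₁, w₂, z₁₁, z₁₂, z₂₁, z₂₂, ⟨hu, hz⟩, h0, ⟨h1, h2⟩, ⟨h3, h4⟩, h5⟩ :=
    (matConj_blk_iff hp).1 h
  have e1 : ∀ x y : ℤ, (p : ℤ) ^ 1 ∣ x - y ↔ (x : ZMod p) = y := fun x y => by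
    rw [pow_one, dvd_iff_cast, Int.cast_sub, sub_eq_zero]
  refine matConj_sq_iff.2 ⟨z₁₁, z₁₂, z₂₁, z₂₂, by exact_mod_cast hz, ?_⟩
  simp only [e1]
  push_cast
  exact h5

/-- Up to units, `b` and `c` change by the block `Z` and by elements of the row and column space of
`D - a`, so membership in these spaces is preserved. If `D = a`, these spaces vanish and the pairing
`b · c` is preserved. Only the direction convenient for each invariant is proved; symmetry of
conjugacy gives the other. -/
theorem row_col_of_matConj_blk (hp : p.Prime) {a b₁ b₂ c₁ c₂ d₁₁ d₁₂ d₂₁ d₂₂ : ℤ}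
    {a' b₁' b₂' c₁' c₂' d₁₁' d₁₂' d₂₁' d₂₂' : ℤ}
    (h : MatConj p ![2, 1, 1] (blk p a b₁ b₂ c₁ c₂ d₁₁ d₁₂ d₂₁ d₂₂)
      (blk p a' b₁' b₂' c₁' c₂' d₁₁' d₁₂' d₂₁' d₂₂')) :
    ((blkInv p a b₁ b₂ c₁ c₂ d₁₁ d₁₂ d₂₁ d₂₂).row →
      (blkInv p a' b₁' b₂' c₁' c₂' d₁₁' d₁₂' d₂₁' d₂₂').row) ∧
    ((blkInv p a' b₁' b₂' c₁' c₂' d₁₁' d₁₂' d₂₁' d₂₂').col →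
      (blkInv p a b₁ b₂ c₁ c₂ d₁₁ d₁₂ d₂₁ d₂₂).col) ∧
    ((blkInv p a b₁ b₂ c₁ c₂ d₁₁ d₁₂ d₂₁ d₂₂).orth →
      (blkInv p a' b₁' b₂' c₁' c₂' d₁₁' d₁₂' d₂₁' d₂₂').orth) := by
  have : Fact p.Prime := ⟨hp⟩
  obtain ⟨-, -, hS⟩ := matConj_sq_invariants hp le_rfl (matConj_sq_of_matConj_blk hp h)
  obtain ⟨u, v₁, v₂, w₁, w₂, z₁₁, z₁₂, z₂₁, z₂₂, hu, hz, haa, h1, h2, h3, h4, h5, h6, h7, h8⟩ :=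
    eig_of_matConj_blk hp h
  have hu' : u⁻¹ * u = 1 := inv_mul_cancel₀ hu
  simp only [blkInv, ← haa]
  refine ⟨?_, ?_, ?_⟩
  · rintro ⟨x, y, hx, hy⟩
    refine ⟨u⁻¹ * (x * z₁₁ + y * z₂₁ - v₁), u⁻¹ * (x * z₁₂ + y * z₂₂ - v₂), ?_, ?_⟩
    · linear_combination -b₁' * hu' - u⁻¹ * h1 + u⁻¹ * (z₁₁ * hx + z₂₁ * hy)
        + u⁻¹ * (x * h5 + y * h7)
    · linear_combination -b₂' * hu' - u⁻¹ * h2 + u⁻¹ * (z₁₂ * hx + z₂₂ * hy)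
        + u⁻¹ * (x * h6 + y * h8)
  · rintro ⟨x, y, hx, hy⟩
    refine ⟨u⁻¹ * (z₁₁ * x + z₁₂ * y - w₁), u⁻¹ * (z₂₁ * x + z₂₂ * y - w₂), ?_, ?_⟩
    · linear_combination -c₁ * hu' + u⁻¹ * h3 + u⁻¹ * (z₁₁ * hx + z₁₂ * hy) - u⁻¹ * (x * h5 + y * h6)
    · linear_combination -c₂ * hu' + u⁻¹ * h4 + u⁻¹ * (z₂₁ * hx + z₂₂ * hy) - u⁻¹ * (x * h7 + y * h8)
  · intro h0 e12 e21 e11 e22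
    obtain ⟨f12, f21, f1122⟩ := hS.2 ⟨e12, e21, by rw [e11, e22]⟩
    have f11 : (d₁₁ : ZMod p) = a := by
      rw [f12, e11, e21] at h5
      rw [f12, e12, e22] at h6
      refine sub_eq_zero.1 ((mul_eq_zero.1 (?_ : ((d₁₁ : ZMod p) - a) * (z₁₁ * z₂₂ - z₁₂ * z₂₁) = 0)
        ).resolve_right hz)
      linear_combination z₂₂ * h5 - z₂₁ * h6
    have h9 := h0 f12 f21 f11 (by rw [← f1122, f11])
    rw [f11, f12] at h3
    rw [f21, ← f1122, f11] at h4
    rw [e11, e21] at h1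
    rw [e22, e12] at h2
    have : u * (b₁' * c₁' + b₂' * c₂') = 0 := by
      linear_combination u * h9 - c₁' * h1 - c₂' * h2 - b₁ * h3 - b₂ * h4
    exact (mul_eq_zero.1 this).resolve_left hu

/-- The matrix `A` acts on `ℤ_{p²} × ℤ_p²` with invariants `I`. -/
def HasBlkInv (p : ℕ) (A : Matrix (Fin 3) (Fin 3) ℤ) (I : BlkInv p) : Prop :=
  ∃ a b₁ b₂ c₁ c₂ d₁₁ d₁₂ d₂₁ d₂₂ : ℤ, A = blk p a b₁ b₂ c₁ c₂ d₁₁ d₁₂ d₂₁ d₂₂ ∧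
    IsAut p ![2, 1, 1] A ∧ I = blkInv p a b₁ b₂ c₁ c₂ d₁₁ d₁₂ d₂₁ d₂₂

theorem HasBlkInv.eq_of_matConj (hp : p.Prime) {A B : Matrix (Fin 3) (Fin 3) ℤ} {I J : BlkInv p}
    (hA : HasBlkInv p A I) (hB : HasBlkInv p B J) (h : MatConj p ![2, 1, 1] A B) : I = J := by
  obtain ⟨a, b₁, b₂, c₁, c₂, d₁₁, d₁₂, d₂₁, d₂₂, rfl, hA, rfl⟩ := hA
  obtain ⟨a', b₁', b₂', c₁', c₂', d₁₁', d₁₂', d₂₁', d₂₂', rfl, hB, rfl⟩ := hB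
  obtain ⟨hT, hD, hS⟩ := matConj_sq_invariants hp le_rfl (matConj_sq_of_matConj_blk hp h)
  replace hT := cast_eq_of_pow_dvd le_rfl hT
  replace hD := cast_eq_of_pow_dvd le_rfl hD
  push_cast at hT hD
  obtain ⟨-, -, -, -, -, -, -, -, -, -, -, haa, -⟩ := eig_of_matConj_blk hp h
  obtain ⟨h1, h2, h3⟩ := row_col_of_matConj_blk hp h
  obtain ⟨h1', h2', h3'⟩ := row_col_of_matConj_blk hp (h.symm hp (by decide) hA hB)
  rw [blkInv.eq_1, blkInv.eq_1, BlkInv.mk.injEq]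
  exact ⟨haa, hT, hD, propext ⟨h1, h1'⟩, propext ⟨h2', h2⟩, propext hS, propext ⟨h3, h3'⟩⟩

theorem hasBlkInv (hp : p.Prime) {a b₁ b₂ c₁ c₂ d₁₁ d₁₂ d₂₁ d₂₂ : ℤ}
    (ha : (a : ZMod p) ≠ 0) (hd : (d₁₁ * d₂₂ - d₁₂ * d₂₁ : ZMod p) ≠ 0) :
    HasBlkInv p !![a, p * b₁, p * b₂; c₁, d₁₁, d₁₂; c₂, d₂₁, d₂₂]
      (blkInv p a b₁ b₂ c₁ c₂ d₁₁ d₁₂ d₂₁ d₂₂) :=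
  ⟨_, _, _, _, _, _, _, _, _, rfl, (isAut_blk_iff hp).2 ⟨ha, hd⟩, rfl⟩

/-- The predicates are chosen to be mutually exclusive. They record whether `b` and `c` can be
cleared, the factorization of the characteristic polynomial of `D`, and whether `D` is scalar. The
pairing is needed only between the third and fourth rows, where `D = a` and the row is nonzero.
There a column that is zero, or that pairs nontrivially with the row, marks the third row. -/
theorem forall₂_auts211 (hp : p.Prime) : List.Forall₂
    (fun (S : Set (Matrix (Fin 3) (Fin 3) ℤ) × ℚ) (Φ : BlkInv p → Prop) =>
      ∀ A ∈ S.1, ∃ I, HasBlkInv p A I ∧ Φ I) (auts211 p)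
    [fun I => I.row ∧ I.col ∧ ∃ c d, I.trace = c + d ∧ I.det = c * d ∧ (I.scalar ↔ c = d),
     fun I => I.row ∧ ¬ I.col ∧ ∃ c, I.trace = I.eig + c ∧ I.det = I.eig * c ∧
      (I.scalar ↔ I.eig = c),
     fun I => ¬ I.row ∧ I.scalar ∧ (I.col ∨ ¬ I.orth),
     fun I => ¬ I.row ∧ I.scalar ∧ ¬ I.col ∧ I.orth,
     fun I => I.row ∧ I.col ∧ ¬ I.scalar ∧ ∃ c, I.trace = c + c ∧ I.det = c * c,
     fun I => I.row ∧ ¬ I.col ∧ ¬ I.scalar ∧ I.trace = I.eig + I.eig ∧ I.det = I.eig * I.eig,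
     fun I => ¬ I.row ∧ ¬ I.scalar ∧ I.trace = I.eig + I.eig ∧ I.det = I.eig * I.eig,
     fun I => ¬ I.row ∧ ¬ I.scalar ∧ ∃ c, c ≠ I.eig ∧ I.trace = I.eig + c ∧ I.det = I.eig * c,
     fun I => I.row ∧ I.col ∧ ∀ x, x ^ 2 - I.trace * x + I.det ≠ 0] := by
  have : Fact p.Prime := ⟨hp⟩
  have hc : ∀ {b : ℤ}, 0 < b → b < p → (b : ZMod p) ≠ 0 := cast_ne_zero_of_pos_lt
  have hm : ∀ {A B : Matrix (Fin 3) (Fin 3) ℤ} {I : BlkInv p} {Φ : BlkInv p → Prop},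
      HasBlkInv p A I → A = B → Φ I → ∃ I, HasBlkInv p B I ∧ Φ I := by
    rintro A _ I Φ h rfl hΦ
    exact ⟨I, h, hΦ⟩
  simp only [auts211, isUnitRep_one_iff, List.forall₂_cons, List.Forall₂.nil, and_true]
  refine ⟨?_, ?_, ?_, ?_, ?_, ?_, ?_, ?_, ?_⟩
  · rintro _ ⟨b, c, d, hb, hc0, hcd, hd, rfl⟩
    have h1 := hc hc0 (by lia)
    have h2 := hc (hc0.trans_le hcd) hd
    refine hm (hasBlkInv hp (b₁ := 0) (b₂ := 0)
      (c₁ := 0) (c₂ := 0) (d₁₁ := c) (d₁₂ := 0) (d₂₁ := 0) (d₂₂ := d) (cast_unitRep_ne_zero hb) (by simp [h1, h2]))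
      (by simp) ⟨⟨0, 0, by simp⟩, ⟨0, 0, by simp⟩, c, d, rfl, by simp [blkInv], by simp [blkInv]⟩
  · rintro _ ⟨b, c, hb0, hb, ⟨hc0, hc'⟩, rfl⟩
    have h1 := hc hb0 hb
    have h2 := hc hc0 hc'
    refine hm (hasBlkInv hp (b₁ := 0) (b₂ := 0)
      (c₁ := 1) (c₂ := 0) (d₁₁ := b) (d₁₂ := 0) (d₂₁ := 0) (d₂₂ := c) h1 (by simp [h1, h2]))
      (by simp) ⟨⟨0, 0, by simp⟩, by simp [blkInv], c, rfl, by simp [blkInv], by simp [blkInv]⟩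
  · rintro _ ⟨b, η, hb0, hb, hη, rfl⟩
    have h1 := hc hb0 hb
    refine hm (hasBlkInv hp (b₁ := 1) (b₂ := 0)
      (c₁ := η) (c₂ := 0) (d₁₁ := b) (d₁₂ := 0) (d₂₁ := 0) (d₂₂ := b) h1 (by simp [h1]))
      (by simp) ⟨by simp [blkInv], by simp [blkInv], ?_⟩
    simp [blkInv, em]
  · rintro _ ⟨b, hb0, hb, rfl⟩
    have h1 := hc hb0 hb
    refine hm (hasBlkInv hp (b₁ := 1) (b₂ := 0)
      (c₁ := 0) (c₂ := 1) (d₁₁ := b) (d₁₂ := 0) (d₂₁ := 0) (d₂₂ := b) h1 (by simp [h1]))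
      (by simp) ⟨by simp [blkInv], by simp [blkInv], by simp [blkInv], by simp [blkInv]⟩
  · rintro _ ⟨b, c, hb, ⟨hc0, hc'⟩, rfl⟩
    have h2 := hc hc0 hc'
    refine hm (hasBlkInv hp (b₁ := 0) (b₂ := 0)
      (c₁ := 0) (c₂ := 0) (d₁₁ := c) (d₁₂ := 1) (d₂₁ := 0) (d₂₂ := c) (cast_unitRep_ne_zero hb) (by simp [h2]))
      (by simp) ⟨⟨0, 0, by simp⟩, ⟨0, 0, by simp⟩, by simp [blkInv], c, rfl, by simp [blkInv]⟩
  · rintro _ ⟨b, hb0, hb, rfl⟩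
    have h1 := hc hb0 hb
    refine hm (hasBlkInv hp (b₁ := 0) (b₂ := 0)
      (c₁ := 0) (c₂ := 1) (d₁₁ := b) (d₁₂ := 1) (d₂₁ := 0) (d₂₂ := b) h1 (by simp [h1]))
      (by simp) ⟨⟨0, 0, by simp⟩, by simp [blkInv], by simp [blkInv], rfl, by simp [blkInv]⟩
  · rintro _ ⟨b, η, hb0, hb, hη, rfl⟩
    have h1 := hc hb0 hb
    refine hm (hasBlkInv hp (b₁ := 1) (b₂ := 0)
      (c₁ := 0) (c₂ := η) (d₁₁ := b) (d₁₂ := 1) (d₂₁ := 0) (d₂₂ := b) h1 (by simp [h1]))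
      (by simp) ⟨by simp [blkInv], by simp [blkInv], rfl, by simp [blkInv]⟩
  · rintro _ ⟨b, c, γ, hb0, hb, hγ, ⟨hc0, hc'⟩, hbc, rfl⟩
    have h1 := hc hb0 hb
    have h2 := hc hc0 hc'
    have hne : (c : ZMod p) ≠ b := fun h => hbc (eq_of_rep_cast hb0.le hb hc0.le hc' h.symm)
    refine hm (hasBlkInv hp (b₁ := 1) (b₂ := 0)
      (c₁ := γ) (c₂ := 0) (d₁₁ := b) (d₁₂ := 0) (d₂₁ := 0) (d₂₂ := c) h1 (by simp [h1, h2]))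
      (by simp) ⟨by simp [blkInv], by simpa [blkInv] using hne.symm, c, hne, rfl, by simp [blkInv]⟩
  · rintro _ ⟨b, c₀, c₁, hb, hi, rfl⟩
    have h := ((irrTwo_iff hp).1 hi).2.2
    refine hm (hasBlkInv hp (b₁ := 0) (b₂ := 0)
      (c₁ := 0) (c₂ := 0) (d₁₁ := 0) (d₁₂ := 1) (d₂₁ := -c₀) (d₂₂ := -c₁) (cast_unitRep_ne_zero hb) (by simpa using h 0))
      (by simp) ⟨⟨0, 0, by simp⟩, ⟨0, 0, by simp⟩, fun x hx => h x ?_⟩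
    simp [blkInv] at hx
    linear_combination hx

theorem isAut_auts211 (hp : p.Prime) : ∀ S ∈ auts211 p, ∀ A ∈ S.1, IsAut p ![2, 1, 1] A := by
  intro S hS A hA
  obtain ⟨i, hi, rfl⟩ := List.getElem_of_mem hS
  obtain ⟨I, ⟨-, -, -, -, -, -, -, -, -, -, h, -⟩, -⟩ :=
    (forall₂_auts211 hp).get hi ((forall₂_auts211 hp).length_eq ▸ hi) A hA
  exact h

theorem pairwise_auts211 (hp : p.Prime) :
    (auts211 p).Pairwise fun S T => ∀ A ∈ S.1, ∀ B ∈ T.1, ¬ MatConj p ![2, 1, 1] A B := by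
  have : Fact p.Prime := ⟨hp⟩
  refine List.pairwise_of_forall₂ (P := fun Φ Ψ => ∀ I, Φ I → ¬ Ψ I) (forall₂_auts211 hp) ?_ ?_
  · simp only [List.pairwise_cons, List.forall_mem_cons, List.not_mem_nil,
      IsEmpty.forall_iff, implies_true, and_true, List.Pairwise.nil]
    refine ⟨⟨?_, ?_, ?_, ?_, ?_, ?_, ?_, ?_⟩, ⟨?_, ?_, ?_, ?_, ?_, ?_, ?_⟩, ⟨?_, ?_, ?_, ?_, ?_, ?_⟩,
      ⟨?_, ?_, ?_, ?_, ?_⟩, ⟨?_, ?_, ?_, ?_⟩, ⟨?_, ?_, ?_⟩, ⟨?_, ?_⟩, ?_⟩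
    all_goals intro I h1 h2
    all_goals first
      | grind
      | (obtain ⟨-, -, c, d, hT, hD, -⟩ := h1; exact h2.2.2 c (by rw [hT, hD]; ring))
      | (obtain ⟨-, -, -, c, hT, hD⟩ := h1; exact h2.2.2 c (by rw [hT, hD]; ring))
  · rintro S T Φ Ψ hS hT hΦΨ A hA B hB h
    obtain ⟨I, hI, hΦ⟩ := hS A hA
    obtain ⟨J, hJ, hΨ⟩ := hT B hB
    obtain rfl := hI.eq_of_matConj hp hJ h
    exact hΦΨ I hΦ hΨ

theorem inj_auts211 (hp : p.Prime) :
    ∀ S ∈ auts211 p, ∀ A ∈ S.1, ∀ B ∈ S.1, MatConj p ![2, 1, 1] A B → A = B := by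
  have : Fact p.Prime := ⟨hp⟩
  have hblk : ∀ a b₁ b₂ c₁ c₂ d₁₁ d₁₂ d₂₁ d₂₂ : ℤ, !![a, p * b₁, p * b₂; c₁, d₁₁, d₁₂; c₂, d₂₁, d₂₂]
      = blk p a b₁ b₂ c₁ c₂ d₁₁ d₁₂ d₂₁ d₂₂ := fun _ _ _ _ _ _ _ _ _ => rfl
  have hz : (0 : ℤ) = p * 0 := by simp
  have hone : (p : ℤ) = p * 1 := by simp
  have key0 : ∀ {a a' d₁₁ d₁₂ d₂₁ d₂₂ d₁₁' d₁₂' d₂₁' d₂₂' : ℤ},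
      MatConj p ![2, 1, 1] !![a, 0, 0; 0, d₁₁, d₁₂; 0, d₂₁, d₂₂]
        !![a', 0, 0; 0, d₁₁', d₁₂'; 0, d₂₁', d₂₂'] →
      (p : ℤ) ^ 2 ∣ a - a' ∧ (d₁₁ + d₂₂ : ZMod p) = d₁₁' + d₂₂' ∧
      (d₁₁ * d₂₂ - d₁₂ * d₂₁ : ZMod p) = d₁₁' * d₂₂' - d₁₂' * d₂₁' := by
    intro a a' d₁₁ d₁₂ d₂₁ d₂₂ d₁₁' d₁₂' d₂₁' d₂₂' h
    have h' : MatConj p ![2, 1, 1] (blk p a 0 0 0 0 d₁₁ d₁₂ d₂₁ d₂₂)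
      (blk p a' 0 0 0 0 d₁₁' d₁₂' d₂₁' d₂₂') := by simpa [blk] using h
    obtain ⟨hT, hD, -⟩ := matConj_sq_invariants hp le_rfl (matConj_sq_of_matConj_blk hp h')
    obtain ⟨u, v₁, v₂, w₁, w₂, z₁₁, z₁₂, z₂₁, z₂₂, ⟨hu, -⟩, h0, -⟩ := (matConj_blk_iff hp).1 h'
    simp only [zero_mul, mul_zero, add_zero, sub_zero] at h0
    replace hT := cast_eq_of_pow_dvd le_rfl hT
    replace hD := cast_eq_of_pow_dvd le_rfl hD
    push_cast at hT hD
    exact ⟨pow_dvd_of_mul hp hu h0, hT, hD⟩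
  simp only [auts211, isUnitRep_one_iff, List.forall_mem_cons, List.not_mem_nil, IsEmpty.forall_iff,
    implies_true, and_true]
  refine ⟨?_, ?_, ?_, ?_, ?_, ?_, ?_, ?_, ?_⟩
  · rintro _ ⟨b, c, d, hb, hc0, hcd, hd, rfl⟩ _ ⟨b', c', d', hb', hc0', hcd', hd', rfl⟩ h
    obtain ⟨h1, hT, hD⟩ := key0 h
    obtain rfl := eq_of_rep hb.1 hb.2.1 hb'.1 hb'.2.1 h1
    have h2 : ((c : ZMod p) - c') * (c - d') = 0 := by push_cast at hT hD; grind
    rcases mul_eq_zero.1 h2 with h2 | h2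
    · obtain rfl := eq_of_rep_cast hc0.le (by lia) hc0'.le (by lia) (sub_eq_zero.1 h2)
      obtain rfl := eq_of_rep_cast (by lia) hd (by lia) hd' (add_left_cancel hT)
      rfl
    · obtain rfl := eq_of_rep_cast hc0.le (by lia) (by lia) hd' (sub_eq_zero.1 h2)
      obtain rfl := eq_of_rep_cast (by lia) hd (by lia) (by lia)
        (show (d : ZMod p) = c' by linear_combination hT)
      rw [le_antisymm hcd hcd']
  · rintro _ ⟨b, c, hb0, hb, ⟨hc0, hc⟩, rfl⟩ _ ⟨b', c', hb0', hb', ⟨hc0', hc'⟩, rfl⟩ h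
    have h' : MatConj p ![2, 1, 1] (blk p b 0 0 1 0 b 0 0 c) (blk p b' 0 0 1 0 b' 0 0 c') := by
      simpa [blk] using h
    obtain ⟨hT, -, -⟩ := matConj_sq_invariants hp le_rfl (matConj_sq_of_matConj_blk hp h')
    replace hT := cast_eq_of_pow_dvd le_rfl hT
    obtain ⟨-, -, -, -, -, -, -, -, -, -, -, haa, -⟩ := eig_of_matConj_blk hp h'
    obtain rfl := eq_of_rep_cast hb0.le hb hb0'.le hb' haa
    push_cast at hT
    rw [eq_of_rep_cast hc0.le hc hc0'.le hc' (add_left_cancel hT)]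
  · rintro _ ⟨b, η, hb0, hb, hη, rfl⟩ _ ⟨b', η', hb0', hb', hη', rfl⟩ h
    have h' : MatConj p ![2, 1, 1] (blk p b 1 0 η 0 b 0 0 b) (blk p b' 1 0 η' 0 b' 0 0 b') := by
      simpa [blk] using h
    obtain ⟨u, v₁, v₂, w₁, w₂, z₁₁, z₁₂, z₂₁, z₂₂, hu, hz, haa, h1, h2, h3, -⟩ :=
      eig_of_matConj_blk hp h'
    obtain rfl := eq_of_rep_cast hb0.le hb hb0'.le hb' haa
    push_cast at h1 h2 h3
    -- The row equation gives `z₁₁ = u` and the column equation `η u = z₁₁ η'`.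
    rw [eq_of_rep_cast hη.1 hη.2 hη'.1 hη'.2 (mul_right_cancel₀ hu (by
      linear_combination h3 + η' * h1))]
  · rintro _ ⟨b, hb0, hb, rfl⟩ _ ⟨b', hb0', hb', rfl⟩ h
    have h' : MatConj p ![2, 1, 1] (blk p b 1 0 0 1 b 0 0 b) (blk p b' 1 0 0 1 b' 0 0 b') := by
      simpa [blk] using h
    obtain ⟨-, -, -, -, -, -, -, -, -, -, -, haa, -⟩ := eig_of_matConj_blk hp h'
    obtain rfl := eq_of_rep_cast hb0.le hb hb0'.le hb' haa
    rfl
  · rintro _ ⟨b, c, hb, ⟨hc0, hc⟩, rfl⟩ _ ⟨b', c', hb', ⟨hc0', hc'⟩, rfl⟩ h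
    obtain ⟨h1, hT, hD⟩ := key0 h
    obtain rfl := eq_of_rep hb.1 hb.2.1 hb'.1 hb'.2.1 h1
    have h2 : ((c : ZMod p) - c') * (c - c') = 0 := by push_cast at hT hD; grind
    rw [eq_of_rep_cast hc0.le hc hc0'.le hc' (sub_eq_zero.1 (mul_self_eq_zero.1 h2))]
  · rintro _ ⟨b, hb0, hb, rfl⟩ _ ⟨b', hb0', hb', rfl⟩ h
    have h' : MatConj p ![2, 1, 1] (blk p b 0 0 0 1 b 1 0 b) (blk p b' 0 0 0 1 b' 1 0 b') := by
      simpa [blk] using h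
    obtain ⟨-, -, -, -, -, -, -, -, -, -, -, haa, -⟩ := eig_of_matConj_blk hp h'
    obtain rfl := eq_of_rep_cast hb0.le hb hb0'.le hb' haa
    rfl
  · rintro _ ⟨b, η, hb0, hb, hη, rfl⟩ _ ⟨b', η', hb0', hb', hη', rfl⟩ h
    have h' : MatConj p ![2, 1, 1] (blk p b 1 0 0 η b 1 0 b) (blk p b' 1 0 0 η' b' 1 0 b') := by
      simpa [blk] using h
    obtain ⟨u, v₁, v₂, w₁, w₂, z₁₁, z₁₂, z₂₁, z₂₂, hu, hz, haa, h1, h2, h3, h4, h5, h6, h7, h8⟩ :=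
      eig_of_matConj_blk hp h'
    obtain rfl := eq_of_rep_cast hb0.le hb hb0'.le hb' haa
    push_cast at h1 h2 h3 h4 h5 h6 h7 h8
    -- A matrix commuting with the Jordan block has equal diagonal entries, so `z₂₂ = z₁₁ = u`, and
    -- the second column equation reads `η u = z₂₂ η'`.
    rw [eq_of_rep_cast hη.1 hη.2 hη'.1 hη'.2 (mul_right_cancel₀ hu (by
      linear_combination h4 + η' * h6 + η' * h1))]
  · rintro _ ⟨b, c, γ, hb0, hb, hγ, ⟨hc0, hc⟩, hbc, rfl⟩
      _ ⟨b', c', γ', hb0', hb', hγ', ⟨hc0', hc'⟩, hbc', rfl⟩ h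
    have h' : MatConj p ![2, 1, 1] (blk p b 1 0 γ 0 b 0 0 c) (blk p b' 1 0 γ' 0 b' 0 0 c') := by
      simpa [blk] using h
    obtain ⟨hT, -, -⟩ := matConj_sq_invariants hp le_rfl (matConj_sq_of_matConj_blk hp h')
    replace hT := cast_eq_of_pow_dvd le_rfl hT
    obtain ⟨u, v₁, v₂, w₁, w₂, z₁₁, z₁₂, z₂₁, z₂₂, hu, hz, haa, h1, h2, h3, h4, h5, h6, h7, h8⟩ :=
      eig_of_matConj_blk hp h'
    obtain rfl := eq_of_rep_cast hb0.le hb hb0'.le hb' haa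
    push_cast at hT h1 h2 h3 h4 h5 h6 h7 h8
    obtain rfl := eq_of_rep_cast hc0.le hc hc0'.le hc' (add_left_cancel hT)
    rw [eq_of_rep_cast hγ.1 hγ.2 hγ'.1 hγ'.2 (mul_right_cancel₀ hu (by
      linear_combination h3 + γ' * h1))]
  · rintro _ ⟨b, c₀, c₁, hb, hi, rfl⟩ _ ⟨b', c₀', c₁', hb', hi', rfl⟩ h
    obtain ⟨h1, hT, hD⟩ := key0 h
    obtain rfl := eq_of_rep hb.1 hb.2.1 hb'.1 hb'.2.1 h1
    push_cast at hT hD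
    rw [eq_of_rep_cast hi.1.1 hi.1.2 hi'.1.1 hi'.1.2 (by linear_combination hD),
      eq_of_rep_cast hi.2.1.1 hi.2.1.2 hi'.2.1.1 hi'.2.1.2 (by linear_combination -hT)]

theorem classifies_auts211 (hp : p.Prime) : Classifies p ![2, 1, 1] (auts211 p) :=
  ⟨isAut_auts211 hp, pairwise_auts211 hp, inj_auts211 hp, exhaust_auts211 hp⟩

end HookThreeSeparation

/-! ### Elementary divisors of finite modules over `K[X]` -/

section ElementaryDivisors

open Module

variable {K : Type} [Field K]

theorem exists_equiv_of_map_univ_eq {ι κ α : Type*} [Fintype ι] [Fintype κ] {f : ι → α} {g : κ → α}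
    (h : (Finset.univ : Finset ι).val.map f = (Finset.univ : Finset κ).val.map g) :
    ∃ σ : ι ≃ κ, ∀ i, g (σ i) = f i := by
  classical
  have hc : ∀ c, Nonempty ({i // f i = c} ≃ {k // g k = c}) := fun c => by
    have := congrArg (Multiset.count c) h
    rw [Multiset.count_map, Multiset.count_map] at this
    refine Fintype.card_eq.1 ?_
    rw [Fintype.card_subtype, Fintype.card_subtype]
    simpa [Finset.card, Finset.filter_val, eq_comm] using this
  exact ⟨Equiv.ofFiberEquiv fun c => (hc c).some, Equiv.ofFiberEquiv_map _⟩

/-- The `K[X]`-module `M` is the direct sum of the modules `K[X] / (q ^ e)` for `(q, e)` in `s`,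
where every `q` is monic and irreducible and every `e` is positive. -/
def HasElemDiv (M : Type*) [AddCommGroup M] [Module K[X] M] (s : Multiset (K[X] × ℕ)) : Prop :=
  (∀ x ∈ s, x.1.Monic ∧ Irreducible x.1 ∧ 0 < x.2) ∧
    ∃ (ι : Type) (_ : Fintype ι) (f : ι → K[X] × ℕ), Finset.univ.val.map f = s ∧
      Nonempty (M ≃ₗ[K[X]] (i : ι) → K[X] ⧸ Ideal.span {(f i).1 ^ (f i).2})

variable {M N : Type*} [AddCommGroup M] [Module K[X] M] [AddCommGroup N] [Module K[X] N]
  {s t : Multiset (K[X] × ℕ)}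

theorem HasElemDiv.congr (h : HasElemDiv M s) (φ : M ≃ₗ[K[X]] N) : HasElemDiv N s := by
  obtain ⟨hs, ι, _, f, hf, ⟨ψ⟩⟩ := h
  exact ⟨hs, ι, _, f, hf, ⟨φ.symm.trans ψ⟩⟩

theorem HasElemDiv.nonempty_linearEquiv (hM : HasElemDiv M s) (hN : HasElemDiv N s) :
    Nonempty (M ≃ₗ[K[X]] N) := by
  obtain ⟨hs, ι, _, f, hf, ⟨φ⟩⟩ := hM
  obtain ⟨-, κ, _, g, hg, ⟨ψ⟩⟩ := hN
  obtain ⟨σ, hσ⟩ := exists_equiv_of_map_univ_eq (hf.trans hg.symm)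
  obtain rfl : f = g ∘ σ := funext fun i => (hσ i).symm
  exact ⟨φ.trans ((LinearEquiv.piCongrLeft K[X]
    (fun k => K[X] ⧸ Ideal.span {(g k).1 ^ (g k).2}) σ).trans ψ.symm)⟩

theorem finite_quotient_span [Finite K] {f : K[X]} (hf : f ≠ 0) : Finite (K[X] ⧸ Ideal.span {f}) := by
  have : Module.Finite K (K[X] ⧸ Ideal.span {f}) :=
    (AdjoinRoot.powerBasis hf).finite
  exact Module.finite_of_finite K

theorem card_quotient_span [Finite K] {f : K[X]} (hf : f ≠ 0) :
    Nat.card (K[X] ⧸ Ideal.span {f}) = Nat.card K ^ f.natDegree := by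
  have : Module.Finite K (K[X] ⧸ Ideal.span {f}) :=
    (AdjoinRoot.powerBasis hf).finite
  rw [Module.natCard_eq_pow_finrank (K := K), finrank_quotient_span_eq_natDegree]

theorem HasElemDiv.card_eq [Finite K] (h : HasElemDiv M s) :
    Nat.card M = Nat.card K ^ (s.map fun x => x.2 * x.1.natDegree).sum := by
  obtain ⟨hs, ι, _, f, rfl, ⟨φ⟩⟩ := h
  rw [Nat.card_congr φ.toEquiv, Nat.card_pi, Multiset.map_map, ← Finset.sum_eq_multiset_sum,
    ← Finset.prod_pow_eq_pow_sum]
  refine Finset.prod_congr rfl fun i _ => ?_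
  have := (hs (f i) (Multiset.mem_map_of_mem f (Finset.mem_univ i))).1
  rw [card_quotient_span (this.pow _).ne_zero, this.natDegree_pow]
  rfl

theorem card_torsion_quotient_of_isCoprime {f g : K[X]} (h : IsCoprime f g) :
    Nat.card {x : K[X] ⧸ Ideal.span {f} // g • x = 0} = 1 := by
  obtain ⟨a, b, hab⟩ := h
  rw [Nat.card_eq_one_iff_unique]
  have h0 : ∀ z : K[X] ⧸ Ideal.span {f}, g • z = 0 → z = 0 := fun z hz => by
    have hf : f • z = 0 := by
      obtain ⟨z, rfl⟩ := Submodule.Quotient.mk_surjective _ z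
      rw [← Submodule.Quotient.mk_smul, Submodule.Quotient.mk_eq_zero, smul_eq_mul]
      exact Ideal.mul_mem_right _ _ (Ideal.mem_span_singleton_self f)
    rw [← one_smul K[X] z, ← hab, add_smul, mul_smul, mul_smul, hz, hf, smul_zero, smul_zero,
      add_zero]
  exact ⟨⟨fun x y => Subtype.ext ((h0 _ x.2).trans (h0 _ y.2).symm)⟩, ⟨0, smul_zero _⟩⟩

/-- Multiplication by `q ^ (e - min j e)` embeds `K[X] / (q ^ min j e)` into `K[X] / (q ^ e)`, with
image the `q ^ j`-torsion. -/
theorem card_torsion_quotient_pow {q : K[X]} (hq : q ≠ 0) (e j : ℕ) :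
    Nat.card {x : K[X] ⧸ Ideal.span {q ^ e} // q ^ j • x = 0}
      = Nat.card (K[X] ⧸ Ideal.span {q ^ min j e}) := by
  have hmk : ∀ (n : ℕ) (g : K[X]), (Submodule.Quotient.mk g : K[X] ⧸ Ideal.span {q ^ n}) = 0 ↔ q ^ n ∣ g :=
    fun n g => by rw [Submodule.Quotient.mk_eq_zero, Ideal.mem_span_singleton]
  have hdvd : ∀ g, q ^ e ∣ q ^ (e - min j e) * g ↔ q ^ min j e ∣ g := fun g => by
    have : q ^ e = q ^ (e - min j e) * q ^ min j e := by
      rw [← pow_add, Nat.sub_add_cancel (min_le_right j e)]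
    rw [this]
    exact mul_dvd_mul_iff_left (pow_ne_zero _ hq)
  let φ : (K[X] ⧸ Ideal.span {q ^ min j e}) →ₗ[K[X]] K[X] ⧸ Ideal.span {q ^ e} :=
    Submodule.liftQ _ (LinearMap.toSpanSingleton K[X] _ (Submodule.Quotient.mk (q ^ (e - min j e))))
      fun g hg => by
        refine LinearMap.mem_ker.2 ((hmk e _).2 ?_)
        change q ^ e ∣ g * q ^ (e - min j e)
        rw [mul_comm, hdvd]
        exact Ideal.mem_span_singleton.1 hg
  have hφ : ∀ g, φ (Submodule.Quotient.mk g) = Submodule.Quotient.mk (q ^ (e - min j e) * g) :=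
    fun g => by
      rw [mul_comm]
      rfl
  have hφ0 : Function.Injective φ := by
    rw [← LinearMap.ker_eq_bot, LinearMap.ker_eq_bot']
    intro x hx
    obtain ⟨x, rfl⟩ := Submodule.Quotient.mk_surjective _ x
    rw [hφ, hmk, hdvd] at hx
    rwa [hmk]
  refine (Nat.card_congr (Equiv.ofBijective
    (fun x => (⟨φ x, ?_⟩ : {x : K[X] ⧸ Ideal.span {q ^ e} // q ^ j • x = 0}))
    ⟨fun x y h => hφ0 (congrArg Subtype.val h), ?_⟩)).symm
  · obtain ⟨x, rfl⟩ := Submodule.Quotient.mk_surjective _ x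
    rw [hφ, ← Submodule.Quotient.mk_smul, hmk, smul_eq_mul, ← mul_assoc, ← pow_add]
    exact (pow_dvd_pow q (by lia)).mul_right x
  · rintro ⟨y, hy⟩
    obtain ⟨y, rfl⟩ := Submodule.Quotient.mk_surjective _ y
    rw [← Submodule.Quotient.mk_smul, hmk, smul_eq_mul] at hy
    have : q ^ (e - min j e) ∣ y := by
      rcases le_total e j with h | h
      · simp [h]
      · rw [min_eq_left h]
        rw [← Nat.add_sub_cancel' h, pow_add] at hy
        exact (mul_dvd_mul_iff_left (pow_ne_zero _ hq)).1 hy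
    obtain ⟨g, rfl⟩ := this
    exact ⟨Submodule.Quotient.mk g, Subtype.ext (hφ g)⟩

open Classical in
theorem HasElemDiv.card_torsion [Finite K] (h : HasElemDiv M s) {q : K[X]} (hq : q.Monic)
    (hqi : Irreducible q) (j : ℕ) :
    Nat.card {x : M // q ^ j • x = 0} = Nat.card K ^
      (q.natDegree * (s.map fun x => if x.1 = q then min j x.2 else 0).sum) := by
  obtain ⟨hs, ι, _, f, rfl, ⟨φ⟩⟩ := h
  have e1 : {x : M // q ^ j • x = 0} ≃
      ((i : ι) → {x : K[X] ⧸ Ideal.span {(f i).1 ^ (f i).2} // q ^ j • x = 0}) :=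
    (φ.toEquiv.subtypeEquiv (q := fun y => ∀ i, q ^ j • y i = 0) fun x => by
      rw [← φ.map_eq_zero_iff, map_smul, funext_iff]
      rfl).trans (Equiv.subtypePiEquivPi
        (p := fun i (y : K[X] ⧸ Ideal.span {(f i).1 ^ (f i).2}) => q ^ j • y = 0))
  rw [Nat.card_congr e1, Nat.card_pi, Multiset.map_map, ← Finset.sum_eq_multiset_sum,
    Finset.mul_sum, ← Finset.prod_pow_eq_pow_sum]
  refine Finset.prod_congr rfl fun i _ => ?_
  have hi := hs (f i) (Multiset.mem_map_of_mem f (Finset.mem_univ i))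
  rw [Function.comp_apply]
  split_ifs with h
  · rw [h, card_torsion_quotient_pow hq.ne_zero, card_quotient_span (hq.pow _).ne_zero,
      hq.natDegree_pow, mul_comm]
  · rw [mul_zero, pow_zero]
    refine card_torsion_quotient_of_isCoprime (IsCoprime.pow ?_)
    refine (Irreducible.coprime_iff_not_dvd hi.2.1).2 fun h' => h ?_
    exact eq_of_monic_of_associated hi.1 hq ((hi.2.1.dvd_irreducible_iff_associated hqi).1 h')

/-- The orders of the `q ^ j`-torsion submodules depend only on `M` and determine every
multiplicity. -/
theorem HasElemDiv.unique [Finite K] (h : HasElemDiv M s) (h' : HasElemDiv M t) : s = t := by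
  classical
  have hK : 1 < Nat.card K := Finite.one_lt_card
  -- The second difference of `j ↦ min j n` at `e + 1` is `-1` if `n = e + 1` and `0` otherwise, so
  -- it isolates the divisors `q ^ (e + 1)`. Working in `ℤ` avoids truncated subtraction.
  have key : ∀ {s : Multiset (K[X] × ℕ)} (q : K[X]) (e : ℕ), 
      (Multiset.count (q, e + 1) s : ℤ) =
        2 * ((s.map fun x => if x.1 = q then min (e + 1) x.2 else 0).sum : ℕ)
        - ((s.map fun x => if x.1 = q then min e x.2 else 0).sum : ℕ)
        - ((s.map fun x => if x.1 = q then min (e + 2) x.2 else 0).sum : ℕ) := by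
    intro s q e
    induction s using Multiset.induction with
    | empty => simp
    | cons x s ih =>
      rw [Multiset.count_cons]
      simp only [Multiset.map_cons, Multiset.sum_cons, Nat.cast_add, ih]
      obtain ⟨r, n⟩ := x
      by_cases hr : r = q
      · by_cases hn : n = e + 1
        · subst hr hn
          simp only [if_true]
          grind
        · have : (q, e + 1) ≠ (r, n) := by grind
          simp only [hr, if_true]
          grind
      · have : (q, e + 1) ≠ (r, n) := by grind
        simp [this, hr]
  have heq : ∀ {q : K[X]} (_ : q.Monic) (_ : Irreducible q) (j : ℕ),
      (s.map fun x => if x.1 = q then min j x.2 else 0).sum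
        = (t.map fun x => if x.1 = q then min j x.2 else 0).sum := fun hq hqi j =>
    Nat.eq_of_mul_eq_mul_left hqi.natDegree_pos (Nat.pow_right_injective hK
      ((h.card_torsion hq hqi j).symm.trans (h'.card_torsion hq hqi j)))
  ext ⟨q, e⟩
  by_cases hq : q.Monic ∧ Irreducible q ∧ 0 < e
  · obtain ⟨hq, hqi, he⟩ := hq
    obtain ⟨e, rfl⟩ := Nat.exists_eq_succ_of_ne_zero he.ne'
    have h1 := key (s := s) q e
    rw [heq hq hqi, heq hq hqi, heq hq hqi, ← key] at h1
    exact_mod_cast h1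
  · rw [Multiset.count_eq_zero_of_notMem fun hx => hq (h.1 _ hx),
      Multiset.count_eq_zero_of_notMem fun hx => hq (h'.1 _ hx)]

/-- A finite module over the infinite ring `K[X]` is torsion, so the structure theorem over a
principal ideal domain applies. Its primes are made monic and its trivial summands, those with
exponent `0`, are discarded. -/
theorem exists_hasElemDiv (K : Type) [Field K] [Finite K] (M : Type*) [AddCommGroup M]
    [Module K[X] M] [Finite M] : ∃ s : Multiset (K[X] × ℕ), HasElemDiv M s := by
  have : Module.Finite K[X] M := inferInstance
  have htors : Module.IsTorsion K[X] M := by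
    intro x
    have hinj : ¬ Function.Injective fun f : K[X] => f • x := fun h => by
      have := Finite.of_injective _ h
      exact not_finite K[X]
    simp only [Function.Injective, not_forall] at hinj
    obtain ⟨f, g, hfg, hne⟩ := hinj
    exact ⟨⟨f - g, mem_nonZeroDivisors_of_ne_zero (sub_ne_zero.2 hne)⟩, by
      rw [Submonoid.mk_smul, sub_smul, sub_eq_zero]; exact hfg⟩
  obtain ⟨ι, _, q, hq, e, ⟨φ⟩⟩ := Module.equiv_directSum_of_isTorsion htors
  classical
  let f : {i : ι // e i ≠ 0} → K[X] × ℕ := fun i => (normalize (q i), e i)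
  have hspan : ∀ i, Ideal.span {normalize (q i) ^ e i} = Submodule.span K[X] {q i ^ e i} := fun i =>
    Ideal.span_singleton_eq_span_singleton.2 ((normalize_associated (q i)).pow_pow)
  refine ⟨Finset.univ.val.map f, ?_, _, _, f, rfl, ?_⟩
  · intro x hx
    obtain ⟨i, -, rfl⟩ := Multiset.mem_map.1 hx
    exact ⟨Polynomial.monic_normalize (hq i).ne_zero,
      (associated_normalize (q i)).irreducible (hq i), Nat.pos_of_ne_zero i.2⟩
  · let ψ : ((i : ι) → K[X] ⧸ Submodule.span K[X] {q i ^ e i}) →ₗ[K[X]]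
        ((i : {i : ι // e i ≠ 0}) → K[X] ⧸ Submodule.span K[X] {q i ^ e i}) :=
      LinearMap.pi fun i => LinearMap.proj i.1
    have hψ : Function.Bijective ψ := by
      constructor
      · intro x y hxy
        ext i
        by_cases hi : e i = 0
        · have : Subsingleton (K[X] ⧸ Submodule.span K[X] {q i ^ e i}) := by
            rw [Submodule.Quotient.subsingleton_iff, hi, pow_zero]
            exact Ideal.span_singleton_one
          exact Subsingleton.elim _ _
        · exact congrFun hxy ⟨i, hi⟩
      · intro y
        refine ⟨fun i => if hi : e i ≠ 0 then y ⟨i, hi⟩ else 0, ?_⟩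
        ext i
        exact dif_pos i.2
    exact ⟨φ.trans ((DirectSum.linearEquivFunOnFintype K[X] ι _).trans
      ((LinearEquiv.ofBijective ψ hψ).trans
        (LinearEquiv.piCongrRight fun i => Submodule.quotEquivOfEq _ _ (hspan i).symm)))⟩

/-- Generators killed by the prescribed powers give a surjection from the direct sum of the cyclic
modules. Equal finite cardinality makes it bijective, so independence need not be checked. -/
theorem hasElemDiv_of_generators [Finite K] {ι : Type} [Fintype ι] [Finite M] (f : ι → K[X] × ℕ)
    (hf : ∀ i, (f i).1.Monic ∧ Irreducible (f i).1 ∧ 0 < (f i).2) (v : ι → M)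
    (hv : ∀ i, (f i).1 ^ (f i).2 • v i = 0) (hspan : Submodule.span K[X] (Set.range v) = ⊤)
    (hcard : Nat.card M = Nat.card K ^ ∑ i, (f i).2 * (f i).1.natDegree) :
    HasElemDiv M (Finset.univ.val.map f) := by
  classical
  refine ⟨fun x hx => ?_, _, _, f, rfl, ?_⟩
  · obtain ⟨i, -, rfl⟩ := Multiset.mem_map.1 hx
    exact hf i
  have hn : ∀ i, (f i).1 ^ (f i).2 ≠ 0 := fun i => ((hf i).1.pow _).ne_zero
  let φ : ((i : ι) → K[X] ⧸ Ideal.span {(f i).1 ^ (f i).2}) →ₗ[K[X]] M :=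
    LinearMap.lsum K[X] _ K[X] fun i => Submodule.liftQ _ (LinearMap.toSpanSingleton K[X] M (v i))
      (by
        rw [Ideal.span, Submodule.span_singleton_le_iff_mem, LinearMap.mem_ker,
          LinearMap.toSpanSingleton_apply, hv])
  have hφ : Function.Surjective φ := by
    rw [← LinearMap.range_eq_top, eq_top_iff, ← hspan, Submodule.span_le]
    rintro _ ⟨i, rfl⟩
    refine ⟨Pi.single i (Submodule.Quotient.mk 1), ?_⟩
    simp only [φ, LinearMap.lsum_piSingle]
    exact one_smul K[X] (v i)
  have hfin : ∀ i, Finite (K[X] ⧸ Ideal.span {(f i).1 ^ (f i).2}) := fun i =>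
    finite_quotient_span (hn i)
  have hb : Function.Bijective φ := by
    refine (Nat.bijective_iff_surjective_and_card φ).2 ⟨hφ, ?_⟩
    rw [hcard, Nat.card_pi, ← Finset.prod_pow_eq_pow_sum]
    refine Finset.prod_congr rfl fun i _ => ?_
    rw [card_quotient_span (hn i), (hf i).1.natDegree_pow]
  exact ⟨(LinearEquiv.ofBijective φ hb).symm⟩

end ElementaryDivisors

/-! ### Elementary divisors of matrices modulo `p` -/

section MatrixElementaryDivisors

variable {p k : ℕ} {e : Fin k → ℕ}

/-- The reduction of an integer matrix modulo `p`, as an endomorphism. -/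
noncomputable def redEnd (p : ℕ) {k : ℕ} (A : Matrix (Fin k) (Fin k) ℤ) :
    Module.End (ZMod p) (Fin k → ZMod p) :=
  Matrix.toLin' (A.map (Int.cast : ℤ → ZMod p))

theorem redEnd_apply (A : Matrix (Fin k) (Fin k) ℤ) (x : Fin k → ZMod p) :
    redEnd p A x = (A.map (Int.cast : ℤ → ZMod p)).mulVec x :=
  Matrix.toLin'_apply _ _

instance (A : Matrix (Fin k) (Fin k) ℤ) [NeZero p] : Finite (Module.AEval' (redEnd p A)) :=
  inferInstanceAs (Finite (Fin k → ZMod p))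

theorem matConj_iff_exists_mul_eq [Fact p.Prime] (he : ∀ i, e i = 1)
    {A B : Matrix (Fin k) (Fin k) ℤ} :
    MatConj p e A B ↔ ∃ Q : Matrix (Fin k) (Fin k) (ZMod p), IsUnit Q.det ∧
      A.map (Int.cast : ℤ → ZMod p) * Q = Q * B.map (Int.cast : ℤ → ZMod p) := by
  have hdet : ∀ P : Matrix (Fin k) (Fin k) ℤ, ((P.det : ℤ) : ZMod p) = (P.map Int.cast).det :=
    fun P => RingHom.map_det (Int.castRingHom (ZMod p)) P
  have hmul : ∀ P Q : Matrix (Fin k) (Fin k) ℤ,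
      (P * Q).map (Int.cast : ℤ → ZMod p) = P.map Int.cast * Q.map Int.cast :=
    fun P Q => Matrix.map_mul (f := Int.castRingHom (ZMod p))
  have hcong : ∀ P Q : Matrix (Fin k) (Fin k) ℤ, MatCong p e P Q ↔
      P.map (Int.cast : ℤ → ZMod p) = Q.map Int.cast := fun P Q => by
    simp only [MatCong, he, pow_one, ← Matrix.ext_iff, Matrix.map_apply, dvd_iff_cast, Int.cast_sub,
      sub_eq_zero]
  constructor
  · rintro ⟨P, hP, h⟩
    rw [hcong, hmul, hmul] at h
    refine ⟨P.map Int.cast, ?_, h⟩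
    rw [← hdet, isUnit_iff_ne_zero, Ne, ← dvd_iff_cast]
    exact hP.det
  · rintro ⟨Q, hQ, h⟩
    choose P hP using fun i j => ZMod.intCast_surjective (Q i j)
    obtain rfl : (Matrix.of P).map Int.cast = Q := by
      ext i j
      exact hP i j
    refine ⟨Matrix.of P, ⟨fun i j => ?_, ?_⟩, ?_⟩
    · rw [he, he]
      exact dvd_mul_left _ _
    · rw [← hdet, isUnit_iff_ne_zero, Ne, ← dvd_iff_cast] at hQ
      exact hQ
    · rw [hcong, hmul, hmul, h]

/-- A `K[X]`-linear isomorphism is a `K`-linear one that intertwines the two actions of `X`. The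
conjugating matrix `Q` satisfies `A Q = Q B`, so it maps the module of `B` to that of `A`. -/
theorem matConj_iff_nonempty_linearEquiv [Fact p.Prime] (he : ∀ i, e i = 1)
    {A B : Matrix (Fin k) (Fin k) ℤ} :
    MatConj p e A B ↔
      Nonempty (Module.AEval' (redEnd p B) ≃ₗ[(ZMod p)[X]] Module.AEval' (redEnd p A)) := by
  rw [matConj_iff_exists_mul_eq he]
  constructor
  · rintro ⟨Q, hQ, h⟩
    have : Invertible Q := Matrix.invertibleOfIsUnitDet Q hQ
    refine ⟨LinearEquiv.ofAEval _ ((Matrix.toLin'OfInv (invOf_mul_self Q)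
      (mul_invOf_self Q)).trans (Module.AEval'.of (redEnd p A)))
      fun x => ?_⟩
    rw [LinearEquiv.trans_apply, LinearEquiv.trans_apply, Module.AEval'.X_smul_of, redEnd_apply]
    congr 1
    change Q.mulVec (redEnd p B x) = _
    rw [redEnd_apply, Matrix.mulVec_mulVec, ← h, ← Matrix.mulVec_mulVec]
    rfl
  · rintro ⟨φ⟩
    let ψ : (Fin k → ZMod p) ≃ₗ[ZMod p] (Fin k → ZMod p) :=
      (Module.AEval'.of (redEnd p B)).trans ((φ.restrictScalars (ZMod p)).trans
        (Module.AEval'.of (redEnd p A)).symm)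
    have hψ : ∀ x, ψ (redEnd p B x) = redEnd p A (ψ x) := fun x => by
      change (Module.AEval'.of (redEnd p A)).symm (φ (Module.AEval'.of (redEnd p B) (redEnd p B x)))
        = redEnd p A ((Module.AEval'.of (redEnd p A)).symm (φ (Module.AEval'.of (redEnd p B) x)))
      rw [← Module.AEval'.X_smul_of, map_smul, Module.AEval'.of_symm_X_smul]
    refine ⟨LinearMap.toMatrix' ψ.toLinearMap, ?_, ?_⟩
    · rw [LinearMap.det_toMatrix']
      exact LinearEquiv.isUnit_det' ψ
    · apply Matrix.toLin'.injective
      rw [Matrix.toLin'_mul, Matrix.toLin'_mul, Matrix.toLin'_toMatrix']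
      exact LinearMap.ext fun x => (hψ x).symm

/-- The elementary divisors of an integer matrix modulo `p`. -/
def HasMatElemDiv (p : ℕ) [Fact p.Prime] {k : ℕ} (A : Matrix (Fin k) (Fin k) ℤ)
    (s : Multiset ((ZMod p)[X] × ℕ)) : Prop :=
  HasElemDiv (Module.AEval' (redEnd p A)) s

variable [Fact p.Prime] {A B : Matrix (Fin k) (Fin k) ℤ} {s t : Multiset ((ZMod p)[X] × ℕ)}

theorem HasMatElemDiv.eq_of_matConj (he : ∀ i, e i = 1) (hA : HasMatElemDiv p A s)
    (hB : HasMatElemDiv p B t) (h : MatConj p e A B) : s = t := by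
  obtain ⟨φ⟩ := (matConj_iff_nonempty_linearEquiv he).1 h
  exact (HasElemDiv.congr hB φ).unique hA |>.symm

theorem HasMatElemDiv.matConj (he : ∀ i, e i = 1) (hA : HasMatElemDiv p A s)
    (hB : HasMatElemDiv p B s) : MatConj p e A B :=
  (matConj_iff_nonempty_linearEquiv he).2 (HasElemDiv.nonempty_linearEquiv hB hA)

theorem HasMatElemDiv.sum_eq (hA : HasMatElemDiv p A s) :
    (s.map fun x => x.2 * x.1.natDegree).sum = k := by
  have h := HasElemDiv.card_eq hA
  have h' : Nat.card (Module.AEval' (redEnd p A)) = Nat.card (ZMod p) ^ k := by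
    rw [show Nat.card (Module.AEval' (redEnd p A)) = Nat.card (Fin k → ZMod p) from rfl]
    simp
  exact (Nat.pow_right_injective (Finite.one_lt_card (α := ZMod p)) (h'.symm.trans h)).symm

/-- The `X`-torsion is the kernel of the reduced matrix, which is zero; each divisor that is a power
of `X` would contribute to it. -/
theorem HasMatElemDiv.ne_X (hA : HasMatElemDiv p A s) (hdet : ¬ (p : ℤ) ∣ A.det) :
    ∀ x ∈ s, x.1 ≠ X := by
  classical
  intro x hx hxX
  have h := HasElemDiv.card_torsion hA monic_X irreducible_X 1
  have h1 : Nat.card {x : Module.AEval' (redEnd p A) // (X : (ZMod p)[X]) ^ 1 • x = 0} = 1 := by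
    rw [Nat.card_eq_one_iff_unique]
    have h0 : ∀ y : Module.AEval' (redEnd p A), (X : (ZMod p)[X]) ^ 1 • y = 0 → y = 0 := by
      intro y hy
      obtain ⟨y, rfl⟩ := (Module.AEval'.of (redEnd p A)).surjective y
      rw [pow_one, Module.AEval'.X_smul_of, LinearEquiv.map_eq_zero_iff, redEnd_apply] at hy
      rw [LinearEquiv.map_eq_zero_iff]
      refine Matrix.eq_zero_of_mulVec_eq_zero ?_ hy
      rw [dvd_iff_cast] at hdet
      exact fun h => hdet ((RingHom.map_det (Int.castRingHom (ZMod p)) A).trans h)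
    exact ⟨⟨fun x y => Subtype.ext ((h0 _ x.2).trans (h0 _ y.2).symm)⟩, ⟨0, smul_zero _⟩⟩
  rw [h1, natDegree_X, one_mul] at h
  have h2 := (Nat.pow_right_injective (Finite.one_lt_card (α := ZMod p))
    ((pow_zero _).trans h)).symm
  rw [Multiset.sum_eq_zero_iff] at h2
  have := h2 _ (Multiset.mem_map_of_mem _ hx)
  rw [if_pos hxX] at this
  have := (hA.1 x hx).2.2
  lia

theorem hasMatElemDiv_of_generators {m : ℕ} (f : Fin m → (ZMod p)[X] × ℕ)
    (v : Fin m → Fin k → ZMod p)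
    (hf : ∀ i, (f i).1.Monic ∧ Irreducible (f i).1 ∧ 0 < (f i).2)
    (hv : ∀ i, aeval (redEnd p A) ((f i).1 ^ (f i).2) (v i) = 0)
    (hspan : ∀ S : Submodule (ZMod p) (Fin k → ZMod p), (∀ x ∈ S, redEnd p A x ∈ S) →
      (∀ i, v i ∈ S) → S = ⊤)
    (hcard : ∑ i, (f i).2 * (f i).1.natDegree = k) :
    HasMatElemDiv p A (Finset.univ.val.map f) := by
  refine hasElemDiv_of_generators f hf (fun i => Module.AEval'.of (redEnd p A) (v i)) (fun i => ?_)
    ?_ ?_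
  · rw [← Module.AEval.of_aeval_smul]
    exact hv i
  · let T := Submodule.span (ZMod p)[X]
      (Set.range fun i => Module.AEval'.of (redEnd p A) (v i))
    have := hspan ((T.restrictScalars (ZMod p)).comap (Module.AEval'.of (redEnd p A)).toLinearMap)
      (fun x hx => ?_) (fun i => show Module.AEval'.of (redEnd p A) (v i) ∈ T from Submodule.subset_span ⟨i, rfl⟩)
    swap
    · have := T.smul_mem X (show Module.AEval'.of (redEnd p A) x ∈ T from hx)
      rwa [Module.AEval'.X_smul_of] at this
    rw [eq_top_iff]
    intro x _
    exact this.ge (Submodule.mem_top (x := (Module.AEval'.of (redEnd p A)).symm x))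
  · rw [hcard, show Nat.card (Module.AEval' (redEnd p A)) = Nat.card (Fin k → ZMod p) from rfl]
    simp

end MatrixElementaryDivisors

/-! ### Elementary divisors of the tabulated matrices -/

section ElementaryDivisorsOfRows

variable {p : ℕ}

/-- The polynomial `X - b` modulo `p`. -/
noncomputable def linPoly (p : ℕ) (b : ℤ) : (ZMod p)[X] := X - C (b : ZMod p)

/-- The polynomial `X ^ 2 + b₁ X + b₀` modulo `p`. -/
noncomputable def quadPoly (p : ℕ) (b₀ b₁ : ℤ) : (ZMod p)[X] :=
  X ^ 2 + C (b₁ : ZMod p) * X + C (b₀ : ZMod p)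

/-- The polynomial `X ^ 3 + b₂ X ^ 2 + b₁ X + b₀` modulo `p`. -/
noncomputable def cubicPoly (p : ℕ) (b₀ b₁ b₂ : ℤ) : (ZMod p)[X] :=
  X ^ 3 + C (b₂ : ZMod p) * X ^ 2 + C (b₁ : ZMod p) * X + C (b₀ : ZMod p)

/-- The polynomial `X ^ 4 + b₃ X ^ 3 + b₂ X ^ 2 + b₁ X + b₀` modulo `p`. -/
noncomputable def quarticPoly (p : ℕ) (b₀ b₁ b₂ b₃ : ℤ) : (ZMod p)[X] :=
  X ^ 4 + C (b₃ : ZMod p) * X ^ 3 + C (b₂ : ZMod p) * X ^ 2 + C (b₁ : ZMod p) * X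
    + C (b₀ : ZMod p)

variable [Fact p.Prime]

theorem natDegree_linPoly (b : ℤ) : (linPoly p b).natDegree = 1 := natDegree_X_sub_C _

theorem natDegree_quadPoly (b₀ b₁ : ℤ) : (quadPoly p b₀ b₁).natDegree = 2 := by
  unfold quadPoly
  compute_degree!

theorem natDegree_cubicPoly (b₀ b₁ b₂ : ℤ) : (cubicPoly p b₀ b₁ b₂).natDegree = 3 := by
  unfold cubicPoly
  compute_degree!

theorem natDegree_quarticPoly (b₀ b₁ b₂ b₃ : ℤ) : (quarticPoly p b₀ b₁ b₂ b₃).natDegree = 4 := by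
  unfold quarticPoly
  compute_degree!

theorem monic_linPoly (b : ℤ) : (linPoly p b).Monic := monic_X_sub_C _

theorem monic_quadPoly (b₀ b₁ : ℤ) : (quadPoly p b₀ b₁).Monic := by
  unfold quadPoly
  monicity!

theorem monic_cubicPoly (b₀ b₁ b₂ : ℤ) : (cubicPoly p b₀ b₁ b₂).Monic := by
  unfold cubicPoly
  monicity!

theorem monic_quarticPoly (b₀ b₁ b₂ b₃ : ℤ) : (quarticPoly p b₀ b₁ b₂ b₃).Monic := by
  unfold quarticPoly
  monicity!

theorem irreducible_linPoly (b : ℤ) : Irreducible (linPoly p b) := irreducible_X_sub_C _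

omit [Fact p.Prime] in
theorem IrrTwo.irreducible {b₀ b₁ : ℤ} (h : IrrTwo p b₀ b₁) : Irreducible (quadPoly p b₀ b₁) :=
  h.2.2

omit [Fact p.Prime] in
theorem IrrThree.irreducible {b₀ b₁ b₂ : ℤ} (h : IrrThree p b₀ b₁ b₂) :
    Irreducible (cubicPoly p b₀ b₁ b₂) :=
  h.2.2.2

omit [Fact p.Prime] in
theorem IrrFour.irreducible {b₀ b₁ b₂ b₃ : ℤ} (h : IrrFour p b₀ b₁ b₂ b₃) :
    Irreducible (quarticPoly p b₀ b₁ b₂ b₃) :=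
  h.2.2.2.2

section

variable {V : Type*} [AddCommGroup V] [Module (ZMod p) V] (T : Module.End (ZMod p) V)

theorem aeval_linPoly_apply (b : ℤ) (x : V) : aeval T (linPoly p b) x = T x - (b : ZMod p) • x := by
  simp [linPoly, Int.cast_smul_eq_zsmul]

theorem aeval_quadPoly_apply (b₀ b₁ : ℤ) (x : V) : aeval T (quadPoly p b₀ b₁) x
    = T (T x) + (b₁ : ZMod p) • T x + (b₀ : ZMod p) • x := by
  simp [quadPoly, Int.cast_smul_eq_zsmul, pow_succ]

theorem aeval_cubicPoly_apply (b₀ b₁ b₂ : ℤ) (x : V) : aeval T (cubicPoly p b₀ b₁ b₂) x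
    = T (T (T x)) + (b₂ : ZMod p) • T (T x) + (b₁ : ZMod p) • T x + (b₀ : ZMod p) • x := by
  simp [cubicPoly, Int.cast_smul_eq_zsmul, pow_succ]

theorem aeval_quarticPoly_apply (b₀ b₁ b₂ b₃ : ℤ) (x : V) : aeval T (quarticPoly p b₀ b₁ b₂ b₃) x
    = T (T (T (T x))) + (b₃ : ZMod p) • T (T (T x)) + (b₂ : ZMod p) • T (T x)
      + (b₁ : ZMod p) • T x + (b₀ : ZMod p) • x := by
  simp [quarticPoly, Int.cast_smul_eq_zsmul, pow_succ]

end

theorem submodule_eq_top_two {S : Submodule (ZMod p) (Fin 2 → ZMod p)} (h0 : ![1, 0] ∈ S)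
    (h1 : ![0, 1] ∈ S) : S = ⊤ := by
  rw [eq_top_iff]
  intro x _
  have : x = x 0 • ![1, 0] + x 1 • ![0, 1] := by
    ext i; fin_cases i <;> simp
  rw [this]
  exact S.add_mem (S.smul_mem _ h0) (S.smul_mem _ h1)

theorem submodule_eq_top_three {S : Submodule (ZMod p) (Fin 3 → ZMod p)} (h0 : ![1, 0, 0] ∈ S)
    (h1 : ![0, 1, 0] ∈ S) (h2 : ![0, 0, 1] ∈ S) : S = ⊤ := by
  rw [eq_top_iff]
  intro x _
  have : x = x 0 • ![1, 0, 0] + x 1 • ![0, 1, 0] + x 2 • ![0, 0, 1] := by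
    ext i; fin_cases i <;> simp
  rw [this]
  exact S.add_mem (S.add_mem (S.smul_mem _ h0) (S.smul_mem _ h1)) (S.smul_mem _ h2)

theorem submodule_eq_top_four {S : Submodule (ZMod p) (Fin 4 → ZMod p)} (h0 : ![1, 0, 0, 0] ∈ S)
    (h1 : ![0, 1, 0, 0] ∈ S) (h2 : ![0, 0, 1, 0] ∈ S) (h3 : ![0, 0, 0, 1] ∈ S) : S = ⊤ := by
  rw [eq_top_iff]
  intro x _
  have : x = x 0 • ![1, 0, 0, 0] + x 1 • ![0, 1, 0, 0] + x 2 • ![0, 0, 1, 0]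
      + x 3 • ![0, 0, 0, 1] := by
    ext i; fin_cases i <;> simp
  rw [this]
  exact S.add_mem (S.add_mem (S.add_mem (S.smul_mem _ h0) (S.smul_mem _ h1)) (S.smul_mem _ h2))
    (S.smul_mem _ h3)

/-- Irreducible polynomials over a finite field are separable. Concretely, a vanishing discriminant
produces a root. -/
theorem IrrTwo.discr_ne_zero {b₀ b₁ : ℤ} (h : IrrTwo p b₀ b₁) :
    (4 * b₀ - b₁ ^ 2 : ZMod p) ≠ 0 := by
  have hr := ((irrTwo_iff Fact.out).1 h).2.2
  intro hd
  by_cases h2 : (2 : ZMod p) = 0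
  · have hp : p = 2 := by
      refine (Nat.prime_dvd_prime_iff_eq Fact.out Nat.prime_two).1 ?_
      rw [← ZMod.natCast_eq_zero_iff]
      exact_mod_cast h2
    have hb : (b₁ : ZMod p) = 0 := by
      refine pow_eq_zero_iff two_ne_zero |>.1 ?_
      linear_combination -hd + 2 * b₀ * h2
    -- In characteristic two the polynomial has become `x ^ 2 + b₀`, and every element of `𝔽₂` is
    -- its own square.
    refine hr b₀ ?_
    have h3 := ZMod.pow_card (b₀ : ZMod p)
    rw [show (b₀ : ZMod p) ^ p = (b₀ : ZMod p) ^ 2 by rw [← hp]] at h3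
    rw [h3, hb]
    linear_combination b₀ * h2
  · refine hr (-b₁ / 2) ?_
    field_simp
    linear_combination hd

theorem redEnd_two (a₁₁ a₁₂ a₂₁ a₂₂ : ℤ) (x₁ x₂ : ZMod p) :
    redEnd p !![a₁₁, a₁₂; a₂₁, a₂₂] ![x₁, x₂]
      = ![a₁₁ * x₁ + a₁₂ * x₂,
        a₂₁ * x₁ + a₂₂ * x₂] := by
  ext i
  fin_cases i <;> simp [redEnd_apply, Matrix.mulVec, dotProduct, Fin.sum_univ_succ]

theorem redEnd_three (a₁₁ a₁₂ a₁₃ a₂₁ a₂₂ a₂₃ a₃₁ a₃₂ a₃₃ : ℤ) (x₁ x₂ x₃ : ZMod p) :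
    redEnd p !![a₁₁, a₁₂, a₁₃; a₂₁, a₂₂, a₂₃; a₃₁, a₃₂, a₃₃] ![x₁, x₂, x₃]
      = ![a₁₁ * x₁ + a₁₂ * x₂ + a₁₃ * x₃,
        a₂₁ * x₁ + a₂₂ * x₂ + a₂₃ * x₃,
        a₃₁ * x₁ + a₃₂ * x₂ + a₃₃ * x₃] := by
  ext i
  fin_cases i <;> simp [redEnd_apply, Matrix.mulVec, dotProduct, Fin.sum_univ_succ] <;> ring

theorem redEnd_four (a₁₁ a₁₂ a₁₃ a₁₄ a₂₁ a₂₂ a₂₃ a₂₄ a₃₁ a₃₂ a₃₃ a₃₄ a₄₁ a₄₂ a₄₃ a₄₄ : ℤ) (x₁ x₂ x₃ x₄ : ZMod p) :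
    redEnd p !![a₁₁, a₁₂, a₁₃, a₁₄; a₂₁, a₂₂, a₂₃, a₂₄; a₃₁, a₃₂, a₃₃, a₃₄; a₄₁, a₄₂, a₄₃, a₄₄] ![x₁, x₂, x₃, x₄]
      = ![a₁₁ * x₁ + a₁₂ * x₂ + a₁₃ * x₃ + a₁₄ * x₄,
        a₂₁ * x₁ + a₂₂ * x₂ + a₂₃ * x₃ + a₂₄ * x₄,
        a₃₁ * x₁ + a₃₂ * x₂ + a₃₃ * x₃ + a₃₄ * x₄,
        a₄₁ * x₁ + a₄₂ * x₂ + a₄₃ * x₃ + a₄₄ * x₄] := by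
  ext i
  fin_cases i <;> simp [redEnd_apply, Matrix.mulVec, dotProduct, Fin.sum_univ_succ] <;> ring

theorem hasMatElemDiv_lin_lin (b c : ℤ) :
    HasMatElemDiv p !![b, 0; 0, c]
      {(linPoly p b, 1), (linPoly p c, 1)} := by
  refine hasMatElemDiv_of_generators ![(linPoly p b, 1), (linPoly p c, 1)]
    ![![1, 0], ![0, 1]] ?_ ?_ ?_ ?_
  · simp [Fin.forall_fin_succ, irreducible_linPoly, monic_linPoly]
  · simp [Fin.forall_fin_succ, aeval_linPoly_apply, redEnd_two]
  · intro S hS hv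
    exact submodule_eq_top_two (hv 0) (hv 1)
  · simp [Fin.sum_univ_succ, natDegree_linPoly]

theorem hasMatElemDiv_jordan_two (b : ℤ) :
    HasMatElemDiv p !![b, 1; 0, b]
      {(linPoly p b, 2)} := by
  refine hasMatElemDiv_of_generators ![(linPoly p b, 2)]
    ![![0, 1]] ?_ ?_ ?_ ?_
  · simp [irreducible_linPoly, monic_linPoly]
  · simp only [Fin.forall_fin_one, pow_succ, pow_zero, one_mul, Module.End.mul_apply, map_mul,
      aeval_linPoly_apply, redEnd_two, Matrix.smul_cons, Matrix.smul_empty, Matrix.cons_sub_cons,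
      Matrix.empty_sub_empty, smul_eq_mul, Matrix.cons_val_zero]
    simp
  · intro S hS hv
    have h_0 : ![1, 0] ∈ S := by
      convert S.sub_mem (hS _ (hv 0)) (S.smul_mem (b : ZMod p) (hv 0)) using 1
      ext i
      fin_cases i <;> simp [redEnd_two, -Matrix.cons_zero_zero]
    exact submodule_eq_top_two h_0 (hv 0)
  · simp [natDegree_linPoly]

theorem hasMatElemDiv_quad {b₀ b₁ : ℤ} (h0 : IrrTwo p b₀ b₁) :
    HasMatElemDiv p !![0, 1; -b₀, -b₁]
      {(quadPoly p b₀ b₁, 1)} := by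
  refine hasMatElemDiv_of_generators ![(quadPoly p b₀ b₁, 1)]
    ![![0, 1]] ?_ ?_ ?_ ?_
  · simp [h0.irreducible, monic_quadPoly]
  · simp [aeval_quadPoly_apply, redEnd_two]
  · intro S hS hv
    have h_0 : ![1, 0] ∈ S := by
      convert S.add_mem (hS _ (hv 0)) (S.smul_mem (b₁ : ZMod p) (hv 0)) using 1
      ext i
      fin_cases i <;> simp [redEnd_two, -Matrix.cons_zero_zero]
    exact submodule_eq_top_two h_0 (hv 0)
  · simp [natDegree_quadPoly]

theorem hasMatElemDiv_lin_lin_lin (b c d : ℤ) :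
    HasMatElemDiv p !![b, 0, 0; 0, c, 0; 0, 0, d]
      {(linPoly p b, 1), (linPoly p c, 1), (linPoly p d, 1)} := by
  refine hasMatElemDiv_of_generators ![(linPoly p b, 1), (linPoly p c, 1), (linPoly p d, 1)]
    ![![1, 0, 0], ![0, 1, 0], ![0, 0, 1]] ?_ ?_ ?_ ?_
  · simp [Fin.forall_fin_succ, irreducible_linPoly, monic_linPoly]
  · simp [Fin.forall_fin_succ, aeval_linPoly_apply, redEnd_three]
  · intro S hS hv
    exact submodule_eq_top_three (hv 0) (hv 1) (hv 2)
  · simp [Fin.sum_univ_succ, natDegree_linPoly]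

theorem hasMatElemDiv_jordan_two_lin (b c : ℤ) :
    HasMatElemDiv p !![b, 1, 0; 0, b, 0; 0, 0, c]
      {(linPoly p b, 2), (linPoly p c, 1)} := by
  refine hasMatElemDiv_of_generators ![(linPoly p b, 2), (linPoly p c, 1)]
    ![![0, 1, 0], ![0, 0, 1]] ?_ ?_ ?_ ?_
  · simp [Fin.forall_fin_succ, irreducible_linPoly, monic_linPoly]
  · simp only [Fin.forall_fin_succ, pow_succ, pow_zero, one_mul, Module.End.mul_apply, map_mul,
      aeval_linPoly_apply, redEnd_three, Matrix.smul_cons, Matrix.smul_empty,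
      Matrix.cons_sub_cons, Matrix.empty_sub_empty, smul_eq_mul, Matrix.cons_val_zero,
      Matrix.cons_val_succ]
    simp
  · intro S hS hv
    have h_0 : ![1, 0, 0] ∈ S := by
      convert S.sub_mem (hS _ (hv 0)) (S.smul_mem (b : ZMod p) (hv 0)) using 1
      ext i
      fin_cases i <;> simp [redEnd_three, -Matrix.cons_zero_zero]
    exact submodule_eq_top_three h_0 (hv 0) (hv 1)
  · simp [Fin.sum_univ_succ, natDegree_linPoly]

theorem hasMatElemDiv_jordan_three (b : ℤ) :
    HasMatElemDiv p !![b, 1, 0; 0, b, 1; 0, 0, b]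
      {(linPoly p b, 3)} := by
  refine hasMatElemDiv_of_generators ![(linPoly p b, 3)]
    ![![0, 0, 1]] ?_ ?_ ?_ ?_
  · simp [irreducible_linPoly, monic_linPoly]
  · simp only [Fin.forall_fin_one, pow_succ, pow_zero, one_mul, Module.End.mul_apply, map_mul,
      aeval_linPoly_apply, redEnd_three, Matrix.smul_cons, Matrix.smul_empty,
      Matrix.cons_sub_cons, Matrix.empty_sub_empty, smul_eq_mul, Matrix.cons_val_zero]
    simp
  · intro S hS hv
    have h_1 : ![0, 1, 0] ∈ S := by
      convert S.sub_mem (hS _ (hv 0)) (S.smul_mem (b : ZMod p) (hv 0)) using 1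
      ext i
      fin_cases i <;> simp [redEnd_three, -Matrix.cons_zero_zero]
    have h_0 : ![1, 0, 0] ∈ S := by
      convert S.sub_mem (hS _ h_1) (S.smul_mem (b : ZMod p) h_1) using 1
      ext i
      fin_cases i <;> simp [redEnd_three, -Matrix.cons_zero_zero]
    exact submodule_eq_top_three h_0 h_1 (hv 0)
  · simp [natDegree_linPoly]

theorem hasMatElemDiv_cubic {b₀ b₁ b₂ : ℤ} (h0 : IrrThree p b₀ b₁ b₂) :
    HasMatElemDiv p !![0, 1, 0; 0, 0, 1; -b₀, -b₁, -b₂]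
      {(cubicPoly p b₀ b₁ b₂, 1)} := by
  refine hasMatElemDiv_of_generators ![(cubicPoly p b₀ b₁ b₂, 1)]
    ![![0, 0, 1]] ?_ ?_ ?_ ?_
  · simp [h0.irreducible, monic_cubicPoly]
  · simp [aeval_cubicPoly_apply, redEnd_three]
  · intro S hS hv
    have h_1 : ![0, 1, 0] ∈ S := by
      convert S.add_mem (hS _ (hv 0)) (S.smul_mem (b₂ : ZMod p) (hv 0)) using 1
      ext i
      fin_cases i <;> simp [redEnd_three, -Matrix.cons_zero_zero]
    have h_0 : ![1, 0, 0] ∈ S := by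
      convert S.add_mem (hS _ h_1) (S.smul_mem (b₁ : ZMod p) (hv 0)) using 1
      ext i
      fin_cases i <;> simp [redEnd_three, -Matrix.cons_zero_zero]
    exact submodule_eq_top_three h_0 h_1 (hv 0)
  · simp [natDegree_cubicPoly]

theorem hasMatElemDiv_quad_lin {b₀ b₁ c : ℤ} (h0 : IrrTwo p b₀ b₁) :
    HasMatElemDiv p !![0, 1, 0; -b₀, -b₁, 0; 0, 0, c]
      {(quadPoly p b₀ b₁, 1), (linPoly p c, 1)} := by
  refine hasMatElemDiv_of_generators ![(quadPoly p b₀ b₁, 1), (linPoly p c, 1)]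
    ![![0, 1, 0], ![0, 0, 1]] ?_ ?_ ?_ ?_
  · simp [Fin.forall_fin_succ, h0.irreducible, irreducible_linPoly, monic_linPoly, monic_quadPoly]
  · simp [Fin.forall_fin_succ, aeval_linPoly_apply, aeval_quadPoly_apply, redEnd_three]
  · intro S hS hv
    have h_0 : ![1, 0, 0] ∈ S := by
      convert S.add_mem (hS _ (hv 0)) (S.smul_mem (b₁ : ZMod p) (hv 0)) using 1
      ext i
      fin_cases i <;> simp [redEnd_three, -Matrix.cons_zero_zero]
    exact submodule_eq_top_three h_0 (hv 0) (hv 1)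
  · simp [Fin.sum_univ_succ, natDegree_linPoly, natDegree_quadPoly]

theorem hasMatElemDiv_lin_lin_lin_lin (b c d e : ℤ) :
    HasMatElemDiv p !![b, 0, 0, 0; 0, c, 0, 0; 0, 0, d, 0; 0, 0, 0, e]
      {(linPoly p b, 1), (linPoly p c, 1), (linPoly p d, 1), (linPoly p e, 1)} := by
  refine hasMatElemDiv_of_generators ![(linPoly p b, 1), (linPoly p c, 1), (linPoly p d, 1),
      (linPoly p e, 1)]
    ![![1, 0, 0, 0], ![0, 1, 0, 0], ![0, 0, 1, 0], ![0, 0, 0, 1]] ?_ ?_ ?_ ?_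
  · simp [Fin.forall_fin_succ, irreducible_linPoly, monic_linPoly]
  · simp [Fin.forall_fin_succ, aeval_linPoly_apply, redEnd_four]
  · intro S hS hv
    exact submodule_eq_top_four (hv 0) (hv 1) (hv 2) (hv 3)
  · simp [Fin.sum_univ_succ, natDegree_linPoly]

theorem hasMatElemDiv_jordan_two_lin_lin (b c d : ℤ) :
    HasMatElemDiv p !![b, 1, 0, 0; 0, b, 0, 0; 0, 0, c, 0; 0, 0, 0, d]
      {(linPoly p b, 2), (linPoly p c, 1), (linPoly p d, 1)} := by
  refine hasMatElemDiv_of_generators ![(linPoly p b, 2), (linPoly p c, 1), (linPoly p d, 1)]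
    ![![0, 1, 0, 0], ![0, 0, 1, 0], ![0, 0, 0, 1]] ?_ ?_ ?_ ?_
  · simp [Fin.forall_fin_succ, irreducible_linPoly, monic_linPoly]
  · simp only [Fin.forall_fin_succ, pow_succ, pow_zero, one_mul, Module.End.mul_apply, map_mul,
      aeval_linPoly_apply, redEnd_four, Matrix.smul_cons, Matrix.smul_empty, Matrix.cons_sub_cons,
      Matrix.empty_sub_empty, smul_eq_mul, Matrix.cons_val_zero, Matrix.cons_val_succ]
    simp
  · intro S hS hv
    have h_0 : ![1, 0, 0, 0] ∈ S := by
      convert S.sub_mem (hS _ (hv 0)) (S.smul_mem (b : ZMod p) (hv 0)) using 1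
      ext i
      fin_cases i <;> simp [redEnd_four, -Matrix.cons_zero_zero]
    exact submodule_eq_top_four h_0 (hv 0) (hv 1) (hv 2)
  · simp [Fin.sum_univ_succ, natDegree_linPoly]

theorem hasMatElemDiv_jordan_two_jordan_two (b c : ℤ) :
    HasMatElemDiv p !![b, 1, 0, 0; 0, b, 0, 0; 0, 0, c, 1; 0, 0, 0, c]
      {(linPoly p b, 2), (linPoly p c, 2)} := by
  refine hasMatElemDiv_of_generators ![(linPoly p b, 2), (linPoly p c, 2)]
    ![![0, 1, 0, 0], ![0, 0, 0, 1]] ?_ ?_ ?_ ?_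
  · simp [Fin.forall_fin_succ, irreducible_linPoly, monic_linPoly]
  · simp only [Fin.forall_fin_succ, pow_succ, pow_zero, one_mul, Module.End.mul_apply, map_mul,
      aeval_linPoly_apply, redEnd_four, Matrix.smul_cons, Matrix.smul_empty, Matrix.cons_sub_cons,
      Matrix.empty_sub_empty, smul_eq_mul, Matrix.cons_val_zero, Matrix.cons_val_succ]
    simp
  · intro S hS hv
    have h_0 : ![1, 0, 0, 0] ∈ S := by
      convert S.sub_mem (hS _ (hv 0)) (S.smul_mem (b : ZMod p) (hv 0)) using 1
      ext i
      fin_cases i <;> simp [redEnd_four, -Matrix.cons_zero_zero]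
    have h_2 : ![0, 0, 1, 0] ∈ S := by
      convert S.sub_mem (hS _ (hv 1)) (S.smul_mem (c : ZMod p) (hv 1)) using 1
      ext i
      fin_cases i <;> simp [redEnd_four, -Matrix.cons_zero_zero]
    exact submodule_eq_top_four h_0 (hv 0) h_2 (hv 1)
  · simp [Fin.sum_univ_succ, natDegree_linPoly]

theorem hasMatElemDiv_jordan_three_lin (b c : ℤ) :
    HasMatElemDiv p !![b, 1, 0, 0; 0, b, 1, 0; 0, 0, b, 0; 0, 0, 0, c]
      {(linPoly p b, 3), (linPoly p c, 1)} := by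
  refine hasMatElemDiv_of_generators ![(linPoly p b, 3), (linPoly p c, 1)]
    ![![0, 0, 1, 0], ![0, 0, 0, 1]] ?_ ?_ ?_ ?_
  · simp [Fin.forall_fin_succ, irreducible_linPoly, monic_linPoly]
  · simp only [Fin.forall_fin_succ, pow_succ, pow_zero, one_mul, Module.End.mul_apply, map_mul,
      aeval_linPoly_apply, redEnd_four, Matrix.smul_cons, Matrix.smul_empty, Matrix.cons_sub_cons,
      Matrix.empty_sub_empty, smul_eq_mul, Matrix.cons_val_zero, Matrix.cons_val_succ]
    simp
  · intro S hS hv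
    have h_1 : ![0, 1, 0, 0] ∈ S := by
      convert S.sub_mem (hS _ (hv 0)) (S.smul_mem (b : ZMod p) (hv 0)) using 1
      ext i
      fin_cases i <;> simp [redEnd_four, -Matrix.cons_zero_zero]
    have h_0 : ![1, 0, 0, 0] ∈ S := by
      convert S.sub_mem (hS _ h_1) (S.smul_mem (b : ZMod p) h_1) using 1
      ext i
      fin_cases i <;> simp [redEnd_four, -Matrix.cons_zero_zero]
    exact submodule_eq_top_four h_0 h_1 (hv 0) (hv 1)
  · simp [Fin.sum_univ_succ, natDegree_linPoly]

theorem hasMatElemDiv_jordan_four (b : ℤ) :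
    HasMatElemDiv p !![b, 1, 0, 0; 0, b, 1, 0; 0, 0, b, 1; 0, 0, 0, b]
      {(linPoly p b, 4)} := by
  refine hasMatElemDiv_of_generators ![(linPoly p b, 4)]
    ![![0, 0, 0, 1]] ?_ ?_ ?_ ?_
  · simp [irreducible_linPoly, monic_linPoly]
  · simp only [Fin.forall_fin_one, pow_succ, pow_zero, one_mul, Module.End.mul_apply, map_mul,
      aeval_linPoly_apply, redEnd_four, Matrix.smul_cons, Matrix.smul_empty, Matrix.cons_sub_cons,
      Matrix.empty_sub_empty, smul_eq_mul, Matrix.cons_val_zero]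
    simp
  · intro S hS hv
    have h_2 : ![0, 0, 1, 0] ∈ S := by
      convert S.sub_mem (hS _ (hv 0)) (S.smul_mem (b : ZMod p) (hv 0)) using 1
      ext i
      fin_cases i <;> simp [redEnd_four, -Matrix.cons_zero_zero]
    have h_1 : ![0, 1, 0, 0] ∈ S := by
      convert S.sub_mem (hS _ h_2) (S.smul_mem (b : ZMod p) h_2) using 1
      ext i
      fin_cases i <;> simp [redEnd_four, -Matrix.cons_zero_zero]
    have h_0 : ![1, 0, 0, 0] ∈ S := by
      convert S.sub_mem (hS _ h_1) (S.smul_mem (b : ZMod p) h_1) using 1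
      ext i
      fin_cases i <;> simp [redEnd_four, -Matrix.cons_zero_zero]
    exact submodule_eq_top_four h_0 h_1 h_2 (hv 0)
  · simp [natDegree_linPoly]

theorem hasMatElemDiv_quad_quad {b₀ b₁ c₀ c₁ : ℤ} (h0 : IrrTwo p b₀ b₁) (h1 : IrrTwo p c₀ c₁) :
    HasMatElemDiv p !![0, 1, 0, 0; -b₀, -b₁, 0, 0; 0, 0, 0, 1; 0, 0, -c₀, -c₁]
      {(quadPoly p b₀ b₁, 1), (quadPoly p c₀ c₁, 1)} := by
  refine hasMatElemDiv_of_generators ![(quadPoly p b₀ b₁, 1), (quadPoly p c₀ c₁, 1)]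
    ![![0, 1, 0, 0], ![0, 0, 0, 1]] ?_ ?_ ?_ ?_
  · simp [Fin.forall_fin_succ, h0.irreducible, h1.irreducible, monic_quadPoly]
  · simp [Fin.forall_fin_succ, aeval_quadPoly_apply, redEnd_four]
  · intro S hS hv
    have h_0 : ![1, 0, 0, 0] ∈ S := by
      convert S.add_mem (hS _ (hv 0)) (S.smul_mem (b₁ : ZMod p) (hv 0)) using 1
      ext i
      fin_cases i <;> simp [redEnd_four, -Matrix.cons_zero_zero]
    have h_2 : ![0, 0, 1, 0] ∈ S := by
      convert S.add_mem (hS _ (hv 1)) (S.smul_mem (c₁ : ZMod p) (hv 1)) using 1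
      ext i
      fin_cases i <;> simp [redEnd_four, -Matrix.cons_zero_zero]
    exact submodule_eq_top_four h_0 (hv 0) h_2 (hv 1)
  · simp [Fin.sum_univ_succ, natDegree_quadPoly]

/-- Two companion blocks linked by an identity block rather than a single `1`: the last basis vector
generates the whole space only because the quadratic is separable. -/
theorem hasMatElemDiv_quad_sq {b₀ b₁ : ℤ} (h0 : IrrTwo p b₀ b₁) :
    HasMatElemDiv p !![0, 1, 1, 0; -b₀, -b₁, 0, 1; 0, 0, 0, 1; 0, 0, -b₀, -b₁]
      {(quadPoly p b₀ b₁, 2)} := by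
  refine hasMatElemDiv_of_generators ![(quadPoly p b₀ b₁, 2)]
    ![![0, 0, 0, 1]] ?_ ?_ ?_ ?_
  · simp [h0.irreducible, monic_quadPoly]
  · simp [pow_succ, aeval_quadPoly_apply, redEnd_four]
  · intro S hS hv
    have h3 : ![0, 0, 0, 1] ∈ S := hv 0
    have hu : ![0, 1, 1, 0] ∈ S := by
      simpa [redEnd_four, -Matrix.cons_zero_zero] using
        S.add_mem (hS _ h3) (S.smul_mem (b₁ : ZMod p) h3)
    have hw : ![2, 0, (b₁ : ZMod p), 0] ∈ S := by
      have := S.add_mem (S.add_mem (hS _ hu) (S.smul_mem (b₁ : ZMod p) hu))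
        (S.smul_mem (b₀ : ZMod p) h3)
      simpa [redEnd_four, -Matrix.cons_zero_zero, one_add_one_eq_two] using this
    have hz : ![(b₁ : ZMod p), 0, 2 * b₀, 0] ∈ S := by
      have := S.add_mem (S.add_mem (hS _ hw) (S.smul_mem (2 * b₀ : ZMod p) hu))
        (S.smul_mem (b₀ * b₁ : ZMod p) h3)
      convert this using 1
      simp [redEnd_four, -Matrix.cons_zero_zero]
      ring
    -- The vectors `hw` and `hz` lie in the span of the first and third basis vectors, with
    -- coordinate determinant `4 * b₀ - b₁ ^ 2`.
    have hd := h0.discr_ne_zero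
    have h_0 : ![1, 0, 0, 0] ∈ S := by
      have := S.smul_mem (4 * b₀ - b₁ ^ 2 : ZMod p)⁻¹
        (S.sub_mem (S.smul_mem (2 * b₀ : ZMod p) hw) (S.smul_mem (b₁ : ZMod p) hz))
      convert this using 1
      ext i
      fin_cases i <;> simp <;> grind
    have h_2 : ![0, 0, 1, 0] ∈ S := by
      have := S.smul_mem (4 * b₀ - b₁ ^ 2 : ZMod p)⁻¹
        (S.sub_mem (S.smul_mem (2 : ZMod p) hz) (S.smul_mem (b₁ : ZMod p) hw))
      convert this using 1
      ext i
      fin_cases i <;> simp <;> grind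
    have h_1 : ![0, 1, 0, 0] ∈ S := by
      convert S.sub_mem hu h_2 using 1
      ext i
      fin_cases i <;> simp
    exact submodule_eq_top_four h_0 h_1 h_2 h3
  · simp [natDegree_quadPoly]

theorem hasMatElemDiv_quartic {b₀ b₁ b₂ b₃ : ℤ} (h0 : IrrFour p b₀ b₁ b₂ b₃) :
    HasMatElemDiv p !![0, 1, 0, 0; 0, 0, 1, 0; 0, 0, 0, 1; -b₀, -b₁, -b₂, -b₃]
      {(quarticPoly p b₀ b₁ b₂ b₃, 1)} := by
  refine hasMatElemDiv_of_generators ![(quarticPoly p b₀ b₁ b₂ b₃, 1)]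
    ![![0, 0, 0, 1]] ?_ ?_ ?_ ?_
  · simp [h0.irreducible, monic_quarticPoly]
  · simp [aeval_quarticPoly_apply, redEnd_four]
  · intro S hS hv
    have h_2 : ![0, 0, 1, 0] ∈ S := by
      convert S.add_mem (hS _ (hv 0)) (S.smul_mem (b₃ : ZMod p) (hv 0)) using 1
      ext i
      fin_cases i <;> simp [redEnd_four, -Matrix.cons_zero_zero]
    have h_1 : ![0, 1, 0, 0] ∈ S := by
      convert S.add_mem (hS _ h_2) (S.smul_mem (b₂ : ZMod p) (hv 0)) using 1
      ext i
      fin_cases i <;> simp [redEnd_four, -Matrix.cons_zero_zero]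
    have h_0 : ![1, 0, 0, 0] ∈ S := by
      convert S.add_mem (hS _ h_1) (S.smul_mem (b₁ : ZMod p) (hv 0)) using 1
      ext i
      fin_cases i <;> simp [redEnd_four, -Matrix.cons_zero_zero]
    exact submodule_eq_top_four h_0 h_1 h_2 (hv 0)
  · simp [natDegree_quarticPoly]

theorem hasMatElemDiv_cubic_lin {b₀ b₁ b₂ c : ℤ} (h0 : IrrThree p b₀ b₁ b₂) :
    HasMatElemDiv p !![0, 1, 0, 0; 0, 0, 1, 0; -b₀, -b₁, -b₂, 0; 0, 0, 0, c]
      {(cubicPoly p b₀ b₁ b₂, 1), (linPoly p c, 1)} := by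
  refine hasMatElemDiv_of_generators ![(cubicPoly p b₀ b₁ b₂, 1), (linPoly p c, 1)]
    ![![0, 0, 1, 0], ![0, 0, 0, 1]] ?_ ?_ ?_ ?_
  · simp [Fin.forall_fin_succ, h0.irreducible, irreducible_linPoly, monic_cubicPoly, monic_linPoly]
  · simp [Fin.forall_fin_succ, aeval_cubicPoly_apply, aeval_linPoly_apply, redEnd_four]
  · intro S hS hv
    have h_1 : ![0, 1, 0, 0] ∈ S := by
      convert S.add_mem (hS _ (hv 0)) (S.smul_mem (b₂ : ZMod p) (hv 0)) using 1
      ext i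
      fin_cases i <;> simp [redEnd_four, -Matrix.cons_zero_zero]
    have h_0 : ![1, 0, 0, 0] ∈ S := by
      convert S.add_mem (hS _ h_1) (S.smul_mem (b₁ : ZMod p) (hv 0)) using 1
      ext i
      fin_cases i <;> simp [redEnd_four, -Matrix.cons_zero_zero]
    exact submodule_eq_top_four h_0 h_1 (hv 0) (hv 1)
  · simp [Fin.sum_univ_succ, natDegree_cubicPoly, natDegree_linPoly]

theorem hasMatElemDiv_quad_lin_lin {b₀ b₁ c d : ℤ} (h0 : IrrTwo p b₀ b₁) :
    HasMatElemDiv p !![0, 1, 0, 0; -b₀, -b₁, 0, 0; 0, 0, c, 0; 0, 0, 0, d]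
      {(quadPoly p b₀ b₁, 1), (linPoly p c, 1), (linPoly p d, 1)} := by
  refine hasMatElemDiv_of_generators ![(quadPoly p b₀ b₁, 1), (linPoly p c, 1), (linPoly p d, 1)]
    ![![0, 1, 0, 0], ![0, 0, 1, 0], ![0, 0, 0, 1]] ?_ ?_ ?_ ?_
  · simp [Fin.forall_fin_succ, h0.irreducible, irreducible_linPoly, monic_linPoly, monic_quadPoly]
  · simp [Fin.forall_fin_succ, aeval_linPoly_apply, aeval_quadPoly_apply, redEnd_four]
  · intro S hS hv
    have h_0 : ![1, 0, 0, 0] ∈ S := by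
      convert S.add_mem (hS _ (hv 0)) (S.smul_mem (b₁ : ZMod p) (hv 0)) using 1
      ext i
      fin_cases i <;> simp [redEnd_four, -Matrix.cons_zero_zero]
    exact submodule_eq_top_four h_0 (hv 0) (hv 1) (hv 2)
  · simp [Fin.sum_univ_succ, natDegree_linPoly, natDegree_quadPoly]

theorem hasMatElemDiv_jordan_two_quad {b c₀ c₁ : ℤ} (h1 : IrrTwo p c₀ c₁) :
    HasMatElemDiv p !![b, 1, 0, 0; 0, b, 0, 0; 0, 0, 0, 1; 0, 0, -c₀, -c₁]
      {(linPoly p b, 2), (quadPoly p c₀ c₁, 1)} := by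
  refine hasMatElemDiv_of_generators ![(linPoly p b, 2), (quadPoly p c₀ c₁, 1)]
    ![![0, 1, 0, 0], ![0, 0, 0, 1]] ?_ ?_ ?_ ?_
  · simp [Fin.forall_fin_succ, h1.irreducible, irreducible_linPoly, monic_linPoly, monic_quadPoly]
  · simp only [Fin.forall_fin_succ, pow_succ, pow_zero, one_mul, Module.End.mul_apply, map_mul,
      aeval_linPoly_apply, aeval_quadPoly_apply, redEnd_four, Matrix.smul_cons, Matrix.smul_empty,
      Matrix.cons_sub_cons, Matrix.cons_add_cons, Matrix.empty_add_empty, Matrix.empty_sub_empty,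
      smul_eq_mul, Matrix.cons_val_zero, Matrix.cons_val_succ]
    simp
  · intro S hS hv
    have h_0 : ![1, 0, 0, 0] ∈ S := by
      convert S.sub_mem (hS _ (hv 0)) (S.smul_mem (b : ZMod p) (hv 0)) using 1
      ext i
      fin_cases i <;> simp [redEnd_four, -Matrix.cons_zero_zero]
    have h_2 : ![0, 0, 1, 0] ∈ S := by
      convert S.add_mem (hS _ (hv 1)) (S.smul_mem (c₁ : ZMod p) (hv 1)) using 1
      ext i
      fin_cases i <;> simp [redEnd_four, -Matrix.cons_zero_zero]
    exact submodule_eq_top_four h_0 (hv 0) h_2 (hv 1)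
  · simp [Fin.sum_univ_succ, natDegree_linPoly, natDegree_quadPoly]

end ElementaryDivisorsOfRows

/-! ### Shapes and parameters of elementary divisors -/

section ClassificationModP

variable {p : ℕ}

/-- Degree of the polynomial and exponent of an elementary divisor. -/
noncomputable def divShape (x : (ZMod p)[X] × ℕ) : ℕ × ℕ := (x.1.natDegree, x.2)

/-- The representatives in `[0, p)` of the roots of the linear elementary divisors with exponent
`e`. -/
noncomputable def linPart (e : ℕ) (s : Multiset ((ZMod p)[X] × ℕ)) : Multiset ℤ :=
  (s.filter fun x => divShape x = (1, e)).map fun x => ((-x.1.coeff 0).cast : ℤ)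

/-- The representatives in `[0, p)` of the coefficients of the quadratic elementary divisors with
exponent `e`. -/
noncomputable def quadPart (e : ℕ) (s : Multiset ((ZMod p)[X] × ℕ)) : Multiset (ℤ × ℤ) :=
  (s.filter fun x => divShape x = (2, e)).map fun x => (((x.1.coeff 0).cast : ℤ), ((x.1.coeff 1).cast : ℤ))

/-- The representatives in `[0, p)` of the coefficients of the cubic elementary divisors with
exponent `1`. -/
noncomputable def cubicPart (s : Multiset ((ZMod p)[X] × ℕ)) : Multiset (ℤ × ℤ × ℤ) :=
  (s.filter fun x => divShape x = (3, 1)).map fun x =>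
    (((x.1.coeff 0).cast : ℤ), ((x.1.coeff 1).cast : ℤ), ((x.1.coeff 2).cast : ℤ))

/-- The representatives in `[0, p)` of the coefficients of the quartic elementary divisors with
exponent `1`. -/
noncomputable def quarticPart (s : Multiset ((ZMod p)[X] × ℕ)) : Multiset (ℤ × ℤ × ℤ × ℤ) :=
  (s.filter fun x => divShape x = (4, 1)).map fun x => (((x.1.coeff 0).cast : ℤ),
    ((x.1.coeff 1).cast : ℤ), ((x.1.coeff 2).cast : ℤ), ((x.1.coeff 3).cast : ℤ))

theorem IsRep.emod {a : ℤ} (h : IsRep p a) : a % p = a := Int.emod_eq_of_lt h.1 h.2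

section

variable [Fact p.Prime]

@[simp]
theorem divShape_linPoly (b : ℤ) (e : ℕ) : divShape (linPoly p b, e) = (1, e) :=
  congrArg (·, e) (natDegree_linPoly b)

@[simp]
theorem divShape_quadPoly (b₀ b₁ : ℤ) (e : ℕ) : divShape (quadPoly p b₀ b₁, e) = (2, e) :=
  congrArg (·, e) (natDegree_quadPoly b₀ b₁)

@[simp]
theorem divShape_cubicPoly (b₀ b₁ b₂ : ℤ) (e : ℕ) : divShape (cubicPoly p b₀ b₁ b₂, e) = (3, e) :=
  congrArg (·, e) (natDegree_cubicPoly b₀ b₁ b₂)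

@[simp]
theorem divShape_quarticPoly (b₀ b₁ b₂ b₃ : ℤ) (e : ℕ) :
    divShape (quarticPoly p b₀ b₁ b₂ b₃, e) = (4, e) :=
  congrArg (·, e) (natDegree_quarticPoly b₀ b₁ b₂ b₃)

theorem linPart_cons (e : ℕ) (x : (ZMod p)[X] × ℕ) (s : Multiset ((ZMod p)[X] × ℕ)) :
    linPart e (x ::ₘ s) = if divShape x = (1, e) then ((-x.1.coeff 0).cast : ℤ) ::ₘ linPart e s
      else linPart e s := by
  split_ifs with h <;> simp [linPart, h]

theorem quadPart_cons (e : ℕ) (x : (ZMod p)[X] × ℕ) (s : Multiset ((ZMod p)[X] × ℕ)) :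
    quadPart e (x ::ₘ s) = if divShape x = (2, e) then
      (((x.1.coeff 0).cast : ℤ), ((x.1.coeff 1).cast : ℤ)) ::ₘ quadPart e s else quadPart e s := by
  split_ifs with h <;> simp [quadPart, h]

theorem cubicPart_cons (x : (ZMod p)[X] × ℕ) (s : Multiset ((ZMod p)[X] × ℕ)) :
    cubicPart (x ::ₘ s) = if divShape x = (3, 1) then
      (((x.1.coeff 0).cast : ℤ), ((x.1.coeff 1).cast : ℤ), ((x.1.coeff 2).cast : ℤ)) ::ₘ cubicPart s
      else cubicPart s := by
  split_ifs with h <;> simp [cubicPart, h]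

theorem quarticPart_cons (x : (ZMod p)[X] × ℕ) (s : Multiset ((ZMod p)[X] × ℕ)) :
    quarticPart (x ::ₘ s) = if divShape x = (4, 1) then
      (((x.1.coeff 0).cast : ℤ), ((x.1.coeff 1).cast : ℤ), ((x.1.coeff 2).cast : ℤ),
        ((x.1.coeff 3).cast : ℤ)) ::ₘ quarticPart s else quarticPart s := by
  split_ifs with h <;> simp [quarticPart, h]

theorem cast_neg_coeff_linPoly (b : ℤ) : ((-(linPoly p b).coeff 0).cast : ℤ) = b % p := by
  simp [linPoly, ZMod.coe_intCast]

theorem cast_coeff_quadPoly (b₀ b₁ : ℤ) : (((quadPoly p b₀ b₁).coeff 0).cast : ℤ) = b₀ % p ∧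
    (((quadPoly p b₀ b₁).coeff 1).cast : ℤ) = b₁ % p := by
  simp [quadPoly, ZMod.coe_intCast, coeff_X, coeff_X_pow, -map_intCast]

theorem cast_coeff_cubicPoly (b₀ b₁ b₂ : ℤ) :
    (((cubicPoly p b₀ b₁ b₂).coeff 0).cast : ℤ) = b₀ % p ∧
    (((cubicPoly p b₀ b₁ b₂).coeff 1).cast : ℤ) = b₁ % p ∧
    (((cubicPoly p b₀ b₁ b₂).coeff 2).cast : ℤ) = b₂ % p := by
  simp [cubicPoly, ZMod.coe_intCast, coeff_X, coeff_X_pow, coeff_C, -map_intCast]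

theorem cast_coeff_quarticPoly (b₀ b₁ b₂ b₃ : ℤ) :
    (((quarticPoly p b₀ b₁ b₂ b₃).coeff 0).cast : ℤ) = b₀ % p ∧
    (((quarticPoly p b₀ b₁ b₂ b₃).coeff 1).cast : ℤ) = b₁ % p ∧
    (((quarticPoly p b₀ b₁ b₂ b₃).coeff 2).cast : ℤ) = b₂ % p ∧
    (((quarticPoly p b₀ b₁ b₂ b₃).coeff 3).cast : ℤ) = b₃ % p := by
  simp [quarticPoly, ZMod.coe_intCast, coeff_X, coeff_X_pow, coeff_C, -map_intCast]

variable {k : ℕ} {e : Fin k → ℕ} {A : Matrix (Fin k) (Fin k) ℤ} {s : Multiset ((ZMod p)[X] × ℕ)}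

/-- If no divisor is a power of `X`, the `X`-torsion is trivial, whereas a singular matrix would
have a nonzero kernel vector. -/
theorem HasMatElemDiv.isAut (he : ∀ i, e i = 1) (hA : HasMatElemDiv p A s)
    (hs : ∀ x ∈ s, x.1 ≠ X) : IsAut p e A := by
  classical
  refine ⟨fun i j => ?_, fun hdet => ?_⟩
  · rw [he, he]
    exact dvd_mul_left _ _
  have h := HasElemDiv.card_torsion hA monic_X irreducible_X 1
  rw [Multiset.sum_eq_zero (by
    intro n hn
    obtain ⟨x, hx, rfl⟩ := Multiset.mem_map.1 hn
    exact if_neg (hs x hx)), mul_zero, pow_zero, Nat.card_eq_one_iff_unique] at h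
  have := h.1
  rw [dvd_iff_cast] at hdet
  obtain ⟨v, hv0, hv⟩ := Matrix.exists_mulVec_eq_zero_iff.2
    ((RingHom.map_det (Int.castRingHom (ZMod p)) A).symm.trans hdet)
  refine hv0 ?_
  have h0 : (X : (ZMod p)[X]) ^ 1 • Module.AEval'.of (redEnd p A) v = 0 := by
    rw [pow_one, Module.AEval'.X_smul_of, LinearEquiv.map_eq_zero_iff, redEnd_apply]
    exact hv
  have := congrArg Subtype.val (Subsingleton.elim
    (⟨_, h0⟩ : {x : Module.AEval' (redEnd p A) // (X : (ZMod p)[X]) ^ 1 • x = 0}) ⟨0, smul_zero _⟩)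
  exact (LinearEquiv.map_eq_zero_iff _).1 this

theorem linPoly_ne_X {b : ℤ} (hb : 0 < b) (hb' : b < p) : linPoly p b ≠ X := by
  intro h
  have := congrArg (fun q => q.coeff 0) h
  simp [linPoly] at this
  exact cast_ne_zero_of_pos_lt hb hb' this

theorem ne_X_of_natDegree {q : (ZMod p)[X]} (h : q.natDegree ≠ 1) : q ≠ X :=
  fun h' => h (h' ▸ natDegree_X)

theorem Multiset.exists_of_sum_eq_one {α : Type*} {w : α → ℕ} {s : Multiset α}
    (hw : ∀ x ∈ s, 0 < w x) (hs : (s.map w).sum = 1) : ∃ a, s = {a} ∧ w a = 1 := by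
  induction s using Multiset.induction with
  | empty => simp at hs
  | cons a s _ =>
    have ha := hw a (s.mem_cons_self a)
    rw [Multiset.map_cons, Multiset.sum_cons] at hs
    rcases s.empty_or_exists_mem with rfl | ⟨b, hb⟩
    · exact ⟨a, rfl, by simpa using hs⟩
    · have := hw b (Multiset.mem_cons_of_mem hb)
      have := Multiset.single_le_sum (fun _ _ => Nat.zero_le _) _ (Multiset.mem_map_of_mem w hb)
      lia

/-- Peeling off one element leaves a strictly smaller positive total. Iterating this enumerates the
partitions of the total weight, with the weight of a divisor equal to exponent times degree. -/
theorem Multiset.exists_cons_of_sum_pos {α : Type*} {w : α → ℕ} {s : Multiset α}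
    (hw : ∀ x ∈ s, 0 < w x) {n : ℕ} (hs : (s.map w).sum = n + 1) :
    (∃ a, s = {a} ∧ w a = n + 1) ∨ ∃ a t, s = a ::ₘ t ∧ 0 < w a ∧ w a ≤ n ∧
      (t.map w).sum = n + 1 - w a ∧ ∀ x ∈ t, 0 < w x := by
  induction s using Multiset.induction with
  | empty => simp at hs
  | cons a s _ =>
    have ha := hw a (s.mem_cons_self a)
    rw [Multiset.map_cons, Multiset.sum_cons] at hs
    rcases s.empty_or_exists_mem with rfl | ⟨b, hb⟩
    · exact .inl ⟨a, rfl, by simpa using hs⟩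
    · have := hw b (Multiset.mem_cons_of_mem hb)
      have := Multiset.single_le_sum (fun _ _ => Nat.zero_le _) _ (Multiset.mem_map_of_mem w hb)
      exact .inr ⟨a, s, rfl, ha, by lia, by lia, fun x hx => hw x (Multiset.mem_cons_of_mem hx)⟩

theorem Multiset.exists_of_sum_eq_two {α : Type*} {w : α → ℕ} {s : Multiset α}
    (hw : ∀ x ∈ s, 0 < w x) (hs : (s.map w).sum = 2) :
    (∃ a, s = {a} ∧ w a = 2) ∨ ∃ a b, s = {a, b} ∧ w a = 1 ∧ w b = 1 := by
  obtain h | ⟨a, t, rfl, h0, h1, ht, hwt⟩ := Multiset.exists_cons_of_sum_pos hw hs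
  · exact .inl h
  · obtain ⟨b, rfl, hb⟩ := Multiset.exists_of_sum_eq_one hwt (by lia)
    exact .inr ⟨a, b, rfl, by lia, hb⟩

theorem Multiset.exists_of_sum_eq_three {α : Type*} {w : α → ℕ} {s : Multiset α}
    (hw : ∀ x ∈ s, 0 < w x) (hs : (s.map w).sum = 3) :
    (∃ a, s = {a} ∧ w a = 3) ∨ (∃ a b, s = {a, b} ∧ w a = 2 ∧ w b = 1) ∨
      ∃ a b c, s = {a, b, c} ∧ w a = 1 ∧ w b = 1 ∧ w c = 1 := by
  obtain h | ⟨a, t, rfl, h0, h1, ht, hwt⟩ := Multiset.exists_cons_of_sum_pos hw hs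
  · exact .inl h
  · obtain h1 | h2 : w a = 1 ∨ w a = 2 := by lia
    · obtain ⟨b, rfl, hb⟩ | ⟨b, c, rfl, hb, hc⟩ := Multiset.exists_of_sum_eq_two hwt (by lia)
      · exact .inr (.inl ⟨b, a, Multiset.pair_comm a b, hb, h1⟩)
      · exact .inr (.inr ⟨a, b, c, rfl, h1, hb, hc⟩)
    · obtain ⟨b, rfl, hb⟩ := Multiset.exists_of_sum_eq_one hwt (by lia)
      exact .inr (.inl ⟨a, b, rfl, h2, hb⟩)

theorem Multiset.exists_of_sum_eq_four {α : Type*} {w : α → ℕ} {s : Multiset α}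
    (hw : ∀ x ∈ s, 0 < w x) (hs : (s.map w).sum = 4) :
    (∃ a, s = {a} ∧ w a = 4) ∨ (∃ a b, s = {a, b} ∧ w a = 3 ∧ w b = 1) ∨
      (∃ a b, s = {a, b} ∧ w a = 2 ∧ w b = 2) ∨
      (∃ a b c, s = {a, b, c} ∧ w a = 2 ∧ w b = 1 ∧ w c = 1) ∨
      ∃ a b c d, s = {a, b, c, d} ∧ w a = 1 ∧ w b = 1 ∧ w c = 1 ∧ w d = 1 := by
  obtain h | ⟨a, t, rfl, h0, h1, ht, hwt⟩ := Multiset.exists_cons_of_sum_pos hw hs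
  · exact .inl h
  · obtain h1 | h2 | h3 : w a = 1 ∨ w a = 2 ∨ w a = 3 := by lia
    · obtain ⟨b, rfl, hb⟩ | ⟨b, c, rfl, hb, hc⟩ | ⟨b, c, d, rfl, hb, hc, hd⟩ :=
        Multiset.exists_of_sum_eq_three hwt (by lia)
      · exact .inr (.inl ⟨b, a, Multiset.pair_comm a b, hb, h1⟩)
      · exact .inr (.inr (.inr (.inl ⟨b, a, c, Multiset.cons_swap a b _, hb, h1, hc⟩)))
      · exact .inr (.inr (.inr (.inr ⟨a, b, c, d, rfl, h1, hb, hc, hd⟩)))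
    · obtain ⟨b, rfl, hb⟩ | ⟨b, c, rfl, hb, hc⟩ := Multiset.exists_of_sum_eq_two hwt (by lia)
      · exact .inr (.inr (.inl ⟨a, b, rfl, h2, hb⟩))
      · exact .inr (.inr (.inr (.inl ⟨a, b, c, rfl, h2, hb, hc⟩)))
    · obtain ⟨b, rfl, hb⟩ := Multiset.exists_of_sum_eq_one hwt (by lia)
      exact .inr (.inl ⟨a, b, rfl, h3, hb⟩)

theorem eq_linPoly {q : (ZMod p)[X]} (hq : q.Monic) (hX : q ≠ X) (hd : q.natDegree = 1) :
    ∃ b : ℤ, 0 < b ∧ b < p ∧ q = linPoly p b := by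
  obtain ⟨b, hb0, hb, h⟩ := exists_rep_cast (p := p) Fact.out (-q.coeff 0)
  have hqb : q = linPoly p b := by
    rw [hq.eq_X_add_C hd, linPoly, h]
    simp
  refine ⟨b, hb0.lt_of_ne ?_, hb, hqb⟩
  -- The value `b = 0` would make the polynomial equal to `X`, which an invertible matrix excludes.
  rintro rfl
  exact hX (hqb.trans (by simp [linPoly]))

theorem eq_quadPoly {q : (ZMod p)[X]} (hq : q.Monic) (hqi : Irreducible q)
    (hd : q.natDegree = 2) : ∃ b₀ b₁ : ℤ, IrrTwo p b₀ b₁ ∧ q = quadPoly p b₀ b₁ := by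
  obtain ⟨b₀, h0, hp0, h0'⟩ := exists_rep_cast (p := p) Fact.out (q.coeff 0)
  obtain ⟨b₁, h1, hp1, h1'⟩ := exists_rep_cast (p := p) Fact.out (q.coeff 1)
  have hqb : q = quadPoly p b₀ b₁ := by
    rw [quadPoly, h0', h1']
    conv_lhs => rw [hq.as_sum, hd]
    simp [Finset.sum_range_succ]
    ring
  exact ⟨b₀, b₁, ⟨⟨h0, hp0⟩, ⟨h1, hp1⟩, by rw [hqb] at hqi; exact hqi⟩, hqb⟩

theorem eq_cubicPoly {q : (ZMod p)[X]} (hq : q.Monic) (hqi : Irreducible q)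
    (hd : q.natDegree = 3) : ∃ b₀ b₁ b₂ : ℤ, IrrThree p b₀ b₁ b₂ ∧ q = cubicPoly p b₀ b₁ b₂ := by
  obtain ⟨b₀, h0, hp0, h0'⟩ := exists_rep_cast (p := p) Fact.out (q.coeff 0)
  obtain ⟨b₁, h1, hp1, h1'⟩ := exists_rep_cast (p := p) Fact.out (q.coeff 1)
  obtain ⟨b₂, h2, hp2, h2'⟩ := exists_rep_cast (p := p) Fact.out (q.coeff 2)
  have hqb : q = cubicPoly p b₀ b₁ b₂ := by
    rw [cubicPoly, h0', h1', h2']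
    conv_lhs => rw [hq.as_sum, hd]
    simp [Finset.sum_range_succ]
    ring
  exact ⟨b₀, b₁, b₂, ⟨⟨h0, hp0⟩, ⟨h1, hp1⟩, ⟨h2, hp2⟩, by rw [hqb] at hqi; exact hqi⟩, hqb⟩

theorem eq_quarticPoly {q : (ZMod p)[X]} (hq : q.Monic) (hqi : Irreducible q)
    (hd : q.natDegree = 4) :
    ∃ b₀ b₁ b₂ b₃ : ℤ, IrrFour p b₀ b₁ b₂ b₃ ∧ q = quarticPoly p b₀ b₁ b₂ b₃ := by
  obtain ⟨b₀, h0, hp0, h0'⟩ := exists_rep_cast (p := p) Fact.out (q.coeff 0)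
  obtain ⟨b₁, h1, hp1, h1'⟩ := exists_rep_cast (p := p) Fact.out (q.coeff 1)
  obtain ⟨b₂, h2, hp2, h2'⟩ := exists_rep_cast (p := p) Fact.out (q.coeff 2)
  obtain ⟨b₃, h3, hp3, h3'⟩ := exists_rep_cast (p := p) Fact.out (q.coeff 3)
  have hqb : q = quarticPoly p b₀ b₁ b₂ b₃ := by
    rw [quarticPoly, h0', h1', h2', h3']
    conv_lhs => rw [hq.as_sum, hd]
    simp [Finset.sum_range_succ]
    ring
  exact ⟨b₀, b₁, b₂, b₃, ⟨⟨h0, hp0⟩, ⟨h1, hp1⟩, ⟨h2, hp2⟩, ⟨h3, hp3⟩, by rw [hqb] at hqi; exact hqi⟩, hqb⟩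

/-- An elementary divisor of an invertible matrix. -/
def IsElemDiv (x : (ZMod p)[X] × ℕ) : Prop :=
  (x.1.Monic ∧ Irreducible x.1 ∧ 0 < x.2) ∧ x.1 ≠ X

theorem IsElemDiv.weight_one {x : (ZMod p)[X] × ℕ} (hx : IsElemDiv x)
    (hw : x.2 * x.1.natDegree = 1) : ∃ b : ℤ, 0 < b ∧ b < p ∧ x = (linPoly p b, 1) := by
  obtain ⟨q, e⟩ := x
  obtain ⟨rfl, hd⟩ : e = 1 ∧ q.natDegree = 1 := by simpa using hw
  obtain ⟨b, hb, hb', rfl⟩ := eq_linPoly hx.1.1 hx.2 hd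
  exact ⟨b, hb, hb', rfl⟩

theorem IsElemDiv.weight_two {x : (ZMod p)[X] × ℕ} (hx : IsElemDiv x)
    (hw : x.2 * x.1.natDegree = 2) : (∃ b : ℤ, 0 < b ∧ b < p ∧ x = (linPoly p b, 2)) ∨
      ∃ b₀ b₁, IrrTwo p b₀ b₁ ∧ x = (quadPoly p b₀ b₁, 1) := by
  obtain ⟨q, e⟩ := x
  change e * q.natDegree = 2 at hw
  have he : e ∣ 2 := Dvd.intro _ hw
  obtain rfl | rfl := (Nat.dvd_prime Nat.prime_two).1 he
  · obtain ⟨b₀, b₁, h, rfl⟩ := eq_quadPoly hx.1.1 hx.1.2.1 (by lia)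
    exact .inr ⟨b₀, b₁, h, rfl⟩
  · obtain ⟨b, hb, hb', rfl⟩ := eq_linPoly hx.1.1 hx.2 (by lia)
    exact .inl ⟨b, hb, hb', rfl⟩

theorem IsElemDiv.weight_three {x : (ZMod p)[X] × ℕ} (hx : IsElemDiv x)
    (hw : x.2 * x.1.natDegree = 3) : (∃ b : ℤ, 0 < b ∧ b < p ∧ x = (linPoly p b, 3)) ∨
      ∃ b₀ b₁ b₂, IrrThree p b₀ b₁ b₂ ∧ x = (cubicPoly p b₀ b₁ b₂, 1) := by
  obtain ⟨q, e⟩ := x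
  change e * q.natDegree = 3 at hw
  have he : e ∣ 3 := Dvd.intro _ hw
  obtain rfl | rfl := (Nat.dvd_prime Nat.prime_three).1 he
  · obtain ⟨b₀, b₁, b₂, h, rfl⟩ := eq_cubicPoly hx.1.1 hx.1.2.1 (by lia)
    exact .inr ⟨b₀, b₁, b₂, h, rfl⟩
  · obtain ⟨b, hb, hb', rfl⟩ := eq_linPoly hx.1.1 hx.2 (by lia)
    exact .inl ⟨b, hb, hb', rfl⟩

theorem IsElemDiv.weight_four {x : (ZMod p)[X] × ℕ} (hx : IsElemDiv x)
    (hw : x.2 * x.1.natDegree = 4) : (∃ b : ℤ, 0 < b ∧ b < p ∧ x = (linPoly p b, 4)) ∨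
      (∃ b₀ b₁, IrrTwo p b₀ b₁ ∧ x = (quadPoly p b₀ b₁, 2)) ∨
      ∃ b₀ b₁ b₂ b₃, IrrFour p b₀ b₁ b₂ b₃ ∧ x = (quarticPoly p b₀ b₁ b₂ b₃, 1) := by
  obtain ⟨q, e⟩ := x
  change e * q.natDegree = 4 at hw
  have he : e ≤ 4 := Nat.le_of_dvd (by lia) (Dvd.intro _ hw)
  interval_cases e
  · lia
  · obtain ⟨b₀, b₁, b₂, b₃, h, rfl⟩ := eq_quarticPoly hx.1.1 hx.1.2.1 (by lia)
    exact .inr (.inr ⟨b₀, b₁, b₂, b₃, h, rfl⟩)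
  · obtain ⟨b₀, b₁, h, rfl⟩ := eq_quadPoly hx.1.1 hx.1.2.1 (by lia)
    exact .inr (.inl ⟨b₀, b₁, h, rfl⟩)
  · lia
  · obtain ⟨b, hb, hb', rfl⟩ := eq_linPoly hx.1.1 hx.2 (by lia)
    exact .inl ⟨b, hb, hb', rfl⟩

theorem exists_hasMatElemDiv (hA : IsAut p e A) : ∃ s : Multiset ((ZMod p)[X] × ℕ),
    HasMatElemDiv p A s ∧ (s.map fun x => x.2 * x.1.natDegree).sum = k ∧
      (∀ x ∈ s, 0 < x.2 * x.1.natDegree) ∧ ∀ x ∈ s, IsElemDiv x := by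
  obtain ⟨s, hs⟩ := exists_hasElemDiv (ZMod p) (Module.AEval' (redEnd p A))
  exact ⟨s, hs, HasMatElemDiv.sum_eq hs, fun x hx => Nat.mul_pos (hs.1 x hx).2.2
    (hs.1 x hx).2.1.natDegree_pos, fun x hx => ⟨hs.1 x hx, HasMatElemDiv.ne_X hs hA.det x hx⟩⟩

end

end ClassificationModP

/-! ### Separating the rows for elementary abelian groups -/

section ClassificationModPRows

variable {p : ℕ} [Fact p.Prime]

/-- Conjugate matrices have equal elementary divisors, hence equal multisets of pairs (degree,
exponent). As the shapes in `σ` are distinct, matrices in different rows are never conjugate.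
Conversely, equal divisors give conjugacy, so exhaustion becomes a question about multisets. -/
theorem classifies_of_divShape {k : ℕ} {e : Fin k → ℕ} (he : ∀ i, e i = 1)
    {L : List (Set (Matrix (Fin k) (Fin k) ℤ) × ℚ)} {σ : List (Multiset (ℕ × ℕ))}
    (hL : List.Forall₂ (fun S τ => ∀ A ∈ S.1, ∃ s : Multiset ((ZMod p)[X] × ℕ),
      HasMatElemDiv p A s ∧ (∀ x ∈ s, x.1 ≠ X) ∧ s.map divShape = τ) L σ) (hσ : σ.Nodup)
    (hinj : ∀ S ∈ L, ∀ A ∈ S.1, ∀ B ∈ S.1, MatConj p e A B → A = B)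
    (hex : ∀ s : Multiset ((ZMod p)[X] × ℕ), (s.map fun x => x.2 * x.1.natDegree).sum = k →
      (∀ x ∈ s, 0 < x.2 * x.1.natDegree) → (∀ x ∈ s, IsElemDiv x) →
      ∃ S ∈ L, ∃ B ∈ S.1, HasMatElemDiv p B s) : Classifies p e L where
  isAut S hS A hA := by
    obtain ⟨i, hi, rfl⟩ := List.getElem_of_mem hS
    obtain ⟨s, hs, hsX, -⟩ := hL.get hi (hL.length_eq ▸ hi) A hA
    exact hs.isAut he hsX
  pairwise := by
    refine List.pairwise_of_forall₂ hL hσ ?_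
    rintro S T σ τ hS hT hστ A hA B hB h
    obtain ⟨s, hs, -, rfl⟩ := hS A hA
    obtain ⟨t, ht, -, rfl⟩ := hT B hB
    exact hστ (by rw [hs.eq_of_matConj he ht h])
  inj := hinj
  exhaust A hA := by
    obtain ⟨s, hs, h1, h2, h3⟩ := exists_hasMatElemDiv hA
    obtain ⟨S, hS, B, hB, hB'⟩ := hex s h1 h2 h3
    exact ⟨S, hS, B, hB, hs.matConj he hB'⟩

theorem Multiset.eq_of_pairwise_le {l m : List ℤ} (h : (l : Multiset ℤ) = m)
    (hl : l.Pairwise (· ≤ ·)) (hm : m.Pairwise (· ≤ ·)) : l = m :=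
  (Multiset.coe_eq_coe.1 h).eq_of_pairwise' hl hm

theorem Multiset.exists_pairwise_le_two (a b : ℤ) :
    ∃ a' b', ({a, b} : Multiset ℤ) = {a', b'} ∧ a' ≤ b' := by
  rcases le_total a b with h | h
  · exact ⟨a, b, rfl, h⟩
  · exact ⟨b, a, Multiset.pair_comm a b, h⟩

theorem Multiset.exists_pairwise_le_three (a b c : ℤ) :
    ∃ a' b' c', ({a, b, c} : Multiset ℤ) = {a', b', c'} ∧ a' ≤ b' ∧ b' ≤ c' := by
  have h1 := Multiset.sort_eq {a, b, c} (· ≤ ·)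
  have h2 := Multiset.pairwise_sort {a, b, c} (· ≤ ·)
  have h3 := Multiset.length_sort (s := {a, b, c}) (r := (· ≤ ·))
  obtain ⟨a', b', c', h⟩ := List.length_eq_three.1 h3
  rw [h] at h1 h2
  simp only [List.pairwise_cons, List.forall_mem_cons] at h2
  exact ⟨a', b', c', h1.symm, h2.1.1, h2.2.1.1⟩

theorem Multiset.exists_pairwise_le_four (a b c d : ℤ) :
    ∃ a' b' c' d', ({a, b, c, d} : Multiset ℤ) = {a', b', c', d'} ∧ a' ≤ b' ∧ b' ≤ c' ∧ c' ≤ d'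
      := by
  have h1 := Multiset.sort_eq {a, b, c, d} (· ≤ ·)
  have h2 := Multiset.pairwise_sort {a, b, c, d} (· ≤ ·)
  have h3 := Multiset.length_sort (s := {a, b, c, d}) (r := (· ≤ ·))
  generalize Multiset.sort {a, b, c, d} (· ≤ ·) = l at h1 h2 h3
  obtain ⟨a', l, rfl⟩ := List.exists_cons_of_length_pos (l := l) (by simp [h3])
  obtain ⟨b', c', d', rfl⟩ := List.length_eq_three.1 (Nat.succ.inj h3)
  simp only [List.pairwise_cons, List.forall_mem_cons] at h2
  exact ⟨a', b', c', d', h1.symm, h2.1.1, h2.2.1.1, h2.2.2.1.1⟩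

@[simp]
theorem linPart_zero (e : ℕ) : linPart e (0 : Multiset ((ZMod p)[X] × ℕ)) = 0 := rfl

@[simp]
theorem quadPart_zero (e : ℕ) : quadPart e (0 : Multiset ((ZMod p)[X] × ℕ)) = 0 := rfl

@[simp]
theorem cubicPart_zero : cubicPart (0 : Multiset ((ZMod p)[X] × ℕ)) = 0 := rfl

@[simp]
theorem quarticPart_zero : quarticPart (0 : Multiset ((ZMod p)[X] × ℕ)) = 0 := rfl

/-- The pairs either match in order or are interchanged; in the latter case antisymmetry of the
lexicographic order makes all of them equal. -/
theorem eq_of_lexLE {b₀ b₁ c₀ c₁ b₀' b₁' c₀' c₁' : ℤ}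
    (h : ({(b₀, b₁), (c₀, c₁)} : Multiset (ℤ × ℤ)) = {(b₀', b₁'), (c₀', c₁')})
    (hl : LexLE b₀ b₁ c₀ c₁) (hl' : LexLE b₀' b₁' c₀' c₁') :
    b₀ = b₀' ∧ b₁ = b₁' ∧ c₀ = c₀' ∧ c₁ = c₁' := by
  have h1 : (b₀, b₁) ∈ ({(b₀', b₁'), (c₀', c₁')} : Multiset (ℤ × ℤ)) := h ▸
    Multiset.mem_cons_self _ _
  simp only [Multiset.insert_eq_cons, Multiset.mem_cons, Multiset.mem_singleton] at h1
  rcases h1 with h1 | h1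
  · rw [h1] at h
    simp at h h1
    exact ⟨h1.1, h1.2, h.1, h.2⟩
  · rw [Multiset.pair_comm (b₀', b₁'), h1] at h
    simp at h h1
    simp only [LexLE] at hl hl'
    lia

theorem forall₂_auts11 : List.Forall₂ (fun S τ => ∀ A ∈ S.1, ∃ s : Multiset ((ZMod p)[X] × ℕ),
      HasMatElemDiv p A s ∧ (∀ x ∈ s, x.1 ≠ X) ∧ s.map divShape = τ) (auts11 p)
    [{(1, 1), (1, 1)}, {(1, 2)}, {(2, 1)}] := by
  simp only [auts11, isUnitRep_one_iff, List.forall₂_cons, List.Forall₂.nil, and_true]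
  refine ⟨?_, ?_, ?_⟩
  · rintro _ ⟨b, c, h0, hbc, h1, rfl⟩
    refine ⟨_, hasMatElemDiv_lin_lin b c, ?_, by simp⟩
    simp [linPoly_ne_X (p := p) (b := b) (by lia) (by lia), linPoly_ne_X (p := p) (b := c) (by
      lia) (by lia)]
  · rintro _ ⟨b, ⟨hb, hbp⟩, rfl⟩
    refine ⟨_, hasMatElemDiv_jordan_two b, ?_, by simp⟩
    simp [linPoly_ne_X (p := p) (b := b) hb hbp]
  · rintro _ ⟨b₀, b₁, hi0, rfl⟩
    refine ⟨_, hasMatElemDiv_quad hi0, ?_, by simp⟩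
    simp [ne_X_of_natDegree, natDegree_quadPoly]

/-- Conjugacy gives equal multisets of divisors. Extracting the part of a given shape recovers the
parameters, uniquely because repeated linear factors are listed in increasing order. -/
theorem inj_auts11 :
    ∀ S ∈ auts11 p, ∀ A ∈ S.1, ∀ B ∈ S.1, MatConj p ![1, 1] A B → A = B := by
  have he : ∀ i, ![1, 1] i = 1 := by decide
  have hr : ∀ {b : ℤ}, 0 < b → b < p → b % p = b := fun h h' => Int.emod_eq_of_lt h.le h'
  simp only [auts11, isUnitRep_one_iff, List.forall_mem_cons, List.not_mem_nil, IsEmpty.forall_iff,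
    implies_true, and_true]
  refine ⟨?_, ?_, ?_⟩
  · rintro _ ⟨b, c, h0, hbc, h1, rfl⟩ _ ⟨b', c', h0', hbc', h1', rfl⟩ h
    replace h := (hasMatElemDiv_lin_lin b c).eq_of_matConj he
      (hasMatElemDiv_lin_lin b' c') h
    have hl : ((([b, c] : List ℤ) : Multiset ℤ)) = ([b', c'] : List ℤ) := by
      simpa [linPart_cons, cast_neg_coeff_linPoly, ← Multiset.cons_zero, ← Multiset.cons_coe, hr
        (b := b) (by lia) (by lia), hr (b := c) (by lia) (by lia), hr (b := b') (by lia) (by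
        lia), hr (b := c') (by lia) (by lia)] using congrArg (linPart 1) h
    replace hl := Multiset.eq_of_pairwise_le hl (by simp; lia) (by simp; lia)
    obtain ⟨rfl, rfl⟩ : b = b' ∧ c = c' := by simpa using hl
    rfl
  · rintro _ ⟨b, ⟨hb, hbp⟩, rfl⟩ _ ⟨b', ⟨hb', hbp'⟩, rfl⟩ h
    replace h := (hasMatElemDiv_jordan_two b).eq_of_matConj he
      (hasMatElemDiv_jordan_two b') h
    obtain rfl : b = b' := by
      simpa [linPart_cons, cast_neg_coeff_linPoly, ← Multiset.cons_zero, hr (b := b) hb hbp, hr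
        (b := b') hb' hbp'] using congrArg (linPart 2) h
    rfl
  · rintro _ ⟨b₀, b₁, hi0, rfl⟩ _ ⟨b₀', b₁', hi0', rfl⟩ h
    replace h := (hasMatElemDiv_quad  hi0).eq_of_matConj he
      (hasMatElemDiv_quad  hi0') h
    obtain ⟨rfl, rfl⟩ : b₀ = b₀' ∧ b₁ = b₁' := by
      simpa [quadPart_cons, cast_coeff_quadPoly, ← Multiset.cons_zero, hi0.1.emod, hi0.2.1.emod,
        hi0'.1.emod, hi0'.2.1.emod] using congrArg (quadPart 1) h
    rfl

theorem forall₂_auts111 : List.Forall₂ (fun S τ => ∀ A ∈ S.1, ∃ s : Multiset ((ZMod p)[X] × ℕ),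
      HasMatElemDiv p A s ∧ (∀ x ∈ s, x.1 ≠ X) ∧ s.map divShape = τ) (auts111 p)
    [{(1, 1), (1, 1), (1, 1)}, {(1, 2), (1, 1)}, {(1, 3)}, {(3, 1)}, {(2, 1), (1, 1)}] := by
  simp only [auts111, isUnitRep_one_iff, List.forall₂_cons, List.Forall₂.nil, and_true]
  refine ⟨?_, ?_, ?_, ?_, ?_⟩
  · rintro _ ⟨b, c, d, h0, hbc, hcd, h1, rfl⟩
    refine ⟨_, hasMatElemDiv_lin_lin_lin b c d, ?_, by simp⟩
    simp [linPoly_ne_X (p := p) (b := b) (by lia) (by lia), linPoly_ne_X (p := p) (b := c) (by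
      lia) (by lia), linPoly_ne_X (p := p) (b := d) (by lia) (by lia)]
  · rintro _ ⟨b, c, ⟨hb, hbp⟩, ⟨hc, hcp⟩, rfl⟩
    refine ⟨_, hasMatElemDiv_jordan_two_lin b c, ?_, by simp⟩
    simp [linPoly_ne_X (p := p) (b := b) hb hbp, linPoly_ne_X (p := p) (b := c) hc hcp]
  · rintro _ ⟨b, ⟨hb, hbp⟩, rfl⟩
    refine ⟨_, hasMatElemDiv_jordan_three b, ?_, by simp⟩
    simp [linPoly_ne_X (p := p) (b := b) hb hbp]
  · rintro _ ⟨b₀, b₁, b₂, hi0, rfl⟩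
    refine ⟨_, hasMatElemDiv_cubic hi0, ?_, by simp⟩
    simp [ne_X_of_natDegree, natDegree_cubicPoly]
  · rintro _ ⟨b₀, b₁, c, hi0, ⟨hc, hcp⟩, rfl⟩
    refine ⟨_, hasMatElemDiv_quad_lin hi0, ?_, by simp⟩
    simp [ne_X_of_natDegree, natDegree_quadPoly, linPoly_ne_X (p := p) (b := c) hc hcp]

theorem inj_auts111 :
    ∀ S ∈ auts111 p, ∀ A ∈ S.1, ∀ B ∈ S.1, MatConj p ![1, 1, 1] A B → A = B := by
  have he : ∀ i, ![1, 1, 1] i = 1 := by decide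
  have hr : ∀ {b : ℤ}, 0 < b → b < p → b % p = b := fun h h' => Int.emod_eq_of_lt h.le h'
  simp only [auts111, isUnitRep_one_iff, List.forall_mem_cons, List.not_mem_nil, IsEmpty.forall_iff,
    implies_true, and_true]
  refine ⟨?_, ?_, ?_, ?_, ?_⟩
  · rintro _ ⟨b, c, d, h0, hbc, hcd, h1, rfl⟩ _ ⟨b', c', d', h0', hbc', hcd', h1', rfl⟩ h
    replace h := (hasMatElemDiv_lin_lin_lin b c d).eq_of_matConj he
      (hasMatElemDiv_lin_lin_lin b' c' d') h
    have hl : ((([b, c, d] : List ℤ) : Multiset ℤ)) = ([b', c', d'] : List ℤ) := by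
      simpa [linPart_cons, cast_neg_coeff_linPoly, ← Multiset.cons_zero, ← Multiset.cons_coe, hr
        (b := b) (by lia) (by lia), hr (b := c) (by lia) (by lia), hr (b := d) (by lia) (by
        lia), hr (b := b') (by lia) (by lia), hr (b := c') (by lia) (by lia), hr (b := d') (by
        lia) (by lia)] using congrArg (linPart 1) h
    replace hl := Multiset.eq_of_pairwise_le hl (by simp; lia) (by simp; lia)
    obtain ⟨rfl, rfl, rfl⟩ : b = b' ∧ c = c' ∧ d = d' := by simpa using hl
    rfl
  · rintro _ ⟨b, c, ⟨hb, hbp⟩, ⟨hc, hcp⟩, rfl⟩ _ ⟨b', c', ⟨hb', hbp'⟩, ⟨hc', hcp'⟩, rfl⟩ h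
    replace h := (hasMatElemDiv_jordan_two_lin b c).eq_of_matConj he
      (hasMatElemDiv_jordan_two_lin b' c') h
    obtain rfl : c = c' := by
      simpa [linPart_cons, cast_neg_coeff_linPoly, ← Multiset.cons_zero, hr (b := c) hc hcp, hr
        (b := c') hc' hcp'] using congrArg (linPart 1) h
    obtain rfl : b = b' := by
      simpa [linPart_cons, cast_neg_coeff_linPoly, ← Multiset.cons_zero, hr (b := b) hb hbp, hr
        (b := b') hb' hbp'] using congrArg (linPart 2) h
    rfl
  · rintro _ ⟨b, ⟨hb, hbp⟩, rfl⟩ _ ⟨b', ⟨hb', hbp'⟩, rfl⟩ h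
    replace h := (hasMatElemDiv_jordan_three b).eq_of_matConj he
      (hasMatElemDiv_jordan_three b') h
    obtain rfl : b = b' := by
      simpa [linPart_cons, cast_neg_coeff_linPoly, ← Multiset.cons_zero, hr (b := b) hb hbp, hr
        (b := b') hb' hbp'] using congrArg (linPart 3) h
    rfl
  · rintro _ ⟨b₀, b₁, b₂, hi0, rfl⟩ _ ⟨b₀', b₁', b₂', hi0', rfl⟩ h
    replace h := (hasMatElemDiv_cubic  hi0).eq_of_matConj he
      (hasMatElemDiv_cubic  hi0') h
    obtain ⟨rfl, rfl, rfl⟩ : b₀ = b₀' ∧ b₁ = b₁' ∧ b₂ = b₂' := by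
      simpa [cubicPart_cons, cast_coeff_cubicPoly, ← Multiset.cons_zero, hi0.1.emod,
        hi0.2.1.emod, hi0.2.2.1.emod, hi0'.1.emod, hi0'.2.1.emod, hi0'.2.2.1.emod] using
        congrArg (cubicPart) h
    rfl
  · rintro _ ⟨b₀, b₁, c, hi0, ⟨hc, hcp⟩, rfl⟩ _ ⟨b₀', b₁', c', hi0', ⟨hc', hcp'⟩, rfl⟩ h
    replace h := (hasMatElemDiv_quad_lin (c := c) hi0).eq_of_matConj he
      (hasMatElemDiv_quad_lin (c := c') hi0') h
    obtain rfl : c = c' := by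
      simpa [linPart_cons, cast_neg_coeff_linPoly, ← Multiset.cons_zero, hr (b := c) hc hcp, hr
        (b := c') hc' hcp'] using congrArg (linPart 1) h
    obtain ⟨rfl, rfl⟩ : b₀ = b₀' ∧ b₁ = b₁' := by
      simpa [quadPart_cons, cast_coeff_quadPoly, ← Multiset.cons_zero, hi0.1.emod, hi0.2.1.emod,
        hi0'.1.emod, hi0'.2.1.emod] using congrArg (quadPart 1) h
    rfl

theorem forall₂_auts1111 : List.Forall₂ (fun S τ => ∀ A ∈ S.1, ∃ s : Multiset ((ZMod p)[X] × ℕ),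
      HasMatElemDiv p A s ∧ (∀ x ∈ s, x.1 ≠ X) ∧ s.map divShape = τ) (auts1111 p)
    [{(1, 1), (1, 1), (1, 1), (1, 1)}, {(1, 2), (1, 1), (1, 1)}, {(1, 2), (1, 2)}, {(1, 3), (1,
      1)}, {(1, 4)}, {(2, 1), (2, 1)}, {(2, 2)}, {(4, 1)}, {(3, 1), (1, 1)}, {(2, 1), (1, 1),
      (1, 1)}, {(1, 2), (2, 1)}] := by
  simp only [auts1111, isUnitRep_one_iff, List.forall₂_cons, List.Forall₂.nil, and_true]
  refine ⟨?_, ?_, ?_, ?_, ?_, ?_, ?_, ?_, ?_, ?_, ?_⟩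
  · rintro _ ⟨b, c, d, e, h0, hbc, hcd, hde, h1, rfl⟩
    refine ⟨_, hasMatElemDiv_lin_lin_lin_lin b c d e, ?_, by simp⟩
    simp [linPoly_ne_X (p := p) (b := b) (by lia) (by lia), linPoly_ne_X (p := p) (b := c) (by
      lia) (by lia), linPoly_ne_X (p := p) (b := d) (by lia) (by lia), linPoly_ne_X (p := p) (b
      := e) (by lia) (by lia)]
  · rintro _ ⟨b, c, d, ⟨hb, hbp⟩, h0, hcd, h1, rfl⟩
    refine ⟨_, hasMatElemDiv_jordan_two_lin_lin b c d, ?_, by simp⟩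
    simp [linPoly_ne_X (p := p) (b := b) hb hbp, linPoly_ne_X (p := p) (b := c) (by lia) (by
      lia), linPoly_ne_X (p := p) (b := d) (by lia) (by lia)]
  · rintro _ ⟨b, c, h0, hbc, h1, rfl⟩
    refine ⟨_, hasMatElemDiv_jordan_two_jordan_two b c, ?_, by simp⟩
    simp [linPoly_ne_X (p := p) (b := b) (by lia) (by lia), linPoly_ne_X (p := p) (b := c) (by
      lia) (by lia)]
  · rintro _ ⟨b, c, ⟨hb, hbp⟩, ⟨hc, hcp⟩, rfl⟩
    refine ⟨_, hasMatElemDiv_jordan_three_lin b c, ?_, by simp⟩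
    simp [linPoly_ne_X (p := p) (b := b) hb hbp, linPoly_ne_X (p := p) (b := c) hc hcp]
  · rintro _ ⟨b, ⟨hb, hbp⟩, rfl⟩
    refine ⟨_, hasMatElemDiv_jordan_four b, ?_, by simp⟩
    simp [linPoly_ne_X (p := p) (b := b) hb hbp]
  · rintro _ ⟨b₀, b₁, c₀, c₁, hi0, hi1, hl, rfl⟩
    refine ⟨_, hasMatElemDiv_quad_quad hi0 hi1, ?_, by simp⟩
    simp [ne_X_of_natDegree, natDegree_quadPoly]
  · rintro _ ⟨b₀, b₁, hi0, rfl⟩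
    refine ⟨_, hasMatElemDiv_quad_sq hi0, ?_, by simp⟩
    simp [ne_X_of_natDegree, natDegree_quadPoly]
  · rintro _ ⟨b₀, b₁, b₂, b₃, hi0, rfl⟩
    refine ⟨_, hasMatElemDiv_quartic hi0, ?_, by simp⟩
    simp [ne_X_of_natDegree, natDegree_quarticPoly]
  · rintro _ ⟨b₀, b₁, b₂, c, hi0, ⟨hc, hcp⟩, rfl⟩
    refine ⟨_, hasMatElemDiv_cubic_lin hi0, ?_, by simp⟩
    simp [ne_X_of_natDegree, natDegree_cubicPoly, linPoly_ne_X (p := p) (b := c) hc hcp]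
  · rintro _ ⟨b₀, b₁, c, d, hi0, h0, hcd, h1, rfl⟩
    refine ⟨_, hasMatElemDiv_quad_lin_lin hi0, ?_, by simp⟩
    simp [ne_X_of_natDegree, natDegree_quadPoly, linPoly_ne_X (p := p) (b := c) (by lia) (by
      lia), linPoly_ne_X (p := p) (b := d) (by lia) (by lia)]
  · rintro _ ⟨b, c₀, c₁, ⟨hb, hbp⟩, hi0, rfl⟩
    refine ⟨_, hasMatElemDiv_jordan_two_quad hi0, ?_, by simp⟩
    simp [ne_X_of_natDegree, natDegree_quadPoly, linPoly_ne_X (p := p) (b := b) hb hbp]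

theorem inj_auts1111 :
    ∀ S ∈ auts1111 p, ∀ A ∈ S.1, ∀ B ∈ S.1, MatConj p ![1, 1, 1, 1] A B → A = B := by
  have he : ∀ i, ![1, 1, 1, 1] i = 1 := by decide
  have hr : ∀ {b : ℤ}, 0 < b → b < p → b % p = b := fun h h' => Int.emod_eq_of_lt h.le h'
  simp only [auts1111, isUnitRep_one_iff, List.forall_mem_cons, List.not_mem_nil,
    IsEmpty.forall_iff,
    implies_true, and_true]
  refine ⟨?_, ?_, ?_, ?_, ?_, ?_, ?_, ?_, ?_, ?_, ?_⟩
  · rintro _ ⟨b, c, d, e, h0, hbc, hcd, hde, h1, rfl⟩ _ ⟨b', c', d', e', h0', hbc', hcd', hde',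
    h1', rfl⟩ h
    replace h := (hasMatElemDiv_lin_lin_lin_lin b c d e).eq_of_matConj he
      (hasMatElemDiv_lin_lin_lin_lin b' c' d' e') h
    have hl : ((([b, c, d, e] : List ℤ) : Multiset ℤ)) = ([b', c', d', e'] : List ℤ) := by
      simpa [linPart_cons, cast_neg_coeff_linPoly, ← Multiset.cons_zero, ← Multiset.cons_coe, hr
        (b := b) (by lia) (by lia), hr (b := c) (by lia) (by lia), hr (b := d) (by lia) (by
        lia), hr (b := e) (by lia) (by lia), hr (b := b') (by lia) (by lia), hr (b := c') (by
        lia) (by lia), hr (b := d') (by lia) (by lia), hr (b := e') (by lia) (by lia)] using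
        congrArg (linPart 1) h
    replace hl := Multiset.eq_of_pairwise_le hl (by simp; lia) (by simp; lia)
    obtain ⟨rfl, rfl, rfl, rfl⟩ : b = b' ∧ c = c' ∧ d = d' ∧ e = e' := by simpa using hl
    rfl
  · rintro _ ⟨b, c, d, ⟨hb, hbp⟩, h0, hcd, h1, rfl⟩ _ ⟨b', c', d', ⟨hb', hbp'⟩, h0', hcd', h1',
    rfl⟩ h
    replace h := (hasMatElemDiv_jordan_two_lin_lin b c d).eq_of_matConj he
      (hasMatElemDiv_jordan_two_lin_lin b' c' d') h
    have hl : ((([c, d] : List ℤ) : Multiset ℤ)) = ([c', d'] : List ℤ) := by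
      simpa [linPart_cons, cast_neg_coeff_linPoly, ← Multiset.cons_zero, ← Multiset.cons_coe, hr
        (b := c) (by lia) (by lia), hr (b := d) (by lia) (by lia), hr (b := c') (by lia) (by
        lia), hr (b := d') (by lia) (by lia)] using congrArg (linPart 1) h
    replace hl := Multiset.eq_of_pairwise_le hl (by simp; lia) (by simp; lia)
    obtain ⟨rfl, rfl⟩ : c = c' ∧ d = d' := by simpa using hl
    obtain rfl : b = b' := by
      simpa [linPart_cons, cast_neg_coeff_linPoly, ← Multiset.cons_zero, hr (b := b) hb hbp, hr
        (b := b') hb' hbp'] using congrArg (linPart 2) h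
    rfl
  · rintro _ ⟨b, c, h0, hbc, h1, rfl⟩ _ ⟨b', c', h0', hbc', h1', rfl⟩ h
    replace h := (hasMatElemDiv_jordan_two_jordan_two b c).eq_of_matConj he
      (hasMatElemDiv_jordan_two_jordan_two b' c') h
    have hl : ((([b, c] : List ℤ) : Multiset ℤ)) = ([b', c'] : List ℤ) := by
      simpa [linPart_cons, cast_neg_coeff_linPoly, ← Multiset.cons_zero, ← Multiset.cons_coe, hr
        (b := b) (by lia) (by lia), hr (b := c) (by lia) (by lia), hr (b := b') (by lia) (by
        lia), hr (b := c') (by lia) (by lia)] using congrArg (linPart 2) h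
    replace hl := Multiset.eq_of_pairwise_le hl (by simp; lia) (by simp; lia)
    obtain ⟨rfl, rfl⟩ : b = b' ∧ c = c' := by simpa using hl
    rfl
  · rintro _ ⟨b, c, ⟨hb, hbp⟩, ⟨hc, hcp⟩, rfl⟩ _ ⟨b', c', ⟨hb', hbp'⟩, ⟨hc', hcp'⟩, rfl⟩ h
    replace h := (hasMatElemDiv_jordan_three_lin b c).eq_of_matConj he
      (hasMatElemDiv_jordan_three_lin b' c') h
    obtain rfl : c = c' := by
      simpa [linPart_cons, cast_neg_coeff_linPoly, ← Multiset.cons_zero, hr (b := c) hc hcp, hr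
        (b := c') hc' hcp'] using congrArg (linPart 1) h
    obtain rfl : b = b' := by
      simpa [linPart_cons, cast_neg_coeff_linPoly, ← Multiset.cons_zero, hr (b := b) hb hbp, hr
        (b := b') hb' hbp'] using congrArg (linPart 3) h
    rfl
  · rintro _ ⟨b, ⟨hb, hbp⟩, rfl⟩ _ ⟨b', ⟨hb', hbp'⟩, rfl⟩ h
    replace h := (hasMatElemDiv_jordan_four b).eq_of_matConj he
      (hasMatElemDiv_jordan_four b') h
    obtain rfl : b = b' := by
      simpa [linPart_cons, cast_neg_coeff_linPoly, ← Multiset.cons_zero, hr (b := b) hb hbp, hr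
        (b := b') hb' hbp'] using congrArg (linPart 4) h
    rfl
  · rintro _ ⟨b₀, b₁, c₀, c₁, hi0, hi1, hl, rfl⟩ _ ⟨b₀', b₁', c₀', c₁', hi0', hi1', hl', rfl⟩ h
    replace h := (hasMatElemDiv_quad_quad  hi0 hi1).eq_of_matConj he
      (hasMatElemDiv_quad_quad  hi0' hi1') h
    have hl₂ : ({(b₀, b₁), (c₀, c₁)} : Multiset (ℤ × ℤ)) = {(b₀', b₁'), (c₀', c₁')} := by
      simpa [quadPart_cons, cast_coeff_quadPoly, ← Multiset.cons_zero, hi0.1.emod, hi0.2.1.emod,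
        hi0'.1.emod, hi0'.2.1.emod, hi1.1.emod, hi1.2.1.emod, hi1'.1.emod, hi1'.2.1.emod] using
        congrArg (quadPart 1) h
    obtain ⟨rfl, rfl, rfl, rfl⟩ := eq_of_lexLE hl₂ hl hl'
    rfl
  · rintro _ ⟨b₀, b₁, hi0, rfl⟩ _ ⟨b₀', b₁', hi0', rfl⟩ h
    replace h := (hasMatElemDiv_quad_sq  hi0).eq_of_matConj he
      (hasMatElemDiv_quad_sq  hi0') h
    obtain ⟨rfl, rfl⟩ : b₀ = b₀' ∧ b₁ = b₁' := by
      simpa [quadPart_cons, cast_coeff_quadPoly, ← Multiset.cons_zero, hi0.1.emod, hi0.2.1.emod,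
        hi0'.1.emod, hi0'.2.1.emod] using congrArg (quadPart 2) h
    rfl
  · rintro _ ⟨b₀, b₁, b₂, b₃, hi0, rfl⟩ _ ⟨b₀', b₁', b₂', b₃', hi0', rfl⟩ h
    replace h := (hasMatElemDiv_quartic  hi0).eq_of_matConj he
      (hasMatElemDiv_quartic  hi0') h
    obtain ⟨rfl, rfl, rfl, rfl⟩ : b₀ = b₀' ∧ b₁ = b₁' ∧ b₂ = b₂' ∧ b₃ = b₃' := by
      simpa [quarticPart_cons, cast_coeff_quarticPoly, ← Multiset.cons_zero, hi0.1.emod,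
        hi0.2.1.emod, hi0.2.2.1.emod, hi0.2.2.2.1.emod, hi0'.1.emod, hi0'.2.1.emod,
        hi0'.2.2.1.emod, hi0'.2.2.2.1.emod] using congrArg (quarticPart) h
    rfl
  · rintro _ ⟨b₀, b₁, b₂, c, hi0, ⟨hc, hcp⟩, rfl⟩ _ ⟨b₀', b₁', b₂', c', hi0', ⟨hc', hcp'⟩, rfl⟩ h
    replace h := (hasMatElemDiv_cubic_lin (c := c) hi0).eq_of_matConj he
      (hasMatElemDiv_cubic_lin (c := c') hi0') h
    obtain rfl : c = c' := by
      simpa [linPart_cons, cast_neg_coeff_linPoly, ← Multiset.cons_zero, hr (b := c) hc hcp, hr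
        (b := c') hc' hcp'] using congrArg (linPart 1) h
    obtain ⟨rfl, rfl, rfl⟩ : b₀ = b₀' ∧ b₁ = b₁' ∧ b₂ = b₂' := by
      simpa [cubicPart_cons, cast_coeff_cubicPoly, ← Multiset.cons_zero, hi0.1.emod,
        hi0.2.1.emod, hi0.2.2.1.emod, hi0'.1.emod, hi0'.2.1.emod, hi0'.2.2.1.emod] using
        congrArg (cubicPart) h
    rfl
  · rintro _ ⟨b₀, b₁, c, d, hi0, h0, hcd, h1, rfl⟩ _ ⟨b₀', b₁', c', d', hi0', h0', hcd', h1', rfl⟩ h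
    replace h := (hasMatElemDiv_quad_lin_lin (c := c) (d := d) hi0).eq_of_matConj he
      (hasMatElemDiv_quad_lin_lin (c := c') (d := d') hi0') h
    have hl : ((([c, d] : List ℤ) : Multiset ℤ)) = ([c', d'] : List ℤ) := by
      simpa [linPart_cons, cast_neg_coeff_linPoly, ← Multiset.cons_zero, ← Multiset.cons_coe, hr
        (b := c) (by lia) (by lia), hr (b := d) (by lia) (by lia), hr (b := c') (by lia) (by
        lia), hr (b := d') (by lia) (by lia)] using congrArg (linPart 1) h
    replace hl := Multiset.eq_of_pairwise_le hl (by simp; lia) (by simp; lia)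
    obtain ⟨rfl, rfl⟩ : c = c' ∧ d = d' := by simpa using hl
    obtain ⟨rfl, rfl⟩ : b₀ = b₀' ∧ b₁ = b₁' := by
      simpa [quadPart_cons, cast_coeff_quadPoly, ← Multiset.cons_zero, hi0.1.emod, hi0.2.1.emod,
        hi0'.1.emod, hi0'.2.1.emod] using congrArg (quadPart 1) h
    rfl
  · rintro _ ⟨b, c₀, c₁, ⟨hb, hbp⟩, hi0, rfl⟩ _ ⟨b', c₀', c₁', ⟨hb', hbp'⟩, hi0', rfl⟩ h
    replace h := (hasMatElemDiv_jordan_two_quad (b := b) hi0).eq_of_matConj he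
      (hasMatElemDiv_jordan_two_quad (b := b') hi0') h
    obtain rfl : b = b' := by
      simpa [linPart_cons, cast_neg_coeff_linPoly, ← Multiset.cons_zero, hr (b := b) hb hbp, hr
        (b := b') hb' hbp'] using congrArg (linPart 2) h
    obtain ⟨rfl, rfl⟩ : c₀ = c₀' ∧ c₁ = c₁' := by
      simpa [quadPart_cons, cast_coeff_quadPoly, ← Multiset.cons_zero, hi0.1.emod, hi0.2.1.emod,
        hi0'.1.emod, hi0'.2.1.emod] using congrArg (quadPart 1) h
    rfl

end ClassificationModPRows

/-! ### Every admissible multiset of elementary divisors occurs -/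

section ExhaustModP

variable {p : ℕ} [Fact p.Prime]

theorem forall_mem_of_eq {α : Type*} {s t : Multiset α} {P : α → Prop} (h : s = t)
    (hs : ∀ x ∈ s, P x) : ∀ x ∈ t, P x :=
  h ▸ hs

theorem exhaust_auts11 (s : Multiset ((ZMod p)[X] × ℕ))
    (hs : (s.map fun x => x.2 * x.1.natDegree).sum = 2)
    (hpos : ∀ x ∈ s, 0 < x.2 * x.1.natDegree) (hx : ∀ x ∈ s, IsElemDiv x) :
    ∃ S ∈ auts11 p, ∃ B ∈ S.1, HasMatElemDiv p B s := by
  simp only [auts11, isUnitRep_one_iff, List.mem_cons, exists_eq_or_imp, List.not_mem_nil,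
    or_false, exists_eq_left]
  obtain ⟨x, rfl, hw⟩ | ⟨x, y, rfl, hw, hw'⟩ := Multiset.exists_of_sum_eq_two hpos hs
  · obtain ⟨b, h0, h1, rfl⟩ | ⟨b₀, b₁, h, rfl⟩ := (hx x (by simp)).weight_two hw
    · exact .inr (.inl ⟨_, ⟨b, ⟨h0, h1⟩, rfl⟩, hasMatElemDiv_jordan_two b⟩)
    · exact .inr (.inr ⟨_, ⟨b₀, b₁, h, rfl⟩, hasMatElemDiv_quad h⟩)
  · obtain ⟨b, hb, hb', rfl⟩ := (hx x (by simp)).weight_one hw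
    obtain ⟨c, hc, hc', rfl⟩ := (hx y (by simp)).weight_one hw'
    obtain ⟨b', c', h, hbc⟩ := Multiset.exists_pairwise_le_two b c
    -- The bounds are transported through the equality of multisets, so it does not matter which
    -- root ends up in which place after sorting.
    have h1 := forall_mem_of_eq h (P := fun x => 0 < x ∧ x < (p : ℤ)) (by simp [hb, hb', hc, hc'])
    have h2 := congrArg (Multiset.map fun b => (linPoly p b, 1)) h
    simp at h1 h2
    simp only [Multiset.insert_eq_cons, h2]
    exact .inl ⟨_, ⟨b', c', by lia, hbc, by lia, rfl⟩, hasMatElemDiv_lin_lin b' c'⟩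

theorem exhaust_auts111 (s : Multiset ((ZMod p)[X] × ℕ))
    (hs : (s.map fun x => x.2 * x.1.natDegree).sum = 3)
    (hpos : ∀ x ∈ s, 0 < x.2 * x.1.natDegree) (hx : ∀ x ∈ s, IsElemDiv x) :
    ∃ S ∈ auts111 p, ∃ B ∈ S.1, HasMatElemDiv p B s := by
  simp only [auts111, isUnitRep_one_iff, List.mem_cons, exists_eq_or_imp, List.not_mem_nil,
    or_false, exists_eq_left]
  obtain ⟨x, rfl, hw⟩ | ⟨x, y, rfl, hw, hw'⟩ | ⟨x, y, z, rfl, hw, hw', hw''⟩ :=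
    Multiset.exists_of_sum_eq_three hpos hs
  · obtain ⟨b, h0, h1, rfl⟩ | ⟨b₀, b₁, b₂, h, rfl⟩ := (hx x (by simp)).weight_three hw
    · exact .inr (.inr (.inl ⟨_, ⟨b, ⟨h0, h1⟩, rfl⟩, hasMatElemDiv_jordan_three b⟩))
    · exact .inr (.inr (.inr (.inl ⟨_, ⟨b₀, b₁, b₂, h, rfl⟩, hasMatElemDiv_cubic h⟩)))
  · obtain ⟨c, hc, hc', rfl⟩ := (hx y (by simp)).weight_one hw'
    obtain ⟨b, h0, h1, rfl⟩ | ⟨b₀, b₁, h, rfl⟩ := (hx x (by simp)).weight_two hw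
    · exact .inr (.inl ⟨_, ⟨b, c, ⟨h0, h1⟩, ⟨hc, hc'⟩, rfl⟩, hasMatElemDiv_jordan_two_lin b c⟩)
    · exact .inr (.inr (.inr (.inr ⟨_, ⟨b₀, b₁, c, h, ⟨hc, hc'⟩, rfl⟩, hasMatElemDiv_quad_lin h⟩)))
  · obtain ⟨b, hb, hb', rfl⟩ := (hx x (by simp)).weight_one hw
    obtain ⟨c, hc, hc', rfl⟩ := (hx y (by simp)).weight_one hw'
    obtain ⟨d, hd, hd', rfl⟩ := (hx z (by simp)).weight_one hw''
    obtain ⟨b', c', d', h, hbc, hcd⟩ := Multiset.exists_pairwise_le_three b c d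
    have h1 := forall_mem_of_eq h (P := fun x => 0 < x ∧ x < (p : ℤ)) (by simp [hb, hb', hc, hc', hd, hd'])
    have h2 := congrArg (Multiset.map fun b => (linPoly p b, 1)) h
    simp at h1 h2
    simp only [Multiset.insert_eq_cons, h2]
    exact .inl ⟨_, ⟨b', c', d', by lia, hbc, hcd, by lia, rfl⟩, hasMatElemDiv_lin_lin_lin b' c' d'⟩

theorem lexLE_total (b₀ b₁ c₀ c₁ : ℤ) : LexLE b₀ b₁ c₀ c₁ ∨ LexLE c₀ c₁ b₀ b₁ := by
  unfold LexLE
  lia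

theorem exhaust_auts1111 (s : Multiset ((ZMod p)[X] × ℕ))
    (hs : (s.map fun x => x.2 * x.1.natDegree).sum = 4)
    (hpos : ∀ x ∈ s, 0 < x.2 * x.1.natDegree) (hx : ∀ x ∈ s, IsElemDiv x) :
    ∃ S ∈ auts1111 p, ∃ B ∈ S.1, HasMatElemDiv p B s := by
  simp only [auts1111, isUnitRep_one_iff, List.mem_cons, exists_eq_or_imp, List.not_mem_nil,
    or_false, exists_eq_left]
  obtain ⟨x, rfl, hw⟩ | ⟨x, y, rfl, hw, hw'⟩ | ⟨x, y, rfl, hw, hw'⟩ | ⟨x, y, z, rfl, hw, hw', hw''⟩ |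
    ⟨x, y, z, t, rfl, hw, hw', hw'', hw₃⟩ := Multiset.exists_of_sum_eq_four hpos hs
  · obtain ⟨b, h0, h1, rfl⟩ | ⟨b₀, b₁, h, rfl⟩ | ⟨b₀, b₁, b₂, b₃, h, rfl⟩ :=
      (hx x (by simp)).weight_four hw
    · iterate 4 right
      exact .inl ⟨_, ⟨b, ⟨h0, h1⟩, rfl⟩, hasMatElemDiv_jordan_four b⟩
    · iterate 6 right
      exact .inl ⟨_, ⟨b₀, b₁, h, rfl⟩, hasMatElemDiv_quad_sq h⟩
    · iterate 7 right
      exact .inl ⟨_, ⟨b₀, b₁, b₂, b₃, h, rfl⟩, hasMatElemDiv_quartic h⟩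
  · obtain ⟨c, hc, hc', rfl⟩ := (hx y (by simp)).weight_one hw'
    obtain ⟨b, h0, h1, rfl⟩ | ⟨b₀, b₁, b₂, h, rfl⟩ := (hx x (by simp)).weight_three hw
    · iterate 3 right
      exact .inl ⟨_, ⟨b, c, ⟨h0, h1⟩, ⟨hc, hc'⟩, rfl⟩, hasMatElemDiv_jordan_three_lin b c⟩
    · iterate 8 right
      exact .inl ⟨_, ⟨b₀, b₁, b₂, c, h, ⟨hc, hc'⟩, rfl⟩, hasMatElemDiv_cubic_lin h⟩
  · obtain ⟨b, hb, hb', rfl⟩ | ⟨b₀, b₁, h, rfl⟩ := (hx x (by simp)).weight_two hw <;>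
      obtain ⟨c, hc, hc', rfl⟩ | ⟨c₀, c₁, h', rfl⟩ := (hx y (by simp)).weight_two hw'
    · iterate 2 right
      obtain hbc | hbc := le_total b c
      · exact .inl ⟨_, ⟨b, c, hb, hbc, hc', rfl⟩, hasMatElemDiv_jordan_two_jordan_two b c⟩
      · rw [Multiset.pair_comm]
        exact .inl ⟨_, ⟨c, b, hc, hbc, hb', rfl⟩, hasMatElemDiv_jordan_two_jordan_two c b⟩
    · iterate 10 right
      exact ⟨_, ⟨b, c₀, c₁, ⟨hb, hb'⟩, h', rfl⟩, hasMatElemDiv_jordan_two_quad h'⟩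
    · rw [Multiset.pair_comm]
      iterate 10 right
      exact ⟨_, ⟨c, b₀, b₁, ⟨hc, hc'⟩, h, rfl⟩, hasMatElemDiv_jordan_two_quad h⟩
    · iterate 5 right
      obtain hbc | hbc := lexLE_total b₀ b₁ c₀ c₁
      · exact .inl ⟨_, ⟨b₀, b₁, c₀, c₁, h, h', hbc, rfl⟩, hasMatElemDiv_quad_quad h h'⟩
      · rw [Multiset.pair_comm]
        exact .inl ⟨_, ⟨c₀, c₁, b₀, b₁, h', h, hbc, rfl⟩, hasMatElemDiv_quad_quad h' h⟩
  · obtain ⟨c, hc, hc', rfl⟩ := (hx y (by simp)).weight_one hw'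
    obtain ⟨d, hd, hd', rfl⟩ := (hx z (by simp)).weight_one hw''
    obtain ⟨c', d', h, hcd⟩ := Multiset.exists_pairwise_le_two c d
    have h1 := forall_mem_of_eq h (P := fun x => 0 < x ∧ x < (p : ℤ)) (by simp [hc, hc', hd, hd'])
    have h2 := congrArg (Multiset.map fun b => (linPoly p b, 1)) h
    simp at h1 h2
    simp only [Multiset.insert_eq_cons, h2]
    obtain ⟨b, h0, h1, rfl⟩ | ⟨b₀, b₁, h, rfl⟩ := (hx x (by simp)).weight_two hw
    · right
      exact .inl ⟨_, ⟨b, c', d', ⟨h0, h1⟩, by lia, hcd, by lia, rfl⟩,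
        hasMatElemDiv_jordan_two_lin_lin b c' d'⟩
    · iterate 9 right
      exact .inl ⟨_, ⟨b₀, b₁, c', d', h, by lia, hcd, by lia, rfl⟩, hasMatElemDiv_quad_lin_lin h⟩
  · obtain ⟨b, hb, hb', rfl⟩ := (hx x (by simp)).weight_one hw
    obtain ⟨c, hc, hc', rfl⟩ := (hx y (by simp)).weight_one hw'
    obtain ⟨d, hd, hd', rfl⟩ := (hx z (by simp)).weight_one hw''
    obtain ⟨e, he, he', rfl⟩ := (hx t (by simp)).weight_one hw₃
    obtain ⟨b', c', d', e', h, hbc, hcd, hde⟩ := Multiset.exists_pairwise_le_four b c d e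
    have h1 := forall_mem_of_eq h (P := fun x => 0 < x ∧ x < (p : ℤ)) (by simp [hb, hb', hc, hc', hd, hd', he, he'])
    have h2 := congrArg (Multiset.map fun b => (linPoly p b, 1)) h
    simp at h1 h2
    simp only [Multiset.insert_eq_cons, h2]
    exact .inl ⟨_, ⟨b', c', d', e', by lia, hbc, hcd, hde, by lia, rfl⟩,
      hasMatElemDiv_lin_lin_lin_lin b' c' d' e'⟩

theorem classifies_auts11 : Classifies p ![1, 1] (auts11 p) :=
  classifies_of_divShape (by decide) forall₂_auts11 (by decide) inj_auts11 exhaust_auts11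

theorem classifies_auts111 : Classifies p ![1, 1, 1] (auts111 p) :=
  classifies_of_divShape (by decide) forall₂_auts111 (by decide) inj_auts111 exhaust_auts111

theorem classifies_auts1111 : Classifies p ![1, 1, 1, 1] (auts1111 p) :=
  classifies_of_divShape (by decide) forall₂_auts1111 (by decide) inj_auts1111 exhaust_auts1111

end ExhaustModP

/-! ### Counting monic irreducible polynomials over a finite field -/

section IrreducibleCount

variable {K : Type} [Field K] [Finite K]

/-- The monic irreducible polynomials of degree `d`. -/
def monicIrreducible (K : Type) [Field K] (d : ℕ) : Set K[X] :=
  {q | q.Monic ∧ Irreducible q ∧ q.natDegree = d}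

theorem finite_monicIrreducible (d : ℕ) : (monicIrreducible K d).Finite := by
  have : Finite (degreeLT K (d + 1)) := Module.finite_of_finite K
  refine (Set.toFinite (degreeLT K (d + 1) : Set K[X])).subset fun q hq => ?_
  rw [SetLike.mem_coe, mem_degreeLT, degree_eq_natDegree hq.1.ne_zero, hq.2.2]
  exact_mod_cast Nat.lt_succ_self d

/-- As its degree divides that of the extension, `q` divides `X ^ |L| - X` and so splits in `L`. It
is separable because `K` is perfect, hence has as many distinct roots as its degree, and each root
has minimal polynomial `q`. -/
theorem card_filter_minpoly_eq {L : Type} [Field L] [Fintype L] [Algebra K L] [DecidableEq K[X]]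
    {q : K[X]} (hq : q.Monic) (hqi : Irreducible q) (hd : q.natDegree ∣ Module.finrank K L) :
    (Finset.univ.filter fun x : L => minpoly K x = q).card = q.natDegree := by
  classical
  have hs : (q.map (algebraMap K L)).Splits := by
    have hdvd := hqi.natDegree_dvd_iff_dvd_X_pow_card_pow_sub_X.1 hd
    rw [← Module.natCard_eq_pow_finrank (K := K) (V := L)] at hdvd
    have hsp : ((X ^ Nat.card L - X : K[X]).map (algebraMap K L)).Splits := by
      rw [← Fintype.card_eq_nat_card]
      exact (FiniteField.isSplittingField_sub L K).splits
    refine hsp.of_dvd ?_ (Polynomial.map_dvd (algebraMap K L) hdvd)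
    exact (Polynomial.map_ne_zero_iff (algebraMap K L).injective).2
      (FiniteField.X_pow_card_sub_X_ne_zero K Finite.one_lt_card)
  have hsep : q.Separable := PerfectField.separable_of_irreducible hqi
  have hroots : (Finset.univ.filter fun x : L => minpoly K x = q) = (q.aroots L).toFinset := by
    ext x
    rw [Finset.mem_filter, Multiset.mem_toFinset, mem_aroots]
    constructor
    · rintro ⟨-, rfl⟩
      exact ⟨hq.ne_zero, minpoly.aeval K x⟩
    · rintro ⟨-, hx⟩
      exact ⟨Finset.mem_univ x, (minpoly.eq_of_irreducible_of_monic hqi hx hq).symm⟩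
  rw [hroots, Multiset.toFinset_card_of_nodup (nodup_aroots_iff_of_splits hq.ne_zero hs |>.2 hsep),
    aroots_def, ← hs.natDegree_eq_card_roots, natDegree_map]

/-- The elements of `L` are sorted by minimal polynomial: its degree `d` divides `n`, and each
irreducible polynomial of such a degree accounts for exactly `d` elements. -/
theorem sum_mul_ncard_monicIrreducible_eq_card {L : Type} [Field L] [Finite L] [Algebra K L]
    {n : ℕ} [NeZero n] (hn : Module.finrank K L = n) :
    ∑ d ∈ n.divisors, d * (monicIrreducible K d).ncard = Nat.card L := by
  classical
  have := Fintype.ofFinite L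
  have : Module.Finite K L := Module.Finite.of_finite
  let F : ℕ → Finset K[X] := fun d => (finite_monicIrreducible (K := K) d).toFinset
  have hF {d : ℕ} {q : K[X]} : q ∈ F d ↔ q.Monic ∧ Irreducible q ∧ q.natDegree = d := by
    simp [F, monicIrreducible]
  have hmaps : ∀ x ∈ (Finset.univ : Finset L), minpoly K x ∈ n.divisors.biUnion F := by
    intro x _
    have hx : IsIntegral K x := IsIntegral.of_finite K x
    refine Finset.mem_biUnion.2 ⟨(minpoly K x).natDegree, ?_,
      hF.2 ⟨minpoly.monic hx, minpoly.irreducible hx, rfl⟩⟩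
    rw [Nat.mem_divisors, ← hn]
    exact ⟨minpoly.degree_dvd hx, hn ▸ NeZero.ne n⟩
  have hdisj : (n.divisors : Set ℕ).PairwiseDisjoint F := by
    intro d _ d' _ hne
    refine Finset.disjoint_left.2 fun q hq hq' => hne ?_
    rw [← (hF.1 hq).2.2, (hF.1 hq').2.2]
  rw [Nat.card_eq_fintype_card, ← Finset.card_univ, Finset.card_eq_sum_card_fiberwise hmaps,
    Finset.sum_biUnion hdisj]
  refine Finset.sum_congr rfl fun d hd => ?_
  have hfib : ∀ q ∈ F d, (Finset.univ.filter fun x : L => minpoly K x = q).card = d := by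
    intro q hq
    obtain ⟨hm, hi, hqd⟩ := hF.1 hq
    rw [card_filter_minpoly_eq hm hi (by rw [hqd, hn]; exact Nat.dvd_of_mem_divisors hd), hqd]
  rw [Finset.sum_congr rfl hfib, Finset.sum_const, smul_eq_mul, mul_comm,
    Set.ncard_eq_toFinset_card _ (finite_monicIrreducible d)]

theorem sum_mul_ncard_monicIrreducible (n : ℕ) [NeZero n] :
    ∑ d ∈ n.divisors, d * (monicIrreducible K d).ncard = Nat.card K ^ n := by
  obtain ⟨p, hp⟩ := CharP.exists K
  have : Fact p.Prime := ⟨CharP.char_is_prime K p⟩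
  rw [sum_mul_ncard_monicIrreducible_eq_card (FiniteField.finrank_extension K p n),
    FiniteField.natCard_extension K p n]

end IrreducibleCount

section

variable {p : ℕ} [Fact p.Prime]

theorem ncard_monicIrreducible_one : ((monicIrreducible (ZMod p) 1).ncard : ℚ) = p := by
  have h := sum_mul_ncard_monicIrreducible (K := ZMod p) 1
  rw [Nat.divisors_one, Finset.sum_singleton, Nat.card_zmod] at h
  exact_mod_cast (by lia : (monicIrreducible (ZMod p) 1).ncard = p)

theorem ncard_monicIrreducible_two :
    ((monicIrreducible (ZMod p) 2).ncard : ℚ) = (p ^ 2 - p) / 2 := by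
  have h := sum_mul_ncard_monicIrreducible (K := ZMod p) 2
  rw [show Nat.divisors 2 = {1, 2} from rfl, Finset.sum_pair (by lia), Nat.card_zmod] at h
  have h' : (1 * (monicIrreducible (ZMod p) 1).ncard + 2 * (monicIrreducible (ZMod p) 2).ncard : ℚ)
    = p ^ 2 := by exact_mod_cast h
  rw [ncard_monicIrreducible_one] at h'
  linarith

theorem ncard_monicIrreducible_three :
    ((monicIrreducible (ZMod p) 3).ncard : ℚ) = (p ^ 3 - p) / 3 := by
  have h := sum_mul_ncard_monicIrreducible (K := ZMod p) 3
  rw [show Nat.divisors 3 = {1, 3} from rfl, Finset.sum_pair (by lia), Nat.card_zmod] at h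
  have h' : (1 * (monicIrreducible (ZMod p) 1).ncard + 3 * (monicIrreducible (ZMod p) 3).ncard : ℚ)
    = p ^ 3 := by exact_mod_cast h
  rw [ncard_monicIrreducible_one] at h'
  linarith

theorem ncard_monicIrreducible_four :
    ((monicIrreducible (ZMod p) 4).ncard : ℚ) = (p ^ 4 - p ^ 2) / 4 := by
  have h := sum_mul_ncard_monicIrreducible (K := ZMod p) 4
  rw [show Nat.divisors 4 = {1, 2, 4} from rfl, Finset.sum_insert (by decide),
    Finset.sum_pair (by lia), Nat.card_zmod] at h
  have h' : (1 * (monicIrreducible (ZMod p) 1).ncard + (2 * (monicIrreducible (ZMod p) 2).ncard +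
    4 * (monicIrreducible (ZMod p) 4).ncard) : ℚ) = p ^ 4 := by exact_mod_cast h
  rw [ncard_monicIrreducible_one, ncard_monicIrreducible_two] at h'
  linarith

end

/-! ### A calculus of finite cardinalities with rational values -/

/-- The set `S` is finite and has `n` elements. -/
def HasCount {α : Type*} (S : Set α) (n : ℚ) : Prop := S.Finite ∧ (S.ncard : ℚ) = n

namespace HasCount

variable {α β : Type*} {S : Set α} {T : Set β} {m n : ℚ}

theorem congr (h : HasCount S m) (hmn : m = n) : HasCount S n := hmn ▸ h

theorem prod (hS : HasCount S m) (hT : HasCount T n) : HasCount (S ×ˢ T) (m * n) :=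
  ⟨hS.1.prod hT.1, by rw [Set.ncard_prod, Nat.cast_mul, hS.2, hT.2]⟩

theorem image (hS : HasCount S n) {f : α → β} (hf : Set.InjOn f S) (hT : f '' S = T) :
    HasCount T n := by
  subst hT
  exact ⟨hS.1.image f, by rw [hf.ncard_image, hS.2]⟩

theorem union {S' : Set α} (hS : HasCount S m) (hS' : HasCount S' n) (h : Disjoint S S') :
    HasCount (S ∪ S') (m + n) :=
  ⟨hS.1.union hS'.1, by rw [Set.ncard_union_eq h hS.1 hS'.1, Nat.cast_add, hS.2, hS'.2]⟩

theorem diff {S' : Set α} (hS : HasCount S m) (hS' : HasCount S' n) (h : S' ⊆ S) :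
    HasCount (S \ S') (m - n) := by
  refine ⟨hS.1.sdiff, ?_⟩
  have := Set.ncard_sdiff_add_ncard_of_subset h hS.1
  rw [← hS.2, ← hS'.2, ← this]
  push_cast
  ring

/-- The ordered pairs of elements of a finite set, with respect to a total order. -/
theorem pairs_le (hS : HasCount S n) (r : α → α → Prop) (hr : ∀ a b, r a b ∨ r b a)
    (ha : ∀ a b, r a b → r b a → a = b) :
    HasCount {x : α × α | x.1 ∈ S ∧ x.2 ∈ S ∧ r x.1 x.2} ((n ^ 2 + n) / 2) := by
  have hSS := hS.prod hS
  have hle : HasCount {x : α × α | x.1 ∈ S ∧ x.2 ∈ S ∧ r x.1 x.2}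
      ({x : α × α | x.1 ∈ S ∧ x.2 ∈ S ∧ r x.1 x.2}.ncard : ℚ) :=
    ⟨hSS.1.subset fun x hx => ⟨hx.1, hx.2.1⟩, rfl⟩
  have hdiag : HasCount {x : α × α | x.1 ∈ S ∧ x.1 = x.2} n := by
    refine hS.image (f := fun a => (a, a)) (fun a _ b _ h => (Prod.mk.inj h).1) ?_
    ext ⟨a, b⟩
    simp only [Set.mem_image, Set.mem_ofPred_eq, Prod.mk.injEq]
    constructor
    · rintro ⟨c, hc, rfl, rfl⟩
      exact ⟨hc, rfl⟩
    · rintro ⟨h, rfl⟩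
      exact ⟨a, h, rfl, rfl⟩
  have hlt := hle.diff hdiag fun x hx => by
    obtain ⟨hx, hx'⟩ := hx
    exact ⟨hx, hx' ▸ hx, hx' ▸ (hr x.1 x.1).elim id id⟩
  -- Swapping coordinates maps the strictly ordered pairs onto the pairs that are not ordered. If
  -- `N` pairs are ordered, then `N - n = n ^ 2 - N`, which gives the formula.
  have hgt : HasCount (S ×ˢ S \ {x : α × α | x.1 ∈ S ∧ x.2 ∈ S ∧ r x.1 x.2})
      ({x : α × α | x.1 ∈ S ∧ x.2 ∈ S ∧ r x.1 x.2}.ncard - n : ℚ) := by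
    refine hlt.image (f := Prod.swap) (Prod.swap_injective.injOn) ?_
    ext ⟨a, b⟩
    simp only [Set.image_swap_eq_preimage_swap, Set.mem_preimage, Prod.swap_prod_mk, Set.mem_sdiff,
      Set.mem_ofPred_eq, Set.mem_prod]
    constructor
    · rintro ⟨⟨h1, h2, h3⟩, h4⟩
      exact ⟨⟨h2, h1⟩, fun h => h4 ⟨h1, ha _ _ h3 h.2.2⟩⟩
    · rintro ⟨⟨h1, h2⟩, h3⟩
      have h3' : ¬ r a b := fun h => h3 ⟨h1, h2, h⟩
      exact ⟨⟨h2, h1, (hr a b).resolve_left h3'⟩, by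
        rintro ⟨-, rfl⟩
        exact h3' ((hr b b).elim id id)⟩
  have h := hgt.2
  have h' := (hSS.diff hle fun x hx => ⟨hx.1, hx.2.1⟩).2
  refine hle.congr ?_
  rw [h] at h'
  linarith

end HasCount

/-! ### Sizes of the parameter sets -/

section BaseCounts

theorem hasCount_Ico (N : ℕ) : HasCount {b : ℤ | 0 ≤ b ∧ b < N} N := by
  have h : {b : ℤ | 0 ≤ b ∧ b < N} = (Finset.Ico (0 : ℤ) N : Finset ℤ) := by
    ext b
    simp
  rw [h]
  exact ⟨Finset.finite_toSet _, by rw [Set.ncard_coe_finset]; simp⟩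

theorem hasCount_isRep (p : ℕ) : HasCount {b : ℤ | IsRep p b} p := hasCount_Ico p

theorem hasCount_isUnitRep_succ {p : ℕ} (hp : p.Prime) (e : ℕ) :
    HasCount {b : ℤ | IsUnitRep p (e + 1) b} (p ^ (e + 1) - p ^ e) := by
  have hp0 : (0 : ℤ) < p := mod_cast hp.pos
  -- Nonunits are the multiples of `p`, in bijection with `[0, p ^ e)`; they are removed from the
  -- full interval.
  have hmul : HasCount {b : ℤ | 0 ≤ b ∧ b < (p ^ (e + 1) : ℕ) ∧ (p : ℤ) ∣ b} (p ^ e : ℕ) := by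
    refine (hasCount_Ico (p ^ e)).image (f := fun b => p * b)
      (mul_right_injective₀ hp0.ne').injOn ?_
    ext b
    simp only [Set.mem_image, Set.mem_ofPred_eq, Nat.cast_pow, pow_succ']
    constructor
    · rintro ⟨c, ⟨h0, h1⟩, rfl⟩
      exact ⟨by positivity, mul_lt_mul_of_pos_left h1 hp0, dvd_mul_right _ _⟩
    · rintro ⟨h0, h1, c, rfl⟩
      exact ⟨c, ⟨nonneg_of_mul_nonneg_right h0 hp0, lt_of_mul_lt_mul_left h1 hp0.le⟩, rfl⟩
  have h := (hasCount_Ico (p ^ (e + 1))).diff hmul fun b hb => ⟨hb.1, hb.2.1⟩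
  convert h.congr (n := (p : ℚ) ^ (e + 1) - p ^ e) (by push_cast; ring) using 1
  ext b
  simp only [IsUnitRep, Set.mem_sdiff, Set.mem_ofPred_eq, Nat.cast_pow]
  tauto

theorem hasCount_isUnitRep_one {p : ℕ} (hp : p.Prime) :
    HasCount {b : ℤ | IsUnitRep p 1 b} (p - 1) :=
  (hasCount_isUnitRep_succ hp 0).congr (by ring)

theorem hasCount_isUnitRep_two {p : ℕ} (hp : p.Prime) :
    HasCount {b : ℤ | IsUnitRep p 2 b} (p ^ 2 - p) :=
  (hasCount_isUnitRep_succ hp 1).congr (by ring)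

theorem hasCount_pos_lt {p : ℕ} (hp : p.Prime) : HasCount {b : ℤ | 0 < b ∧ b < p} (p - 1) := by
  convert hasCount_isUnitRep_one hp using 1
  ext b
  exact isUnitRep_one_iff.symm

theorem hasCount_pos_lt_sq {p : ℕ} (hp : p.Prime) :
    HasCount {b : ℤ | 0 < b ∧ b < p ^ 2 ∧ ¬ (p : ℤ) ∣ b} (p ^ 2 - p) := by
  convert hasCount_isUnitRep_two hp using 1
  ext b
  simp only [IsUnitRep, Set.mem_ofPred_eq]
  constructor
  · rintro ⟨h0, h⟩
    exact ⟨h0.le, h⟩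
  · rintro ⟨h0, h1, h2⟩
    refine ⟨lt_of_le_of_ne h0 ?_, h1, h2⟩
    rintro rfl
    exact h2 (dvd_zero _)

/-- Raising the bound by one adds the tuples whose last entry is `n`, which are counted by the
remaining entries; Pascal's rule sums the layers. The longer tuples below are counted in the same
way. -/
theorem hasCount_sorted_two (n : ℕ) :
    HasCount {x : ℤ × ℤ | 0 < x.1 ∧ x.1 ≤ x.2 ∧ x.2 < n} (n.choose 2 : ℕ) := by
  induction n with
  | zero =>
    have h : {x : ℤ × ℤ | 0 < x.1 ∧ x.1 ≤ x.2 ∧ x.2 < (0 : ℕ)} = ∅ := by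
      ext x
      simp only [Set.mem_ofPred_eq, Set.mem_empty_iff_false]
      lia
    rw [h]
    exact ⟨Set.finite_empty, by simp⟩
  | succ n ih =>
    have hn : HasCount {b : ℤ | 0 < b ∧ b < (n + 1 : ℕ)} n :=
      (hasCount_Ico n).image (f := fun b => b + 1) (fun a _ b _ h => by simpa using h) (by
        ext b
        simp only [Set.mem_image, Set.mem_ofPred_eq]
        exact ⟨by rintro ⟨c, hc, rfl⟩; lia, fun h => ⟨b - 1, by lia, by lia⟩⟩)
    have himage : HasCount {x : ℤ × ℤ | 0 < x.1 ∧ x.1 ≤ x.2 ∧ x.2 = n} n :=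
      hn.image (f := fun b => (b, (n : ℤ))) (fun a _ b _ h => by simpa using h) (by
        ext ⟨b, c⟩
        simp only [Set.mem_image, Set.mem_ofPred_eq, Prod.mk.injEq]
        exact ⟨by rintro ⟨b, hb, rfl, rfl⟩; lia, fun h => ⟨b, by lia, rfl, by lia⟩⟩)
    convert (ih.union himage ?_).congr (n := ((n + 1).choose 2 : ℕ)) ?_ using 1
    · ext x
      simp only [Set.mem_union, Set.mem_ofPred_eq]
      lia
    · refine Set.disjoint_left.2 fun x hx hx' => ?_
      simp only [Set.mem_ofPred_eq] at hx hx'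
      lia
    · rw [Nat.choose_succ_succ' n 1, Nat.choose_one_right]
      push_cast
      ring

theorem hasCount_sorted_three (n : ℕ) :
    HasCount {x : ℤ × ℤ × ℤ | 0 < x.1 ∧ x.1 ≤ x.2.1 ∧ x.2.1 ≤ x.2.2 ∧ x.2.2 < n}
      ((n + 1).choose 3 : ℕ) := by
  induction n with
  | zero =>
    have h : {x : ℤ × ℤ × ℤ | 0 < x.1 ∧ x.1 ≤ x.2.1 ∧ x.2.1 ≤ x.2.2 ∧ x.2.2 < (0 : ℕ)} = ∅ := by
      ext x
      simp only [Set.mem_ofPred_eq, Set.mem_empty_iff_false]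
      lia
    rw [h]
    exact ⟨Set.finite_empty, by simp [Nat.choose]⟩
  | succ n ih =>
    have himage : HasCount {x : ℤ × ℤ × ℤ | 0 < x.1 ∧ x.1 ≤ x.2.1 ∧ x.2.1 ≤ x.2.2 ∧ x.2.2 = n}
        ((n + 1).choose 2 : ℕ) :=
      (hasCount_sorted_two (n + 1)).image (f := fun x => (x.1, x.2, (n : ℤ)))
        (fun a _ b _ h => by simpa [Prod.ext_iff] using h) (by
        ext ⟨b, c, d⟩
        simp only [Set.mem_image, Set.mem_ofPred_eq, Prod.mk.injEq, Prod.exists]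
        exact ⟨by rintro ⟨b, c, hb, rfl, rfl, rfl⟩; lia,
          fun h => ⟨b, c, by lia, rfl, rfl, by lia⟩⟩)
    convert (ih.union himage ?_).congr (n := ((n + 1 + 1).choose 3 : ℕ)) ?_ using 1
    · ext x
      simp only [Set.mem_union, Set.mem_ofPred_eq]
      lia
    · refine Set.disjoint_left.2 fun x hx hx' => ?_
      simp only [Set.mem_ofPred_eq] at hx hx'
      lia
    · rw [Nat.choose_succ_succ' (n + 1) 2]
      push_cast
      ring

theorem hasCount_sorted_four (n : ℕ) :
    HasCount {x : ℤ × ℤ × ℤ × ℤ | 0 < x.1 ∧ x.1 ≤ x.2.1 ∧ x.2.1 ≤ x.2.2.1 ∧ x.2.2.1 ≤ x.2.2.2 ∧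
      x.2.2.2 < n} ((n + 2).choose 4 : ℕ) := by
  induction n with
  | zero =>
    have h : {x : ℤ × ℤ × ℤ × ℤ | 0 < x.1 ∧ x.1 ≤ x.2.1 ∧ x.2.1 ≤ x.2.2.1 ∧ x.2.2.1 ≤ x.2.2.2 ∧
        x.2.2.2 < (0 : ℕ)} = ∅ := by
      ext x
      simp only [Set.mem_ofPred_eq, Set.mem_empty_iff_false]
      lia
    rw [h]
    exact ⟨Set.finite_empty, by simp [Nat.choose]⟩
  | succ n ih =>
    have himage : HasCount {x : ℤ × ℤ × ℤ × ℤ | 0 < x.1 ∧ x.1 ≤ x.2.1 ∧ x.2.1 ≤ x.2.2.1 ∧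
        x.2.2.1 ≤ x.2.2.2 ∧ x.2.2.2 = n} ((n + 2).choose 3 : ℕ) :=
      (hasCount_sorted_three (n + 1)).image (f := fun x => (x.1, x.2.1, x.2.2, (n : ℤ)))
        (fun a _ b _ h => by simpa [Prod.ext_iff] using h) (by
        ext ⟨b, c, d, e⟩
        simp only [Set.mem_image, Set.mem_ofPred_eq, Prod.mk.injEq, Prod.exists]
        exact ⟨by rintro ⟨b, c, d, hb, rfl, rfl, rfl, rfl⟩; lia,
          fun h => ⟨b, c, d, by lia, rfl, rfl, rfl, by lia⟩⟩)
    convert (ih.union himage ?_).congr (n := ((n + 1 + 2).choose 4 : ℕ)) ?_ using 1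
    · ext x
      simp only [Set.mem_union, Set.mem_ofPred_eq]
      lia
    · refine Set.disjoint_left.2 fun x hx hx' => ?_
      simp only [Set.mem_ofPred_eq] at hx hx'
      lia
    · rw [show n + 1 + 2 = n + 2 + 1 by ring, Nat.choose_succ_succ' (n + 2) 3]
      push_cast
      ring

theorem hasCount_ne {p : ℕ} (hp : p.Prime) :
    HasCount {x : ℤ × ℤ | (0 < x.1 ∧ x.1 < p) ∧ IsUnitRep p 1 x.2 ∧ x.1 ≠ x.2}
      ((p - 1) * (p - 2)) := by
  have hdiag : HasCount {x : ℤ × ℤ | (0 < x.1 ∧ x.1 < p) ∧ x.1 = x.2} (p - 1) := by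
    refine (hasCount_pos_lt hp).image (f := fun a => (a, a)) (fun a _ b _ h => (Prod.mk.inj h).1) ?_
    ext ⟨a, b⟩
    simp only [Set.mem_image, Set.mem_ofPred_eq, Prod.mk.injEq]
    exact ⟨by rintro ⟨c, hc, rfl, rfl⟩; exact ⟨hc, rfl⟩, fun h => ⟨a, h.1, rfl, h.2⟩⟩
  convert (((hasCount_pos_lt hp).prod (hasCount_pos_lt hp)).diff hdiag ?_).congr
    (n := ((p - 1) * (p - 2) : ℚ)) (by ring) using 1
  · ext x
    simp only [isUnitRep_one_iff, Set.mem_sdiff, Set.mem_prod, Set.mem_ofPred_eq]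
    tauto
  · rintro x ⟨hx, hx'⟩
    exact ⟨hx, hx' ▸ hx⟩

variable {p : ℕ} [Fact p.Prime]

/-- Reading off canonical representatives of the lower coefficients identifies the monic irreducible
polynomials with the admissible parameter tuples. -/
theorem hasCount_irrTwo : HasCount {x : ℤ × ℤ | IrrTwo p x.1 x.2} ((p ^ 2 - p) / 2) := by
  have h : HasCount (monicIrreducible (ZMod p) 2) ((p ^ 2 - p) / 2) :=
    ⟨finite_monicIrreducible 2, ncard_monicIrreducible_two⟩
  have hr : ∀ b₀ b₁ : ℤ, IrrTwo p b₀ b₁ → ((((quadPoly p b₀ b₁).coeff 0).cast : ℤ),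
      (((quadPoly p b₀ b₁).coeff 1).cast : ℤ)) = (b₀, b₁) := fun b₀ b₁ hb => by
    rw [(cast_coeff_quadPoly b₀ b₁).1, (cast_coeff_quadPoly b₀ b₁).2, hb.1.emod, hb.2.1.emod]
  refine h.image (f := fun q => (((q.coeff 0).cast : ℤ), ((q.coeff 1).cast : ℤ))) ?_ ?_
  · rintro q ⟨hq, hqi, hd⟩ q' ⟨hq', hqi', hd'⟩ hqq
    obtain ⟨b₀, b₁, hb, rfl⟩ := eq_quadPoly hq hqi hd
    obtain ⟨c₀, c₁, hc, rfl⟩ := eq_quadPoly hq' hqi' hd'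
    obtain ⟨rfl, rfl⟩ := Prod.mk.inj ((hr _ _ hb).symm.trans (hqq.trans (hr _ _ hc)))
    rfl
  · ext ⟨b₀, b₁⟩
    constructor
    · rintro ⟨q, ⟨hq, hqi, hd⟩, hqb⟩
      obtain ⟨c₀, c₁, hc, rfl⟩ := eq_quadPoly hq hqi hd
      obtain ⟨rfl, rfl⟩ := Prod.mk.inj (hqb.symm.trans (hr _ _ hc))
      exact hc
    · intro hb
      exact ⟨quadPoly p b₀ b₁, ⟨monic_quadPoly _ _, hb.irreducible, natDegree_quadPoly _ _⟩,
        hr _ _ hb⟩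

theorem hasCount_irrThree :
    HasCount {x : ℤ × ℤ × ℤ | IrrThree p x.1 x.2.1 x.2.2} ((p ^ 3 - p) / 3) := by
  have h : HasCount (monicIrreducible (ZMod p) 3) ((p ^ 3 - p) / 3) :=
    ⟨finite_monicIrreducible 3, ncard_monicIrreducible_three⟩
  have hr : ∀ b₀ b₁ b₂ : ℤ, IrrThree p b₀ b₁ b₂ → ((((cubicPoly p b₀ b₁ b₂).coeff 0).cast : ℤ),
      (((cubicPoly p b₀ b₁ b₂).coeff 1).cast : ℤ), (((cubicPoly p b₀ b₁ b₂).coeff 2).cast : ℤ)) =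
      (b₀, b₁, b₂) := fun b₀ b₁ b₂ hb => by
    obtain ⟨h0, h1, h2⟩ := cast_coeff_cubicPoly (p := p) b₀ b₁ b₂
    rw [h0, h1, h2, hb.1.emod, hb.2.1.emod, hb.2.2.1.emod]
  refine h.image (f := fun q =>
    (((q.coeff 0).cast : ℤ), ((q.coeff 1).cast : ℤ), ((q.coeff 2).cast : ℤ))) ?_ ?_
  · rintro q ⟨hq, hqi, hd⟩ q' ⟨hq', hqi', hd'⟩ hqq
    obtain ⟨b₀, b₁, b₂, hb, rfl⟩ := eq_cubicPoly hq hqi hd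
    obtain ⟨c₀, c₁, c₂, hc, rfl⟩ := eq_cubicPoly hq' hqi' hd'
    have := (hr _ _ _ hb).symm.trans (hqq.trans (hr _ _ _ hc))
    simp only [Prod.mk.injEq] at this
    obtain ⟨rfl, rfl, rfl⟩ := this
    rfl
  · ext ⟨b₀, b₁, b₂⟩
    constructor
    · rintro ⟨q, ⟨hq, hqi, hd⟩, hqb⟩
      obtain ⟨c₀, c₁, c₂, hc, rfl⟩ := eq_cubicPoly hq hqi hd
      have := hqb.symm.trans (hr _ _ _ hc)
      simp only [Prod.mk.injEq] at this
      obtain ⟨rfl, rfl, rfl⟩ := this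
      exact hc
    · intro hb
      exact ⟨cubicPoly p b₀ b₁ b₂,
        ⟨monic_cubicPoly _ _ _, hb.2.2.2, natDegree_cubicPoly _ _ _⟩, hr _ _ _ hb⟩

theorem hasCount_irrFour :
    HasCount {x : ℤ × ℤ × ℤ × ℤ | IrrFour p x.1 x.2.1 x.2.2.1 x.2.2.2} ((p ^ 4 - p ^ 2) / 4) := by
  have h : HasCount (monicIrreducible (ZMod p) 4) ((p ^ 4 - p ^ 2) / 4) :=
    ⟨finite_monicIrreducible 4, ncard_monicIrreducible_four⟩
  have hr : ∀ b₀ b₁ b₂ b₃ : ℤ, IrrFour p b₀ b₁ b₂ b₃ →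
      ((((quarticPoly p b₀ b₁ b₂ b₃).coeff 0).cast : ℤ),
      (((quarticPoly p b₀ b₁ b₂ b₃).coeff 1).cast : ℤ),
      (((quarticPoly p b₀ b₁ b₂ b₃).coeff 2).cast : ℤ),
      (((quarticPoly p b₀ b₁ b₂ b₃).coeff 3).cast : ℤ)) =
      (b₀, b₁, b₂, b₃) := fun b₀ b₁ b₂ b₃ hb => by
    obtain ⟨h0, h1, h2, h3⟩ := cast_coeff_quarticPoly (p := p) b₀ b₁ b₂ b₃
    rw [h0, h1, h2, h3, hb.1.emod, hb.2.1.emod, hb.2.2.1.emod, hb.2.2.2.1.emod]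
  refine h.image (f := fun q => (((q.coeff 0).cast : ℤ), ((q.coeff 1).cast : ℤ),
    ((q.coeff 2).cast : ℤ), ((q.coeff 3).cast : ℤ))) ?_ ?_
  · rintro q ⟨hq, hqi, hd⟩ q' ⟨hq', hqi', hd'⟩ hqq
    obtain ⟨b₀, b₁, b₂, b₃, hb, rfl⟩ := eq_quarticPoly hq hqi hd
    obtain ⟨c₀, c₁, c₂, c₃, hc, rfl⟩ := eq_quarticPoly hq' hqi' hd'
    have := (hr _ _ _ _ hb).symm.trans (hqq.trans (hr _ _ _ _ hc))
    simp only [Prod.mk.injEq] at this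
    obtain ⟨rfl, rfl, rfl, rfl⟩ := this
    rfl
  · ext ⟨b₀, b₁, b₂, b₃⟩
    constructor
    · rintro ⟨q, ⟨hq, hqi, hd⟩, hqb⟩
      obtain ⟨c₀, c₁, c₂, c₃, hc, rfl⟩ := eq_quarticPoly hq hqi hd
      have := hqb.symm.trans (hr _ _ _ _ hc)
      simp only [Prod.mk.injEq] at this
      obtain ⟨rfl, rfl, rfl, rfl⟩ := this
      exact hc
    · intro hb
      exact ⟨quarticPoly p b₀ b₁ b₂ b₃,
        ⟨monic_quarticPoly _ _ _ _, hb.2.2.2.2, natDegree_quarticPoly _ _ _ _⟩, hr _ _ _ _ hb⟩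

end BaseCounts

/-! ### Sizes of the rows -/

section RowCounts

set_option linter.unusedSimpArgs false

variable {p : ℕ} [Fact p.Prime]

theorem hasCount_lexLE_irrTwo : HasCount {x : (ℤ × ℤ) × ℤ × ℤ | IrrTwo p x.1.1 x.1.2 ∧
    IrrTwo p x.2.1 x.2.2 ∧ LexLE x.1.1 x.1.2 x.2.1 x.2.2}
    ((((p ^ 2 - p) / 2) ^ 2 + (p ^ 2 - p) / 2) / 2) :=
  hasCount_irrTwo.pairs_le (fun a b => LexLE a.1 a.2 b.1 b.2)
    (fun a b => by simp only [LexLE]; lia) fun a b => by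
      simp only [LexLE, Prod.ext_iff]
      lia

/-- A table entry divides inside a binomial coefficient, in `ℕ`; the division is exact because `p *
(p - 1)` is even. -/
theorem cast_sq_sub_half (p : ℕ) : (((p ^ 2 - p) / 2 : ℕ) : ℚ) = (p ^ 2 - p) / 2 := by
  have h : 2 ∣ p ^ 2 - p := by
    rw [sq, ← Nat.mul_sub_one]
    exact (Nat.even_mul_pred_self p).two_dvd
  rw [Nat.cast_div h (by norm_num), Nat.cast_sub (Nat.le_self_pow two_ne_zero p)]
  push_cast
  rfl

theorem cast_mul_pred {p : ℕ} (hp : p.Prime) : ((p * (p - 1) : ℕ) : ℚ) = p * (p - 1) := by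
  rw [Nat.cast_mul, Nat.cast_sub hp.one_le, Nat.cast_one]

theorem hasCount_tableOne : ∀ r ∈ tableOne p, HasCount r.matrices r.total := by
  have hp : p.Prime := Fact.out
  have hp0 : (p : ℤ) ≠ 0 := mod_cast hp.ne_zero
  simp only [tableOne, List.forall_mem_cons, List.not_mem_nil, false_imp_iff,
    imp_true_iff, and_true]
  · refine ((hasCount_isUnitRep_one hp).congr ?_).image
      (f := fun x => !![x]) ?_ ?_
    · ring
    · intro x _ y _ h
      simp_all [Prod.ext_iff, Matrix.ext_iff.symm, Fin.forall_fin_succ]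
    · ext A
      simp only [Set.mem_image, Set.mem_prod, Set.mem_ofPred_eq, Prod.exists, and_assoc,
        eq_comm (a := A)]

theorem hasCount_tableTwo : ∀ r ∈ tableTwo p, HasCount r.matrices r.total := by
  have hp : p.Prime := Fact.out
  have hp0 : (p : ℤ) ≠ 0 := mod_cast hp.ne_zero
  simp only [tableTwo, List.forall_mem_cons, List.not_mem_nil, false_imp_iff,
    imp_true_iff, and_true]
  refine ⟨?_, ?_, ?_, ?_⟩
  · refine ((hasCount_isUnitRep_two hp).congr ?_).image
      (f := fun x => !![x]) ?_ ?_
    · ring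
    · intro x _ y _ h
      simp_all [Prod.ext_iff, Matrix.ext_iff.symm, Fin.forall_fin_succ]
    · ext A
      simp only [Set.mem_image, Set.mem_prod, Set.mem_ofPred_eq, Prod.exists, and_assoc,
        eq_comm (a := A)]
  · refine ((hasCount_sorted_two p).congr ?_).image
      (f := fun x => !![x.1, 0; 0, x.2]) ?_ ?_
    · rfl
    · intro x _ y _ h
      simp_all [Prod.ext_iff, Matrix.ext_iff.symm, Fin.forall_fin_succ]
    · ext A
      simp only [Set.mem_image, Set.mem_prod, Set.mem_ofPred_eq, Prod.exists, and_assoc,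
        eq_comm (a := A)]
  · refine ((hasCount_isUnitRep_one hp).congr ?_).image
      (f := fun x => !![x, 1; 0, x]) ?_ ?_
    · ring
    · intro x _ y _ h
      simp_all [Prod.ext_iff, Matrix.ext_iff.symm, Fin.forall_fin_succ]
    · ext A
      simp only [Set.mem_image, Set.mem_prod, Set.mem_ofPred_eq, Prod.exists, and_assoc,
        eq_comm (a := A)]
  · refine ((hasCount_irrTwo (p := p)).congr ?_).image
      (f := fun x => !![0, 1; -x.1, -x.2]) ?_ ?_
    · ring
    · intro x _ y _ h
      simp_all [Prod.ext_iff, Matrix.ext_iff.symm, Fin.forall_fin_succ]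
    · ext A
      simp only [Set.mem_image, Set.mem_prod, Set.mem_ofPred_eq, Prod.exists, and_assoc,
        eq_comm (a := A)]

theorem hasCount_tableThree : ∀ r ∈ tableThree p, HasCount r.matrices r.total := by
  have hp : p.Prime := Fact.out
  have hp0 : (p : ℤ) ≠ 0 := mod_cast hp.ne_zero
  simp only [tableThree, List.forall_mem_cons, List.not_mem_nil, false_imp_iff,
    imp_true_iff, and_true]
  refine ⟨?_, ?_, ?_, ?_, ?_, ?_, ?_, ?_, ?_⟩
  · refine ((hasCount_isUnitRep_succ hp 2).congr ?_).image
      (f := fun x => !![x]) ?_ ?_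
    · ring
    · intro x _ y _ h
      simp_all [Prod.ext_iff, Matrix.ext_iff.symm, Fin.forall_fin_succ]
    · ext A
      simp only [Set.mem_image, Set.mem_prod, Set.mem_ofPred_eq, Prod.exists, and_assoc,
        eq_comm (a := A)]
  · refine (((hasCount_isUnitRep_two hp).prod (hasCount_isUnitRep_one hp)).congr ?_).image
      (f := fun x => !![x.1, 0; 0, x.2]) ?_ ?_
    · ring
    · intro x _ y _ h
      simp_all [Prod.ext_iff, Matrix.ext_iff.symm, Fin.forall_fin_succ]
    · ext A
      simp only [Set.mem_image, Set.mem_prod, Set.mem_ofPred_eq, Prod.exists, and_assoc,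
        eq_comm (a := A)]
  · refine ((hasCount_pos_lt hp).congr ?_).image
      (f := fun x => !![x, 0; 1, x]) ?_ ?_
    · ring
    · intro x _ y _ h
      simp_all [Prod.ext_iff, Matrix.ext_iff.symm, Fin.forall_fin_succ]
    · ext A
      simp only [Set.mem_image, Set.mem_prod, Set.mem_ofPred_eq, Prod.exists, and_assoc,
        eq_comm (a := A)]
  · refine (((hasCount_pos_lt hp).prod (hasCount_isRep p)).congr ?_).image
      (f := fun x => !![x.1, p; x.2, x.1]) ?_ ?_
    · ring
    · intro x _ y _ h
      simp_all [Prod.ext_iff, Matrix.ext_iff.symm, Fin.forall_fin_succ]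
    · ext A
      simp only [Set.mem_image, Set.mem_prod, Set.mem_ofPred_eq, Prod.exists, and_assoc,
        eq_comm (a := A)]
  · refine ((hasCount_sorted_three p).congr ?_).image
      (f := fun x => !![x.1, 0, 0; 0, x.2.1, 0; 0, 0, x.2.2]) ?_ ?_
    · ring
    · intro x _ y _ h
      simp_all [Prod.ext_iff, Matrix.ext_iff.symm, Fin.forall_fin_succ]
    · ext A
      simp only [Set.mem_image, Set.mem_prod, Set.mem_ofPred_eq, Prod.exists, and_assoc,
        eq_comm (a := A)]
  · refine (((hasCount_isUnitRep_one hp).prod (hasCount_isUnitRep_one hp)).congr ?_).image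
      (f := fun x => !![x.1, 1, 0; 0, x.1, 0; 0, 0, x.2]) ?_ ?_
    · ring
    · intro x _ y _ h
      simp_all [Prod.ext_iff, Matrix.ext_iff.symm, Fin.forall_fin_succ]
    · ext A
      simp only [Set.mem_image, Set.mem_prod, Set.mem_ofPred_eq, Prod.exists, and_assoc,
        eq_comm (a := A)]
  · refine ((hasCount_isUnitRep_one hp).congr ?_).image
      (f := fun x => !![x, 1, 0; 0, x, 1; 0, 0, x]) ?_ ?_
    · ring
    · intro x _ y _ h
      simp_all [Prod.ext_iff, Matrix.ext_iff.symm, Fin.forall_fin_succ]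
    · ext A
      simp only [Set.mem_image, Set.mem_prod, Set.mem_ofPred_eq, Prod.exists, and_assoc,
        eq_comm (a := A)]
  · refine ((hasCount_irrThree (p := p)).congr ?_).image
      (f := fun x => !![0, 1, 0; 0, 0, 1; -x.1, -x.2.1, -x.2.2]) ?_ ?_
    · ring
    · intro x _ y _ h
      simp_all [Prod.ext_iff, Matrix.ext_iff.symm, Fin.forall_fin_succ]
    · ext A
      simp only [Set.mem_image, Set.mem_prod, Set.mem_ofPred_eq, Prod.exists, and_assoc,
        eq_comm (a := A)]
  · refine (((hasCount_irrTwo (p := p)).prod (hasCount_isUnitRep_one hp)).congr ?_).image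
      (f := fun x => !![0, 1, 0; -x.1.1, -x.1.2, 0; 0, 0, x.2]) ?_ ?_
    · ring
    · intro x _ y _ h
      simp_all [Prod.ext_iff, Matrix.ext_iff.symm, Fin.forall_fin_succ]
    · ext A
      simp only [Set.mem_image, Set.mem_prod, Set.mem_ofPred_eq, Prod.exists, and_assoc,
        eq_comm (a := A)]

theorem hasCount_tableFour : ∀ r ∈ tableFour p, HasCount r.matrices r.total := by
  have hp : p.Prime := Fact.out
  have hp0 : (p : ℤ) ≠ 0 := mod_cast hp.ne_zero
  simp only [tableFour, List.forall_mem_cons, List.not_mem_nil, false_imp_iff,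
    imp_true_iff, and_true]
  refine ⟨?_, ?_, ?_, ?_, ?_, ?_, ?_, ?_, ?_, ?_, ?_, ?_, ?_, ?_, ?_, ?_, ?_, ?_, ?_, ?_, ?_, ?_, ?_, ?_, ?_, ?_, ?_, ?_, ?_⟩
  · refine ((hasCount_isUnitRep_succ hp 3).congr ?_).image
      (f := fun x => !![x]) ?_ ?_
    · ring
    · intro x _ y _ h
      simp_all [Prod.ext_iff, Matrix.ext_iff.symm, Fin.forall_fin_succ]
    · ext A
      simp only [Set.mem_image, Set.mem_prod, Set.mem_ofPred_eq, Prod.exists, and_assoc,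
        eq_comm (a := A)]
  · refine (((hasCount_isUnitRep_succ hp 2).prod (hasCount_isUnitRep_one hp)).congr ?_).image
      (f := fun x => !![x.1, 0; 0, x.2]) ?_ ?_
    · ring
    · intro x _ y _ h
      simp_all [Prod.ext_iff, Matrix.ext_iff.symm, Fin.forall_fin_succ]
    · ext A
      simp only [Set.mem_image, Set.mem_prod, Set.mem_ofPred_eq, Prod.exists, and_assoc,
        eq_comm (a := A)]
  · refine ((hasCount_pos_lt_sq hp).congr ?_).image
      (f := fun x => !![x, 0; 1, x]) ?_ ?_
    · ring
    · intro x _ y _ h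
      simp_all [Prod.ext_iff, Matrix.ext_iff.symm, Fin.forall_fin_succ]
    · ext A
      simp only [Set.mem_image, Set.mem_prod, Set.mem_ofPred_eq, Prod.exists, and_assoc,
        eq_comm (a := A)]
  · refine (((hasCount_pos_lt_sq hp).prod (hasCount_isRep p)).congr ?_).image
      (f := fun x => !![x.1, p ^ 2; x.2, x.1]) ?_ ?_
    · ring
    · intro x _ y _ h
      simp_all [Prod.ext_iff, Matrix.ext_iff.symm, Fin.forall_fin_succ]
    · ext A
      simp only [Set.mem_image, Set.mem_prod, Set.mem_ofPred_eq, Prod.exists, and_assoc,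
        eq_comm (a := A)]
  · refine (((hasCount_isUnitRep_two hp).pairs_le (· ≤ ·) le_total fun _ _ => le_antisymm).congr ?_).image
      (f := fun x => !![x.1, 0; 0, x.2]) ?_ ?_
    · push_cast [Nat.cast_choose_two, cast_mul_pred hp]
      ring
    · intro x _ y _ h
      simp_all [Prod.ext_iff, Matrix.ext_iff.symm, Fin.forall_fin_succ]
    · ext A
      simp only [Set.mem_image, Set.mem_prod, Set.mem_ofPred_eq, Prod.exists, and_assoc,
        eq_comm (a := A)]
  · refine ((hasCount_isUnitRep_two hp).congr ?_).image
      (f := fun x => !![x, p; 0, x]) ?_ ?_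
    · ring
    · intro x _ y _ h
      simp_all [Prod.ext_iff, Matrix.ext_iff.symm, Fin.forall_fin_succ]
    · ext A
      simp only [Set.mem_image, Set.mem_prod, Set.mem_ofPred_eq, Prod.exists, and_assoc,
        eq_comm (a := A)]
  · refine (((hasCount_pos_lt hp).prod (hasCount_irrTwo (p := p))).congr ?_).image
      (f := fun x => !![x.1, p; -(p * x.2.1), x.1 - p * x.2.2]) ?_ ?_
    · ring
    · intro x _ y _ h
      simp_all [Prod.ext_iff, Matrix.ext_iff.symm, Fin.forall_fin_succ]
      -- The diagonal entry `b - p * b₁` determines `b₁` only after `b` has been read off from the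
      -- other diagonal entry.
      exact mul_left_cancel₀ (by exact_mod_cast hp0) (by linarith [h.1, h.2.2] : (p : ℤ) * x.2.2 = p * y.2.2)
    · ext A
      simp only [Set.mem_image, Set.mem_prod, Set.mem_ofPred_eq, Prod.exists, and_assoc,
        eq_comm (a := A)]
  · refine (((hasCount_pos_lt hp).prod ((hasCount_isRep p).prod (hasCount_isRep p))).congr ?_).image
      (f := fun x => !![x.1 + p * x.2.1, 1; p * x.2.2, x.1]) ?_ ?_
    · ring
    · intro x _ y _ h
      simp_all [Prod.ext_iff, Matrix.ext_iff.symm, Fin.forall_fin_succ]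
      exact mul_left_cancel₀ (by exact_mod_cast hp0) (by linarith [h.1, h.2.2] : (p : ℤ) * x.2.1 = p * y.2.1)
    · ext A
      simp only [Set.mem_image, Set.mem_prod, Set.mem_ofPred_eq, Prod.exists, and_assoc,
        eq_comm (a := A)]
  · refine (((hasCount_irrTwo (p := p)).prod ((hasCount_isRep p).prod (hasCount_isRep p))).congr ?_).image
      (f := fun x => !![p * x.2.1, 1 + p * x.2.2; -x.1.1, -x.1.2]) ?_ ?_
    · ring
    · intro x _ y _ h
      simp_all [Prod.ext_iff, Matrix.ext_iff.symm, Fin.forall_fin_succ]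
    · ext A
      simp only [Set.mem_image, Set.mem_prod, Set.mem_ofPred_eq, Prod.exists, and_assoc,
        eq_comm (a := A)]
  · refine (((hasCount_isUnitRep_two hp).prod (hasCount_sorted_two p)).congr ?_).image
      (f := fun x => !![x.1, 0, 0; 0, x.2.1, 0; 0, 0, x.2.2]) ?_ ?_
    · rw [Nat.cast_choose_two]
      ring
    · intro x _ y _ h
      simp_all [Prod.ext_iff, Matrix.ext_iff.symm, Fin.forall_fin_succ]
    · ext A
      simp only [Set.mem_image, Set.mem_prod, Set.mem_ofPred_eq, Prod.exists, and_assoc,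
        eq_comm (a := A)]
  · refine (((hasCount_pos_lt hp).prod (hasCount_isUnitRep_one hp)).congr ?_).image
      (f := fun x => !![x.1, 0, 0; 1, x.1, 0; 0, 0, x.2]) ?_ ?_
    · ring
    · intro x _ y _ h
      simp_all [Prod.ext_iff, Matrix.ext_iff.symm, Fin.forall_fin_succ]
    · ext A
      simp only [Set.mem_image, Set.mem_prod, Set.mem_ofPred_eq, Prod.exists, and_assoc,
        eq_comm (a := A)]
  · refine (((hasCount_pos_lt hp).prod (hasCount_isRep p)).congr ?_).image
      (f := fun x => !![x.1, p, 0; x.2, x.1, 0; 0, 0, x.1]) ?_ ?_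
    · ring
    · intro x _ y _ h
      simp_all [Prod.ext_iff, Matrix.ext_iff.symm, Fin.forall_fin_succ]
    · ext A
      simp only [Set.mem_image, Set.mem_prod, Set.mem_ofPred_eq, Prod.exists, and_assoc,
        eq_comm (a := A)]
  · refine ((hasCount_pos_lt hp).congr ?_).image
      (f := fun x => !![x, p, 0; 0, x, 0; 1, 0, x]) ?_ ?_
    · ring
    · intro x _ y _ h
      simp_all [Prod.ext_iff, Matrix.ext_iff.symm, Fin.forall_fin_succ]
    · ext A
      simp only [Set.mem_image, Set.mem_prod, Set.mem_ofPred_eq, Prod.exists, and_assoc,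
        eq_comm (a := A)]
  · refine (((hasCount_isUnitRep_two hp).prod (hasCount_isUnitRep_one hp)).congr ?_).image
      (f := fun x => !![x.1, 0, 0; 0, x.2, 1; 0, 0, x.2]) ?_ ?_
    · ring
    · intro x _ y _ h
      simp_all [Prod.ext_iff, Matrix.ext_iff.symm, Fin.forall_fin_succ]
    · ext A
      simp only [Set.mem_image, Set.mem_prod, Set.mem_ofPred_eq, Prod.exists, and_assoc,
        eq_comm (a := A)]
  · refine ((hasCount_pos_lt hp).congr ?_).image
      (f := fun x => !![x, 0, 0; 0, x, 1; 1, 0, x]) ?_ ?_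
    · ring
    · intro x _ y _ h
      simp_all [Prod.ext_iff, Matrix.ext_iff.symm, Fin.forall_fin_succ]
    · ext A
      simp only [Set.mem_image, Set.mem_prod, Set.mem_ofPred_eq, Prod.exists, and_assoc,
        eq_comm (a := A)]
  · refine (((hasCount_pos_lt hp).prod (hasCount_isRep p)).congr ?_).image
      (f := fun x => !![x.1, p, 0; 0, x.1, 1; x.2, 0, x.1]) ?_ ?_
    · ring
    · intro x _ y _ h
      simp_all [Prod.ext_iff, Matrix.ext_iff.symm, Fin.forall_fin_succ]
    · ext A
      simp only [Set.mem_image, Set.mem_prod, Set.mem_ofPred_eq, Prod.exists, and_assoc,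
        eq_comm (a := A)]
  · refine ((hasCount_sorted_four p).congr ?_).image
      (f := fun x => !![x.1, 0, 0, 0; 0, x.2.1, 0, 0; 0, 0, x.2.2.1, 0; 0, 0, 0, x.2.2.2]) ?_ ?_
    · ring
    · intro x _ y _ h
      simp_all [Prod.ext_iff, Matrix.ext_iff.symm, Fin.forall_fin_succ]
    · ext A
      simp only [Set.mem_image, Set.mem_prod, Set.mem_ofPred_eq, Prod.exists, and_assoc,
        eq_comm (a := A)]
  · refine (((hasCount_isUnitRep_one hp).prod (hasCount_sorted_two p)).congr ?_).image
      (f := fun x => !![x.1, 1, 0, 0; 0, x.1, 0, 0; 0, 0, x.2.1, 0; 0, 0, 0, x.2.2]) ?_ ?_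
    · rw [Nat.cast_choose_two]
      ring
    · intro x _ y _ h
      simp_all [Prod.ext_iff, Matrix.ext_iff.symm, Fin.forall_fin_succ]
    · ext A
      simp only [Set.mem_image, Set.mem_prod, Set.mem_ofPred_eq, Prod.exists, and_assoc,
        eq_comm (a := A)]
  · refine ((hasCount_sorted_two p).congr ?_).image
      (f := fun x => !![x.1, 1, 0, 0; 0, x.1, 0, 0; 0, 0, x.2, 1; 0, 0, 0, x.2]) ?_ ?_
    · rfl
    · intro x _ y _ h
      simp_all [Prod.ext_iff, Matrix.ext_iff.symm, Fin.forall_fin_succ]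
    · ext A
      simp only [Set.mem_image, Set.mem_prod, Set.mem_ofPred_eq, Prod.exists, and_assoc,
        eq_comm (a := A)]
  · refine (((hasCount_isUnitRep_one hp).prod (hasCount_isUnitRep_one hp)).congr ?_).image
      (f := fun x => !![x.1, 1, 0, 0; 0, x.1, 1, 0; 0, 0, x.1, 0; 0, 0, 0, x.2]) ?_ ?_
    · ring
    · intro x _ y _ h
      simp_all [Prod.ext_iff, Matrix.ext_iff.symm, Fin.forall_fin_succ]
    · ext A
      simp only [Set.mem_image, Set.mem_prod, Set.mem_ofPred_eq, Prod.exists, and_assoc,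
        eq_comm (a := A)]
  · refine ((hasCount_isUnitRep_one hp).congr ?_).image
      (f := fun x => !![x, 1, 0, 0; 0, x, 1, 0; 0, 0, x, 1; 0, 0, 0, x]) ?_ ?_
    · ring
    · intro x _ y _ h
      simp_all [Prod.ext_iff, Matrix.ext_iff.symm, Fin.forall_fin_succ]
    · ext A
      simp only [Set.mem_image, Set.mem_prod, Set.mem_ofPred_eq, Prod.exists, and_assoc,
        eq_comm (a := A)]
  · refine ((hasCount_lexLE_irrTwo (p := p)).congr ?_).image
      (f := fun x => !![0, 1, 0, 0; -x.1.1, -x.1.2, 0, 0; 0, 0, 0, 1; 0, 0, -x.2.1, -x.2.2]) ?_ ?_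
    · push_cast [Nat.cast_choose_two, cast_sq_sub_half]
      ring
    · intro x _ y _ h
      simp_all [Prod.ext_iff, Matrix.ext_iff.symm, Fin.forall_fin_succ]
    · ext A
      simp only [Set.mem_image, Set.mem_prod, Set.mem_ofPred_eq, Prod.exists, and_assoc,
        eq_comm (a := A)]
  · refine ((hasCount_irrTwo (p := p)).congr ?_).image
      (f := fun x => !![0, 1, 1, 0; -x.1, -x.2, 0, 1; 0, 0, 0, 1; 0, 0, -x.1, -x.2]) ?_ ?_
    · ring
    · intro x _ y _ h
      simp_all [Prod.ext_iff, Matrix.ext_iff.symm, Fin.forall_fin_succ]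
    · ext A
      simp only [Set.mem_image, Set.mem_prod, Set.mem_ofPred_eq, Prod.exists, and_assoc,
        eq_comm (a := A)]
  · refine ((hasCount_irrFour (p := p)).congr ?_).image
      (f := fun x => !![0, 1, 0, 0; 0, 0, 1, 0; 0, 0, 0, 1; -x.1, -x.2.1, -x.2.2.1, -x.2.2.2]) ?_ ?_
    · ring
    · intro x _ y _ h
      simp_all [Prod.ext_iff, Matrix.ext_iff.symm, Fin.forall_fin_succ]
    · ext A
      simp only [Set.mem_image, Set.mem_prod, Set.mem_ofPred_eq, Prod.exists, and_assoc,
        eq_comm (a := A)]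
  · refine (((hasCount_ne hp).prod (hasCount_isRep p)).congr ?_).image
      (f := fun x => !![x.1.1, p, 0; x.2, x.1.1, 0; 0, 0, x.1.2]) ?_ ?_
    · ring
    · intro x _ y _ h
      simp_all [Prod.ext_iff, Matrix.ext_iff.symm, Fin.forall_fin_succ]
    · ext A
      simp only [Set.mem_image, Set.mem_prod, Set.mem_ofPred_eq, Prod.exists, and_assoc,
        eq_comm (a := A)]
      exact ⟨fun ⟨a, b, c, h1, h2, h3, h4, h5, h6⟩ => ⟨a, b, c, h1, h2, h5, h3, h4, h6⟩,
        fun ⟨a, b, c, h1, h2, h3, h4, h5, h6⟩ => ⟨a, b, c, h1, h2, h4, h5, h3, h6⟩⟩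
  · refine (((hasCount_irrThree (p := p)).prod (hasCount_isUnitRep_one hp)).congr ?_).image
      (f := fun x => !![0, 1, 0, 0; 0, 0, 1, 0; -x.1.1, -x.1.2.1, -x.1.2.2, 0; 0, 0, 0, x.2]) ?_ ?_
    · ring
    · intro x _ y _ h
      simp_all [Prod.ext_iff, Matrix.ext_iff.symm, Fin.forall_fin_succ]
    · ext A
      simp only [Set.mem_image, Set.mem_prod, Set.mem_ofPred_eq, Prod.exists, and_assoc,
        eq_comm (a := A)]
  · refine (((hasCount_isUnitRep_two hp).prod (hasCount_irrTwo (p := p))).congr ?_).image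
      (f := fun x => !![x.1, 0, 0; 0, 0, 1; 0, -x.2.1, -x.2.2]) ?_ ?_
    · ring
    · intro x _ y _ h
      simp_all [Prod.ext_iff, Matrix.ext_iff.symm, Fin.forall_fin_succ]
    · ext A
      simp only [Set.mem_image, Set.mem_prod, Set.mem_ofPred_eq, Prod.exists, and_assoc,
        eq_comm (a := A)]
  · refine (((hasCount_irrTwo (p := p)).prod (hasCount_sorted_two p)).congr ?_).image
      (f := fun x => !![0, 1, 0, 0; -x.1.1, -x.1.2, 0, 0; 0, 0, x.2.1, 0; 0, 0, 0, x.2.2]) ?_ ?_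
    · rw [Nat.cast_choose_two]
      ring
    · intro x _ y _ h
      simp_all [Prod.ext_iff, Matrix.ext_iff.symm, Fin.forall_fin_succ]
    · ext A
      simp only [Set.mem_image, Set.mem_prod, Set.mem_ofPred_eq, Prod.exists, and_assoc,
        eq_comm (a := A)]
  · refine (((hasCount_isUnitRep_one hp).prod (hasCount_irrTwo (p := p))).congr ?_).image
      (f := fun x => !![x.1, 1, 0, 0; 0, x.1, 0, 0; 0, 0, 0, 1; 0, 0, -x.2.1, -x.2.2]) ?_ ?_
    · ring
    · intro x _ y _ h
      simp_all [Prod.ext_iff, Matrix.ext_iff.symm, Fin.forall_fin_succ]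
    · ext A
      simp only [Set.mem_image, Set.mem_prod, Set.mem_ofPred_eq, Prod.exists, and_assoc,
        eq_comm (a := A)]

end RowCounts

/-! ### Summing the row sizes -/

section Totals

theorem cast_choose_succ_three (n : ℕ) :
    (((n + 1).choose 3 : ℕ) : ℚ) = (n + 1) * n * (n - 1) / 6 := by
  induction n with
  | zero => norm_num [Nat.choose]
  | succ n ih =>
    rw [Nat.choose_succ_succ' (n + 1) 2, Nat.cast_add, ih, Nat.cast_choose_two]
    push_cast
    ring

theorem cast_choose_add_two_four (n : ℕ) :
    (((n + 2).choose 4 : ℕ) : ℚ) = (n + 2) * (n + 1) * n * (n - 1) / 24 := by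
  induction n with
  | zero => norm_num [Nat.choose]
  | succ n ih =>
    rw [show n + 1 + 2 = (n + 2) + 1 by ring, Nat.choose_succ_succ' (n + 2) 3, Nat.cast_add, ih,
      cast_choose_succ_three]
    push_cast
    ring

variable (p : ℕ)

theorem sum_total_tableTwo : ((tableTwo p).map TableRow.total).sum = 2 * p ^ 2 - p - 1 := by
  simp only [tableTwo, List.map_cons, List.map_nil, List.sum_cons, List.sum_nil,
    Nat.cast_choose_two]
  ring

theorem sum_total_tableThree :
    ((tableThree p).map TableRow.total).sum = 3 * p ^ 3 - 2 * p ^ 2 - 1 := by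
  simp only [tableThree, List.map_cons, List.map_nil, List.sum_cons, List.sum_nil,
    cast_choose_succ_three]
  ring

theorem sum_total_tableFour (hp : p.Prime) :
    ((tableFour p).map TableRow.total).sum = 5 * p ^ 4 - 2 * p ^ 3 - 2 * p - 1 := by
  simp only [tableFour, List.map_cons, List.map_nil, List.sum_cons, List.sum_nil,
    cast_choose_add_two_four, Nat.cast_choose_two, Nat.cast_add, Nat.cast_one, cast_mul_pred hp,
    cast_sq_sub_half]
  ring

end Totals

/-! ### Assembly of the classification and of the counts -/

section Main

variable {p : ℕ} [Fact p.Prime]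

theorem exists_tau_table {n : ℕ} (hn : n ≤ 4) :
    ∃ τ : (E : Entry p n) → (E.Group ≃+ E.Group),
      (∀ (E : Entry p n) (x : E.Group), τ E x = E.matrixMap x) ∧
      (∀ E : Entry p n, Nat.card (LambdaModule (τ E)) = p ^ n) ∧
      (∀ E F : Entry p n,
        Nonempty (LambdaModule (τ E) ≃ₗ[LambdaRing] LambdaModule (τ F)) → E = F) ∧
      (∀ (M : Type u) [AddCommGroup M] [Module LambdaRing M], Nat.card M = p ^ n →
        ∃ E : Entry p n, Nonempty (M ≃ₗ[LambdaRing] LambdaModule (τ E))) := by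
  have hp : p.Prime := Fact.out
  obtain rfl | rfl | rfl | rfl | rfl : n = 0 ∨ n = 1 ∨ n = 2 ∨ n = 3 ∨ n = 4 := by lia
  · exact exists_tau_zero p
  · exact exists_tau (separates_one (classifies_auts1 hp)) (exhausts_one (classifies_auts1 hp))
  · exact exists_tau (separates_two (classifies_auts2 hp) classifies_auts11)
      (exhausts_two (classifies_auts2 hp) classifies_auts11)
  · exact exists_tau
      (separates_three (classifies_auts3 hp) (classifies_auts21 hp) classifies_auts111)
      (exhausts_three (classifies_auts3 hp) (classifies_auts21 hp) classifies_auts111)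
  · exact exists_tau
      (separates_four (classifies_auts4 hp) (classifies_auts31 hp) (classifies_auts22 hp)
        (classifies_auts211 hp) classifies_auts1111)
      (exhausts_four (classifies_auts4 hp) (classifies_auts31 hp) (classifies_auts22 hp)
        (classifies_auts211 hp) classifies_auts1111)

theorem hasCount_table {n : ℕ} (hn : n ≤ 4) :
    ∀ r ∈ table p n, HasCount r.matrices r.total := by
  obtain rfl | rfl | rfl | rfl | rfl : n = 0 ∨ n = 1 ∨ n = 2 ∨ n = 3 ∨ n = 4 := by lia
  · intro r hr
    obtain rfl := List.mem_singleton.1 hr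
    exact ⟨Set.finite_singleton _, by rw [Set.ncard_singleton, Nat.cast_one]⟩
  · exact hasCount_tableOne
  · exact hasCount_tableTwo
  · exact hasCount_tableThree
  · exact hasCount_tableFour

end Main

theorem mainTheorem1 (p : ℕ) (hp : p.Prime) (n : ℕ) (hn : n ≤ 4) :
    -- On the group of each entry, its matrix acts as an automorphism; let `t` act by it.
    (∃ τ : (E : Entry p n) → (E.Group ≃+ E.Group),
      (∀ (E : Entry p n) (x : E.Group), τ E x = E.matrixMap x) ∧
      -- the listed modules have order `p ^ n`
      (∀ E : Entry p n, Nat.card (LambdaModule (τ E)) = p ^ n) ∧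
      -- they are pairwise nonisomorphic
      (∀ E F : Entry p n,
        Nonempty (LambdaModule (τ E) ≃ₗ[LambdaRing] LambdaModule (τ F)) → E = F) ∧
      -- every module of order `p ^ n` is isomorphic to a listed one
      (∀ (M : Type u) [AddCommGroup M] [Module LambdaRing M], Nat.card M = p ^ n →
        ∃ E : Entry p n, Nonempty (M ≃ₗ[LambdaRing] LambdaModule (τ E)))) ∧
    -- the number of entries in each row
    (∀ r : Fin (table p n).length,
      ((table p n).get r).matrices.Finite ∧
      (((table p n).get r).matrices.ncard : ℚ) = ((table p n).get r).total) ∧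
    -- the number of isomorphism classes
    (n = 0 → (numLambdaModules.{u} (p ^ n) : ℤ) = 1) ∧
    (n = 1 → (numLambdaModules.{u} (p ^ n) : ℤ) = p - 1) ∧
    (n = 2 → (numLambdaModules.{u} (p ^ n) : ℤ) = 2 * p ^ 2 - p - 1) ∧
    (n = 3 → (numLambdaModules.{u} (p ^ n) : ℤ) = 3 * p ^ 3 - 2 * p ^ 2 - 1) ∧
    (n = 4 → (numLambdaModules.{u} (p ^ n) : ℤ) = 5 * p ^ 4 - 2 * p ^ 3 - 2 * p - 1) := by
  have : Fact p.Prime := ⟨hp⟩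
  have hcard : (numLambdaModules.{u} (p ^ n) : ℚ) = ((table p n).map TableRow.total).sum := by
    rw [numLambdaModules_eq_card_entry (exists_tau_table hn), card_entry_eq_sum (hasCount_table hn)]
  refine ⟨exists_tau_table hn, fun r => hasCount_table hn _ (List.get_mem _ r), ?_, ?_, ?_, ?_, ?_⟩ <;>
    rintro rfl
  · have h : (numLambdaModules.{u} (p ^ 0) : ℚ) = 1 := hcard.trans (by simp [table, tableZero])
    exact_mod_cast h
  · have h : (numLambdaModules.{u} (p ^ 1) : ℚ) = p - 1 := hcard.trans (by simp [table, tableOne])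
    exact_mod_cast h
  · have h := hcard.trans (sum_total_tableTwo p)
    exact_mod_cast h
  · have h := hcard.trans (sum_total_tableThree p)
    exact_mod_cast h
  · have h := hcard.trans (sum_total_tableFour p hp)
    exact_mod_cast h
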